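/- Let $X$ be a connected, Hausdorff, second-countable smooth manifold of dimension $n\ge 2$, and let $Y=\mathbb R\times\bigwedge^{n-1}T^*X\to X$, with fibre coordinates $A$, $B_{\mu_1\dots\mu_{n-1}}$. The topological BF theory is given by the Lagrangian $L=\frac1n A\,d_HB$; up to the common factor $1/n!$ its variational derivatives are $$\mathcal E=\epsilon^{\mu\mu_1\dots\mu_{n-1}}d_\mu B_{\mu_1\dots\mu_{n-1}},\qquad \mathcal E^{\mu_1\dots\mu_{n-1}}=-\epsilon^{\mu\mu_1\dots\mu_{n-1}}d_\mu A ,$$ where $d_\mu$ are total derivatives. Introduce antifields $\bar s$ (a density) and, for $-1\le k\le n-2$, $\bar c^{\mu_{k+2}\dots\mu_{n-1}}$ (antisymmetric contravariant tensor densities with $n-k-2$ indices, $\bar c^{\mu_1\dots\mu_{n-1}}=\bar s^{\mu_1\dots\mu_{n-1}}$), of antifield number $1$ and $k+2$ respectively and with Grassmann parity equal to the antifield number mod 2. Put $\Delta^{\mu_1\dots\mu_{n-1}}=\mathcal E^{\mu_1\dots\mu_{n-1}}$ and $\Delta^{\mu_{k+2}\dots\mu_{n-1}}=d_{\mu_{k+1}}\bar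 c^{\mu_{k+1}\mu_{k+2}\dots\mu_{n-1}}$ for $k\ge 0$. For $-1\le N\le n-2$ let $\mathcal P\{N\}_a$ be the space of graded densities $\Phi\,\omega$ on $X$, $\omega=dx^1\wedge\dots\wedge dx^n$, of antifield number $a$, that are polynomial in the antifields $\bar s,\bar c^{\mu_{k+2}\dots\mu_{n-1}}$, $k\le N$, and their jets, of finite jet order, with coefficients in the ring $\mathcal O^0_\infty Y$ of smooth functions on finite order jet manifolds of $Y$. Let $\delta_N$ (with $\delta_{-1}=\bar\delta$) be the odd right graded derivation, linear over $\mathcal O^0_\infty Y$ and commuting with total derivatives, with $\delta_N\bar s=\mathcal E$, $\delta_N\bar c^{\mu_{k+2}\dots\mu_{n-1}}=\Delta^{\mu_{k+2}\dots\mu_{n-1}}$. (1) Let $0\le N\le n-2$ and let $\Phi\in\mathcal P\{N-1\}_{N+2}$ satisfy $\delta_{N-1}\Phi=0$. Then there is $\Psi\in\mathcal P\{N-1\}_{N+3}$ such that in every coordinate chart $\Phi-\delta_{N-1}\Psi$ is a finite sum $$\sum G^{\Lambda_1\cdots\Lambda_i}_{\mu^1_{k_1+2}\dots\mu^1_{n-1};\dots;\mu^i_{k_i+2}\dots\mu^i_{n-1}}\;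 d_{\Lambda_1}\Delta^{\mu^1_{k_1+2}\dots\mu^1_{n-1}}\cdots d_{\Lambda_i}\Delta^{\mu^i_{k_i+2}\dots\mu^i_{n-1}}\,\omega ,$$ over $-1\le k_1,\dots,k_i\le N$ with $(k_1+1)+\dots+(k_i+1)=N+2$, with coefficients $G$ that are smooth functions on a finite order jet manifold of $Y$. Moreover $\Phi=\delta_N\Psi'$ for some $\Psi'\in\mathcal P\{N\}_{N+3}$. (2) Consequently, for $0\le N\le n-2$ the $(N+2)$-homology regularity condition holds: for every $-1\le k\le N-1$, each $\delta_k$-cycle in $\mathcal P\{k\}_{k+3}$ is the $\delta_{k+1}$-image of an element of $\mathcal P\{k+1\}_{k+4}$. (3) For $0\le N\le n-2$ the BF theory is $N$-stage reducible: $\delta_N$ maps $\mathcal P\{N\}_{a+1}$ to $\mathcal P\{N\}_a$ and $\delta_N^2=0$; the complex $(\mathcal P\{N\}_*,\delta_N)$ is exact at antifield numbers $1,\dots,N+1$; the $(N+1)$-homology regularity condition holds; and for $0\le k\le N$ each $\delta_{k-1}$-cycle in $\mathcal P\{k-1\}_{k+1}$ is, up to a $\delta_{k-1}$-boundary, in every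 chart a finite sum $\sum G^\Lambda_{\mu_{k+2}\dots\mu_{n-1}}d_\Lambda\Delta^{\mu_{k+2}\dots\mu_{n-1}}\omega$ with coefficients $G$ as in (1), so that the $\Delta^{\mu_{k+2}\dots\mu_{n-1}}$ are complete $k$-stage Noether identities. For $N=n-2$ the complex (the Koszul–Tate complex) is moreover exact at antifield number $n$. (4) Let $c_{\mu_{k+2}\dots\mu_{n-1}}$, $0\le k\le n-2$, be ghosts (antisymmetric covariant tensors) of ghost number $k+1$ and Grassmann parity $(k+1)\bmod 2$. On the graded functions on $X$ that are polynomial in the ghosts and their jets, with coefficients in $\mathcal O^0_\infty Y$, the ascent operator $$u_e=-d_{\mu_1}c_{\mu_2\dots\mu_{n-1}}\frac{\partial}{\partial B_{\mu_1\dots\mu_{n-1}}}-\sum_{k=1}^{n-2}d_{\mu_{k+1}}c_{\mu_{k+2}\dots\mu_{n-1}}\frac{\partial}{\partial c_{\mu_{k+1}\dots\mu_{n-1}}},$$ prolonged to jets as an odd graded derivation commuting with total derivatives, raises the ghost number by one and satisfies $u_e\circ u_e=0$. -/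

import Mathlib

open scoped Manifold ContDiff

noncomputable section

namespace BFTheory

/-! ### Free graded commutative algebras and their derivations -/

section GradedCommutative

variable {G : Type*}

/-- Relations of the free graded commutative real algebra on generators `a : G` of degree
`par a`, where in addition `a = z • b` is imposed whenever `lin a b z`. -/
inductive GCRel (par : G → ℕ) (lin : G → G → ℤ → Prop) :
    FreeAlgebra ℝ G → FreeAlgebra ℝ G → Prop
  | comm (a b : G) : GCRel par lin (FreeAlgebra.ι ℝ a * FreeAlgebra.ι ℝ b)
      ((-1 : ℝ) ^ (par a * par b) • (FreeAlgebra.ι ℝ b * FreeAlgebra.ι ℝ a))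
  | lin (a b : G) (z : ℤ) (h : lin a b z) :
      GCRel par lin (FreeAlgebra.ι ℝ a) ((z : ℝ) • FreeAlgebra.ι ℝ b)

/-- The free graded commutative real algebra (odd generators anticommute, hence square to zero;
even generators are central). -/
abbrev GCAlg (par : G → ℕ) (lin : G → G → ℤ → Prop) := RingQuot (GCRel par lin)

variable {par : G → ℕ} {lin : G → G → ℤ → Prop}

variable (par lin) in
/-- The generators. -/
def gen (a : G) : GCAlg par lin :=
  RingQuot.mkAlgHom ℝ (GCRel par lin) (FreeAlgebra.ι ℝ a)

theorem gen_comm (a b : G) :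
    gen par lin a * gen par lin b =
      (-1 : ℝ) ^ (par a * par b) • (gen par lin b * gen par lin a) := by
  have h := RingQuot.mkAlgHom_rel ℝ (GCRel.comm (par := par) (lin := lin) a b)
  simpa [gen] using h

theorem gen_lin {a b : G} {z : ℤ} (h : lin a b z) :
    gen par lin a = (z : ℝ) • gen par lin b := by
  have h := RingQuot.mkAlgHom_rel ℝ (GCRel.lin (par := par) (lin := lin) a b z h)
  simpa [gen] using h

variable (par lin) in
/-- Elements that commute with all generators as an element of degree `p` does. -/
def superComm (p : ℕ) : Submodule ℝ (GCAlg par lin) where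
  carrier := {y | ∀ g, y * gen par lin g =
    (-1 : ℝ) ^ (p * par g) • (gen par lin g * y)}
  add_mem' := by
    intro x y hx hy g
    rw [add_mul, mul_add, smul_add, hx g, hy g]
  zero_mem' := by intro g; simp
  smul_mem' := by
    intro c x hx g
    rw [smul_mul_assoc, hx g, mul_smul_comm, smul_comm]

theorem gen_mem_superComm {p : ℕ} {a : G} (h : (p : ZMod 2) = par a) :
    gen par lin a ∈ superComm par lin p := by
  intro g
  rw [gen_comm]
  congr 1
  rw [neg_one_pow_congr]
  rw [Nat.even_mul, Nat.even_mul]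
  have : Even p ↔ Even (par a) := by
    rw [← ZMod.natCast_eq_zero_iff_even, ← ZMod.natCast_eq_zero_iff_even, h]
  tauto

theorem algebraMap_mem_superComm {p : ℕ} (h : (p : ZMod 2) = 0) (c : ℝ) :
    algebraMap ℝ (GCAlg par lin) c ∈ superComm par lin p := by
  intro g
  rw [Even.neg_one_pow ((ZMod.natCast_eq_zero_iff_even.mp h).mul_right _), one_smul]
  exact Algebra.commutes _ _

/-- The algebra homomorphism with prescribed values on the generators. -/
def gcHom (f : G → GCAlg par lin)
    (hf : ∀ a b, f a * f b = (-1 : ℝ) ^ (par a * par b) • (f b * f a))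
    (hl : ∀ a b z, lin a b z → f a = (z : ℝ) • f b) :
    GCAlg par lin →ₐ[ℝ] GCAlg par lin :=
  RingQuot.liftAlgHom ℝ ⟨FreeAlgebra.lift ℝ f, by
    intro x y h
    cases h with
    | comm a b => simpa using hf a b
    | lin a b z h => simpa using hl a b z h⟩

theorem gcHom_gen (f : G → GCAlg par lin) (hf hl) (a : G) : gcHom f hf hl (gen par lin a) = f a := by
  simp [gcHom, gen]

/-- The matrix of `a` in the representation `a ↦ [[a, D a], [0, (-1)^[a] a]]` that encodes
an odd right derivation `D`. -/
def rightMat (D : G → GCAlg par lin) (a : G) : Matrix (Fin 2) (Fin 2) (GCAlg par lin) :=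
  !![gen par lin a, D a; 0, (-1 : ℝ) ^ par a • gen par lin a]

/-- The matrix of `a` in the representation `a ↦ [[(-1)^[a] a, D a], [0, a]]` that encodes
an odd left derivation `D`. -/
def leftMat (D : G → GCAlg par lin) (a : G) : Matrix (Fin 2) (Fin 2) (GCAlg par lin) :=
  !![(-1 : ℝ) ^ par a • gen par lin a, D a; 0, gen par lin a]

theorem signs (p q : ℕ) : (-1 : ℝ) ^ p * (-1 : ℝ) ^ ((q + 1) * p) = (-1 : ℝ) ^ (q * p) := by
  rw [← pow_add, neg_one_pow_congr]
  simp only [Nat.even_add, Nat.even_mul, Nat.even_add_one]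
  tauto

theorem right_aux (D : G → GCAlg par lin) (hD : ∀ a, D a ∈ superComm par lin (par a + 1))
    (a b : G) :
    rightMat D a * rightMat D b =
      (-1 : ℝ) ^ (par a * par b) • (rightMat D b * rightMat D a) := by
  have h1 := hD a b
  have h2 := hD b a
  have s2 := signs (par a) (par b)
  have s1 := signs (par b) (par a)
  have sq : (-1 : ℝ) ^ (par a * par b) * (-1 : ℝ) ^ (par a * par b) = 1 := by
    rw [← mul_pow]; simp
  ext i j
  fin_cases i <;> fin_cases j
  · simp [rightMat, gen_comm a b]
  · simp only [rightMat, Matrix.mul_apply, Fin.sum_univ_two, Matrix.smul_apply]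
    simp only [Matrix.of_apply, Matrix.cons_val', Matrix.cons_val_zero, Matrix.cons_val_one,
      Matrix.cons_val_fin_one, Fin.zero_eta, Fin.mk_one, mul_smul_comm]
    rw [h1, h2, smul_add, smul_smul, smul_smul, smul_smul, s1, mul_assoc, s2, mul_comm (par b) (par a), sq,
      one_smul, add_comm]
  · simp [rightMat]
  · simp [rightMat, gen_comm a b, smul_smul]
    congr 1; ring

theorem left_aux (D : G → GCAlg par lin) (hD : ∀ a, D a ∈ superComm par lin (par a + 1))
    (a b : G) :
    leftMat D a * leftMat D b =
      (-1 : ℝ) ^ (par a * par b) • (leftMat D b * leftMat D a) := by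
  have h1 := hD a b
  have h2 := hD b a
  have s1 := signs (par b) (par a)
  have s2 := signs (par a) (par b)
  have sq : (-1 : ℝ) ^ (par a * par b) * (-1 : ℝ) ^ (par a * par b) = 1 := by
    rw [← mul_pow]; simp
  have s3 : (-1 : ℝ) ^ ((par a + 1) * par b) = (-1 : ℝ) ^ (par a * par b) * (-1 : ℝ) ^ par b := by
    rw [← pow_add]; congr 1; ring
  have s4 : (-1 : ℝ) ^ ((par b + 1) * par a) = (-1 : ℝ) ^ (par a * par b) * (-1 : ℝ) ^ par a := by
    rw [← pow_add]; congr 1; ring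
  ext i j
  fin_cases i <;> fin_cases j
  · simp [leftMat, gen_comm a b, smul_smul]
    congr 1; ring
  · simp only [leftMat, Matrix.mul_apply, Fin.sum_univ_two, Matrix.smul_apply]
    simp only [Matrix.of_apply, Matrix.cons_val', Matrix.cons_val_zero, Matrix.cons_val_one,
      Matrix.cons_val_fin_one, Fin.zero_eta, Fin.mk_one, smul_mul_assoc]
    rw [h1, h2, smul_add, smul_smul, smul_smul, s3, s4, ← mul_assoc, sq, one_mul, add_comm]
  · simp [leftMat]
  · simp [leftMat, gen_comm a b]

/-- The odd right graded derivation `δ(φ φ') = φ δ(φ') + (-1)^[φ'] δ(φ) φ'` with prescribed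
values `D` on the generators. -/
def rightDer (D : G → GCAlg par lin) (hD : ∀ a, D a ∈ superComm par lin (par a + 1))
    (hl : ∀ a b z, lin a b z → D a = (z : ℝ) • D b ∧ par a = par b) :
    GCAlg par lin →ₗ[ℝ] GCAlg par lin :=
  (Matrix.entryLinearMap ℝ (GCAlg par lin) 0 1).comp
    (RingQuot.liftAlgHom ℝ (s := GCRel par lin) ⟨FreeAlgebra.lift ℝ (rightMat D), by
      intro x y h
      cases h with
      | comm a b => simpa using right_aux D hD a b
      | lin a b z h =>
        obtain ⟨h1, h2⟩ := hl a b z h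
        have h3 := gen_lin (par := par) h
        simp only [FreeAlgebra.lift_ι_apply, map_smul]
        ext i j
        fin_cases i <;> fin_cases j <;> simp [rightMat, h1, h2, h3] <;>
          exact smul_comm _ _ _⟩).toLinearMap

/-- The odd left graded derivation `u(φ φ') = u(φ) φ' + (-1)^[φ] φ u(φ')` with prescribed
values `D` on the generators. -/
def leftDer (D : G → GCAlg par lin) (hD : ∀ a, D a ∈ superComm par lin (par a + 1))
    (hl : ∀ a b z, lin a b z → D a = (z : ℝ) • D b ∧ par a = par b) :
    GCAlg par lin →ₗ[ℝ] GCAlg par lin :=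
  (Matrix.entryLinearMap ℝ (GCAlg par lin) 0 1).comp
    (RingQuot.liftAlgHom ℝ (s := GCRel par lin) ⟨FreeAlgebra.lift ℝ (leftMat D), by
      intro x y h
      cases h with
      | comm a b => simpa using left_aux D hD a b
      | lin a b z h =>
        obtain ⟨h1, h2⟩ := hl a b z h
        have h3 := gen_lin (par := par) h
        simp only [FreeAlgebra.lift_ι_apply, map_smul]
        ext i j
        fin_cases i <;> fin_cases j <;> simp [leftMat, h1, h2, h3] <;>
          exact smul_comm _ _ _⟩).toLinearMap

theorem rightDer_gen (D : G → GCAlg par lin) (hD hl) (a : G) :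
    rightDer D hD hl (gen par lin a) = D a := by
  simp [rightDer, gen, rightMat]

theorem leftDer_gen (D : G → GCAlg par lin) (hD hl) (a : G) :
    leftDer D hD hl (gen par lin a) = D a := by
  simp [leftDer, gen, leftMat]

end GradedCommutative
/-! ### Coordinates, jets and their transformation laws

The base manifold has dimension `n = m + 1`. -/

/-- The model space `ℝⁿ`. -/
abbrev E (m : ℕ) := EuclideanSpace ℝ (Fin (m + 1))

/-- Symmetric multi-indices. -/
abbrev MI (m : ℕ) := Multiset (Fin (m + 1))

/-- Partial derivative with respect to the coordinate `x^μ`. -/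
def pderiv {m : ℕ} (μ : Fin (m + 1)) (f : E m → ℝ) : E m → ℝ :=
  fun x => fderiv ℝ f x (EuclideanSpace.single μ 1)

/-- Linear expressions `∑ f_{bΛ}(x) y^b_Λ` in jet coordinates of fibre coordinates `y^b`. -/
abbrev LinJet (β : Type) (m : ℕ) := (β × MI m) →₀ (E m → ℝ)

/-- Total derivative `d_μ (f y^b_Λ) = (∂_μ f) y^b_Λ + f y^b_{μ+Λ}`. -/
def LinJet.total {β : Type} {m : ℕ} (μ : Fin (m + 1)) (F : LinJet β m) : LinJet β m :=
  F.sum fun p f => Finsupp.single p (pderiv μ f) + Finsupp.single (p.1, μ ::ₘ p.2) f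

/-- The value of a linear expression at the base point `x` when `y^b_Λ` is given the
value `v b Λ`. -/
def LinJet.eval {β : Type} {m : ℕ} {M : Type*} [AddCommGroup M] [Module ℝ M]
    (F : LinJet β m) (x : E m) (v : β → MI m → M) : M :=
  F.sum fun p f => f x • v p.1 p.2

/-- Jet prolongation of a linear change of fibre coordinates `y'^a = ∑ T^a_b(x) y^b`:
`y'^a_{λ+Λ} = d'_λ y'^a_Λ` with `d'_λ = ∑ K^μ_λ d_μ`, `K^μ_λ = ∂x^μ/∂x'^λ`. -/
def prolong {β : Type} [Fintype β] {m : ℕ} (K : Fin (m + 1) → Fin (m + 1) → E m → ℝ)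
    (T : β → β → E m → ℝ) : List (Fin (m + 1)) → β → LinJet β m
  | [], a => ∑ b, Finsupp.single (b, 0) (T a b)
  | l :: L, a => ∑ μ, K μ l • LinJet.total μ (prolong K T L a)

theorem total_mapDomain {β : Type} {m : ℕ} (e : β ≃ β) (μ : Fin (m + 1)) (F : LinJet β m) :
    LinJet.total μ (F.mapDomain (Prod.map e id)) =
      (LinJet.total μ F).mapDomain (Prod.map e id) := by
  have hinj : Function.Injective (Prod.map e (id : MI m → MI m)) :=
    e.injective.prodMap Function.injective_id
  unfold LinJet.total
  rw [Finsupp.sum_mapDomain_index_inj hinj]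
  unfold Finsupp.sum
  rw [Finsupp.mapDomain_finsetSum]
  refine Finset.sum_congr rfl fun p _ => ?_
  rw [Finsupp.mapDomain_add, Finsupp.mapDomain_single, Finsupp.mapDomain_single]
  rfl

theorem prolong_equivariant {β : Type} [Fintype β] {m : ℕ}
    (K : Fin (m + 1) → Fin (m + 1) → E m → ℝ) (T : β → β → E m → ℝ) (e : β ≃ β)
    (h : ∀ a b, T (e a) (e b) = T a b) (L : List (Fin (m + 1))) (a : β) :
    prolong K T L (e a) = (prolong K T L a).mapDomain (Prod.map e id) := by
  induction L with
  | nil =>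
    simp only [prolong, Finsupp.mapDomain_finsetSum, Finsupp.mapDomain_single]
    rw [← Equiv.sum_comp e]
    simp [h]
  | cons l L ih =>
    simp only [prolong, ih, total_mapDomain, Finsupp.mapDomain_finsetSum,
      Finsupp.mapDomain_smul]

theorem eval_equivariant {β : Type} {m : ℕ} {M : Type*} [AddCommGroup M] [Module ℝ M]
    (e : β ≃ β) (F : LinJet β m) (x : E m) (v : β → MI m → M) (z : ℝ)
    (h : ∀ b L, v (e b) L = z • v b L) :
    LinJet.eval (F.mapDomain (Prod.map e id)) x v = z • LinJet.eval F x v := by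
  have hinj : Function.Injective (Prod.map e (id : MI m → MI m)) :=
    e.injective.prodMap Function.injective_id
  unfold LinJet.eval
  rw [Finsupp.sum_mapDomain_index_inj hinj, Finsupp.smul_sum]
  refine Finset.sum_congr rfl fun p _ => ?_
  simp only [Prod.map, h, id]
  exact smul_comm _ _ _

theorem eval_mem {β : Type} {m : ℕ} {M : Type*} [AddCommGroup M] [Module ℝ M]
    (S : Submodule ℝ M) (F : LinJet β m) (x : E m) (v : β → MI m → M) (h : ∀ b L, v b L ∈ S) :
    LinJet.eval F x v ∈ S :=
  S.sum_mem fun _ _ => S.smul_mem _ (h _ _)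

section Charts

variable {m : ℕ} {X : Type*} [TopologicalSpace X]

/-- `∂x'^μ/∂x^ν` for the change from the coordinates `x` of `φ` to the coordinates `x'` of `ψ`,
as a function of `x`. -/
def jac (φ ψ : OpenPartialHomeomorph X (E m)) (μ ν : Fin (m + 1)) : E m → ℝ :=
  pderiv ν fun x => ψ (φ.symm x) μ

/-- `∂x^μ/∂x'^ν`, as a function of `x`. -/
def invJac (φ ψ : OpenPartialHomeomorph X (E m)) (μ ν : Fin (m + 1)) : E m → ℝ :=
  fun x => jac ψ φ μ ν (ψ (φ.symm x))

/-- `det (∂x'/∂x)`. -/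
def jacDet (φ ψ : OpenPartialHomeomorph X (E m)) (x : E m) : ℝ :=
  (Matrix.of fun μ ν => jac φ ψ μ ν x).det

/-- `det (∂x/∂x')`. -/
def invDet (φ ψ : OpenPartialHomeomorph X (E m)) (x : E m) : ℝ :=
  (Matrix.of fun μ ν => invJac φ ψ μ ν x).det

/-- Transformation law of covariant tensors: `b'_t = ∑_u (∏ᵢ ∂x^{uᵢ}/∂x'^{tᵢ}) b_u`. -/
def covLaw (φ ψ : OpenPartialHomeomorph X (E m)) (q : ℕ) (t u : Fin q → Fin (m + 1)) :
    E m → ℝ :=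
  fun x => ∏ i, invJac φ ψ (u i) (t i) x

/-- Transformation law of contravariant tensor densities:
`c'^t = det(∂x/∂x') ∑_u (∏ᵢ ∂x'^{tᵢ}/∂x^{uᵢ}) c^u`. -/
def conDensLaw (φ ψ : OpenPartialHomeomorph X (E m)) (q : ℕ) (t u : Fin q → Fin (m + 1)) :
    E m → ℝ :=
  fun x => invDet φ ψ x * ∏ i, jac φ ψ (t i) (u i) x

end Charts

/-- Components `b_{μ₁…μ_q}` of `q`-forms: antisymmetric functions of `q`-tuples of indices. -/
def AltComp (m q : ℕ) : Submodule ℝ ((Fin q → Fin (m + 1)) → ℝ) where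
  carrier := {b | ∀ (σ : Equiv.Perm (Fin q)) (t : Fin q → Fin (m + 1)),
    b (t ∘ σ) = ((Equiv.Perm.sign σ : ℤ) : ℝ) * b t}
  add_mem' := by
    intro a b ha hb σ t
    simp [ha σ t, hb σ t, mul_add]
  zero_mem' := by intro σ t; simp
  smul_mem' := by
    intro c b hb σ t
    simp only [Pi.smul_apply, hb σ t, smul_eq_mul]
    ring

/-- The typical fibre of `Y = ℝ × ⋀^{n-1} T*X`. -/
abbrev Fib (m : ℕ) := ℝ × AltComp m m

/-- Points `(A_Λ, B_{μ₁…μ_{n-1},Λ})_Λ` of the fibre of `J^∞ Y` in a coordinate chart. -/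
abbrev Jet (m : ℕ) := MI m → Fib m

/-- The jet coordinate `A_Λ`. -/
def jetA {m : ℕ} (j : Jet m) (L : MI m) : ℝ := (j L).1

/-- The jet coordinate `B_{t,Λ}`. -/
def jetB {m : ℕ} (j : Jet m) (t : Fin m → Fin (m + 1)) (L : MI m) : ℝ := (j L).2.1 t

/-- `j` and `j'` are the coordinates of the same point of `J^∞ Y`, over the point with
`φ`-coordinates `x`, in the charts `φ` and `ψ`. -/
def JetTransf {m : ℕ} {X : Type*} [TopologicalSpace X] (φ ψ : OpenPartialHomeomorph X (E m))
    (x : E m) (j j' : Jet m) : Prop :=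
  (∀ L : MI m, jetA j' L =
    (prolong (invJac φ ψ) (fun _ _ : Unit => 1) L.sort ()).eval x fun _ S => jetA j S) ∧
  ∀ (t : Fin m → Fin (m + 1)) (L : MI m), jetB j' t L =
    (prolong (invJac φ ψ) (covLaw φ ψ m) L.sort t).eval x fun u S => jetB j u S

/-- Restrictions to `π^{-1}(U) ⊂ J^∞ Y` of smooth functions on the jet manifold `J^r Y`. -/
def IsJetFun {m : ℕ} (U : Set (E m)) (r : ℕ) (f : E m → Jet m → ℝ) : Prop :=
  ∃ g : E m × ((Σ i : Fin (r + 1), Sym (Fin (m + 1)) i) → Fib m) → ℝ,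
    ContDiffOn ℝ ∞ g (U ×ˢ Set.univ) ∧
      ∀ x ∈ U, ∀ j : Jet m, f x j = g (x, fun p => j (p.2 : MI m))

/-! ### The Lagrangian and its variational derivatives -/

/-- The Levi-Civita symbol. -/
def levi {m : ℕ} (f : Fin (m + 1) → Fin (m + 1)) : ℝ :=
  (Matrix.of fun i k => if f i = k then (1 : ℝ) else 0).det

/-- `d_Λ 𝓔 = ∑ ε^{μ μ₁…μ_{n-1}} B_{μ₁…μ_{n-1}, μ+Λ}`. -/
def eulA {m : ℕ} (j : Jet m) (L : MI m) : ℝ :=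
  ∑ μ : Fin (m + 1), ∑ t : Fin m → Fin (m + 1), levi (Fin.cons μ t) * jetB j t (μ ::ₘ L)

/-- `d_Λ 𝓔^{μ₁…μ_{n-1}} = - ∑_μ ε^{μ μ₁…μ_{n-1}} A_{μ+Λ}`. -/
def eulB {m : ℕ} (j : Jet m) (t : Fin m → Fin (m + 1)) (L : MI m) : ℝ :=
  -∑ μ : Fin (m + 1), levi (Fin.cons μ t) * jetA j (μ ::ₘ L)

/-- The Lagrangian `(1/n) A d_H B` as a multiple of `dx¹ ∧ … ∧ dxⁿ`, where
`d_H B = (1/(n-1)!) ∑ ε^{μ μ₁…μ_{n-1}} d_μ B_{μ₁…μ_{n-1}} dx¹ ∧ … ∧ dxⁿ`. -/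
def lagBF {m : ℕ} (_x : E m) (j : Jet m) : ℝ :=
  (1 / (m + 1 : ℝ)) * jetA j 0 * ((1 / (m.factorial : ℝ)) *
    ∑ μ : Fin (m + 1), ∑ t : Fin m → Fin (m + 1), levi (Fin.cons μ t) * jetB j t {μ})

/-- The total derivative `d_λ = ∂_λ + ∑ y_{λ+Λ} ∂/∂y_Λ` of functions on the jet space. -/
def totalDeriv {m : ℕ} (l : Fin (m + 1)) (f : E m → Jet m → ℝ) : E m → Jet m → ℝ :=
  fun x j => deriv (fun s : ℝ =>
    f (x + s • EuclideanSpace.single l 1) (j + s • fun L => j (l ::ₘ L))) 0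

/-- The variational derivative `∑_Λ (-1)^{|Λ|} d_Λ (∂𝓛/∂y_Λ)` in the direction `v` of the
fibre. -/
def varDeriv {m : ℕ} (Lag : E m → Jet m → ℝ) (v : Fib m) : E m → Jet m → ℝ :=
  fun x j => ∑ᶠ L : MI m, (-1 : ℝ) ^ L.card *
    L.sort.foldr totalDeriv (fun x j => lineDeriv ℝ (Lag x) j (Pi.single L v)) x j

/-! ### Antifields and the Koszul-Tate differential -/

/-- Labels of jet coordinates of antisymmetric tensors with `q < p` indices. -/
structure Lab (m p : ℕ) where
  /-- number of tensor indices -/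
  q : ℕ
  lt : q < p
  /-- tensor indices -/
  idx : Fin q → Fin (m + 1)
  /-- jet multi-index -/
  ord : MI m

/-- The antifields `s̄_Λ` and `c̄^{t}_Λ`, `t` a tuple of `q ≤ n - 1` indices. For `q = n - 1`
the latter are `s̄^{μ₁…μ_{n-1}}_Λ`, for `q = n - 2 - k`, `k ≥ 0`, they are the `k`-stage
antifields `c̄^{μ_{k+2}…μ_{n-1}}_Λ`. -/
inductive Anti (m : ℕ)
  | s (L : MI m)
  | c (l : Lab m (m + 1))

/-- The antifield number: `1` for `s̄`, `s̄^{μ₁…μ_{n-1}}` and `k + 2` for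
`c̄^{μ_{k+2}…μ_{n-1}}`. Its parity is the Grassmann parity. -/
def Anti.ant {m : ℕ} : Anti m → ℕ
  | s _ => 1
  | c l => m + 1 - l.q

/-- The jet order of an antifield. -/
def Anti.order {m : ℕ} : Anti m → ℕ
  | s L => L.card
  | c l => l.ord.card

/-- Antisymmetry of the antifields in their tensor indices. -/
inductive Anti.Alt {m : ℕ} : Anti m → Anti m → ℤ → Prop
  | mk (q : ℕ) (lt : q < m + 1) (t : Fin q → Fin (m + 1)) (L : MI m)
      (σ : Equiv.Perm (Fin q)) :
      Alt (c ⟨q, lt, t ∘ σ, L⟩) (c ⟨q, lt, t, L⟩) (Equiv.Perm.sign σ : ℤ)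

/-- Graded polynomials in the antifields and their jets. -/
abbrev AntiAlg (m : ℕ) := GCAlg (Anti.ant (m := m)) Anti.Alt

/-- The antifields as elements of the algebra. -/
abbrev agen {m : ℕ} (a : Anti m) : AntiAlg m := gen Anti.ant Anti.Alt a

/-- `d_Λ Δ^{t}`: it is `d_Λ 𝓔^{t}` if `t` has `n - 1` indices, and otherwise
`∑_μ c̄^{μ t}_{μ+Λ}`. -/
def dDelta {m : ℕ} (j : Jet m) : Lab m (m + 1) → AntiAlg m
  | ⟨q, _, t, L⟩ =>
    if h : q < m then
      ∑ μ : Fin (m + 1), agen (.c ⟨q + 1, Nat.succ_lt_succ h, Fin.cons μ t, μ ::ₘ L⟩)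
    else if h : q = m then algebraMap ℝ _ (eulB j (t ∘ Fin.cast h.symm) L)
    else 0

/-- The values on antifields of the Koszul-Tate differential that involves the antifields of
antifield number at most `T`. -/
def ktVal {m : ℕ} (T : ℕ) (j : Jet m) (a : Anti m) : AntiAlg m :=
  if a.ant ≤ T then
    match a with
    | .s L => algebraMap ℝ _ (eulA j L)
    | .c l => dDelta j l
  else 0

theorem levi_comp {m : ℕ} (f : Fin (m + 1) → Fin (m + 1)) (σ : Equiv.Perm (Fin (m + 1))) :
    levi (f ∘ σ) = ((Equiv.Perm.sign σ : ℤ) : ℝ) * levi f := by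
  unfold levi
  rw [← Matrix.det_permute σ]
  rfl

theorem cons_comp {m q : ℕ} (μ : Fin (m + 1)) (t : Fin q → Fin (m + 1))
    (σ : Equiv.Perm (Fin q)) :
    (Fin.cons μ (t ∘ σ) : Fin (q + 1) → Fin (m + 1)) =
      (Fin.cons μ t : Fin (q + 1) → Fin (m + 1)) ∘ Equiv.Perm.decomposeFin.symm (0, σ) := by
  funext i
  refine Fin.cases ?_ (fun i => ?_) i
  · simp
  · simp [Equiv.Perm.decomposeFin_symm_apply_succ]

theorem eulB_comp {m : ℕ} (j : Jet m) (t : Fin m → Fin (m + 1)) (L : MI m)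
    (σ : Equiv.Perm (Fin m)) :
    eulB j (t ∘ σ) L = ((Equiv.Perm.sign σ : ℤ) : ℝ) * eulB j t L := by
  unfold eulB
  rw [mul_neg, Finset.mul_sum]
  congr 1
  refine Finset.sum_congr rfl fun μ _ => ?_
  rw [cons_comp, levi_comp]
  simp [mul_assoc]

theorem dDelta_alt {m : ℕ} (j : Jet m) (q : ℕ) (lt : q < m + 1) (t : Fin q → Fin (m + 1))
    (L : MI m) (σ : Equiv.Perm (Fin q)) :
    dDelta j ⟨q, lt, t ∘ σ, L⟩ = ((Equiv.Perm.sign σ : ℤ) : ℝ) • dDelta j ⟨q, lt, t, L⟩ := by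
  unfold dDelta
  by_cases h : q < m
  · simp only [h, dif_pos, Finset.smul_sum]
    refine Finset.sum_congr rfl fun μ _ => ?_
    rw [cons_comp]
    have := gen_lin (par := Anti.ant (m := m)) (Anti.Alt.mk (q + 1) (Nat.succ_lt_succ h)
      (Fin.cons μ t) (μ ::ₘ L) (Equiv.Perm.decomposeFin.symm (0, σ)))
    rw [agen, this]
    simp [Equiv.Perm.decomposeFin.symm_sign]
  · have hq : q = m := by omega
    subst hq
    simp only [lt_irrefl, dif_neg, not_false_eq_true, dif_pos]
    have : (t ∘ σ) ∘ Fin.cast rfl = t ∘ σ := rfl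
    rw [this, eulB_comp, map_mul, Algebra.smul_def]
    rfl

theorem dDelta_mem {m : ℕ} (j : Jet m) (l : Lab m (m + 1)) :
    dDelta j l ∈ superComm Anti.ant Anti.Alt ((Anti.c l).ant + 1) := by
  obtain ⟨q, lt, t, L⟩ := l
  unfold dDelta
  by_cases h : q < m
  · simp only [h, dif_pos]
    refine Submodule.sum_mem _ fun μ _ => gen_mem_superComm ?_
    have : m + 1 - q + 1 = (m + 1 - (q + 1)) + 2 := by omega
    simp only [Anti.ant, this]
    push_cast
    rw [show (2 : ZMod 2) = 0 from rfl, add_zero]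
  · have hq : q = m := by omega
    subst hq
    simp only [lt_irrefl, dif_neg, not_false_eq_true, dif_pos]
    refine algebraMap_mem_superComm ?_ _
    have : q + 1 - q = 1 := by omega
    simp only [Anti.ant, this]
    rfl

theorem ktVal_mem {m : ℕ} (T : ℕ) (j : Jet m) (a : Anti m) :
    ktVal T j a ∈ superComm Anti.ant Anti.Alt (a.ant + 1) := by
  unfold ktVal
  split_ifs
  · cases a with
    | s L => exact algebraMap_mem_superComm (p := 1 + 1) rfl _
    | c l => exact dDelta_mem j l
  · exact Submodule.zero_mem _

theorem ktVal_alt {m : ℕ} (T : ℕ) (j : Jet m) (a b : Anti m) (z : ℤ) (h : Anti.Alt a b z) :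
    ktVal T j a = (z : ℝ) • ktVal T j b ∧ a.ant = b.ant := by
  obtain ⟨q, lt, t, L, σ⟩ := h
  refine ⟨?_, rfl⟩
  unfold ktVal
  by_cases h : m + 1 - q ≤ T
  · simp only [Anti.ant, h, if_true]
    exact dDelta_alt j q lt t L σ
  · simp [Anti.ant, h]

/-- The Koszul-Tate differential at the point `j` of the jet space, with antifields of antifield
number at most `T`: the right graded derivation with `s̄_Λ ↦ d_Λ 𝓔`, `c̄^t_Λ ↦ d_Λ Δ^t`.
It is `δ̄` for `T = 1` and the `N`-stage differential `δ_N` for `T = N + 2`. -/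
def kt {m : ℕ} (T : ℕ) (j : Jet m) : AntiAlg m →ₗ[ℝ] AntiAlg m :=
  rightDer (ktVal T j) (ktVal_mem T j) (ktVal_alt T j)

/-! ### Coordinate changes of antifields -/

theorem superComm_mul {G : Type*} {par : G → ℕ} {lin : G → G → ℤ → Prop} {p q : ℕ}
    {y z : GCAlg par lin} (hy : y ∈ superComm par lin p)
    (hz : z ∈ Submodule.span ℝ (gen par lin '' {g | par g = q})) :
    y * z = (-1 : ℝ) ^ (p * q) • (z * y) := by
  induction hz using Submodule.span_induction with
  | mem x h =>
    obtain ⟨g, rfl, rfl⟩ := h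
    exact hy g
  | zero => simp
  | add a b _ _ ha hb => rw [mul_add, ha, hb, add_mul, smul_add]
  | smul c a _ ha => rw [mul_smul_comm, ha, smul_mul_assoc, smul_comm]

theorem span_le_superComm {G : Type*} {par : G → ℕ} {lin : G → G → ℤ → Prop} {p : ℕ} :
    Submodule.span ℝ (gen par lin '' {g | par g = p}) ≤ superComm par lin p := by
  rw [Submodule.span_le]
  rintro _ ⟨g, rfl, rfl⟩
  exact gen_mem_superComm rfl

/-- Precomposition of tuples of indices with a permutation. -/
def tupPerm (m : ℕ) {q : ℕ} (σ : Equiv.Perm (Fin q)) :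
    (Fin q → Fin (m + 1)) ≃ (Fin q → Fin (m + 1)) where
  toFun t := t ∘ σ
  invFun t := t ∘ σ.symm
  left_inv t := by funext i; simp
  right_inv t := by funext i; simp

section Transport

variable {m : ℕ} {X : Type*} [TopologicalSpace X]

/-- The antifields of the chart `ψ` through those of the chart `φ`, at the point with
`φ`-coordinates `x`. -/
def antiTr (φ ψ : OpenPartialHomeomorph X (E m)) (x : E m) : Anti m → AntiAlg m
  | .s L => (prolong (invJac φ ψ) (fun _ _ : Unit => invDet φ ψ) L.sort ()).eval x
      fun _ S => agen (.s S)
  | .c ⟨q, lt, t, L⟩ => (prolong (invJac φ ψ) (conDensLaw φ ψ q) L.sort t).eval x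
      fun u S => agen (.c ⟨q, lt, u, S⟩)

theorem antiTr_mem (φ ψ : OpenPartialHomeomorph X (E m)) (x : E m) (a : Anti m) :
    antiTr φ ψ x a ∈ Submodule.span ℝ (gen Anti.ant Anti.Alt '' {g | g.ant = a.ant}) := by
  match a with
  | .s L =>
    unfold antiTr
    exact eval_mem _ _ _ _ fun _ S => Submodule.subset_span (Set.mem_image_of_mem _ rfl)
  | .c ⟨q, lt, t, L⟩ =>
    unfold antiTr
    exact eval_mem _ _ _ _ fun _ S => Submodule.subset_span (Set.mem_image_of_mem _ rfl)

/-- Substitution of the antifields of `φ` for those of `ψ`. -/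
def antiTransport (φ ψ : OpenPartialHomeomorph X (E m)) (x : E m) :
    AntiAlg m →ₐ[ℝ] AntiAlg m :=
  gcHom (antiTr φ ψ x)
    (fun a b => superComm_mul (span_le_superComm (antiTr_mem φ ψ x a)) (antiTr_mem φ ψ x b))
    (by
      rintro _ _ _ ⟨q, lt, t, L, σ⟩
      have h1 := prolong_equivariant (invJac φ ψ) (conDensLaw φ ψ q) (tupPerm m σ)
        (by
          intro a b
          funext x
          simp only [conDensLaw, tupPerm, Equiv.coe_fn_mk, Function.comp_apply]
          rw [Equiv.prod_comp σ fun i => jac φ ψ (a i) (b i) x]) L.sort t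
      have h2 := eval_equivariant (tupPerm m σ) (prolong (invJac φ ψ) (conDensLaw φ ψ q) L.sort t)
        x (fun u S => agen (.c ⟨q, lt, u, S⟩)) ((Equiv.Perm.sign σ : ℤ) : ℝ)
        (fun b S => gen_lin (Anti.Alt.mk q lt b S σ))
      simp only [antiTr]
      rw [← h2, ← h1]
      rfl)

end Transport

/-! ### Ghosts and the ascent operator -/

/-- The ghost number `m - q = k + 1` of the ghosts `c_{μ_{k+2}…μ_{n-1}}`, which have
`q = n - 2 - k` indices. Its parity is the Grassmann parity. -/
def ghostNum {m : ℕ} (l : Lab m m) : ℕ := m - l.q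

/-- Antisymmetry of the ghosts in their tensor indices. -/
inductive GhostAlt {m : ℕ} : Lab m m → Lab m m → ℤ → Prop
  | mk (q : ℕ) (lt : q < m) (t : Fin q → Fin (m + 1)) (L : MI m) (σ : Equiv.Perm (Fin q)) :
      GhostAlt ⟨q, lt, t ∘ σ, L⟩ ⟨q, lt, t, L⟩ (Equiv.Perm.sign σ : ℤ)

/-- Graded polynomials in the ghosts `c_t` and their jets. -/
abbrev GhostAlg (m : ℕ) := GCAlg (ghostNum (m := m)) GhostAlt

/-- The ghosts as elements of the algebra. -/
abbrev ggen {m : ℕ} (l : Lab m m) : GhostAlg m := gen ghostNum GhostAlt l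

/-- `- d_Λ d_{[v₁} c_{v₂…v_q]}`, with antisymmetrization of weight one; `0` if `q = 0`. -/
def gaugeVar {m : ℕ} : (q : ℕ) → q ≤ m → (Fin q → Fin (m + 1)) → MI m → GhostAlg m
  | 0, _, _, _ => 0
  | q + 1, h, v, L => -((1 / ((q + 1).factorial : ℝ)) •
      ∑ σ : Equiv.Perm (Fin (q + 1)), ((Equiv.Perm.sign σ : ℤ) : ℝ) •
        ggen ⟨q, h, Fin.tail (v ∘ σ), v (σ 0) ::ₘ L⟩)

theorem gaugeVar_alt {m : ℕ} (q : ℕ) (h : q ≤ m) (v : Fin q → Fin (m + 1)) (L : MI m)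
    (τ : Equiv.Perm (Fin q)) :
    gaugeVar q h (v ∘ τ) L = ((Equiv.Perm.sign τ : ℤ) : ℝ) • gaugeVar q h v L := by
  cases q with
  | zero => simp [gaugeVar]
  | succ q =>
    simp only [gaugeVar, smul_neg]
    rw [smul_comm]
    congr 2
    rw [Finset.smul_sum]
    conv_rhs => rw [← Equiv.sum_comp (Equiv.mulLeft τ)]
    refine Finset.sum_congr rfl fun σ _ => ?_
    rw [smul_smul]
    congr 1
    simp only [Equiv.coe_mulLeft, Equiv.Perm.sign_mul, Units.val_mul, Int.cast_mul]
    rw [← mul_assoc, ← Int.cast_mul, ← Units.val_mul, Int.units_mul_self]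
    simp

theorem gaugeVar_mem {m : ℕ} (l : Lab m m) :
    gaugeVar l.q l.lt.le l.idx l.ord ∈ superComm ghostNum GhostAlt (ghostNum l + 1) := by
  obtain ⟨q, lt, v, L⟩ := l
  cases q with
  | zero => exact Submodule.zero_mem _
  | succ q =>
    refine Submodule.neg_mem _ (Submodule.smul_mem _ _ (Submodule.sum_mem _ fun σ _ =>
      Submodule.smul_mem _ _ (gen_mem_superComm ?_)))
    simp only [ghostNum]
    congr 1
    omega

/-- The part of the ascent operator that acts on ghosts, `c_v ↦ - d_{[v₁} c_{v₂…v_q]}`,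
as a left graded derivation. -/
def ghostDer (m : ℕ) : GhostAlg m →ₗ[ℝ] GhostAlg m :=
  leftDer (fun l => gaugeVar l.q l.lt.le l.idx l.ord) gaugeVar_mem (by
    rintro _ _ _ ⟨q, lt, t, L, σ⟩
    exact ⟨gaugeVar_alt q lt.le t L σ, rfl⟩)

section GhostTransport

variable {m : ℕ} {X : Type*} [TopologicalSpace X]

/-- The ghosts of the chart `ψ` through those of the chart `φ`. -/
def ghostTr (φ ψ : OpenPartialHomeomorph X (E m)) (x : E m) : Lab m m → GhostAlg m
  | ⟨q, lt, t, L⟩ => (prolong (invJac φ ψ) (covLaw φ ψ q) L.sort t).eval x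
      fun u S => ggen ⟨q, lt, u, S⟩

theorem ghostTr_mem (φ ψ : OpenPartialHomeomorph X (E m)) (x : E m) (a : Lab m m) :
    ghostTr φ ψ x a ∈
      Submodule.span ℝ (gen ghostNum GhostAlt '' {g | ghostNum g = ghostNum a}) := by
  obtain ⟨q, lt, t, L⟩ := a
  unfold ghostTr
  exact eval_mem _ _ _ _ fun _ S => Submodule.subset_span (Set.mem_image_of_mem _ rfl)

/-- Substitution of the ghosts of `φ` for those of `ψ`. -/
def ghostTransport (φ ψ : OpenPartialHomeomorph X (E m)) (x : E m) :
    GhostAlg m →ₐ[ℝ] GhostAlg m :=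
  gcHom (ghostTr φ ψ x)
    (fun a b => superComm_mul (span_le_superComm (ghostTr_mem φ ψ x a)) (ghostTr_mem φ ψ x b))
    (by
      rintro _ _ _ ⟨q, lt, t, L, σ⟩
      have h1 := prolong_equivariant (invJac φ ψ) (covLaw φ ψ q) (tupPerm m σ)
        (by
          intro a b
          funext x
          simp only [covLaw, tupPerm, Equiv.coe_fn_mk, Function.comp_apply]
          rw [Equiv.prod_comp σ fun i => invJac φ ψ (b i) (a i) x]) L.sort t
      have h2 := eval_equivariant (tupPerm m σ) (prolong (invJac φ ψ) (covLaw φ ψ q) L.sort t)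
        x (fun u S => ggen ⟨q, lt, u, S⟩) ((Equiv.Perm.sign σ : ℤ) : ℝ)
        (fun b S => gen_lin (GhostAlt.mk q lt b S σ))
      simp only [ghostTr]
      rw [← h2, ← h1]
      rfl)

end GhostTransport

/-! ### Graded densities and graded functions on `X` -/

section Global

variable {m : ℕ} (X : Type*) [TopologicalSpace X] [ChartedSpace (E m) X]

/-- The smooth coordinate charts of `X`. -/
def charts (m : ℕ) (X : Type*) [TopologicalSpace X] [ChartedSpace (E m) X] :
    Set (OpenPartialHomeomorph X (E m)) :=
  IsManifold.maximalAtlas 𝓘(ℝ, E m) ∞ X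

/-- Families of local coordinate expressions: for every chart, a function of the coordinates
`x` and of the jet coordinates of the fields, with values in an algebra of polynomials. -/
abbrev Fam (m : ℕ) (X : Type*) [TopologicalSpace X] (Q : Type*) :=
  OpenPartialHomeomorph X (E m) → E m → Jet m → Q

/-- `F` is, over `U`, a finite sum `∑_w G_w w` over products `w` of the elements `val j g`,
with `w` subject to `P` and coefficients `G_w` smooth functions on `J^r Y`. -/
def IsPolyIn {G Q : Type*} [Ring Q] [Algebra ℝ Q] (val : Jet m → G → Q) (P : List G → Prop)
    (U : Set (E m)) (r : ℕ) (F : E m → Jet m → Q) : Prop :=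
  ∃ (S : Finset (List G)) (c : List G → E m → Jet m → ℝ),
    (∀ w ∈ S, P w ∧ IsJetFun U r (c w)) ∧
      ∀ x ∈ U, ∀ j, F x j = ∑ w ∈ S, c w x j • (w.map (val j)).prod

/-- The space `P^{0,n}_∞{N}_a`, `N = T - 2`, of graded densities `Φ dx¹ ∧ … ∧ dxⁿ` of antifield
number `a` in the antifields of antifield number at most `T`: they have finite jet order, are
polynomial in antifields, and their coordinate expressions agree on overlaps of charts.
For `T = 1` these are densities in the antifields `s̄`, `s̄^{μ₁…μ_{n-1}}` only. -/
structure IsGradedDensity (T a : ℕ) (Φ : Fam m X (AntiAlg m)) : Prop where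
  /-- normalization outside the domain of the chart -/
  zero : ∀ φ x j, ¬ (φ ∈ charts m X ∧ x ∈ φ.target) → Φ φ x j = 0
  poly : ∃ r : ℕ, ∀ φ ∈ charts m X,
    IsPolyIn (fun _ => agen)
      (fun w => (∀ g ∈ w, g.ant ≤ T ∧ g.order ≤ r) ∧ (w.map Anti.ant).sum = a)
      φ.target r (Φ φ)
  compat : ∀ φ ∈ charts m X, ∀ ψ ∈ charts m X, ∀ x ∈ φ.target, φ.symm x ∈ ψ.source →
    ∀ j j', JetTransf φ ψ x j j' →
      Φ φ x j = jacDet φ ψ x • antiTransport φ ψ x (Φ ψ (ψ (φ.symm x)) j')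

/-- The space `P^0_∞{n-2}_a` of graded functions of ghost number `a` on `X`, polynomial in
ghosts. -/
structure IsGhostFun (a : ℕ) (f : Fam m X (GhostAlg m)) : Prop where
  /-- normalization outside the domain of the chart -/
  zero : ∀ φ x j, ¬ (φ ∈ charts m X ∧ x ∈ φ.target) → f φ x j = 0
  poly : ∃ r : ℕ, ∀ φ ∈ charts m X,
    IsPolyIn (fun _ => ggen)
      (fun w => (∀ g ∈ w, g.ord.card ≤ r) ∧ (w.map ghostNum).sum = a) φ.target r (f φ)
  compat : ∀ φ ∈ charts m X, ∀ ψ ∈ charts m X, ∀ x ∈ φ.target, φ.symm x ∈ ψ.source →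
    ∀ j j', JetTransf φ ψ x j j' →
      f φ x j = ghostTransport φ ψ x (f ψ (ψ (φ.symm x)) j')

variable {X}

/-- The Koszul-Tate differential of families; `δ_N` for `T = N + 2` and `δ̄` for `T = 1`. -/
def KT (T : ℕ) (Φ : Fam m X (AntiAlg m)) : Fam m X (AntiAlg m) :=
  fun φ x j => kt T j (Φ φ x j)

variable (X)

/-- `Φ` of antifield number `a` is a boundary of the differential `KT T`. -/
def IsBoundary (T a : ℕ) (Φ : Fam m X (AntiAlg m)) : Prop :=
  ∃ Ψ, IsGradedDensity X T (a + 1) Ψ ∧ Φ = KT T Ψ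

/-- In every chart, `Φ` is a finite sum `∑ G d_{Λ₁}Δ^{t₁} ⋯ d_{Λᵢ}Δ^{tᵢ}` with smooth
coefficients `G` on a finite order jet manifold of `Y`, over the products that satisfy `P`. -/
def FactorsThroughDelta (P : List (Lab m (m + 1)) → Prop) (Φ : Fam m X (AntiAlg m)) : Prop :=
  ∃ r : ℕ, ∀ φ ∈ charts m X,
    IsPolyIn dDelta (fun w => P w ∧ ∀ l ∈ w, l.ord.card ≤ r) φ.target r (Φ φ)

/-- Exactness at antifield number `a` of the complex with differential `KT T`. -/
def ExactAt (m T a : ℕ) (X : Type*) [TopologicalSpace X] [ChartedSpace (E m) X] : Prop :=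
  ∀ Φ : Fam m X (AntiAlg m), IsGradedDensity X T a Φ → KT T Φ = 0 → IsBoundary X T a Φ

/-- The `M`-homology regularity condition: for `-1 ≤ k ≤ M - 3`, every `δ_k`-cycle in
`P^{0,n}_∞{k}_{k+3}` is a `δ_{k+1}`-boundary (here `T = k + 2`). -/
def HomologyRegular (m M : ℕ) (X : Type*) [TopologicalSpace X] [ChartedSpace (E m) X] : Prop :=
  ∀ T : ℕ, 1 ≤ T → T + 1 ≤ M → ∀ Φ : Fam m X (AntiAlg m),
    IsGradedDensity X T (T + 1) Φ → KT T Φ = 0 → IsBoundary X (T + 1) (T + 1) Φ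

/-- Completeness of the `k`-stage Noether identities `Δ^{μ_{k+2}…μ_{n-1}}` (`k = T - 1`): every
`T`-cycle of `KT T` is, up to a boundary, locally a sum `∑ G d_Λ Δ^{μ_{k+2}…μ_{n-1}}`. -/
def CompleteNoether (m T : ℕ) (X : Type*) [TopologicalSpace X] [ChartedSpace (E m) X] : Prop :=
  ∀ Φ : Fam m X (AntiAlg m), IsGradedDensity X T T Φ → KT T Φ = 0 →
    ∃ Ψ, IsGradedDensity X T (T + 1) Ψ ∧
      FactorsThroughDelta X (fun w => ∃ l, w = [l] ∧ l.q + T = m) (Φ - KT T Ψ)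

/-- `N`-stage reducibility, with the complete `k`-stage Noether identities
`Δ^{μ_{k+2}…μ_{n-1}}`, `0 ≤ k ≤ N`: the graded densities with the differential `δ_N` form an
`(N+1)`-exact chain complex that satisfies the `(N+1)`-homology regularity condition. -/
structure StageReducible (m N : ℕ) (X : Type*) [TopologicalSpace X] [ChartedSpace (E m) X] :
    Prop where
  map_chain : ∀ (a : ℕ) (Φ : Fam m X (AntiAlg m)), IsGradedDensity X (N + 2) (a + 1) Φ →
    IsGradedDensity X (N + 2) a (KT (N + 2) Φ)
  nilpotent : ∀ (a : ℕ) (Φ : Fam m X (AntiAlg m)), IsGradedDensity X (N + 2) a Φ →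
    KT (N + 2) (KT (N + 2) Φ) = 0
  complete : ∀ T : ℕ, 1 ≤ T → T ≤ N + 1 → CompleteNoether m T X
  exact_at : ∀ a : ℕ, 1 ≤ a → a ≤ N + 1 → ExactAt m (N + 2) a X
  regular : HomologyRegular m (N + 1) X

end Global

/-- The derivative at `0` of a curve in a real vector space, taken with respect to all linear
functionals (`0` if there is none). -/
def weakDeriv {Q : Type*} [AddCommGroup Q] [Module ℝ Q] (F : ℝ → Q) : Q :=
  open Classical in
  if h : ∃ v : Q, ∀ ℓ : Module.Dual ℝ Q, HasDerivAt (fun s => ℓ (F s)) (ℓ v) 0 then h.choose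
  else 0

/-- The direction `∂/∂B_v` in the fibre of `Y`: `∂B_u/∂B_v` is the product of Kronecker symbols
`δ^{vᵢ}_{uᵢ}`, antisymmetrized with weight one. -/
def altBasis {m : ℕ} (v : Fin m → Fin (m + 1)) : AltComp m m :=
  ⟨fun u => (1 / (m.factorial : ℝ)) * ∑ σ : Equiv.Perm (Fin m),
      ((Equiv.Perm.sign σ : ℤ) : ℝ) * if u = v ∘ σ then 1 else 0, by
    intro τ u
    beta_reduce
    rw [mul_left_comm ((Equiv.Perm.sign τ : ℤ) : ℝ)]
    congr 1
    rw [Finset.mul_sum]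
    conv_lhs => rw [← Equiv.sum_comp (Equiv.mulRight τ)]
    refine Finset.sum_congr rfl fun σ _ => ?_
    have h : (u ∘ τ = v ∘ ⇑(σ * τ)) ↔ u = v ∘ σ := by
      rw [Equiv.Perm.coe_mul, ← Function.comp_assoc]
      exact ⟨fun h => τ.surjective.injective_comp_right h, fun h => by rw [h]⟩
    simp only [Equiv.coe_mulRight, h, Equiv.Perm.sign_mul, Units.val_mul, Int.cast_mul]
    ring⟩

/-- The ascent operator `u_e = u + u_{(1)} + … + u_{(n-2)}`, the left graded derivation with
`u = - d_{μ₁} c_{μ₂…μ_{n-1}} ∂/∂B_{μ₁…μ_{n-1}}`,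
`u_{(k)} = - d_{μ_{k+1}} c_{μ_{k+2}…μ_{n-1}} ∂/∂c_{μ_{k+1}…μ_{n-1}}`, prolonged to jets. -/
def ascent {m : ℕ} {X : Type*} [TopologicalSpace X] (f : Fam m X (GhostAlg m)) :
    Fam m X (GhostAlg m) :=
  fun φ x j =>
    (∑ᶠ p : (Fin m → Fin (m + 1)) × MI m, gaugeVar m le_rfl p.1 p.2 *
      weakDeriv fun s : ℝ => f φ x (j + s • (Pi.single p.2 (0, altBasis p.1) : Jet m))) +
    ghostDer m (f φ x j)

end BFTheory

end

open BFTheory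

/-! At a fixed point of the jet space the Koszul–Tate differential `δ` is an odd derivation of a
free graded commutative algebra, and on generators it is the algebraic Koszul (divergence) complex
`c̄ → c̄^μ → … → c̄^{μ₁…μ_{n-1}} → A`, with `-ε A_Λ` in the place of the generators with `n`
indices, together with the separate pairs `s̄_Λ → d_Λ 𝓔`. Contracting a tensor index with a
multi-index inverts the divergence up to the factor `|Λ| + n - q` (`koszul_identity`,
`kosz_identity`). This factor vanishes only for the undifferentiated `A`. The functions `d_Λ 𝓔` are
independent because each has its own dual jet direction of `B`.

The coefficients are smooth rather than polynomial in the jets, so the homotopy acts on them through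
derivatives along the finitely many directions dual to `A_S` and `d_S 𝓔` that matter at a given jet
order. Its anticommutator with `δ` is an Euler operator: it counts antifields and differentiates the
coefficients along the field jets that `δ` detects (`homLap_word`, `ktf_homOp`). The Euler operator
is inverted by radial integrals along the detected jets with weight determined by the word length
(`jint_euler`). These integrals keep cycles closed because simultaneous scaling of jets and
antifields commutes with `δ` (`jint_closed`). This gives local exactness on every chart domain, of
whatever shape, since only fibre variables are contracted (`local_exact`).

For a complex truncated at antifield number `T`, the homotopy must not create antifields of number
`T + 1`, so its action on generators of number `T` is dropped. The error is the even derivation `P =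
homProj T`, which kills lower generators and sends those of number `T` to combinations of `d_Λ Δ`.
In antifield number `T` the error is linear in `d_Λ Δ` (`local_complete`). In antifield number `T +
1` the homotopy is applied a second time, to the `P`-image, which is again a cycle; what remains is
a multiple of `P² - P`. It vanishes if `T ≥ 2`, since then a word has at most one letter of number
`T`, and for `T = 1` it is a sum of products of two `d_Λ Δ` (`local_factor`).

The passage to `X` needs naturality under coordinate changes. Formal prolongations are compared by
realizing jets by Taylor polynomials and applying the chain rule to actual functions
(`prolong_jets`, `prolong_natural`). The invariant content is that the divergence of an
antisymmetric tensor density and the exterior derivative are tensorial (`div_transf`,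
`extDeriv_transf`). Hence `δ` commutes with transport (`kt_antiTransport`), and as it is linear over
functions on `X`, local primitives are glued by a partition of unity (`kt_glue`,
`isBoundary_of_cycle`).

For the ascent operator, `u_e² = 0` splits into three cancellations: symmetric second derivatives
against anticommuting gauge variations, the mixed terms against each other, and `d ∘ d = 0` on
ghosts (`ascent_ascent_eq_zero`). The variational derivatives follow from writing the Lagrangian as
`A 𝓔 / n!`. -/

namespace BFTheory

/-! ### Derivations of free graded commutative algebras -/

section GradedCommutative

variable {G : Type*} {par : G → ℕ} {lin : G → G → ℤ → Prop}

theorem gc_mul_neg (u v : GCAlg par lin) : u * -v = -(u * v) := mul_neg u v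

theorem gc_neg_mul (u v : GCAlg par lin) : -u * v = -(u * v) := neg_mul u v

theorem gc_neg_smul (c : ℝ) (v : GCAlg par lin) : (-c) • v = -(c • v) := neg_smul c v

theorem gc_induction {p : GCAlg par lin → Prop} (h0 : ∀ c : ℝ, p (algebraMap ℝ _ c))
    (h1 : ∀ a, p (gen par lin a)) (hm : ∀ u v, p u → p v → p (u * v))
    (ha : ∀ u v, p u → p v → p (u + v)) (u : GCAlg par lin) : p u := by
  obtain ⟨x, rfl⟩ := RingQuot.mkAlgHom_surjective ℝ (GCRel par lin) u
  induction x using FreeAlgebra.induction with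
  | grade0 r => simpa using h0 r
  | grade1 a => exact h1 a
  | mul a b ha hb => rw [map_mul]; exact hm _ _ ha hb
  | add a b hx hy => rw [map_add]; exact ha _ _ hx hy

variable (par lin) in
/-- Products of generators. -/
def word (w : List G) : GCAlg par lin := (w.map (gen par lin)).prod

@[simp] theorem word_nil : word par lin [] = 1 := rfl

@[simp] theorem word_cons (a : G) (w : List G) :
    word par lin (a :: w) = gen par lin a * word par lin w := by simp [word]

theorem word_append (v w : List G) :
    word par lin (v ++ w) = word par lin v * word par lin w := by simp [word]

theorem word_singleton (a : G) : word par lin [a] = gen par lin a := by simp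

/-- Scalars and generators are spanned by words, and concatenation makes the span of words closed
under products. Linear statements thereby reduce to words. -/
theorem span_word : Submodule.span ℝ (Set.range (word par lin)) = ⊤ := by
  rw [eq_top_iff]
  intro u _hu
  clear _hu
  induction u using gc_induction (par := par) (lin := lin) with
  | h0 c =>
    rw [Algebra.algebraMap_eq_smul_one]
    exact Submodule.smul_mem _ _ (Submodule.subset_span ⟨[], rfl⟩)
  | h1 a => exact Submodule.subset_span ⟨[a], word_singleton a⟩
  | hm u v hu hv =>
    have := Submodule.mul_mem_mul hu hv
    rw [Submodule.span_mul_span] at this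
    refine Submodule.span_mono ?_ this
    rintro _ ⟨_, ⟨w, rfl⟩, _, ⟨w', rfl⟩, rfl⟩
    exact ⟨w ++ w', word_append w w'⟩
  | ha u v hu hv => exact Submodule.add_mem _ hu hv

theorem linearMap_ext_word {M : Type*} [AddCommGroup M] [Module ℝ M]
    {f g : GCAlg par lin →ₗ[ℝ] M} (h : ∀ w, f (word par lin w) = g (word par lin w)) : f = g := by
  refine LinearMap.ext_on_range (v := word par lin) span_word h

theorem algHom_ext_gen {B : Type*} [Semiring B] [Algebra ℝ B] {f g : GCAlg par lin →ₐ[ℝ] B}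
    (h : ∀ a, f (gen par lin a) = g (gen par lin a)) : f = g := by
  refine AlgHom.ext fun u => ?_
  induction u using gc_induction with
  | h0 c => simp
  | h1 a => exact h a
  | hm u v hu hv => simp [hu, hv]
  | ha u v hu hv => simp [hu, hv]

variable (par lin) in
/-- The parity involution. It needs the relations `lin` to preserve the degree. -/
noncomputable def parityInv (hl : ∀ a b z, lin a b z → par a = par b) :
    GCAlg par lin →ₐ[ℝ] GCAlg par lin :=
  gcHom (fun a => (-1 : ℝ) ^ par a • gen par lin a)
    (fun a b => by
      simp only [smul_mul_smul_comm]
      rw [gen_comm a b, smul_comm, mul_comm ((-1 : ℝ) ^ par a)])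
    (fun a b z h => by
      rw [hl a b z h, gen_lin h, smul_comm])

variable {hp : ∀ a b z, lin a b z → par a = par b}

theorem parityInv_gen (a : G) :
    parityInv par lin hp (gen par lin a) = (-1 : ℝ) ^ par a • gen par lin a := gcHom_gen ..

theorem parityInv_word (w : List G) :
    parityInv par lin hp (word par lin w) =
      (-1 : ℝ) ^ (w.map par).sum • word par lin w := by
  induction w with
  | nil => simp
  | cons a w ih =>
    rw [word_cons, map_mul, parityInv_gen, ih, smul_mul_smul_comm, List.map_cons, List.sum_cons,
      pow_add]

/-- Membership in `superComm` only concerns generators. Against a product the signs multiply, and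
for odd degree the total sign is what the parity involution records. -/
theorem superComm_mul_eq {p : ℕ} {y : GCAlg par lin} (hy : y ∈ superComm par lin p)
    (h : Odd p) (v : GCAlg par lin) : y * v = parityInv par lin hp v * y := by
  induction v using gc_induction with
  | h0 c => simp [Algebra.commutes]
  | h1 a =>
    rw [hy a, parityInv_gen, smul_mul_assoc]
    congr 1
    rw [pow_mul, h.neg_one_pow]
  | hm u v hu hv => rw [map_mul, mul_assoc, ← hv, ← mul_assoc, ← mul_assoc, hu]
  | ha u v hu hv => rw [map_add, mul_add, add_mul, hu, hv]

variable (hp) in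
/-- Odd right derivations. -/
structure IsOddRight (D : GCAlg par lin →ₗ[ℝ] GCAlg par lin) : Prop where
  map_mul : ∀ u v, D (u * v) = u * D v + D u * parityInv par lin hp v
  map_inv : ∀ u, D (parityInv par lin hp u) = - parityInv par lin hp (D u)

variable (hp) in
/-- Odd left derivations. -/
structure IsOddLeft (D : GCAlg par lin →ₗ[ℝ] GCAlg par lin) : Prop where
  map_mul : ∀ u v, D (u * v) = D u * v + parityInv par lin hp u * D v
  map_inv : ∀ u, D (parityInv par lin hp u) = - parityInv par lin hp (D u)

/-- Even derivations. -/
def IsEvenDer (D : GCAlg par lin →ₗ[ℝ] GCAlg par lin) : Prop :=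
  ∀ u v, D (u * v) = u * D v + D u * v

theorem IsOddRight.map_one {D : GCAlg par lin →ₗ[ℝ] GCAlg par lin} (h : IsOddRight hp D) :
    D 1 = 0 := by
  have := h.map_mul 1 1
  simpa using this

theorem IsOddLeft.map_one {D : GCAlg par lin →ₗ[ℝ] GCAlg par lin} (h : IsOddLeft hp D) :
    D 1 = 0 := by
  have := h.map_mul 1 1
  simpa using this

theorem IsEvenDer.map_one {D : GCAlg par lin →ₗ[ℝ] GCAlg par lin} (h : IsEvenDer D) :
    D 1 = 0 := by
  have := h 1 1
  simpa using this

theorem IsOddRight.map_algebraMap {D : GCAlg par lin →ₗ[ℝ] GCAlg par lin} (h : IsOddRight hp D)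
    (c : ℝ) : D (algebraMap ℝ _ c) = 0 := by
  rw [Algebra.algebraMap_eq_smul_one, map_smul, h.map_one, smul_zero]

theorem parityInv_parityInv (u : GCAlg par lin) :
    parityInv par lin hp (parityInv par lin hp u) = u := by
  have : (parityInv par lin hp).comp (parityInv par lin hp) = AlgHom.id ℝ _ := by
    refine algHom_ext_gen fun a => ?_
    simp [parityInv_gen, smul_smul, ← mul_pow]
  exact DFunLike.congr_fun this u

/-- The derivation is the upper right entry of a representation by upper triangular matrices with
diagonal entries `u` and the parity involution of `u`. Multiplicativity of the representation is the
graded Leibniz rule. -/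
theorem rightDer_isOddRight (D : G → GCAlg par lin) (hD : ∀ a, D a ∈ superComm par lin (par a + 1))
    (hl : ∀ a b z, lin a b z → D a = (z : ℝ) • D b ∧ par a = par b)
    (hi : ∀ a, parityInv par lin hp (D a) = (-1 : ℝ) ^ (par a + 1) • D a) :
    IsOddRight hp (rightDer D hD hl) := by
  have key : ∃ ρ : GCAlg par lin →ₐ[ℝ] Matrix (Fin 2) (Fin 2) (GCAlg par lin),
      (∀ u, rightDer D hD hl u = ρ u 0 1) ∧ ∀ a, ρ (gen par lin a) = rightMat D a :=
    ⟨RingQuot.liftAlgHom ℝ (s := GCRel par lin) ⟨FreeAlgebra.lift ℝ (rightMat D), _⟩,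
      fun u => rfl, fun a => by simp [gen]⟩
  obtain ⟨ρ, h1, h2⟩ := key
  have h3 : ∀ u, ρ u 0 0 = u ∧ ρ u 1 0 = 0 ∧ ρ u 1 1 = parityInv par lin hp u := by
    intro u
    induction u using gc_induction with
    | h0 c => simp [Matrix.algebraMap_matrix_apply]
    | h1 a => simp [h2, rightMat, parityInv_gen]
    | hm u v hu hv => simp [Matrix.mul_apply, hu, hv]
    | ha u v hu hv => simp [hu, hv]
  have hm : ∀ u v, rightDer D hD hl (u * v) = u * rightDer D hD hl v +
      rightDer D hD hl u * parityInv par lin hp v := by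
    intro u v
    simp only [h1, map_mul, Matrix.mul_apply, Fin.sum_univ_two]
    rw [(h3 u).1, (h3 v).2.2]
  refine ⟨hm, fun u => ?_⟩
  induction u using gc_induction with
  | h0 c =>
    have : rightDer D hD hl (algebraMap ℝ _ c) = 0 := by
      rw [h1]; simp [Matrix.algebraMap_matrix_apply]
    simp [this]
  | h1 a =>
    rw [parityInv_gen, map_smul, rightDer_gen, hi, ← gc_neg_smul, pow_succ]
    simp
  | hm u v hu hv =>
    rw [map_mul, hm, hm, hu, hv, map_add, map_mul, map_mul]
    simp only [gc_mul_neg, gc_neg_mul, neg_add]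
  | ha u v hu hv => simp only [map_add, hu, hv, neg_add]

/-- The same matrix representation with the two diagonal entries exchanged puts the sign on the left
factor. -/
theorem leftDer_isOddLeft (D : G → GCAlg par lin) (hD : ∀ a, D a ∈ superComm par lin (par a + 1))
    (hl : ∀ a b z, lin a b z → D a = (z : ℝ) • D b ∧ par a = par b)
    (hi : ∀ a, parityInv par lin hp (D a) = (-1 : ℝ) ^ (par a + 1) • D a) :
    IsOddLeft hp (leftDer D hD hl) := by
  have key : ∃ ρ : GCAlg par lin →ₐ[ℝ] Matrix (Fin 2) (Fin 2) (GCAlg par lin),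
      (∀ u, leftDer D hD hl u = ρ u 0 1) ∧ ∀ a, ρ (gen par lin a) = leftMat D a :=
    ⟨RingQuot.liftAlgHom ℝ (s := GCRel par lin) ⟨FreeAlgebra.lift ℝ (leftMat D), _⟩,
      fun u => rfl, fun a => by simp [gen]⟩
  obtain ⟨ρ, h1, h2⟩ := key
  have h3 : ∀ u, ρ u 0 0 = parityInv par lin hp u ∧ ρ u 1 0 = 0 ∧ ρ u 1 1 = u := by
    intro u
    induction u using gc_induction with
    | h0 c => simp [Matrix.algebraMap_matrix_apply]
    | h1 a => simp [h2, leftMat, parityInv_gen]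
    | hm u v hu hv => simp [Matrix.mul_apply, hu, hv]
    | ha u v hu hv => simp [hu, hv]
  have hm : ∀ u v, leftDer D hD hl (u * v) = leftDer D hD hl u * v +
      parityInv par lin hp u * leftDer D hD hl v := by
    intro u v
    simp only [h1, map_mul, Matrix.mul_apply, Fin.sum_univ_two]
    rw [(h3 u).1, (h3 v).2.2, add_comm]
  refine ⟨hm, fun u => ?_⟩
  induction u using gc_induction with
  | h0 c =>
    have : leftDer D hD hl (algebraMap ℝ _ c) = 0 := by
      rw [h1]; simp [Matrix.algebraMap_matrix_apply]
    simp [this]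
  | h1 a =>
    rw [parityInv_gen, map_smul, leftDer_gen, hi, ← gc_neg_smul, pow_succ]
    simp
  | hm u v hu hv =>
    rw [map_mul, hm, hm, hu, hv, map_add, map_mul, map_mul]
    simp only [gc_mul_neg, gc_neg_mul, neg_add]
  | ha u v hu hv => simp only [map_add, hu, hv, neg_add]

/-- The anticommutator of odd right derivations is an even derivation. -/
theorem IsOddRight.anticomm {D D' : GCAlg par lin →ₗ[ℝ] GCAlg par lin} (h : IsOddRight hp D)
    (h' : IsOddRight hp D') : IsEvenDer (D ∘ₗ D' + D' ∘ₗ D) := by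
  intro u v
  simp only [LinearMap.add_apply, LinearMap.comp_apply, h.map_mul, h'.map_mul, map_add, h.map_inv,
    h'.map_inv, parityInv_parityInv, gc_mul_neg, mul_add, add_mul]
  abel

theorem IsOddLeft.anticomm {D D' : GCAlg par lin →ₗ[ℝ] GCAlg par lin} (h : IsOddLeft hp D)
    (h' : IsOddLeft hp D') : IsEvenDer (D ∘ₗ D' + D' ∘ₗ D) := by
  intro u v
  simp only [LinearMap.add_apply, LinearMap.comp_apply, h.map_mul, h'.map_mul, map_add, h.map_inv,
    h'.map_inv, parityInv_parityInv, gc_neg_mul, mul_add, add_mul]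
  abel

theorem IsOddRight.add {D D' : GCAlg par lin →ₗ[ℝ] GCAlg par lin} (h : IsOddRight hp D)
    (h' : IsOddRight hp D') : IsOddRight hp (D + D') where
  map_mul u v := by
    simp only [LinearMap.add_apply, h.map_mul, h'.map_mul]
    noncomm_ring
  map_inv u := by
    simp only [LinearMap.add_apply, h.map_inv, h'.map_inv, map_add, neg_add]

theorem IsOddRight.smul {D : GCAlg par lin →ₗ[ℝ] GCAlg par lin} (h : IsOddRight hp D)
    (c : ℝ) : IsOddRight hp (c • D) where
  map_mul u v := by
    simp only [LinearMap.smul_apply, h.map_mul, smul_add, mul_smul_comm, smul_mul_assoc]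
  map_inv u := by simp [h.map_inv]

theorem IsOddRight.sub {D D' : GCAlg par lin →ₗ[ℝ] GCAlg par lin} (h : IsOddRight hp D)
    (h' : IsOddRight hp D') : IsOddRight hp (D - D') := by
  have := h.add (h'.smul (-1))
  have h2 : D - D' = D + (-1 : ℝ) • D' := by module
  rwa [h2]

/-- `u ↦ D(u) y` is an even derivation if `D` is an odd right derivation and `y` is odd. -/
theorem IsOddRight.mulRight {D : GCAlg par lin →ₗ[ℝ] GCAlg par lin} (h : IsOddRight hp D)
    {p : ℕ} {y : GCAlg par lin} (hy : y ∈ superComm par lin p) (hp' : Odd p) :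
    IsEvenDer (LinearMap.mulRight ℝ y ∘ₗ D) := by
  intro u v
  have := superComm_mul_eq (hp := hp) hy hp' (v)
  simp only [LinearMap.comp_apply, LinearMap.mulRight_apply, h.map_mul, add_mul, mul_assoc, this]

theorem IsEvenDer.add {D D' : GCAlg par lin →ₗ[ℝ] GCAlg par lin} (h : IsEvenDer D)
    (h' : IsEvenDer D') : IsEvenDer (D + D') := by
  intro u v
  simp only [LinearMap.add_apply, h u v, h' u v]
  noncomm_ring

theorem IsEvenDer.sum {ι : Type*} (s : Finset ι) {D : ι → GCAlg par lin →ₗ[ℝ] GCAlg par lin}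
    (h : ∀ i ∈ s, IsEvenDer (D i)) : IsEvenDer (∑ i ∈ s, D i) := by
  intro u v
  simp only [LinearMap.sum_apply, Finset.mul_sum, Finset.sum_mul, ← Finset.sum_add_distrib]
  exact Finset.sum_congr rfl fun i hi => h i hi u v

/-- Only the letters of the given word matter. This is essential for the homotopy operator, which is
a sum over jets of bounded order and has the right values only on antifields of that order. -/
theorem IsEvenDer.word_eq {D D' : GCAlg par lin →ₗ[ℝ] GCAlg par lin} (h : IsEvenDer D)
    (h' : IsEvenDer D') {w : List G} (hw : ∀ a ∈ w, D (gen par lin a) = D' (gen par lin a)) :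
    D (word par lin w) = D' (word par lin w) := by
  induction w with
  | nil => simp [h.map_one, h'.map_one]
  | cons a w ih =>
    rw [word_cons, h, h', ih fun b hb => hw b (by simp [hb]), hw a (by simp)]

theorem IsEvenDer.ext {D D' : GCAlg par lin →ₗ[ℝ] GCAlg par lin} (h : IsEvenDer D)
    (h' : IsEvenDer D') (hw : ∀ a, D (gen par lin a) = D' (gen par lin a)) : D = D' :=
  linearMap_ext_word fun _ => h.word_eq h' fun a _ => hw a

/-- An even derivation that fixes each letter is an Euler operator: the Leibniz rule reproduces the
word once per letter. -/
theorem IsEvenDer.word_length {D : GCAlg par lin →ₗ[ℝ] GCAlg par lin} (h : IsEvenDer D)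
    {w : List G} (hw : ∀ a ∈ w, D (gen par lin a) = gen par lin a) :
    D (word par lin w) = (w.length : ℝ) • word par lin w := by
  induction w with
  | nil => simp [h.map_one]
  | cons a w ih =>
    rw [word_cons, h, ih fun b hb => hw b (by simp [hb]), hw a (by simp)]
    simp [add_smul]

theorem IsOddRight.word_eq {D D' : GCAlg par lin →ₗ[ℝ] GCAlg par lin} (h : IsOddRight hp D)
    (h' : IsOddRight hp D') {w : List G} (hw : ∀ a ∈ w, D (gen par lin a) = D' (gen par lin a)) :
    D (word par lin w) = D' (word par lin w) := by
  induction w with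
  | nil => simp [h.map_one, h'.map_one]
  | cons a w ih =>
    rw [word_cons, h.map_mul, h'.map_mul, ih fun b hb => hw b (by simp [hb]), hw a (by simp)]

theorem IsOddRight.ext {D D' : GCAlg par lin →ₗ[ℝ] GCAlg par lin} (h : IsOddRight hp D)
    (h' : IsOddRight hp D') (hw : ∀ a, D (gen par lin a) = D' (gen par lin a)) : D = D' :=
  linearMap_ext_word fun _ => h.word_eq h' fun a _ => hw a

/-- An odd right derivation whose square vanishes on generators has vanishing square. -/
theorem IsOddRight.sq_zero {D : GCAlg par lin →ₗ[ℝ] GCAlg par lin} (h : IsOddRight hp D)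
    (hw : ∀ a, D (D (gen par lin a)) = 0) (u : GCAlg par lin) : D (D u) = 0 := by
  -- The square is half of the anticommutator of `D` with itself, which is an even derivation and
  -- hence determined by its values on generators.
  have h1 := (h.anticomm h).ext (D' := 0) (by intro u v; simp) (by simp [hw])
  have h2 := DFunLike.congr_fun h1 u
  simp only [LinearMap.add_apply, LinearMap.comp_apply, LinearMap.zero_apply, ← two_smul ℝ (D (D u))] at h2
  simpa using h2

theorem IsOddLeft.sq_zero {D : GCAlg par lin →ₗ[ℝ] GCAlg par lin} (h : IsOddLeft hp D)
    (hw : ∀ a, D (D (gen par lin a)) = 0) (u : GCAlg par lin) : D (D u) = 0 := by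
  have h1 := (h.anticomm h).ext (D' := 0) (by intro u v; simp) (by simp [hw])
  have h2 := DFunLike.congr_fun h1 u
  simp only [LinearMap.add_apply, LinearMap.comp_apply, LinearMap.zero_apply, ← two_smul ℝ (D (D u))] at h2
  simpa using h2

/-- If an algebra homomorphism intertwines odd right derivations on generators and preserves
parity, it intertwines them. -/
theorem IsOddRight.intertwine {D D' : GCAlg par lin →ₗ[ℝ] GCAlg par lin} (h : IsOddRight hp D)
    (h' : IsOddRight hp D') (θ : GCAlg par lin →ₐ[ℝ] GCAlg par lin)
    (hθ : ∀ a, parityInv par lin hp (θ (gen par lin a)) = (-1 : ℝ) ^ par a • θ (gen par lin a))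
    (hw : ∀ a, D (θ (gen par lin a)) = θ (D' (gen par lin a))) (u : GCAlg par lin) :
    D (θ u) = θ (D' u) := by
  have h0 : ∀ v, parityInv par lin hp (θ v) = θ (parityInv par lin hp v) := by
    intro v
    have : (parityInv par lin hp).comp θ = θ.comp (parityInv par lin hp) :=
      algHom_ext_gen fun a => by simp [hθ, parityInv_gen]
    exact DFunLike.congr_fun this v
  induction u using gc_induction with
  | h0 c => simp [h.map_algebraMap, h'.map_algebraMap]
  | h1 a => exact hw a
  | hm u v hu hv => rw [_root_.map_mul, h.map_mul, h'.map_mul, hu, hv, h0, map_add, _root_.map_mul, _root_.map_mul]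
  | ha u v hu hv => simp only [map_add, hu, hv]

theorem IsOddLeft.map_algebraMap {D : GCAlg par lin →ₗ[ℝ] GCAlg par lin} (h : IsOddLeft hp D)
    (c : ℝ) : D (algebraMap ℝ _ c) = 0 := by
  rw [Algebra.algebraMap_eq_smul_one, map_smul, h.map_one, smul_zero]

theorem IsOddLeft.intertwine {D D' : GCAlg par lin →ₗ[ℝ] GCAlg par lin} (h : IsOddLeft hp D)
    (h' : IsOddLeft hp D') (θ : GCAlg par lin →ₐ[ℝ] GCAlg par lin)
    (hθ : ∀ a, parityInv par lin hp (θ (gen par lin a)) = (-1 : ℝ) ^ par a • θ (gen par lin a))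
    (hw : ∀ a, D (θ (gen par lin a)) = θ (D' (gen par lin a))) (u : GCAlg par lin) :
    D (θ u) = θ (D' u) := by
  have h0 : ∀ v, parityInv par lin hp (θ v) = θ (parityInv par lin hp v) := by
    intro v
    have : (parityInv par lin hp).comp θ = θ.comp (parityInv par lin hp) :=
      algHom_ext_gen fun a => by simp [hθ, parityInv_gen]
    exact DFunLike.congr_fun this v
  induction u using gc_induction with
  | h0 c => simp [h.map_algebraMap, h'.map_algebraMap]
  | h1 a => exact hw a
  | hm u v hu hv => rw [_root_.map_mul, h.map_mul, h'.map_mul, hu, hv, h0, map_add, _root_.map_mul, _root_.map_mul]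
  | ha u v hu hv => simp only [map_add, hu, hv]

/-- Elements of the span of the generators of degree `p` are eigenvectors of the parity
involution. -/
theorem parityInv_span {p : ℕ} {y : GCAlg par lin}
    (hy : y ∈ Submodule.span ℝ (gen par lin '' {g | par g = p})) :
    parityInv par lin hp y = (-1 : ℝ) ^ p • y := by
  induction hy using Submodule.span_induction with
  | mem x h =>
    obtain ⟨g, rfl, rfl⟩ := h
    exact parityInv_gen g
  | zero => simp
  | add a b _ _ ha hb => rw [map_add, ha, hb, smul_add]
  | smul c a _ ha => rw [map_smul, ha, smul_comm]

end GradedCommutative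

end BFTheory

namespace BFTheory

/-! ### Antisymmetric functions of tuples of indices -/

section Antisymmetric

variable {M : Type*} [AddCommGroup M] [Module ℝ M] {m q : ℕ}

/-- Antisymmetry of a function of tuples. -/
def IsAlt (f : (Fin q → Fin (m + 1)) → M) : Prop :=
  ∀ (σ : Equiv.Perm (Fin q)) (t : Fin q → Fin (m + 1)),
    f (t ∘ σ) = ((Equiv.Perm.sign σ : ℤ) : ℝ) • f t

theorem IsAlt.eq_zero {f : (Fin q → Fin (m + 1)) → M} (h : IsAlt f) {t : Fin q → Fin (m + 1)}
    (ht : ¬ Function.Injective t) : f t = 0 := by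
  simp only [Function.Injective, not_forall] at ht
  obtain ⟨a, b, hab, hne⟩ := ht
  have h1 := h (Equiv.swap a b) t
  have h2 : t ∘ Equiv.swap a b = t := by
    funext i
    simp only [Function.comp_apply, Equiv.swap_apply_def]
    split_ifs with h3 h4
    · rw [h3, hab]
    · rw [h4, hab]
    · rfl
  rw [h2, Equiv.Perm.sign_swap hne] at h1
  have h3 : (2 : ℝ) • f t = 0 := by
    have : f t = -f t := by simpa using h1
    rw [two_smul]
    nth_rewrite 1 [this]
    simp
  simpa using h3

/-- Bringing the `i`-th index to the front is the inverse of a cycle of sign `(-1)^i`; this is the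
source of all alternating signs below. -/
theorem cons_succAbove (v : Fin (q + 1) → Fin (m + 1)) (i : Fin (q + 1)) :
    (Fin.cons (v i) (v ∘ i.succAbove) : Fin (q + 1) → Fin (m + 1)) = v ∘ ⇑((i.cycleRange)⁻¹ : Equiv.Perm (Fin (q + 1))) := by
  funext k
  refine Fin.cases ?_ (fun k => ?_) k
  · simp [Equiv.Perm.inv_def, Fin.cycleRange_symm_zero]
  · simp [Equiv.Perm.inv_def, Fin.cycleRange_symm_succ]

theorem IsAlt.cons_succAbove {f : (Fin (q + 1) → Fin (m + 1)) → M} (h : IsAlt f)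
    (v : Fin (q + 1) → Fin (m + 1)) (i : Fin (q + 1)) :
    f (Fin.cons (v i) (v ∘ i.succAbove)) = (-1 : ℝ) ^ (i : ℕ) • f v := by
  rw [BFTheory.cons_succAbove, h, Equiv.Perm.sign_inv, Fin.sign_cycleRange]
  simp

/-- The antisymmetrized sum over permutations is a sum over the choices of the first index. -/
theorem sum_perm_eq {F : Fin (m + 1) → (Fin q → Fin (m + 1)) → M} (h : ∀ μ, IsAlt (F μ))
    (v : Fin (q + 1) → Fin (m + 1)) :
    ∑ σ : Equiv.Perm (Fin (q + 1)), ((Equiv.Perm.sign σ : ℤ) : ℝ) •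
        F (v (σ 0)) (Fin.tail (v ∘ σ)) =
      (q.factorial : ℝ) • ∑ i : Fin (q + 1), (-1 : ℝ) ^ (i : ℕ) • F (v i) (v ∘ i.succAbove) := by
  -- Every permutation factors uniquely into the choice of its value at `0` and a permutation of the
  -- remaining positions. The latter is absorbed by antisymmetry, which explains the factor `q!`.
  let e : Fin (q + 1) × Equiv.Perm (Fin q) → Equiv.Perm (Fin (q + 1)) :=
    fun p => (p.1.cycleRange)⁻¹ * Equiv.Perm.decomposeFin.symm (0, p.2)
  have h0 : ∀ p, e p 0 = p.1 := by
    intro p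
    simp [e, Equiv.Perm.inv_def, Fin.cycleRange_symm_zero]
  have hs : ∀ p k, e p (Fin.succ k) = p.1.succAbove (p.2 k) := by
    intro p k
    simp [e, Equiv.Perm.decomposeFin_symm_apply_succ, Equiv.Perm.inv_def,
      Fin.cycleRange_symm_succ]
  have hb : Function.Bijective e := by
    rw [Fintype.bijective_iff_injective_and_card]
    refine ⟨fun p p' hpp => ?_, ?_⟩
    · have h1 : p.1 = p'.1 := by rw [← h0 p, ← h0 p', hpp]
      refine Prod.ext h1 (Equiv.ext fun k => ?_)
      have h2 := hs p k
      rw [hpp, hs, h1] at h2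
      exact (Fin.succAbove_right_injective h2).symm
    · simp [Fintype.card_perm, Nat.factorial_succ]
  rw [← Function.Bijective.sum_comp hb, Fintype.sum_prod_type, Finset.smul_sum]
  refine Finset.sum_congr rfl fun i _ => ?_
  have : ∀ τ : Equiv.Perm (Fin q), ((Equiv.Perm.sign (e (i, τ)) : ℤ) : ℝ) •
        F (v (e (i, τ) 0)) (Fin.tail (v ∘ e (i, τ))) =
      (-1 : ℝ) ^ (i : ℕ) • F (v i) (v ∘ i.succAbove) := by
    intro τ
    have h1 : Fin.tail (v ∘ e (i, τ)) = (v ∘ i.succAbove) ∘ τ := by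
      funext k
      simp [Fin.tail, hs]
    have h2 : ((Equiv.Perm.sign (e (i, τ)) : ℤ) : ℝ) =
        (-1 : ℝ) ^ (i : ℕ) * ((Equiv.Perm.sign τ : ℤ) : ℝ) := by
      simp [e, Equiv.Perm.decomposeFin.symm_sign, Fin.sign_cycleRange]
    rw [h1, h0, h, h2, smul_smul, mul_assoc, ← Int.cast_mul, Int.units_coe_mul_self]
    simp
  simp only [this, Finset.sum_const, Finset.card_univ, Fintype.card_perm, Fintype.card_fin]
  rw [Nat.cast_smul_eq_nsmul]

theorem isAlt_levi : IsAlt (levi (m := m)) := fun σ t => levi_comp t σ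

theorem levi_id : levi (m := m) id = 1 := by
  have : (Matrix.of fun i k : Fin (m + 1) => if id i = k then (1 : ℝ) else 0) = 1 := by
    ext i k
    simp [Matrix.one_apply]
  rw [levi, this, Matrix.det_one]

/-- An antisymmetric function of `n` indices is a multiple of the Levi-Civita symbol. -/
theorem IsAlt.eq_levi {f : (Fin (m + 1) → Fin (m + 1)) → M} (h : IsAlt f)
    (v : Fin (m + 1) → Fin (m + 1)) : f v = levi v • f id := by
  by_cases hv : Function.Injective v
  · let σ : Equiv.Perm (Fin (m + 1)) := Equiv.ofBijective v (Finite.injective_iff_bijective.mp hv)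
    have h1 := h σ id
    have h2 := isAlt_levi σ (id : Fin (m + 1) → Fin (m + 1))
    have h3 : id ∘ (σ : Fin (m + 1) → Fin (m + 1)) = v := rfl
    rw [h3] at h1 h2
    rw [h1, h2, levi_id]
    simp
  · rw [h.eq_zero hv, isAlt_levi.eq_zero hv, zero_smul]

theorem IsAlt.cons {f : (Fin (q + 1) → Fin (m + 1)) → M} (h : IsAlt f) (μ : Fin (m + 1)) :
    IsAlt fun t => f (Fin.cons μ t) := by
  intro σ t
  simp only [cons_comp, h _ (Fin.cons μ t), Equiv.Perm.decomposeFin.symm_sign]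
  simp

theorem cons_injective_fin (μ : Fin (m + 1)) (i : Fin (m + 1)) (h : μ ≠ i) :
    ¬ Function.Injective (Fin.cons μ i.succAbove : Fin (m + 1) → Fin (m + 1)) := by
  intro h1
  obtain ⟨k, hk⟩ := Fin.exists_succAbove_eq h
  have := @h1 0 k.succ (by simp [hk])
  exact absurd this.symm (Fin.succ_ne_zero k)

/-- A symmetric expression in the first two indices of an antisymmetric function sums to zero. -/
theorem sum_cons_cons_eq_zero {f : Fin (m + 1) → Fin (m + 1) → (Fin (q + 2) → Fin (m + 1)) → M}
    (h : ∀ μ ν, IsAlt (f μ ν)) (hf : ∀ μ ν, f μ ν = f ν μ) (t : Fin q → Fin (m + 1)) :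
    ∑ μ : Fin (m + 1), ∑ ν : Fin (m + 1), f μ ν (Fin.cons ν (Fin.cons μ t)) = 0 := by
  have h1 : ∀ μ ν, f μ ν (Fin.cons ν (Fin.cons μ t)) = -f ν μ (Fin.cons μ (Fin.cons ν t)) := by
    intro μ ν
    have h2 := h μ ν (Equiv.swap 0 1) (Fin.cons μ (Fin.cons ν t))
    have h3 : (Fin.cons μ (Fin.cons ν t) : Fin (q + 2) → Fin (m + 1)) ∘ Equiv.swap 0 1 =
        Fin.cons ν (Fin.cons μ t) := by
      funext k
      refine Fin.cases ?_ (fun k => ?_) k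
      · simp only [Function.comp_apply, Equiv.swap_apply_left]
        rfl
      · refine Fin.cases ?_ (fun k => ?_) k
        · have : Equiv.swap (0 : Fin (q + 2)) 1 (Fin.succ 0) = 0 := Equiv.swap_apply_right _ _
          simp only [Function.comp_apply, this]
          rfl
        · have : Equiv.swap (0 : Fin (q + 2)) 1 k.succ.succ = k.succ.succ :=
            Equiv.swap_apply_of_ne_of_ne (Fin.succ_ne_zero _) (by
              rw [← Fin.succ_zero_eq_one]
              intro h
              exact absurd (Fin.succ_injective _ h) (Fin.succ_ne_zero _))
          simp [this]
    rw [h3] at h2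
    rw [h2, hf]
    simp
  have h2 : ∑ μ : Fin (m + 1), ∑ ν : Fin (m + 1), f μ ν (Fin.cons ν (Fin.cons μ t)) =
      -∑ μ : Fin (m + 1), ∑ ν : Fin (m + 1), f μ ν (Fin.cons ν (Fin.cons μ t)) := by
    conv_lhs => rw [Finset.sum_comm]
    rw [← Finset.sum_neg_distrib]
    refine Finset.sum_congr rfl fun μ _ => ?_
    rw [← Finset.sum_neg_distrib]
    exact Finset.sum_congr rfl fun ν _ => h1 ν μ
  have h3 : (2 : ℝ) • ∑ μ : Fin (m + 1), ∑ ν : Fin (m + 1), f μ ν (Fin.cons ν (Fin.cons μ t)) = 0 := by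
    rw [two_smul]
    nth_rewrite 1 [h2]
    simp
  simpa using h3

/-- Each of the `m!` permutations in the antisymmetrized Kronecker symbol contributes the same value
`f v`, and weight one means division by `m!`. -/
theorem sum_altBasis {f : (Fin m → Fin (m + 1)) → M} (h : IsAlt f) (v : Fin m → Fin (m + 1)) :
    ∑ t, (altBasis v).1 t • f t = f v := by
  have h1 : ∀ t, (altBasis v).1 t • f t = (1 / (m.factorial : ℝ)) •
      ∑ σ : Equiv.Perm (Fin m), ((Equiv.Perm.sign σ : ℤ) : ℝ) •
        (if t = v ∘ σ then f t else 0) := by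
    intro t
    simp only [altBasis, mul_smul, Finset.sum_smul]
    congr 1
    refine Finset.sum_congr rfl fun σ _ => ?_
    split_ifs <;> simp
  simp only [h1, ← Finset.smul_sum]
  rw [Finset.sum_comm]
  have h2 : ∀ σ : Equiv.Perm (Fin m), ∑ t, ((Equiv.Perm.sign σ : ℤ) : ℝ) •
      (if t = v ∘ σ then f t else 0) = f v := by
    intro σ
    rw [← Finset.smul_sum, Finset.sum_ite_eq' Finset.univ (v ∘ σ)]
    rw [if_pos (Finset.mem_univ _), h, smul_smul, ← Int.cast_mul, Int.units_coe_mul_self]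
    simp
  simp only [h2, Finset.sum_const, Finset.card_univ, Fintype.card_perm, Fintype.card_fin]
  rw [← Nat.cast_smul_eq_nsmul ℝ, smul_smul, one_div, inv_mul_cancel₀, one_smul]
  exact_mod_cast m.factorial_ne_zero

/-- The algebraic Koszul identity. -/
theorem koszul_identity {G : (Fin (q + 1) → Fin (m + 1)) → MI m → M}
    (h : ∀ L, IsAlt fun t => G t L) (t : Fin (q + 1) → Fin (m + 1)) (L : MI m) :
    ∑ μ : Fin (m + 1), ∑ i : Fin (q + 2), (-1 : ℝ) ^ (i : ℕ) •
        ((μ ::ₘ L).count ((Fin.cons μ t : Fin (q + 2) → Fin (m + 1)) i) : ℝ) •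
        G ((Fin.cons μ t : Fin (q + 2) → Fin (m + 1)) ∘ i.succAbove)
          ((μ ::ₘ L).erase ((Fin.cons μ t : Fin (q + 2) → Fin (m + 1)) i)) +
      ∑ i : Fin (q + 1), (-1 : ℝ) ^ (i : ℕ) • (L.count (t i) : ℝ) •
        ∑ μ : Fin (m + 1), G (Fin.cons μ (t ∘ i.succAbove)) (μ ::ₘ L.erase (t i)) =
    ((L.card : ℝ) + (m + 1) - (q + 1)) • G t L := by
  have h1 : ∀ μ : Fin (m + 1), ∑ i : Fin (q + 2), (-1 : ℝ) ^ (i : ℕ) •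
        ((μ ::ₘ L).count ((Fin.cons μ t : Fin (q + 2) → Fin (m + 1)) i) : ℝ) •
        G ((Fin.cons μ t : Fin (q + 2) → Fin (m + 1)) ∘ i.succAbove)
          ((μ ::ₘ L).erase ((Fin.cons μ t : Fin (q + 2) → Fin (m + 1)) i)) =
      ((L.count μ : ℝ) + 1) • G t L - ∑ i : Fin (q + 1), (-1 : ℝ) ^ (i : ℕ) •
        ((L.count (t i) : ℝ) • G (Fin.cons μ (t ∘ i.succAbove)) (μ ::ₘ L.erase (t i)) +
          (if μ = t i then G (Fin.cons μ (t ∘ i.succAbove)) L else 0)) := by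
    intro μ
    rw [Fin.sum_univ_succ, sub_eq_add_neg, ← Finset.sum_neg_distrib]
    congr 1
    · simp only [Fin.cons_zero, Multiset.count_cons_self, Multiset.erase_cons_head]
      have : (Fin.cons μ t : Fin (q + 2) → Fin (m + 1)) ∘ (0 : Fin (q + 2)).succAbove = t := by
        funext k; simp
      rw [this]
      simp
    · refine Finset.sum_congr rfl fun i _ => ?_
      have : (Fin.cons μ t : Fin (q + 2) → Fin (m + 1)) ∘ i.succ.succAbove =
          Fin.cons μ (t ∘ i.succAbove) := by
        funext k
        refine Fin.cases ?_ (fun k => ?_) k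
        · simp
        · simp
      rw [this]
      simp only [Fin.cons_succ, Fin.val_succ, pow_succ, mul_neg, mul_one, neg_smul]
      congr 2
      -- If `μ = t i`, the multiplicity in `μ ::ₘ L` exceeds that in `L` by one. The excess is the
      -- extra summand with the multi-index `L` itself; the rest cancels against the second sum of
      -- the identity.
      by_cases hμ : μ = t i
      · subst hμ
        rw [Multiset.count_cons_self, Multiset.erase_cons_head, if_pos rfl]
        by_cases h0 : t i ∈ L
        · rw [Multiset.cons_erase h0]
          push_cast
          rw [add_smul, one_smul]
        · rw [Multiset.count_eq_zero_of_notMem h0]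
          simp
      · rw [Multiset.count_cons_of_ne (Ne.symm hμ), if_neg hμ, add_zero]
        by_cases h0 : t i ∈ L
        · rw [Multiset.erase_cons_tail _ hμ]
        · rw [Multiset.count_eq_zero_of_notMem h0]
          simp
  simp only [h1, Finset.sum_sub_distrib, smul_add, Finset.sum_add_distrib, ← Finset.sum_smul]
  -- The terms that remove the index just inserted carry the factor `L.count μ + 1`, which adds up
  -- to `|L| + n` over all `μ`.
  have h2 : ∑ μ : Fin (m + 1), (L.count μ : ℝ) = L.card := by
    rw [← Nat.cast_sum]
    congr 1
    exact Multiset.sum_count_eq_card fun a _ => Finset.mem_univ a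
  -- The excess terms put `t i` back to the front, so each of the `q + 1` positions returns `G t L`
  -- with sign `+1`. This is the number subtracted in the eigenvalue.
  have h3 : ∑ μ : Fin (m + 1), ∑ i : Fin (q + 1), (-1 : ℝ) ^ (i : ℕ) •
      (if μ = t i then G (Fin.cons μ (t ∘ i.succAbove)) L else 0) = ((q : ℝ) + 1) • G t L := by
    rw [Finset.sum_comm]
    have : ∀ i : Fin (q + 1), ∑ μ : Fin (m + 1), (-1 : ℝ) ^ (i : ℕ) •
        (if μ = t i then G (Fin.cons μ (t ∘ i.succAbove)) L else 0) = G t L := by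
      intro i
      rw [← Finset.smul_sum, Finset.sum_ite_eq' Finset.univ (t i), if_pos (Finset.mem_univ _)]
      have h4 := (h L).cons_succAbove t i
      rw [h4, smul_smul, ← mul_pow]
      simp
    simp only [this, Finset.sum_const, Finset.card_univ, Fintype.card_fin]
    rw [← Nat.cast_smul_eq_nsmul ℝ]
    push_cast
    rfl
  have h4 : ∑ μ : Fin (m + 1), ∑ i : Fin (q + 1), (-1 : ℝ) ^ (i : ℕ) • (L.count (t i) : ℝ) •
        G (Fin.cons μ (t ∘ i.succAbove)) (μ ::ₘ L.erase (t i)) =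
      ∑ i : Fin (q + 1), (-1 : ℝ) ^ (i : ℕ) • (L.count (t i) : ℝ) •
        ∑ μ : Fin (m + 1), G (Fin.cons μ (t ∘ i.succAbove)) (μ ::ₘ L.erase (t i)) := by
    rw [Finset.sum_comm]
    simp only [Finset.smul_sum]
  rw [h3, h4, h2]
  simp only [Finset.sum_const, Finset.card_univ, Fintype.card_fin]
  rw [nsmul_eq_mul, mul_one]
  push_cast
  module

end Antisymmetric

end BFTheory

namespace BFTheory

/-! ### The Koszul homotopy -/

variable {m : ℕ}

theorem Anti.Alt.ant_eq (a b : Anti m) (z : ℤ) (h : Anti.Alt a b z) : a.ant = b.ant := by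
  obtain ⟨q, lt, t, L, σ⟩ := h
  rfl

variable (m) in
/-- The parity involution of the algebra of antifields. -/
noncomputable abbrev antiInv : AntiAlg m →ₐ[ℝ] AntiAlg m :=
  parityInv Anti.ant Anti.Alt Anti.Alt.ant_eq

theorem isAlt_agen (q : ℕ) (h : q < m + 1) (L : MI m) :
    IsAlt fun t => agen (m := m) (.c ⟨q, h, t, L⟩) :=
  fun σ t => gen_lin (Anti.Alt.mk q h t L σ)

/-- The antifields `c̄^t_Λ`, where for `n` indices `- ε^t A_Λ` is put in their place. -/
noncomputable def extGen (j : Jet m) (q : ℕ) (t : Fin (q + 1) → Fin (m + 1)) (L : MI m) :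
    AntiAlg m :=
  if h : q < m then agen (.c ⟨q + 1, Nat.succ_lt_succ h, t, L⟩)
  else if h : q = m then
    algebraMap ℝ _ (-(levi (fun i => t (Fin.cast (by rw [h]) i)) * jetA j L)) else 0

theorem isAlt_extGen (j : Jet m) (q : ℕ) (L : MI m) : IsAlt fun t => extGen j q t L := by
  intro σ t
  unfold extGen
  by_cases h : q < m
  · simp only [h, dif_pos]
    exact isAlt_agen _ _ _ σ t
  · by_cases h' : q = m
    · subst h'
      simp only [lt_irrefl, dif_neg, not_false_eq_true, dif_pos]
      have := levi_comp t σ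
      simp only [Fin.cast_eq_self]
      rw [show (fun i => (t ∘ ⇑σ) i) = t ∘ σ from rfl, this, Algebra.smul_def, ← map_mul]
      change _ = algebraMap ℝ _ _ 
      congr 1
      ring
    · simp [h, h']

/-- With `-ε^t A_Λ` admitted as a generator with `n` indices, the variational derivatives `𝓔^t`
become divergences too, and all levels obey a single formula. -/
theorem dDelta_eq (j : Jet m) (q : ℕ) (lt : q < m + 1) (t : Fin q → Fin (m + 1)) (L : MI m) :
    dDelta j ⟨q, lt, t, L⟩ =
      ∑ μ : Fin (m + 1), extGen j q (Fin.cons μ t) (μ ::ₘ L) := by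
  unfold dDelta extGen
  by_cases h : q < m
  · simp only [h, dif_pos]
  · have hq : q = m := by omega
    subst hq
    simp only [lt_irrefl, dif_neg, not_false_eq_true, dif_pos, ← map_sum]
    congr 1
    simp [eulB]

/-- The contraction of a tuple of indices with a multi-index. -/
noncomputable def kosz (q : ℕ) (h : q < m + 1) (v : Fin (q + 1) → Fin (m + 1)) (L : MI m) :
    AntiAlg m :=
  (1 / ((q.factorial : ℝ) * ((L.card : ℝ) + m - q))) •
    ∑ σ : Equiv.Perm (Fin (q + 1)), ((Equiv.Perm.sign σ : ℤ) : ℝ) •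
      (L.count (v (σ 0)) : ℝ) • agen (.c ⟨q, h, Fin.tail (v ∘ σ), L.erase (v (σ 0))⟩)

theorem isAlt_kosz (q : ℕ) (h : q < m + 1) (L : MI m) : IsAlt fun v => kosz q h v L := by
  intro τ v
  simp only [kosz]
  rw [smul_comm]
  congr 1
  rw [Finset.smul_sum]
  conv_rhs => rw [← Equiv.sum_comp (Equiv.mulLeft τ)]
  refine Finset.sum_congr rfl fun σ _ => ?_
  conv_rhs => rw [smul_smul]
  congr 1
  simp only [Equiv.coe_mulLeft, Equiv.Perm.sign_mul, Units.val_mul, Int.cast_mul]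
  rw [← mul_assoc, ← Int.cast_mul, ← Units.val_mul, Int.units_mul_self]
  simp

/-- The definition by permutations is convenient for antisymmetry, this form for computation. The
denominator is the eigenvalue of the Koszul identity for `q + 1` indices and multi-index `L`. It
vanishes only for `q = m`, `L = 0`, where the multiplicities vanish as well. -/
theorem kosz_eq (q : ℕ) (h : q < m + 1) (v : Fin (q + 1) → Fin (m + 1)) (L : MI m) :
    kosz q h v L = (1 / ((L.card : ℝ) + m - q)) • ∑ i : Fin (q + 1), (-1 : ℝ) ^ (i : ℕ) •
      (L.count (v i) : ℝ) • agen (.c ⟨q, h, v ∘ i.succAbove, L.erase (v i)⟩) := by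
  have := sum_perm_eq (F := fun μ t => (L.count μ : ℝ) • agen (m := m) (.c ⟨q, h, t, L.erase μ⟩))
    (fun μ σ t => by
      have := isAlt_agen q h (L.erase μ) σ t
      simp only [this]
      exact smul_comm _ _ _) v
  rw [kosz, this, smul_smul]
  congr 1
  have : (q.factorial : ℝ) ≠ 0 := by exact_mod_cast q.factorial_ne_zero
  field_simp

/-- Spans of antifields of given antifield number and jet order. -/
abbrev genSpan (m : ℕ) (P : Anti m → Prop) : Submodule ℝ (AntiAlg m) :=
  Submodule.span ℝ (agen '' {g | P g})

theorem agen_mem_genSpan {P : Anti m → Prop} {g : Anti m} (h : P g) : agen g ∈ genSpan m P :=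
  Submodule.subset_span (Set.mem_image_of_mem _ h)

theorem kosz_mem (q : ℕ) (h : q < m + 1) (v : Fin (q + 1) → Fin (m + 1)) (L : MI m) :
    kosz q h v L ∈ genSpan m fun g => g.ant = m + 1 - q ∧ g.order + 1 = L.card := by
  rw [kosz_eq]
  refine Submodule.smul_mem _ _ (Submodule.sum_mem _ fun i _ => Submodule.smul_mem _ _ ?_)
  -- An index that is absent from `L` has multiplicity zero, so the jet order really drops in every
  -- term that survives.
  by_cases hi : v i ∈ L
  · refine Submodule.smul_mem _ _ (agen_mem_genSpan ⟨rfl, ?_⟩)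
    simp only [Anti.order]
    rw [Multiset.card_erase_add_one hi]
  · rw [Multiset.count_eq_zero_of_notMem hi]
    simp

open Classical in
/-- Values of the Koszul homotopy on antifields, restricted to antifield numbers in `p`. -/
noncomputable def koszVal (p : Set ℕ) : Anti m → AntiAlg m
  | .s _ => 0
  | .c ⟨0, _, _, _⟩ => 0
  | .c ⟨q + 1, lt, t, L⟩ => if m - q ∈ p then kosz q (by omega) t L else 0

theorem koszVal_mem (p : Set ℕ) (g : Anti m) :
    koszVal p g ∈ genSpan m fun g' => g'.ant = g.ant + 1 ∧ g'.order + 1 = g.order := by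
  match g with
  | .s _ => exact Submodule.zero_mem _
  | .c ⟨0, _, _, _⟩ => exact Submodule.zero_mem _
  | .c ⟨q + 1, lt, t, L⟩ =>
    simp only [koszVal]
    split_ifs
    · have := kosz_mem q (by omega) t L
      have h : m + 1 - q = (m + 1 - (q + 1)) + 1 := by omega
      rw [h] at this
      exact this
    · exact Submodule.zero_mem _

theorem koszVal_not_mem {p : Set ℕ} {g : Anti m} (h : g.ant ∉ p) : koszVal p g = 0 := by
  match g with
  | .s _ => rfl
  | .c ⟨0, _, _, _⟩ => rfl
  | .c ⟨q + 1, lt, t, L⟩ =>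
    simp only [Anti.ant] at h
    have h' : m + 1 - (q + 1) = m - q := by omega
    rw [h'] at h
    simp [koszVal, h]

theorem koszVal_eq_of_mem {p : Set ℕ} {g : Anti m} (h : g.ant ∈ p) :
    koszVal p g = koszVal Set.univ g := by
  match g with
  | .s _ => rfl
  | .c ⟨0, _, _, _⟩ => rfl
  | .c ⟨q + 1, lt, t, L⟩ =>
    simp only [Anti.ant] at h
    have h' : m + 1 - (q + 1) = m - q := by omega
    rw [h'] at h
    simp [koszVal, h]

theorem genSpan_mono {P Q : Anti m → Prop} (h : ∀ g, P g → Q g) : genSpan m P ≤ genSpan m Q :=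
  Submodule.span_mono (Set.image_mono h)

theorem koszVal_alt (p : Set ℕ) (a b : Anti m) (z : ℤ) (h : Anti.Alt a b z) :
    koszVal p a = (z : ℝ) • koszVal p b ∧ a.ant = b.ant := by
  obtain ⟨q, lt, t, L, σ⟩ := h
  refine ⟨?_, rfl⟩
  cases q with
  | zero => simp [koszVal]
  | succ q =>
    simp only [koszVal]
    split_ifs
    · exact isAlt_kosz q _ L σ t
    · simp

/-- The algebraic part of the Koszul homotopy, an odd right derivation. -/
noncomputable def koszDer (p : Set ℕ) : AntiAlg m →ₗ[ℝ] AntiAlg m :=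
  rightDer (koszVal p)
    (fun a => span_le_superComm (genSpan_mono (fun _ h => h.1) (koszVal_mem p a)))
    (koszVal_alt p)

theorem koszDer_agen (p : Set ℕ) (g : Anti m) : koszDer p (agen g) = koszVal p g :=
  rightDer_gen ..

theorem koszDer_isOddRight (p : Set ℕ) :
    IsOddRight Anti.Alt.ant_eq (koszDer (m := m) p) :=
  rightDer_isOddRight _ _ _ fun a =>
    parityInv_span (genSpan_mono (fun _ h => h.1) (koszVal_mem p a))

theorem antiInv_dDelta (j : Jet m) (l : Lab m (m + 1)) :
    antiInv m (dDelta j l) = (-1 : ℝ) ^ ((Anti.c l).ant + 1) • dDelta j l := by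
  obtain ⟨q, lt, t, L⟩ := l
  unfold dDelta
  by_cases h : q < m
  · simp only [h, dif_pos]
    refine (parityInv_span (p := m + 1 - (q + 1))
      (Submodule.sum_mem _ fun μ _ => ?_)).trans ?_
    · exact agen_mem_genSpan (P := fun g => g.ant = m + 1 - (q + 1)) rfl
    · congr 1
      simp only [Anti.ant]
      rw [show m + 1 - q + 1 = m + 1 - (q + 1) + 2 by omega, pow_add]
      simp
  · have hq : q = m := by omega
    subst hq
    simp [Anti.ant]

theorem kt_agen (T : ℕ) (j : Jet m) (g : Anti m) : kt T j (agen g) = ktVal T j g :=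
  rightDer_gen ..

theorem kt_isOddRight (T : ℕ) (j : Jet m) : IsOddRight Anti.Alt.ant_eq (kt T j) := by
  refine rightDer_isOddRight _ _ _ fun a => ?_
  unfold ktVal
  split_ifs
  · cases a with
    | s L => simp [Anti.ant]
    | c l => exact antiInv_dDelta j l
  · simp

theorem ant_le (g : Anti m) : g.ant ≤ m + 1 := by
  cases g with
  | s L => simp [Anti.ant]
  | c l => simp only [Anti.ant]; omega

theorem one_le_ant (g : Anti m) : 1 ≤ g.ant := by
  cases g with
  | s L => simp [Anti.ant]
  | c l => simp only [Anti.ant]; have := l.lt; omega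

/-- The full Koszul-Tate differential. -/
noncomputable abbrev ktf (j : Jet m) : AntiAlg m →ₗ[ℝ] AntiAlg m := kt (m + 1) j

theorem ktf_s (j : Jet m) (L : MI m) : ktf j (agen (.s L)) = algebraMap ℝ _ (eulA j L) := by
  rw [kt_agen]
  simp only [ktVal, ant_le, if_true]

theorem ktf_c (j : Jet m) (l : Lab m (m + 1)) : ktf j (agen (.c l)) = dDelta j l := by
  rw [kt_agen]
  simp only [ktVal, ant_le, if_true]

/-- Truncated differentials agree with the full one on the antifields they involve, so the homotopy
only has to be built for the full differential. -/
theorem kt_agen_eq {T : ℕ} (j : Jet m) {g : Anti m} (h : g.ant ≤ T) :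
    kt T j (agen g) = ktf j (agen g) := by
  rw [kt_agen, kt_agen]
  simp only [ktVal, ant_le, h, if_true]

theorem ktf_extGen (j : Jet m) (q : ℕ) (t : Fin (q + 1) → Fin (m + 1)) (L : MI m) :
    ktf j (extGen j q t L) = if q < m then
      ∑ μ : Fin (m + 1), extGen j (q + 1) (Fin.cons μ t) (μ ::ₘ L) else 0 := by
  by_cases h : q < m
  · rw [if_pos h, extGen, dif_pos h, ktf_c, dDelta_eq]
  · rw [if_neg h, extGen, dif_neg h]
    split_ifs
    · exact (kt_isOddRight _ _).map_algebraMap _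
    · simp

/-- The double divergence of an antisymmetric tensor vanishes because multi-indices are symmetric.
In the extended generators this covers the Noether identities of `𝓔^t` as well as the higher stages.
-/
theorem ktf_ktf (j : Jet m) (u : AntiAlg m) : ktf j (ktf j u) = 0 := by
  refine (kt_isOddRight _ j).sq_zero (fun g => ?_) u
  cases g with
  | s L =>
    have := ktf_s j L
    rw [agen] at this
    rw [this]
    exact (kt_isOddRight _ _).map_algebraMap _
  | c l =>
    obtain ⟨q, lt, t, L⟩ := l
    have := ktf_c j ⟨q, lt, t, L⟩
    rw [agen] at this
    rw [this, dDelta_eq, map_sum]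
    simp only [ktf_extGen]
    split_ifs with h
    · exact sum_cons_cons_eq_zero (f := fun μ ν v => extGen j (q + 1) v (ν ::ₘ μ ::ₘ L))
        (fun μ ν => isAlt_extGen _ _ _) (fun μ ν => by simp only [Multiset.cons_swap]) t
    · simp

/-- Multi-indices of bounded order. -/
def miLe (m r : ℕ) : Finset (MI m) :=
  (Finset.range (r + 1)).biUnion fun i =>
    (Finset.univ : Finset (Sym (Fin (m + 1)) i)).image
      fun s => (Sym.toMultiset s : MI m)

theorem mem_miLe {r : ℕ} {L : MI m} : L ∈ miLe m r ↔ L.card ≤ r := by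
  simp only [miLe, Finset.mem_biUnion, Finset.mem_range, Finset.mem_image, Finset.mem_univ,
    true_and]
  constructor
  · rintro ⟨i, hi, s, rfl⟩
    have h2 : Multiset.card (Sym.toMultiset s) = i := s.2
    omega
  · intro h
    exact ⟨L.card, by omega, Sym.mk L rfl, rfl⟩

/-- The direction `∂/∂A_S` in the jet space. -/
noncomputable def dirA (S : MI m) : Jet m := Pi.single S (1, 0)

/-- A direction in the jet space dual to `d_S 𝓔`. -/
noncomputable def dirB (S : MI m) : Jet m := Pi.single (0 ::ₘ S) (0, altBasis Fin.succ)

theorem jetA_dirA (S L : MI m) : jetA (dirA S) L = if L = S then 1 else 0 := by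
  simp only [jetA, dirA, Pi.single_apply]
  split_ifs <;> simp

theorem jetA_dirB (S L : MI m) : jetA (dirB S) L = 0 := by
  simp only [jetA, dirB, Pi.single_apply]
  split_ifs <;> simp

theorem jetB_dirA (S L : MI m) (t) : jetB (dirA S) t L = 0 := by
  simp only [jetB, dirA, Pi.single_apply]
  split_ifs <;> simp

theorem jetB_dirB (S L : MI m) (t) :
    jetB (dirB S) t L = if L = 0 ::ₘ S then (altBasis Fin.succ).1 t else 0 := by
  simp only [jetB, dirB, Pi.single_apply]
  split_ifs <;> simp

theorem levi_cons_succ (μ : Fin (m + 1)) :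
    levi (Fin.cons μ Fin.succ) = if μ = 0 then 1 else 0 := by
  split_ifs with h
  · subst h
    rw [← levi_id]
    congr 1
    funext k
    refine Fin.cases rfl (fun k => rfl) k
  · refine isAlt_levi.eq_zero ?_
    have := cons_injective_fin μ 0 h
    rwa [Fin.succAbove_zero] at this

theorem sum_levi_altBasis (μ : Fin (m + 1)) :
    ∑ t : Fin m → Fin (m + 1), levi (Fin.cons μ t) * (altBasis Fin.succ).1 t =
      if μ = 0 then 1 else 0 := by
  rw [← levi_cons_succ, ← sum_altBasis (f := fun t => levi (Fin.cons μ t)) (isAlt_levi.cons μ)]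
  simp only [smul_eq_mul, mul_comm]

/-- The component of `B` with indices `1, …, n-1` enters `d_L 𝓔` only through the term `μ = 0`, and
there with multi-index `0 ::ₘ L`. This makes the chosen directions dual to the functions `d_L 𝓔`. -/
theorem eulA_dirB (S L : MI m) : eulA (dirB S) L = if L = S then 1 else 0 := by
  simp only [eulA, jetB_dirB]
  have : ∀ μ : Fin (m + 1), ∑ t : Fin m → Fin (m + 1), levi (Fin.cons μ t) *
      (if μ ::ₘ L = 0 ::ₘ S then (altBasis Fin.succ).1 t else 0) =
      if μ = 0 then (if L = S then 1 else 0) else 0 := by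
    intro μ
    by_cases h : μ = 0
    · subst h
      simp only [Multiset.cons_inj_right]
      split_ifs
      · rw [sum_levi_altBasis]; simp
      · simp
    · simp only [h, if_false]
      split_ifs
      · rw [sum_levi_altBasis, if_neg h]
      · simp
  simp only [this, Finset.sum_ite_eq', Finset.mem_univ, if_true]

theorem eulA_dirA (S L : MI m) : eulA (dirA S) L = 0 := by simp [eulA, jetB_dirA]

theorem eulB_dirB (S L : MI m) (t) : eulB (dirB S) t L = 0 := by simp [eulB, jetA_dirB]

/-- The Koszul homotopy on `A_S`. -/
noncomputable def koszA (S : MI m) : AntiAlg m := -kosz m (Nat.lt_succ_self m) id S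

/-- The part of the Koszul-Tate differential that is linear in the jets of the fields. -/
noncomputable def ktLin (j : Jet m) : AntiAlg m →ₗ[ℝ] AntiAlg m := ktf j - ktf 0

theorem ktLin_isOddRight (j : Jet m) : IsOddRight Anti.Alt.ant_eq (ktLin j) :=
  (kt_isOddRight _ _).sub (kt_isOddRight _ _)

theorem eulA_zero (L : MI m) : eulA (0 : Jet m) L = 0 := by simp [eulA, jetB]

theorem eulB_zero (t) (L : MI m) : eulB (0 : Jet m) t L = 0 := by simp [eulB, jetA]

theorem ktLin_s (j : Jet m) (L : MI m) : ktLin j (agen (.s L)) = algebraMap ℝ _ (eulA j L) := by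
  rw [ktLin, LinearMap.sub_apply, ktf_s, ktf_s, eulA_zero]
  simp

theorem ktLin_c_lt (j : Jet m) {q : ℕ} (lt : q < m + 1) (h : q < m) (t) (L : MI m) :
    ktLin j (agen (.c ⟨q, lt, t, L⟩)) = 0 := by
  rw [ktLin, LinearMap.sub_apply, ktf_c, ktf_c]
  simp [dDelta, h]

theorem ktLin_c (j : Jet m) (lt : m < m + 1) (t) (L : MI m) :
    ktLin j (agen (.c ⟨m, lt, t, L⟩)) = algebraMap ℝ _ (eulB j t L) := by
  rw [ktLin, LinearMap.sub_apply, ktf_c, ktf_c]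
  simp only [dDelta, lt_irrefl, dif_neg, not_false_eq_true, dif_pos]
  have : t ∘ Fin.cast rfl = t := rfl
  rw [this, eulB_zero]
  simp

theorem dDelta_top (j : Jet m) (lt : m < m + 1) (t) (L : MI m) :
    dDelta j ⟨m, lt, t, L⟩ = algebraMap ℝ _ (eulB j t L) := by
  simp only [dDelta, lt_irrefl, dif_neg, not_false_eq_true, dif_pos]
  rfl

theorem ktf_koszVal (j : Jet m) (p : Set ℕ) (q : ℕ) (lt : q + 1 < m + 1) (hp : m - q ∈ p)
    (t : Fin (q + 1) → Fin (m + 1)) (L : MI m) :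
    ktf j (koszVal p (.c ⟨q + 1, lt, t, L⟩)) = (1 / ((L.card : ℝ) + m - q)) •
      ∑ i : Fin (q + 1), (-1 : ℝ) ^ (i : ℕ) • (L.count (t i) : ℝ) •
        ∑ μ : Fin (m + 1), agen (.c ⟨q + 1, lt, Fin.cons μ (t ∘ i.succAbove), μ ::ₘ L.erase (t i)⟩) := by
  simp only [koszVal, hp, if_true, kosz_eq, map_smul, map_sum, ktf_c]
  congr 1
  refine Finset.sum_congr rfl fun i _ => ?_
  congr 2
  have : q < m := by omega
  simp only [dDelta, this, dif_pos]

theorem sum_kosz (q : ℕ) (lt : q < m + 1) (t : Fin q → Fin (m + 1)) (L : MI m) :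
    ∑ μ : Fin (m + 1), kosz q lt (Fin.cons μ t) (μ ::ₘ L) =
      (1 / ((L.card : ℝ) + m + 1 - q)) • ∑ μ : Fin (m + 1), ∑ i : Fin (q + 1), (-1 : ℝ) ^ (i : ℕ) •
        ((μ ::ₘ L).count ((Fin.cons μ t : Fin (q + 1) → Fin (m + 1)) i) : ℝ) •
        agen (.c ⟨q, lt, (Fin.cons μ t : Fin (q + 1) → Fin (m + 1)) ∘ i.succAbove,
          ((μ ::ₘ L).erase ((Fin.cons μ t : Fin (q + 1) → Fin (m + 1)) i))⟩) := by
  simp only [kosz_eq, Multiset.card_cons, Finset.smul_sum]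
  refine Finset.sum_congr rfl fun μ _ => Finset.sum_congr rfl fun i _ => ?_
  congr 2
  push_cast
  ring

/-- The Koszul identity for the antifields `c̄^t_Λ`. -/
theorem kosz_identity (j : Jet m) (q : ℕ) (lt : q < m + 1) (t : Fin q → Fin (m + 1)) (L : MI m) :
    ∑ μ : Fin (m + 1), kosz q lt (Fin.cons μ t) (μ ::ₘ L) +
      ktf j (koszVal Set.univ (.c ⟨q, lt, t, L⟩)) = agen (.c ⟨q, lt, t, L⟩) := by
  rw [sum_kosz]
  have hpos : (0 : ℝ) < (L.card : ℝ) + m + 1 - q := by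
    have h1 : (q : ℝ) < m + 1 := by exact_mod_cast lt
    have h2 : (0 : ℝ) ≤ (L.card : ℝ) := by positivity
    linarith
  cases q with
  | zero =>
    -- Without tensor indices nothing lies above in antifield number. The homotopy of the generator
    -- itself vanishes and the multiplicities alone give `|L| + n`.
    simp only [koszVal, map_zero, add_zero]
    have h1 : ∀ μ : Fin (m + 1), ∑ i : Fin (0 + 1), (-1 : ℝ) ^ (i : ℕ) •
        ((μ ::ₘ L).count ((Fin.cons μ t : Fin (0 + 1) → Fin (m + 1)) i) : ℝ) •
        agen (m := m) (.c ⟨0, lt, (Fin.cons μ t : Fin (0 + 1) → Fin (m + 1)) ∘ i.succAbove,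
          ((μ ::ₘ L).erase ((Fin.cons μ t : Fin (0 + 1) → Fin (m + 1)) i))⟩) =
        ((L.count μ : ℝ) + 1) • agen (.c ⟨0, lt, t, L⟩) := by
      intro μ
      rw [Fin.sum_univ_one]
      have : ((Fin.cons μ t : Fin (0 + 1) → Fin (m + 1)) ∘ Fin.succAbove 0) = t := by
        funext k; exact k.elim0
      rw [this]
      simp
    simp only [h1, ← Finset.sum_smul, Finset.sum_add_distrib]
    have h2 : ∑ μ : Fin (m + 1), (L.count μ : ℝ) = L.card := by
      rw [← Nat.cast_sum]
      congr 1
      exact Multiset.sum_count_eq_card fun a _ => Finset.mem_univ a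
    rw [h2, smul_smul]
    simp only [Finset.sum_const, Finset.card_univ, Fintype.card_fin, nsmul_eq_mul, mul_one]
    push_cast at hpos ⊢
    rw [show 1 / ((L.card : ℝ) + m + 1 - 0) * (L.card + (m + 1)) = 1 by
      field_simp; ring, one_smul]
  | succ q =>
    have h := koszul_identity (G := fun t L => agen (m := m) (.c ⟨q + 1, lt, t, L⟩))
      (fun L => isAlt_agen _ _ _) t L
    rw [ktf_koszVal j _ q lt (Set.mem_univ _)]
    -- The divergence of the contraction and the contraction of the divergence carry the same
    -- denominator, since the divergence raises both the order and the number of indices by one.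
    have h1 : (L.card : ℝ) + m - q = (L.card : ℝ) + m + 1 - ((q + 1 : ℕ) : ℝ) := by
      push_cast; ring
    rw [h1, ← smul_add, h, smul_smul]
    push_cast at hpos ⊢
    rw [show 1 / ((L.card : ℝ) + m + 1 - (q + 1)) * (L.card + (m + 1) - (q + 1)) = 1 by
      field_simp; ring, one_smul]

theorem koszDer_extGen (j : Jet m) (q : ℕ) (h : q < m) (t : Fin (q + 1) → Fin (m + 1)) (L : MI m) :
    koszDer Set.univ (extGen j q t L) = kosz q (by omega) t L := by
  rw [extGen, dif_pos h, koszDer_agen]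
  simp [koszVal]

/-- The homotopy identity on generators. -/
theorem homotopy_agen (j : Jet m) {r : ℕ} {g : Anti m} (hg : g.order ≤ r) :
    (∑ S ∈ miLe m (r + 1), ktLin (dirA S) (agen g) * koszA S +
      ∑ S ∈ miLe m r, ktLin (dirB S) (agen g) * agen (.s S)) +
      (ktf j (koszDer Set.univ (agen g)) + koszDer Set.univ (ktf j (agen g))) = agen g := by
  cases g with
  | s L =>
    have hL : L ∈ miLe m r := mem_miLe.mpr hg
    simp only [ktLin_s, eulA_dirA, eulA_dirB, koszDer_agen, ktf_s,
      (koszDer_isOddRight _).map_algebraMap, koszVal, map_zero, zero_mul, Finset.sum_const_zero,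
      add_zero, zero_add]
    rw [Finset.sum_eq_single_of_mem L hL]
    · simp
    · intro S _ hS
      simp [hS.symm]
  | c l =>
    obtain ⟨q, lt, t, L⟩ := l
    have hL : L.card ≤ r := hg
    rw [koszDer_agen, ktf_c]
    by_cases h : q < m
    · simp only [ktLin_c_lt _ lt h, zero_mul, Finset.sum_const_zero, zero_add]
      rw [dDelta_eq, map_sum]
      simp only [koszDer_extGen j q h]
      rw [add_comm, kosz_identity]
    · have hq : q = m := by omega
      subst hq
      simp only [ktLin_c, dDelta_top, (koszDer_isOddRight _).map_algebraMap, add_zero, eulB_dirB,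
        map_zero, zero_mul, Finset.sum_const_zero]
      -- On `s̄^{μ₁…μ_{n-1}}` the differential is a function of the jets, which `koszDer`
      -- annihilates. The missing half of the Koszul identity is supplied by the derivatives along
      -- `A_S`, where orders up to `r + 1` occur because `δ` raises the jet order by one.
      rw [← kosz_identity j q lt t L]
      congr 1
      simp only [eulB, jetA_dirA, map_neg, map_sum, gc_neg_mul, Finset.sum_mul, Finset.sum_neg_distrib]
      rw [Finset.sum_comm, ← Finset.sum_neg_distrib]
      refine Finset.sum_congr rfl fun μ _ => ?_
      have hμ : μ ::ₘ L ∈ miLe q (r + 1) := mem_miLe.mpr (by simpa using hL)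
      rw [Finset.sum_eq_single_of_mem _ hμ]
      -- A contraction of `n` antisymmetric indices is a multiple of the Levi-Civita symbol. The
      -- sign in `koszA` compensates that in `-ε A`.
      · have := (isAlt_kosz q lt (μ ::ₘ L)).eq_levi (Fin.cons μ t)
        rw [this, koszA, if_pos rfl, mul_one, gc_mul_neg, neg_neg, Algebra.smul_def]
      · intro S _ hS
        simp [hS.symm]

end BFTheory

/-! ### Words of antifields and the anticommutator of differential and homotopy -/

namespace BFTheory

variable {m : ℕ}

/-- Products of antifields. -/
noncomputable abbrev aword (w : List (Anti m)) : AntiAlg m := word Anti.ant Anti.Alt w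

/-- The words of antifield number `a` in antifields of antifield number at most `T` and jet order
at most `r`. -/
def AntiWord (T a r : ℕ) (w : List (Anti m)) : Prop :=
  (∀ g ∈ w, g.ant ≤ T ∧ g.order ≤ r) ∧ (w.map Anti.ant).sum = a

/-- The span of the words `AntiWord T a r`. -/
def antiSpan (m T a r : ℕ) : Submodule ℝ (AntiAlg m) :=
  Submodule.span ℝ (aword '' {w | AntiWord T a r w})

theorem aword_mem {T a r : ℕ} {w : List (Anti m)} (h : AntiWord T a r w) :
    aword w ∈ antiSpan m T a r := Submodule.subset_span (Set.mem_image_of_mem _ h)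

theorem AntiWord.append {T a b r : ℕ} {v w : List (Anti m)} (hv : AntiWord T a r v)
    (hw : AntiWord T b r w) : AntiWord T (a + b) r (v ++ w) := by
  refine ⟨fun g hg => ?_, ?_⟩
  · rcases List.mem_append.mp hg with h | h
    · exact hv.1 g h
    · exact hw.1 g h
  · rw [List.map_append, List.sum_append, hv.2, hw.2]

theorem antiSpan_mul {T a b r : ℕ} {u v : AntiAlg m} (hu : u ∈ antiSpan m T a r)
    (hv : v ∈ antiSpan m T b r) : u * v ∈ antiSpan m T (a + b) r := by
  have := Submodule.mul_mem_mul hu hv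
  rw [antiSpan, antiSpan, Submodule.span_mul_span] at this
  refine Submodule.span_mono ?_ this
  rintro _ ⟨_, ⟨w, hw, rfl⟩, _, ⟨w', hw', rfl⟩, rfl⟩
  exact ⟨w ++ w', hw.append hw', word_append w w'⟩

theorem antiSpan_mono {T T' a r r' : ℕ} (hT : T ≤ T') (hr : r ≤ r') :
    antiSpan m T a r ≤ antiSpan m T' a r' :=
  Submodule.span_mono (Set.image_mono fun _ h =>
    ⟨fun g hg => ⟨(h.1 g hg).1.trans hT, (h.1 g hg).2.trans hr⟩, h.2⟩)

theorem agen_mem_antiSpan {T a r : ℕ} {g : Anti m} (h1 : g.ant ≤ T) (h2 : g.order ≤ r)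
    (h3 : g.ant = a) : agen g ∈ antiSpan m T a r := by
  have : AntiWord T a r [g] := ⟨by simp [h1, h2], by simp [h3]⟩
  have h := aword_mem this
  rwa [aword, word_singleton] at h

theorem genSpan_le_antiSpan {T a r : ℕ} {P : Anti m → Prop}
    (h : ∀ g, P g → g.ant ≤ T ∧ g.order ≤ r ∧ g.ant = a) : genSpan m P ≤ antiSpan m T a r := by
  rw [Submodule.span_le]
  rintro _ ⟨g, hg, rfl⟩
  obtain ⟨h1, h2, h3⟩ := h g hg
  exact agen_mem_antiSpan h1 h2 h3

/-- The contraction lowers the order by one, so coefficients may be differentiated along `A_S` with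
`|S| = r + 1` without leaving the antifields of order at most `r`. -/
theorem koszA_mem {r : ℕ} {S : MI m} (h : S.card ≤ r + 1) : koszA S ∈ antiSpan m 1 1 r := by
  refine Submodule.neg_mem _ (genSpan_le_antiSpan ?_ (kosz_mem _ _ _ _))
  rintro g ⟨h1, h2⟩
  omega

theorem antiInv_mem {T a r : ℕ} {u : AntiAlg m} (h : u ∈ antiSpan m T a r) :
    antiInv m u ∈ antiSpan m T a r := by
  induction h using Submodule.span_induction with
  | mem x h =>
    obtain ⟨w, hw, rfl⟩ := h
    rw [antiInv, aword, parityInv_word]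
    exact Submodule.smul_mem _ _ (aword_mem hw)
  | zero => simp
  | add a b _ _ ha hb => rw [map_add]; exact Submodule.add_mem _ ha hb
  | smul c a _ ha => rw [map_smul]; exact Submodule.smul_mem _ _ ha

theorem IsOddRight.map_antiSpan {D : AntiAlg m →ₗ[ℝ] AntiAlg m}
    (hD : IsOddRight Anti.Alt.ant_eq D) {T T' r : ℕ} (hT : T ≤ T')
    (h : ∀ g : Anti m, g.ant ≤ T → g.order ≤ r → D (agen g) ∈ antiSpan m T' (g.ant + 1) r)
    {a : ℕ} {u : AntiAlg m} (hu : u ∈ antiSpan m T a r) : D u ∈ antiSpan m T' (a + 1) r := by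
  induction hu using Submodule.span_induction with
  | zero => simp
  | add a b _ _ ha hb => rw [map_add]; exact Submodule.add_mem _ ha hb
  | smul c a _ ha => rw [map_smul]; exact Submodule.smul_mem _ _ ha
  | mem x hx =>
    obtain ⟨w, hw, rfl⟩ := hx
    obtain ⟨h1, rfl⟩ := hw
    induction w with
    | nil => simp [aword, hD.map_one]
    | cons g w ih =>
      rw [aword, word_cons, hD.map_mul]
      have h2 : ∀ g ∈ w, g.ant ≤ T ∧ g.order ≤ r := fun b hb => h1 b (by simp [hb])
      have hg := h1 g (by simp)
      have hw2 : aword w ∈ antiSpan m T' (w.map Anti.ant).sum r :=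
        antiSpan_mono hT le_rfl (aword_mem ⟨h2, rfl⟩)
      simp only [List.map_cons, List.sum_cons]
      refine Submodule.add_mem _ ?_ ?_
      · have := antiSpan_mul (agen_mem_antiSpan (hg.1.trans hT) hg.2 rfl) (ih h2)
        rwa [← add_assoc] at this
      · have := antiSpan_mul (h g hg.1 hg.2) (antiInv_mem hw2)
        rwa [show g.ant + 1 + (w.map Anti.ant).sum = g.ant + (w.map Anti.ant).sum + 1 by ring]
          at this

/-- The condition on `p` guarantees that no letter of antifield number above `T'` is produced. With
`p` the complement of `{T}` the homotopy stays among antifields of number at most `T`. -/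
theorem koszDer_mem {p : Set ℕ} {T T' : ℕ} (hT : T ≤ T') (hp : ∀ b ∈ p, b ≤ T → b + 1 ≤ T')
    {a r : ℕ} {u : AntiAlg m} (hu : u ∈ antiSpan m T a r) :
    koszDer p u ∈ antiSpan m T' (a + 1) r := by
  refine (koszDer_isOddRight p).map_antiSpan hT (fun g h1 h2 => ?_) hu
  rw [koszDer_agen]
  by_cases hg : g.ant ∈ p
  · refine genSpan_le_antiSpan ?_ (koszVal_mem p g)
    rintro g' ⟨h3, h4⟩
    have := hp _ hg h1
    omega
  · rw [koszVal_not_mem hg]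
    exact Submodule.zero_mem _

theorem koszDer_add (p : Set ℕ) :
    koszDer (m := m) Set.univ = koszDer pᶜ + koszDer p := by
  refine (koszDer_isOddRight _).ext ((koszDer_isOddRight _).add (koszDer_isOddRight _)) fun g => ?_
  have h := koszDer_agen (m := m)
  simp only [agen] at h
  rw [LinearMap.add_apply, h, h, h]
  by_cases hg : g.ant ∈ p
  · rw [koszVal_eq_of_mem hg, koszVal_not_mem (p := pᶜ) (by simpa using hg), zero_add]
  · rw [koszVal_eq_of_mem (p := pᶜ) (by simpa using hg), koszVal_not_mem hg, add_zero]

/-- The anticommutator of the Koszul-Tate differential with the homotopy, at a point `j` of the jet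
space and for antifields of jet order at most `r`. -/
noncomputable def homLap (r : ℕ) (j : Jet m) : AntiAlg m →ₗ[ℝ] AntiAlg m :=
  (∑ S ∈ miLe m (r + 1), LinearMap.mulRight ℝ (koszA S) ∘ₗ ktLin (dirA S) +
      ∑ S ∈ miLe m r, LinearMap.mulRight ℝ (agen (.s S)) ∘ₗ ktLin (dirB S)) +
      (ktf j ∘ₗ koszDer Set.univ + koszDer Set.univ ∘ₗ ktf j)

theorem homLap_apply (r : ℕ) (j : Jet m) (u : AntiAlg m) : homLap r j u =
    (∑ S ∈ miLe m (r + 1), ktLin (dirA S) u * koszA S +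
      ∑ S ∈ miLe m r, ktLin (dirB S) u * agen (.s S)) +
      (ktf j (koszDer Set.univ u) + koszDer Set.univ (ktf j u)) := by
  simp only [homLap, LinearMap.add_apply, LinearMap.sum_apply, LinearMap.comp_apply,
      LinearMap.mulRight_apply]

theorem koszA_mem_superComm (S : MI m) : koszA S ∈ superComm Anti.ant Anti.Alt 1 :=
  span_le_superComm (genSpan_mono (fun g h => by
      have := h.1
      change g.ant = 1
      omega)
      (Submodule.neg_mem _ (kosz_mem m (Nat.lt_succ_self m) id S)))

/-- An odd right derivation followed by multiplication with an odd element is an even derivation,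
and so is an anticommutator of odd derivations. The operator is thus controlled by its values on
letters. -/
theorem homLap_isEvenDer (r : ℕ) (j : Jet m) : IsEvenDer (homLap r j) :=
  ((IsEvenDer.sum _ fun S _ => (ktLin_isOddRight _).mulRight (koszA_mem_superComm S) odd_one).add
      (IsEvenDer.sum _ fun S _ => (ktLin_isOddRight _).mulRight
        (gen_mem_superComm (p := 1) (a := Anti.s S) rfl) odd_one)).add
      ((kt_isOddRight _ _).anticomm (koszDer_isOddRight _))

theorem homLap_agen (j : Jet m) {r : ℕ} {g : Anti m} (hg : g.order ≤ r) :
    homLap r j (agen g) = agen g := by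
  rw [homLap_apply, homotopy_agen j hg]

theorem homLap_genSpan (j : Jet m) {r : ℕ} {u : AntiAlg m}
    (hu : u ∈ genSpan m fun g => g.order ≤ r) : homLap r j u = u := by
  induction hu using Submodule.span_induction with
  | zero => simp
  | add a b _ _ ha hb => rw [map_add, ha, hb]
  | smul c a _ ha => rw [map_smul, ha]
  | mem x hx =>
    obtain ⟨g, hg, rfl⟩ := hx
    exact homLap_agen j hg

theorem homLap_word (j : Jet m) {r : ℕ} {w : List (Anti m)} (hw : ∀ g ∈ w, g.order ≤ r) :
    homLap r j (aword w) = (w.length : ℝ) • aword w :=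
  (homLap_isEvenDer r j).word_length fun g hg => homLap_agen j (hw g hg)

/-! ### The projection onto the homology of a truncated complex -/

/-- The anticommutator of the Koszul-Tate differential with the part of the homotopy that acts on
antifields of antifield number `T`. -/
noncomputable def homProj (T : ℕ) (j : Jet m) : AntiAlg m →ₗ[ℝ] AntiAlg m :=
  ktf j ∘ₗ koszDer {T} + koszDer {T} ∘ₗ ktf j

theorem homProj_isEvenDer (T : ℕ) (j : Jet m) : IsEvenDer (homProj T j) :=
  (kt_isOddRight _ _).anticomm (koszDer_isOddRight _)

theorem ktf_homProj (T : ℕ) (j : Jet m) (u : AntiAlg m) :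
    ktf j (homProj T j u) = homProj T j (ktf j u) := by
  simp [homProj, ktf_ktf]

theorem koszDer_genSpan {p : Set ℕ} {P : Anti m → Prop} (h : ∀ g, P g → g.ant ∉ p)
    {u : AntiAlg m} (hu : u ∈ genSpan m P) : koszDer p u = 0 := by
  induction hu using Submodule.span_induction with
  | mem x hx =>
    obtain ⟨g, hg, rfl⟩ := hx
    rw [koszDer_agen, koszVal_not_mem (h g hg)]
  | zero => simp
  | add a b _ _ ha hb => rw [map_add, ha, hb, add_zero]
  | smul c a _ ha => rw [map_smul, ha, smul_zero]

theorem ktf_agen_cases (j : Jet m) (g : Anti m) :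
    (∃ c, ktf j (agen g) = algebraMap ℝ _ c) ∨
      ktf j (agen g) ∈ genSpan m fun g' => g'.ant + 1 = g.ant := by
  cases g with
  | s L => exact Or.inl ⟨_, ktf_s j L⟩
  | c l =>
    obtain ⟨q, lt, t, L⟩ := l
    by_cases h : q < m
    · right
      rw [ktf_c]
      simp only [dDelta, h, dif_pos]
      refine Submodule.sum_mem _ fun μ _ => agen_mem_genSpan ?_
      simp only [Anti.ant]
      omega
    · left
      have hq : q = m := by omega
      subst hq
      exact ⟨_, (ktf_c j _).trans (dDelta_top j lt t L)⟩

/-- `δ g` has lower antifield number than `g`, hence contains no letter of number `T`, and the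
homotopy restricted to number `T` kills it. Only the term `δ h g` remains, and only if `g` has
number `T`. -/
theorem homProj_agen {T : ℕ} (j : Jet m) {g : Anti m} (hg : g.ant ≤ T) :
    homProj T j (agen g) = if g.ant = T then ktf j (koszVal Set.univ g) else 0 := by
  have h1 : koszDer {T} (ktf j (agen g)) = 0 := by
    rcases ktf_agen_cases j g with ⟨c, hc⟩ | h
    · rw [hc, (koszDer_isOddRight _).map_algebraMap]
    · refine koszDer_genSpan (fun g' hg' => ?_) h
      simp only [Set.mem_singleton_iff]
      omega
  simp only [homProj, LinearMap.add_apply, LinearMap.comp_apply, h1, add_zero, koszDer_agen]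
  split_ifs with h
  · rw [koszVal_eq_of_mem (by simpa using h)]
  · rw [koszVal_not_mem (by simpa using h), map_zero]

/-- From antifield number two on, `δ` takes divergences of antifields and does not involve the
fields. -/
theorem ktf_genSpan_indep {P : Anti m → Prop} (hP : ∀ g, P g → 2 ≤ g.ant) (j j' : Jet m)
    {u : AntiAlg m} (hu : u ∈ genSpan m P) : ktf j u = ktf j' u := by
  induction hu using Submodule.span_induction with
  | zero => simp
  | add a b _ _ ha hb => rw [map_add, ha, hb, map_add]
  | smul c a _ ha => rw [map_smul, ha, map_smul]
  | mem x hx =>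
    obtain ⟨g, hg, rfl⟩ := hx
    have h2 := hP g hg
    cases g with
    | s L => simp [Anti.ant] at h2
    | c l =>
      obtain ⟨q, lt, t, L⟩ := l
      simp only [Anti.ant] at h2
      have : q < m := by omega
      rw [ktf_c, ktf_c]
      simp only [dDelta, this, dif_pos]

/-- The projection may be evaluated at the zero jet once and for all. Projected words are then
constant elements of the algebra, so the homotopy formula can be applied to them again with only
their coefficients being differentiated. -/
theorem homProj_indep {T : ℕ} (j j' : Jet m) {w : List (Anti m)} (hw : ∀ g ∈ w, g.ant ≤ T) :
    homProj T j (aword w) = homProj T j' (aword w) := by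
  refine (homProj_isEvenDer T j).word_eq (homProj_isEvenDer T j') fun g hg => ?_
  have h1 := homProj_agen j (hw g hg)
  have h2 := homProj_agen j' (hw g hg)
  rw [agen] at h1 h2
  rw [h1, h2]
  split_ifs with h
  · refine ktf_genSpan_indep (fun g' hg' => ?_) j j' (koszVal_mem Set.univ g)
    have := one_le_ant g
    have := hg'.1
    omega
  · rfl

theorem homProj_agen_mem {T : ℕ} (j : Jet m) {g : Anti m} (hg : g.ant ≤ T) :
    homProj T j (agen g) ∈ genSpan m fun g' => g'.ant = g.ant ∧ g'.order = g.order := by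
  rw [homProj_agen j hg]
  split_ifs with h
  · have hu := koszVal_mem Set.univ g
    generalize koszVal Set.univ g = u at hu
    induction hu using Submodule.span_induction with
    | zero => simp
    | add a b _ _ ha hb => rw [map_add]; exact Submodule.add_mem _ ha hb
    | smul c a _ ha => rw [map_smul]; exact Submodule.smul_mem _ _ ha
    | mem x hx =>
      obtain ⟨g', ⟨ha, hb⟩, rfl⟩ := hx
      have hone := one_le_ant g
      cases g' with
      | s L =>
        have e1 : (Anti.s L).ant = 1 := rfl
        omega
      | c l =>
        obtain ⟨q, lt, t, L⟩ := l
        have e1 : (Anti.c ⟨q, lt, t, L⟩ : Anti m).ant = m + 1 - q := rfl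
        have e2 : (Anti.c ⟨q, lt, t, L⟩ : Anti m).order = L.card := rfl
        have : q < m := by omega
        rw [ktf_c]
        simp only [dDelta, this, dif_pos]
        refine Submodule.sum_mem _ fun μ _ => agen_mem_genSpan ⟨?_, ?_⟩
        · change m + 1 - (q + 1) = g.ant
          omega
        · change (μ ::ₘ L).card = g.order
          rw [Multiset.card_cons]
          omega
  · exact Submodule.zero_mem _

theorem homProj_mem {T a r : ℕ} {w : List (Anti m)} (j : Jet m) (h : AntiWord T a r w) :
    homProj T j (aword w) ∈ antiSpan m T a r := by
  obtain ⟨h1, rfl⟩ := h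
  induction w with
  | nil => simp [aword, (homProj_isEvenDer T j).map_one]
  | cons g w ih =>
    have hw : ∀ g ∈ w, g.ant ≤ T ∧ g.order ≤ r := fun b hb => h1 b (by simp [hb])
    have hg := h1 g (by simp)
    rw [aword, word_cons, homProj_isEvenDer T j, List.map_cons, List.sum_cons]
    refine Submodule.add_mem _ (antiSpan_mul (agen_mem_antiSpan hg.1 hg.2 rfl) (ih hw))
      (antiSpan_mul ?_ (aword_mem ⟨hw, rfl⟩))
    refine genSpan_le_antiSpan ?_ (homProj_agen_mem j hg.1)
    rintro g' ⟨h3, h4⟩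
    exact ⟨h3 ▸ hg.1, h4 ▸ hg.2, h3⟩

/-- The derivation `homProj` replaces a letter by a combination of letters of the same order bound,
so the number of letters and with it the Euler eigenvalue are unchanged. -/
theorem homLap_homProj_word {T r : ℕ} (j j' : Jet m) {w : List (Anti m)}
    (hw : ∀ g ∈ w, g.ant ≤ T ∧ g.order ≤ r) :
    homLap r j (homProj T j' (aword w)) = (w.length : ℝ) • homProj T j' (aword w) := by
  induction w with
  | nil => simp [aword, (homProj_isEvenDer T j').map_one]
  | cons g w ih =>
    have hw' : ∀ g ∈ w, g.ant ≤ T ∧ g.order ≤ r := fun b hb => hw b (by simp [hb])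
    have hg := hw g (by simp)
    have h1 := homLap_agen j hg.2
    have h2 : homLap r j (homProj T j' (agen g)) = homProj T j' (agen g) :=
      homLap_genSpan j (genSpan_mono (fun g' h' => h'.2 ▸ hg.2) (homProj_agen_mem j' hg.1))
    have h3 := homLap_word j (fun g hg => (hw' g hg).2)
    have h4 := ih hw'
    rw [aword] at h3 h4
    rw [agen] at h1 h2
    rw [aword, word_cons, homProj_isEvenDer T j', map_add, homLap_isEvenDer, homLap_isEvenDer, h1,
      h2, h3, h4]
    simp only [List.length_cons, mul_smul_comm]
    push_cast
    module

theorem homProj_genSpan {T : ℕ} (j : Jet m) {u : AntiAlg m}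
    (hu : u ∈ genSpan m fun g => g.ant = T) : homProj T j u = ktf j (koszDer Set.univ u) := by
  induction hu using Submodule.span_induction with
  | zero => simp
  | add a b _ _ ha hb => simp only [map_add, ha, hb]
  | smul c a _ ha => simp only [map_smul, ha]
  | mem x hx =>
    obtain ⟨g, hg, rfl⟩ := hx
    have hg' : g.ant = T := hg
    rw [homProj_agen j hg'.le, if_pos hg', koszDer_agen]

/-- On single letters of number at least two the homotopy identity needs no derivatives of
coefficients. -/
theorem ktf_koszDer_genSpan (j : Jet m) {P : Anti m → Prop} (hP : ∀ g, P g → 2 ≤ g.ant)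
    {u : AntiAlg m} (hu : u ∈ genSpan m P) :
    ktf j (koszDer Set.univ u) + koszDer Set.univ (ktf j u) = u := by
  induction hu using Submodule.span_induction with
  | zero => simp
  | add a b _ _ ha hb =>
    conv_rhs => rw [← ha, ← hb]
    simp only [map_add]
    abel
  | smul c a _ ha =>
    conv_rhs => rw [← ha]
    simp only [map_smul, smul_add]
  | mem x hx =>
    obtain ⟨g, hg, rfl⟩ := hx
    have h2 := hP g hg
    cases g with
    | s L => simp [Anti.ant] at h2
    | c l =>
      obtain ⟨q, lt, t, L⟩ := l
      simp only [Anti.ant] at h2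
      have hq : q < m := by omega
      rw [ktf_c, dDelta_eq, map_sum, koszDer_agen]
      simp only [koszDer_extGen j q hq]
      rw [add_comm, kosz_identity]

theorem ktf_genSpan_mem (j : Jet m) {T : ℕ} (hT : 1 ≤ T) {u : AntiAlg m}
    (hu : u ∈ genSpan m fun g => g.ant = T + 1) : ktf j u ∈ genSpan m fun g => g.ant = T := by
  induction hu using Submodule.span_induction with
  | zero => simp
  | add a b _ _ ha hb => rw [map_add]; exact Submodule.add_mem _ ha hb
  | smul c a _ ha => rw [map_smul]; exact Submodule.smul_mem _ _ ha
  | mem x hx =>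
    obtain ⟨g, hg, rfl⟩ := hx
    change g.ant = T + 1 at hg
    cases g with
    | s L => simp only [Anti.ant] at hg; omega
    | c l =>
      obtain ⟨q, lt, t, L⟩ := l
      simp only [Anti.ant] at hg
      have hq : q < m := by omega
      rw [ktf_c]
      simp only [dDelta, hq, dif_pos]
      refine Submodule.sum_mem _ fun μ _ => agen_mem_genSpan ?_
      simp only [Anti.ant]
      omega

theorem homProj_homProj_agen {T : ℕ} (hT : 1 ≤ T) (j : Jet m) {g : Anti m} (hg : g.ant ≤ T) :
    homProj T j (homProj T j (agen g)) = homProj T j (agen g) := by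
  rw [homProj_agen j hg]
  split_ifs with h
  · have h1 : koszVal Set.univ g ∈ genSpan m fun g' => g'.ant = T + 1 :=
      genSpan_mono (fun g' h' => by have := h'.1; omega) (koszVal_mem Set.univ g)
    rw [homProj_genSpan j (ktf_genSpan_mem j hT h1)]
    -- For `u = h g` of antifield number `T + 1`, applying `δ` to `δ h u + h δ u = u` gives `δ h δ u
    -- = δ u`, and `δ u` is the projection of `g`.
    have h2 := ktf_koszDer_genSpan j (fun g' h' => by omega) h1
    have h3 := congrArg (ktf j) h2
    rwa [map_add, ktf_ktf, zero_add] at h3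
  · simp

theorem sum_ant_eq_zero {w : List (Anti m)} (h : (w.map Anti.ant).sum = 0) : w = [] := by
  cases w with
  | nil => rfl
  | cons g w =>
    have := one_le_ant g
    simp at h
    omega

theorem homProj_word_eq_zero {T : ℕ} (j : Jet m) {w : List (Anti m)} (hw : ∀ g ∈ w, g.ant < T) :
    homProj T j (aword w) = 0 := by
  have := (homProj_isEvenDer T j).word_eq (D' := 0) (w := w) (by intro u v; simp) (fun g hg => by
    have := homProj_agen j (hw g hg).le
    rw [if_neg (hw g hg).ne] at this
    simpa using this)
  simpa using this

theorem ant_le_sum {w : List (Anti m)} {g : Anti m} (hg : g ∈ w) : g.ant ≤ (w.map Anti.ant).sum :=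
  List.single_le_sum (by simp) _ (List.mem_map_of_mem hg)

/-- On words of antifield number at most `T + 1`, `T ≥ 2`, `homProj T` is a projector. -/
theorem homProj_homProj_word {T : ℕ} (hT : 2 ≤ T) (j : Jet m) {w : List (Anti m)}
    (hw : ∀ g ∈ w, g.ant ≤ T) (hs : (w.map Anti.ant).sum ≤ T + 1) :
    homProj T j (homProj T j (aword w)) = homProj T j (aword w) := by
  induction w with
  | nil => simp [aword, (homProj_isEvenDer T j).map_one]
  | cons g w ih =>
    have hg := hw g (by simp)
    have hw' : ∀ g ∈ w, g.ant ≤ T := fun b hb => hw b (by simp [hb])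
    simp only [List.map_cons, List.sum_cons] at hs
    rw [aword, word_cons, homProj_isEvenDer T j, map_add, homProj_isEvenDer T j,
      homProj_isEvenDer T j]
    have h3 := homProj_homProj_agen (by omega) j hg
    have h4 := homProj_agen j hg
    rw [agen] at h3 h4
    -- A letter of number `T` leaves total number at most `1 < T` for the rest of the word. So at
    -- most one letter is moved by the derivation, and idempotence on letters suffices.
    by_cases h : g.ant = T
    · have h5 : homProj T j (word Anti.ant Anti.Alt w) = 0 := homProj_word_eq_zero j fun b hb => by
        have := ant_le_sum hb
        omega
      rw [h5, h3]
      simp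
    · rw [if_neg h] at h4
      have h5 : homProj T j (homProj T j (word Anti.ant Anti.Alt w)) =
          homProj T j (word Anti.ant Anti.Alt w) := ih hw' (by omega)
      rw [h4, h5]
      simp

end BFTheory

/-! ### Smooth functions on jet spaces: parameter integrals and derivatives -/

namespace BFTheory

open MeasureTheory intervalIntegral

/-- Integrals over `[0, 1]` depend smoothly on parameters. -/
theorem contDiffOn_integral {P : Type} [NormedAddCommGroup P] [NormedSpace ℝ P] {s : Set P}
    (hs : IsOpen s) {G : P → ℝ → ℝ}
    (hG : ContDiffOn ℝ ∞ (fun q : P × ℝ => G q.1 q.2) (s ×ˢ Set.univ)) :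
    ContDiffOn ℝ ∞ (fun p => ∫ t in (0 : ℝ)..1, G p t) s := by
  -- The integral is the value at `0` of the convolution of the indicator function of `(0, 1]` with
  -- the reflected integrand. The bump, equal to one on the relevant interval, makes that factor
  -- compactly supported so that smoothness of convolutions with parameters applies.
  let χ : ContDiffBump (0 : ℝ) := ⟨2, 3, by norm_num, by norm_num⟩
  let g : P → ℝ → ℝ := fun p t => χ t * G p (-t)
  let f : ℝ → ℝ := Set.indicator (Set.Ioc 0 1) 1
  have hf : LocallyIntegrable f volume := by
    refine Integrable.locallyIntegrable ?_
    refine (integrable_indicator_iff measurableSet_Ioc).mpr ?_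
    exact integrableOn_const (by simp) (by simp)
  have hg : ContDiffOn ℝ ∞ (Function.uncurry g) (s ×ˢ Set.univ) := by
    refine ContDiffOn.mul ?_ ?_
    · exact (χ.contDiff.comp contDiff_snd).contDiffOn
    · exact hG.comp (g := fun q : P × ℝ => G q.1 q.2) (f := fun q : P × ℝ => (q.1, -q.2))
        (by fun_prop) (fun q hq => ⟨hq.1, Set.mem_univ _⟩)
  have key := contDiffOn_convolution_right_with_param (n := ⊤) (μ := volume)
    (ContinuousLinearMap.mul ℝ ℝ) hs (isCompact_closedBall (0 : ℝ) 3) (g := g) (f := f)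
    (fun p t _ ht => by
      have : χ t = 0 := χ.zero_of_le_dist (by
        simp only [Metric.mem_closedBall, not_le] at ht
        exact ht.le)
      simp [g, this]) hf hg
  have key2 := key.comp (g := fun q : P × ℝ => (convolution f (g q.1)
      (ContinuousLinearMap.mul ℝ ℝ) volume) q.2) (f := fun p : P => (p, (0 : ℝ))) (s := s)
    (by fun_prop) (fun p hp => ⟨hp, Set.mem_univ _⟩)
  refine key2.congr fun p _ => ?_
  simp only [Function.comp_apply, convolution, ContinuousLinearMap.mul_apply', zero_sub]
  rw [integral_of_le zero_le_one, ← MeasureTheory.integral_indicator measurableSet_Ioc]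
  refine integral_congr_ae (Filter.Eventually.of_forall fun t => ?_)
  simp only [f, g, Set.indicator_apply]
  split_ifs with h
  · have : χ (-t) = 1 := χ.one_of_mem_closedBall (by
      simp only [Metric.mem_closedBall, dist_zero_right, norm_neg, Real.norm_eq_abs]
      rw [abs_of_pos h.1]
      change t ≤ 2
      linarith [h.2])
    simp [this]
  · simp

variable {m : ℕ}

/-! ### Smooth functions on finite order jet spaces -/

/-- Jets of order at most `r`. -/
abbrev TJet (m r : ℕ) := (Σ i : Fin (r + 1), Sym (Fin (m + 1)) i) → Fib m

/-- Truncation of jets. -/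
def trunc (r : ℕ) : Jet m →ₗ[ℝ] TJet m r where
  toFun j p := j (p.2 : MI m)
  map_add' _ _ := rfl
  map_smul' _ _ := rfl

/-- Extension of truncated jets by zero. -/
noncomputable def extend (r : ℕ) : TJet m r →ₗ[ℝ] Jet m where
  toFun y L := if h : L.card < r + 1 then y ⟨⟨L.card, h⟩, Sym.mk L rfl⟩ else 0
  map_add' y z := by
    funext L
    simp only [Pi.add_apply]
    split_ifs <;> simp
  map_smul' c y := by
    funext L
    simp only [Pi.smul_apply, RingHom.id_apply]
    split_ifs <;> simp

theorem extend_apply {r i : ℕ} (h : i < r + 1) (y : TJet m r) (s : Sym (Fin (m + 1)) i) :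
    extend r y (s : MI m) = y ⟨⟨i, h⟩, s⟩ := by
  obtain ⟨L, rfl⟩ := s
  exact dif_pos h

theorem trunc_extend (r : ℕ) (y : TJet m r) : trunc r (extend r y) = y := by
  funext ⟨⟨i, hi⟩, s⟩
  exact extend_apply hi y s

theorem extend_trunc (r : ℕ) (j : Jet m) {L : MI m} (h : L.card ≤ r) :
    extend r (trunc r j) L = j L := by
  simp only [trunc, extend, LinearMap.coe_mk, AddHom.coe_mk]
  rw [dif_pos (by omega)]
  rfl

theorem trunc_eq_iff {r : ℕ} {j j' : Jet m} :
    trunc r j = trunc r j' ↔ ∀ L : MI m, L.card ≤ r → j L = j' L := by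
  constructor
  · intro h L hL
    rw [← extend_trunc r j hL, h, extend_trunc r j' hL]
  · intro h
    funext ⟨i, s⟩
    refine h _ ?_
    have h2 : Multiset.card (Sym.toMultiset s) = i := s.2
    have := i.2
    simp only
    omega

/-- Extension of truncated jets by zero gives a canonical representative, which separates smoothness
from the dependence on finitely many jets. -/
theorem isJetFun_iff {U : Set (E m)} {r : ℕ} {f : E m → Jet m → ℝ} :
    IsJetFun U r f ↔ ContDiffOn ℝ ∞ (fun p : E m × TJet m r => f p.1 (extend r p.2))
      (U ×ˢ Set.univ) ∧ ∀ x ∈ U, ∀ j j', trunc r j = trunc r j' → f x j = f x j' := by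
  constructor
  · rintro ⟨g, hg, hf⟩
    refine ⟨hg.congr fun p hp => ?_, fun x hx j j' h => ?_⟩
    · rw [hf _ hp.1]
      congr 2
      exact trunc_extend r p.2
    · rw [hf x hx, hf x hx]
      congr 2
  · rintro ⟨h1, h2⟩
    refine ⟨_, h1, fun x hx j => h2 x hx _ _ ?_⟩
    exact (trunc_extend r (trunc r j)).symm

section Closure

variable {U : Set (E m)} {r : ℕ} {f g : E m → Jet m → ℝ}

theorem IsJetFun.mono_set {V : Set (E m)} (h : IsJetFun U r f) (hV : V ⊆ U) : IsJetFun V r f := by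
  obtain ⟨g, h1, h2⟩ := h
  exact ⟨g, h1.mono (Set.prod_mono hV le_rfl), fun x hx => h2 x (hV hx)⟩

theorem IsJetFun.congr (h : IsJetFun U r f) (hg : ∀ x ∈ U, ∀ j, g x j = f x j) :
    IsJetFun U r g := by
  obtain ⟨k, h1, h2⟩ := h
  exact ⟨k, h1, fun x hx j => (hg x hx j).trans (h2 x hx j)⟩

theorem IsJetFun.mono {r' : ℕ} (h : IsJetFun U r f) (hr : r ≤ r') : IsJetFun U r' f := by
  obtain ⟨g, h1, h2⟩ := h
  have hlt : ∀ i : Fin (r + 1), (i : ℕ) < r' + 1 := fun i => by have := i.2; omega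
  refine ⟨fun p => g (p.1, fun q => p.2 ⟨⟨q.1, hlt q.1⟩, q.2⟩), ?_, fun x hx j => h2 x hx j⟩
  refine h1.comp (g := g) (f := fun p : E m × TJet m r' =>
    (p.1, fun q : (Σ i : Fin (r + 1), Sym (Fin (m + 1)) i) => p.2 ⟨⟨q.1, hlt q.1⟩, q.2⟩)) ?_
    (fun p hp => ⟨hp.1, Set.mem_univ _⟩)
  exact ContDiff.contDiffOn (by fun_prop)

theorem isJetFun_base {h : E m → ℝ} (hh : ContDiffOn ℝ ∞ h U) : IsJetFun U r fun x _ => h x :=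
  ⟨fun p => h p.1, hh.comp contDiff_fst.contDiffOn fun _ hp => hp.1, fun _ _ _ => rfl⟩

theorem isJetFun_const (c : ℝ) : IsJetFun U r fun _ _ => c := isJetFun_base contDiffOn_const

theorem IsJetFun.add (hf : IsJetFun U r f) (hg : IsJetFun U r g) :
    IsJetFun U r fun x j => f x j + g x j := by
  obtain ⟨k, h1, h2⟩ := hf
  obtain ⟨k', h1', h2'⟩ := hg
  exact ⟨_, h1.add h1', fun x hx j => by simp only [h2 x hx, h2' x hx]⟩

theorem IsJetFun.mul (hf : IsJetFun U r f) (hg : IsJetFun U r g) :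
    IsJetFun U r fun x j => f x j * g x j := by
  obtain ⟨k, h1, h2⟩ := hf
  obtain ⟨k', h1', h2'⟩ := hg
  exact ⟨_, h1.mul h1', fun x hx j => by simp only [h2 x hx, h2' x hx]⟩

theorem IsJetFun.sum {ι : Type*} {s : Finset ι} {f : ι → E m → Jet m → ℝ}
    (hf : ∀ i ∈ s, IsJetFun U r (f i)) : IsJetFun U r fun x j => ∑ i ∈ s, f i x j := by
  classical
  induction s using Finset.induction_on with
  | empty => simpa using isJetFun_const 0
  | insert a s ha ih =>
    simp only [Finset.sum_insert ha]
    exact (hf a (by simp)).add (ih fun i hi => hf i (by simp [hi]))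

theorem IsJetFun.const_mul (c : ℝ) (hf : IsJetFun U r f) : IsJetFun U r fun x j => c * f x j :=
  (isJetFun_const c).mul hf

theorem IsJetFun.neg (hf : IsJetFun U r f) : IsJetFun U r fun x j => -f x j :=
  (hf.const_mul (-1)).congr fun x _ j => by simp

/-- Linear functions of truncated jets are jet functions. -/
theorem isJetFun_linear (φ : Jet m →ₗ[ℝ] ℝ) (h : ∀ j j', trunc r j = trunc r j' → φ j = φ j') :
    IsJetFun U r fun _ j => φ j := by
  rw [isJetFun_iff]
  refine ⟨?_, fun x _ j j' hj => h j j' hj⟩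
  have : Continuous (φ ∘ₗ extend r) := LinearMap.continuous_of_finiteDimensional _
  let ψ : TJet m r →L[ℝ] ℝ := ⟨φ ∘ₗ extend r, this⟩
  exact (ψ.contDiff.comp contDiff_snd).contDiffOn

/-- The functional `A_L`. -/
def jetAₗ (L : MI m) : Jet m →ₗ[ℝ] ℝ where
  toFun j := jetA j L
  map_add' _ _ := rfl
  map_smul' _ _ := rfl

/-- The functional `B_{t,L}`. -/
def jetBₗ (t : Fin m → Fin (m + 1)) (L : MI m) : Jet m →ₗ[ℝ] ℝ where
  toFun j := jetB j t L
  map_add' _ _ := rfl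
  map_smul' _ _ := rfl

theorem isJetFun_jetA {L : MI m} (h : L.card ≤ r) : IsJetFun U r fun _ j => jetA j L :=
  isJetFun_linear (jetAₗ L) fun j j' hj => by
    simp [jetAₗ, jetA, trunc_eq_iff.mp hj L h]

theorem isJetFun_jetB {t : Fin m → Fin (m + 1)} {L : MI m} (h : L.card ≤ r) :
    IsJetFun U r fun _ j => jetB j t L :=
  isJetFun_linear (jetBₗ t L) fun j j' hj => by
    simp [jetBₗ, jetB, trunc_eq_iff.mp hj L h]

end Closure

/-! ### Directional derivatives -/

/-- The derivative of a function of jets along a jet direction. -/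
noncomputable def jdir (e : Jet m) (f : E m → Jet m → ℝ) (x : E m) (j : Jet m) : ℝ :=
  deriv (fun s : ℝ => f x (j + s • e)) 0

section Dir

variable {U : Set (E m)} {r : ℕ} {f : E m → Jet m → ℝ}

theorem IsJetFun.hasDerivAt_aux (hU : IsOpen U) {g : E m × TJet m r → ℝ}
    (h1 : ContDiffOn ℝ ∞ g (U ×ˢ Set.univ)) (h2 : ∀ x ∈ U, ∀ j, f x j = g (x, trunc r j))
    {x : E m} (hx : x ∈ U) (j e : Jet m) :
    HasDerivAt (fun s : ℝ => f x (j + s • e)) (fderiv ℝ g (x, trunc r j) (0, trunc r e)) 0 := by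
  have hd : DifferentiableAt ℝ g (x, trunc r j) :=
    (h1.contDiffAt ((hU.prod isOpen_univ).mem_nhds ⟨hx, Set.mem_univ _⟩)).differentiableAt
      (by simp)
  have h3 : (fun s : ℝ => f x (j + s • e)) =
      fun s : ℝ => g ((x, trunc r j) + s • (0, trunc r e)) := by
    funext s
    rw [h2 x hx, map_add, map_smul]
    simp
  rw [h3]
  have h4 := hd.hasFDerivAt.hasLineDerivAt (0, trunc r e)
  exact h4

theorem IsJetFun.hasDerivAt (hU : IsOpen U) (hf : IsJetFun U r f) {x : E m} (hx : x ∈ U)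
    (j e : Jet m) : HasDerivAt (fun s : ℝ => f x (j + s • e)) (jdir e f x j) 0 := by
  obtain ⟨g, h1, h2⟩ := hf
  have := IsJetFun.hasDerivAt_aux hU h1 h2 hx j e
  rw [jdir, this.deriv]
  exact this

theorem IsJetFun.jdir (hU : IsOpen U) (hf : IsJetFun U r f) (e : Jet m) :
    IsJetFun U r (jdir e f) := by
  obtain ⟨g, h1, h2⟩ := hf
  refine ⟨fun p => fderiv ℝ g p (0, trunc r e), ?_, fun x hx j => ?_⟩
  · refine ContDiffOn.clm_apply ?_ contDiffOn_const
    exact h1.fderiv_of_isOpen (hU.prod isOpen_univ) (by simp)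
  · exact (IsJetFun.hasDerivAt_aux hU h1 h2 hx j e).deriv

/-- Directional derivatives are linear in the truncated direction. -/
theorem IsJetFun.jdir_sum (hU : IsOpen U) (hf : IsJetFun U r f) {x : E m} (hx : x ∈ U)
    (j e : Jet m) {ι : Type*} (s : Finset ι) (c : ι → ℝ) (d : ι → Jet m)
    (h : trunc r e = ∑ i ∈ s, c i • trunc r (d i)) :
    BFTheory.jdir e f x j = ∑ i ∈ s, c i * BFTheory.jdir (d i) f x j := by
  obtain ⟨g, h1, h2⟩ := hf
  have h3 : ∀ e, BFTheory.jdir e f x j = fderiv ℝ g (x, trunc r j) (0, trunc r e) := fun e =>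
    (IsJetFun.hasDerivAt_aux hU h1 h2 hx j e).deriv
  simp only [h3, h]
  have h4 : ((0, ∑ i ∈ s, c i • trunc r (d i)) : E m × TJet m r) =
      ∑ i ∈ s, c i • ((0, trunc r (d i)) : E m × TJet m r) := by
    refine Prod.ext ?_ ?_
    · simp [Prod.fst_sum]
    · simp [Prod.snd_sum]
  rw [h4, map_sum]
  simp only [map_smul, smul_eq_mul]

theorem IsJetFun.jdir_comm (hU : IsOpen U) (hf : IsJetFun U r f) {x : E m} (hx : x ∈ U)
    (j e e' : Jet m) :
    BFTheory.jdir e (BFTheory.jdir e' f) x j = BFTheory.jdir e' (BFTheory.jdir e f) x j := by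
  obtain ⟨g, h1, h2⟩ := hf
  have h3 : ∀ e, ∀ x ∈ U, ∀ j, BFTheory.jdir e f x j =
      fderiv ℝ g (x, trunc r j) (0, trunc r e) := fun e x hx j =>
    (IsJetFun.hasDerivAt_aux hU h1 h2 hx j e).deriv
  have hn := (hU.prod isOpen_univ).mem_nhds (show (x, trunc r j) ∈ U ×ˢ Set.univ from
    ⟨hx, Set.mem_univ _⟩)
  have h5 : ContDiffOn ℝ ∞ (fderiv ℝ g) (U ×ˢ Set.univ) :=
    h1.fderiv_of_isOpen (hU.prod isOpen_univ) (by simp)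
  have h6 : DifferentiableAt ℝ (fderiv ℝ g) (x, trunc r j) :=
    (h5.contDiffAt hn).differentiableAt (by simp)
  have h4 : ∀ e e', BFTheory.jdir e (BFTheory.jdir e' f) x j =
      fderiv ℝ (fderiv ℝ g) (x, trunc r j) (0, trunc r e) (0, trunc r e') := by
    intro e e'
    have hk : ContDiffOn ℝ ∞ (fun p => fderiv ℝ g p (0, trunc r e')) (U ×ˢ Set.univ) :=
      ContDiffOn.clm_apply h5 contDiffOn_const
    have h7 : BFTheory.jdir e (BFTheory.jdir e' f) x j = _ :=
      (IsJetFun.hasDerivAt_aux hU hk (h3 e') hx j e).deriv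
    rw [h7, fderiv_clm_apply h6 (differentiableAt_const _)]
    simp
  rw [h4, h4]
  have := (h1.contDiffAt hn).isSymmSndFDerivAt (by
    rw [minSmoothness_of_isRCLikeNormedField]
    exact ENat.LEInfty.out)
  exact this _ _

end Dir

end BFTheory

namespace BFTheory

variable {m : ℕ}

/-! ### Sums of products with smooth coefficients -/

section Poly

variable {G Q : Type*} [Ring Q] [Algebra ℝ Q] {val : Jet m → G → Q} {P : List G → Prop}
  {U : Set (E m)} {r : ℕ} {F F' : E m → Jet m → Q}

theorem IsPolyIn.congr (h : IsPolyIn val P U r F) (h' : ∀ x ∈ U, ∀ j, F' x j = F x j) :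
    IsPolyIn val P U r F' := by
  obtain ⟨S, c, h1, h2⟩ := h
  exact ⟨S, c, h1, fun x hx j => (h' x hx j).trans (h2 x hx j)⟩

theorem IsPolyIn.mono {P' : List G → Prop} {r' : ℕ} (h : IsPolyIn val P U r F)
    (hP : ∀ w, P w → P' w) (hr : r ≤ r') : IsPolyIn val P' U r' F := by
  obtain ⟨S, c, h1, h2⟩ := h
  exact ⟨S, c, fun w hw => ⟨hP w (h1 w hw).1, (h1 w hw).2.mono hr⟩, h2⟩

theorem IsPolyIn.mono_set {V : Set (E m)} (h : IsPolyIn val P U r F) (hV : V ⊆ U) :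
    IsPolyIn val P V r F := by
  obtain ⟨S, c, h1, h2⟩ := h
  exact ⟨S, c, fun w hw => ⟨(h1 w hw).1, (h1 w hw).2.mono_set hV⟩, fun x hx => h2 x (hV hx)⟩

theorem isPolyIn_zero : IsPolyIn val P U r fun _ _ => 0 :=
  ⟨∅, fun _ _ _ => 0, by simp, by simp⟩

theorem isPolyIn_single {w : List G} (hw : P w) {c : E m → Jet m → ℝ} (hc : IsJetFun U r c) :
    IsPolyIn val P U r fun x j => c x j • (w.map (val j)).prod :=
  ⟨{w}, fun _ => c, by simpa using ⟨hw, hc⟩, by simp⟩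

theorem IsPolyIn.add (h : IsPolyIn val P U r F) (h' : IsPolyIn val P U r F') :
    IsPolyIn val P U r fun x j => F x j + F' x j := by
  classical
  obtain ⟨S, c, h1, h2⟩ := h
  obtain ⟨S', c', h1', h2'⟩ := h'
  refine ⟨S ∪ S', fun w x j => (if w ∈ S then c w x j else 0) + (if w ∈ S' then c' w x j else 0),
    fun w hw => ⟨?_, IsJetFun.add ?_ ?_⟩, fun x hx j => ?_⟩
  · rcases Finset.mem_union.mp hw with h | h
    · exact (h1 w h).1
    · exact (h1' w h).1
  · split_ifs with h
    · exact (h1 w h).2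
    · exact isJetFun_const 0
  · split_ifs with h
    · exact (h1' w h).2
    · exact isJetFun_const 0
  · simp only [add_smul, Finset.sum_add_distrib]
    rw [h2 x hx, h2' x hx]
    congr 1
    · rw [← Finset.sum_subset Finset.subset_union_left]
      · exact Finset.sum_congr rfl fun w hw => by rw [if_pos hw]
      · intro w _ hw
        rw [if_neg hw, zero_smul]
    · rw [← Finset.sum_subset Finset.subset_union_right]
      · exact Finset.sum_congr rfl fun w hw => by rw [if_pos hw]
      · intro w _ hw
        rw [if_neg hw, zero_smul]

theorem isPolyIn_sum {ι : Type*} {s : Finset ι} {F : ι → E m → Jet m → Q}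
    (h : ∀ i ∈ s, IsPolyIn val P U r (F i)) : IsPolyIn val P U r fun x j => ∑ i ∈ s, F i x j := by
  classical
  induction s using Finset.induction_on with
  | empty => simpa using isPolyIn_zero
  | insert a s ha ih =>
    simp only [Finset.sum_insert ha]
    exact (h a (by simp)).add (ih fun i hi => h i (by simp [hi]))

theorem IsPolyIn.smul {f : E m → Jet m → ℝ} (hf : IsJetFun U r f) (h : IsPolyIn val P U r F) :
    IsPolyIn val P U r fun x j => f x j • F x j := by
  obtain ⟨S, c, h1, h2⟩ := h
  refine ⟨S, fun w x j => f x j * c w x j, fun w hw => ⟨(h1 w hw).1, hf.mul (h1 w hw).2⟩,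
    fun x hx j => ?_⟩
  simp only [h2 x hx, Finset.smul_sum, smul_smul]

theorem IsPolyIn.neg (h : IsPolyIn val P U r F) : IsPolyIn val P U r fun x j => -F x j :=
  ((h.smul (isJetFun_const (-1)))).congr fun x _ j => by simp

/-- Application of linear operators that depend on the point. -/
theorem IsPolyIn.bind {G' Q' : Type*} [Ring Q'] [Algebra ℝ Q'] {val' : Jet m → G' → Q'}
    {P' : List G' → Prop} {r' : ℕ} (h : IsPolyIn val P U r F) (hr : r ≤ r')
    (L : E m → Jet m → Q →ₗ[ℝ] Q')
    (hL : ∀ w, P w → IsPolyIn val' P' U r' fun x j => L x j (w.map (val j)).prod) :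
    IsPolyIn val' P' U r' fun x j => L x j (F x j) := by
  obtain ⟨S, c, h1, h2⟩ := h
  refine (isPolyIn_sum (s := S) (F := fun w x j => c w x j • L x j (w.map (val j)).prod)
    fun w hw => (hL w (h1 w hw).1).smul ((h1 w hw).2.mono hr)).congr fun x hx j => ?_
  rw [h2 x hx, map_sum]
  simp only [map_smul]

theorem IsPolyIn.mul {P' P'' : List G → Prop} (h : IsPolyIn val P U r F)
    (h' : IsPolyIn val P' U r F') (hP : ∀ v w, P v → P' w → P'' (v ++ w)) :
    IsPolyIn val P'' U r fun x j => F x j * F' x j := by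
  refine h.bind le_rfl (fun x j => LinearMap.mulRight ℝ (F' x j)) fun v hv => ?_
  simp only [LinearMap.mulRight_apply]
  refine h'.bind le_rfl (fun x j => LinearMap.mulLeft ℝ (v.map (val j)).prod) fun w hw => ?_
  refine (isPolyIn_single (hP v w hv hw) (isJetFun_const 1)).congr fun x _ j => ?_
  simp

end Poly

/-- Constant elements of the span of words. -/
theorem isPolyIn_of_mem_antiSpan {U : Set (E m)} {T a r : ℕ} {u : AntiAlg m}
    (hu : u ∈ antiSpan m T a r) {c : E m → Jet m → ℝ} (hc : IsJetFun U r c) :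
    IsPolyIn (fun _ => agen) (AntiWord T a r) U r fun x j => c x j • u := by
  induction hu using Submodule.span_induction with
  | mem x h =>
    obtain ⟨w, hw, rfl⟩ := h
    exact isPolyIn_single hw hc
  | zero => simpa using isPolyIn_zero
  | add a b _ _ ha hb =>
    simp only [smul_add]
    exact ha.add hb
  | smul k a _ ha =>
    refine (ha.smul (isJetFun_const k)).congr fun x _ j => smul_comm _ _ _

/-! ### The Euler projector on jets and the scaling homotopy -/

theorem eulA_add (j j' : Jet m) (L : MI m) : eulA (j + j') L = eulA j L + eulA j' L := by
  simp only [eulA, ← Finset.sum_add_distrib, ← mul_add]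
  rfl

theorem eulA_smul (c : ℝ) (j : Jet m) (L : MI m) : eulA (c • j) L = c * eulA j L := by
  simp only [eulA, Finset.mul_sum]
  refine Finset.sum_congr rfl fun μ _ => Finset.sum_congr rfl fun t _ => ?_
  rw [mul_left_comm]
  rfl

theorem eulB_add (j j' : Jet m) (t) (L : MI m) : eulB (j + j') t L = eulB j t L + eulB j' t L := by
  simp only [eulB, ← neg_add, ← Finset.sum_add_distrib, ← mul_add]
  rfl

theorem eulB_smul (c : ℝ) (j : Jet m) (t) (L : MI m) : eulB (c • j) t L = c * eulB j t L := by
  simp only [eulB, mul_neg, Finset.mul_sum]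
  congr 1
  refine Finset.sum_congr rfl fun μ _ => ?_
  rw [mul_left_comm]
  rfl

/-- The projector onto the jet directions that are detected by the Koszul-Tate differential. -/
noncomputable def eulProj : Jet m →ₗ[ℝ] Jet m where
  toFun j L := (if L = 0 then 0 else jetA j L,
    if (0 : Fin (m + 1)) ∈ L then eulA j (L.erase 0) • altBasis Fin.succ else 0)
  map_add' j j' := by
    funext L
    refine Prod.ext ?_ ?_
    · simp only [Pi.add_apply, Prod.fst_add]
      split_ifs
      · simp
      · rfl
    · simp only [Pi.add_apply, Prod.snd_add]
      split_ifs
      · rw [eulA_add, add_smul]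
      · simp
  map_smul' c j := by
    funext L
    refine Prod.ext ?_ ?_
    · simp only [Pi.smul_apply, Prod.smul_fst, RingHom.id_apply]
      split_ifs
      · simp
      · rfl
    · simp only [Pi.smul_apply, Prod.smul_snd, RingHom.id_apply]
      split_ifs
      · rw [eulA_smul, mul_smul]
      · simp

theorem jetA_eulProj (j : Jet m) (L : MI m) :
    jetA (eulProj j) L = if L = 0 then 0 else jetA j L := rfl

theorem jetB_eulProj (j : Jet m) (t) (L : MI m) : jetB (eulProj j) t L =
    if (0 : Fin (m + 1)) ∈ L then eulA j (L.erase 0) * (altBasis Fin.succ).1 t else 0 := by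
  simp only [jetB, eulProj, LinearMap.coe_mk, AddHom.coe_mk]
  split_ifs <;> simp

/-- The projection stores `d_L 𝓔` in the single component of `B` that is dual to it, so the
projected jet has the same field equations. Consequently `δ` depends on a jet only through its
projection. -/
theorem eulA_eulProj (j : Jet m) (L : MI m) : eulA (eulProj j) L = eulA j L := by
  have : ∀ μ : Fin (m + 1), ∑ t : Fin m → Fin (m + 1), levi (Fin.cons μ t) *
      jetB (eulProj j) t (μ ::ₘ L) = if μ = 0 then eulA j L else 0 := by
    intro μ
    simp only [jetB_eulProj]
    split_ifs with h h' h'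
    · subst h'
      simp only [Multiset.erase_cons_head, mul_left_comm _ (eulA j L), ← Finset.mul_sum]
      rw [sum_levi_altBasis]
      simp
    · simp only [mul_left_comm _ (eulA j _), ← Finset.mul_sum]
      rw [sum_levi_altBasis, if_neg h', mul_zero]
    · subst h'
      simp at h
    · simp
  rw [eulA]
  simp only [this, Finset.sum_ite_eq', Finset.mem_univ, if_true]

theorem eulB_eulProj (j : Jet m) (t) (L : MI m) : eulB (eulProj j) t L = eulB j t L := by
  simp [eulB, jetA_eulProj]

theorem eulProj_eulProj (j : Jet m) : eulProj (eulProj j) = eulProj j := by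
  funext L
  refine Prod.ext ?_ ?_
  · change jetA (eulProj (eulProj j)) L = jetA (eulProj j) L
    simp only [jetA_eulProj]
    split_ifs <;> rfl
  · simp only [eulProj, LinearMap.coe_mk, AddHom.coe_mk]
    have := eulA_eulProj j (L.erase 0)
    simp only [eulProj, LinearMap.coe_mk, AddHom.coe_mk] at this
    rw [this]

/-- The component at `L` uses `d_{L - 0} 𝓔`, whose jets have order `|L|`. So the projection does not
raise the jet order. -/
theorem trunc_eulProj {r : ℕ} {j j' : Jet m} (h : trunc r j = trunc r j') :
    trunc r (eulProj j) = trunc r (eulProj j') := by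
  rw [trunc_eq_iff] at h ⊢
  intro L hL
  refine Prod.ext ?_ ?_
  · change jetA (eulProj j) L = jetA (eulProj j') L
    rw [jetA_eulProj, jetA_eulProj, jetA, jetA, h L hL]
  · simp only [eulProj, LinearMap.coe_mk, AddHom.coe_mk]
    split_ifs with h0
    · congr 1
      simp only [eulA]
      refine Finset.sum_congr rfl fun μ _ => Finset.sum_congr rfl fun t _ => ?_
      have : (μ ::ₘ L.erase 0).card ≤ r := by
        rw [Multiset.card_cons, Multiset.card_erase_add_one h0]
        exact hL
      simp only [jetB, h _ this]
    · rfl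

theorem levi_cons_succAbove (μ i : Fin (m + 1)) :
    levi (Fin.cons μ i.succAbove) = if μ = i then (-1 : ℝ) ^ (i : ℕ) else 0 := by
  split_ifs with h
  · subst h
    have := isAlt_levi.cons_succAbove (id : Fin (m + 1) → Fin (m + 1)) μ
    simpa [levi_id] using this
  · exact isAlt_levi.eq_zero (cons_injective_fin μ i h)

/-- The contraction runs over the `|S|` derivative indices and each returns `A_S`. The
undifferentiated `A` is missed, since no function `d_Λ 𝓔^t` contains it. -/
theorem ktf_koszA (j : Jet m) (S : MI m) :
    ktf j (koszA S) = algebraMap ℝ _ (if S = 0 then 0 else jetA j S) := by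
  rw [koszA, map_neg, kosz_eq]
  simp only [map_smul, map_sum, ktf_c, dDelta_top, id, Function.id_comp]
  have h1 : ∀ i : Fin (m + 1), (-1 : ℝ) ^ (i : ℕ) • (S.count i : ℝ) •
      algebraMap ℝ (AntiAlg m) (eulB j i.succAbove (S.erase i)) =
      -((S.count i : ℝ) • algebraMap ℝ (AntiAlg m) (jetA j S)) := by
    intro i
    by_cases hi : i ∈ S
    · have : eulB j i.succAbove (S.erase i) = -((-1 : ℝ) ^ (i : ℕ) * jetA j S) := by
        simp only [eulB, levi_cons_succAbove, ite_mul, zero_mul, Finset.sum_ite_eq',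
          Finset.mem_univ, if_true, Multiset.cons_erase hi]
      rw [this, map_neg, smul_neg, smul_neg, smul_comm, Algebra.algebraMap_eq_smul_one,
        Algebra.algebraMap_eq_smul_one, smul_smul _ _ (1 : AntiAlg m), ← mul_assoc, ← mul_pow]
      simp
    · rw [Multiset.count_eq_zero_of_notMem hi]
      simp
  simp only [h1, Finset.sum_neg_distrib, ← Finset.sum_smul]
  have h2 : ∑ μ : Fin (m + 1), (S.count μ : ℝ) = S.card := by
    rw [← Nat.cast_sum]
    congr 1
    exact Multiset.sum_count_eq_card fun a _ => Finset.mem_univ a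
  rw [h2, smul_neg, neg_neg, smul_smul]
  split_ifs with h
  · subst h; simp
  · have : (S.card : ℝ) ≠ 0 := by
      simpa using h
    rw [show 1 / ((S.card : ℝ) + m - m) * S.card = 1 by
      rw [add_sub_cancel_right]; field_simp, one_smul]

/-- The coefficients are the values of `δ` on `koszA S` and `s̄_S`. Differentiation of a coefficient
along `eulProj j` is therefore what `δ` makes of the coefficient part of the homotopy. -/
theorem trunc_eulProj_eq (r : ℕ) (j : Jet m) : trunc r (eulProj j) =
    ∑ S ∈ miLe m (r + 1), (if S = 0 then 0 else jetA j S) • trunc r (dirA S) +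
      ∑ S ∈ miLe m r, eulA j S • trunc r (dirB S) := by
  have h : trunc r (eulProj j) = trunc r
      (∑ S ∈ miLe m (r + 1), (if S = 0 then 0 else jetA j S) • dirA S +
      ∑ S ∈ miLe m r, eulA j S • dirB S) := by
    rw [trunc_eq_iff]
    intro L hL
    simp only [Pi.add_apply, Finset.sum_apply, Pi.smul_apply]
    rw [Finset.sum_eq_single_of_mem L (mem_miLe.mpr (by omega))]
    · by_cases h0 : (0 : Fin (m + 1)) ∈ L
      · rw [Finset.sum_eq_single_of_mem (L.erase 0)]
        · refine Prod.ext ?_ ?_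
          · simp only [eulProj, dirA, dirB, LinearMap.coe_mk, AddHom.coe_mk, Pi.single_eq_same,
              Multiset.cons_erase h0]
            split_ifs <;> simp
          · simp only [eulProj, dirA, dirB, LinearMap.coe_mk, AddHom.coe_mk, Pi.single_eq_same,
              Multiset.cons_erase h0]
            split_ifs <;> simp
        · refine mem_miLe.mpr ?_
          have := Multiset.card_erase_add_one h0
          omega
        · intro S _ hS
          have : L ≠ 0 ::ₘ S := by
            rintro rfl
            simp at hS
          simp [dirB, this]
      · rw [Finset.sum_eq_zero]
        · refine Prod.ext ?_ ?_
          · simp only [eulProj, dirA, LinearMap.coe_mk, AddHom.coe_mk, Pi.single_eq_same]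
            split_ifs <;> simp
          · simp only [eulProj, dirA, LinearMap.coe_mk, AddHom.coe_mk, Pi.single_eq_same, if_neg h0]
            split_ifs <;> simp
        · intro S _
          have : L ≠ 0 ::ₘ S := by
            rintro rfl
            simp at h0
          simp [dirB, this]
    · intro S _ hS
      simp [dirA, hS.symm]
  rw [h, map_add, map_sum, map_sum]
  simp only [map_smul]

/-- The scaling of the jet directions that are detected by the Koszul-Tate differential. -/
noncomputable def jscale (t : ℝ) (j : Jet m) : Jet m := j + (t - 1) • eulProj j

theorem jscale_one (j : Jet m) : jscale 1 j = j := by simp [jscale]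

theorem eulProj_jscale (t : ℝ) (j : Jet m) : eulProj (jscale t j) = t • eulProj j := by
  rw [jscale, map_add, map_smul, eulProj_eulProj]
  module

theorem jscale_jscale (s t : ℝ) (j : Jet m) : jscale s (jscale t j) = jscale (s * t) j := by
  conv_lhs => rw [jscale, eulProj_jscale]
  rw [jscale, jscale]
  module

theorem eulA_jscale (t : ℝ) (j : Jet m) (L : MI m) : eulA (jscale t j) L = t * eulA j L := by
  rw [← eulA_eulProj, eulProj_jscale, eulA_smul, eulA_eulProj]

theorem eulB_jscale (t : ℝ) (j : Jet m) (v) (L : MI m) : eulB (jscale t j) v L = t * eulB j v L := by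
  rw [← eulB_eulProj, eulProj_jscale, eulB_smul, eulB_eulProj]

theorem trunc_jscale {r : ℕ} {j j' : Jet m} (h : trunc r j = trunc r j') (t : ℝ) :
    trunc r (jscale t j) = trunc r (jscale t j') := by
  simp only [jscale, map_add, map_smul, h, trunc_eulProj h]

/-- The scaling of antifields. -/
noncomputable def scaleHom (m : ℕ) (t : ℝ) : AntiAlg m →ₐ[ℝ] AntiAlg m :=
  gcHom (fun g => t • agen g)
    (fun a b => by
      simp only [smul_mul_smul_comm]
      rw [agen, agen, gen_comm, smul_comm])
    (fun a b z h => by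
      rw [agen, agen, gen_lin h, smul_comm])

theorem scaleHom_agen (t : ℝ) (g : Anti m) : scaleHom m t (agen g) = t • agen g := gcHom_gen ..

theorem scaleHom_word (t : ℝ) (w : List (Anti m)) :
    scaleHom m t (aword w) = t ^ w.length • aword w := by
  induction w with
  | nil => simp [aword]
  | cons g w ih =>
    have := scaleHom_agen t g
    rw [agen] at this
    rw [aword, word_cons, map_mul, this, ih, smul_mul_smul_comm, List.length_cons, pow_succ']

/-- The functions `d_Λ 𝓔` and `d_Λ 𝓔^t` scale with the detected jets, and the higher `Δ` are linear
in antifields. So `δ` commutes with the simultaneous scaling of detected jets and antifields. -/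
theorem ktf_scaleHom (t : ℝ) (j : Jet m) (u : AntiAlg m) :
    ktf j (scaleHom m t u) = scaleHom m t (ktf (jscale t j) u) := by
  refine (kt_isOddRight _ j).intertwine (kt_isOddRight _ _) (scaleHom m t) (fun g => ?_)
    (fun g => ?_) u
  · have := scaleHom_agen t g
    rw [agen] at this
    rw [this, map_smul, parityInv_gen, smul_comm]
  · change ktf j (scaleHom m t (agen g)) = scaleHom m t (ktf (jscale t j) (agen g))
    rw [scaleHom_agen, map_smul]
    cases g with
    | s L =>
      rw [ktf_s, ktf_s, eulA_jscale, AlgHom.commutes, map_mul, Algebra.smul_def]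
    | c l =>
      obtain ⟨q, lt, v, L⟩ := l
      rw [ktf_c, ktf_c]
      by_cases h : q < m
      · simp only [dDelta, h, dif_pos, map_sum, scaleHom_agen, Finset.smul_sum]
      · have hq : q = m := by omega
        subst hq
        rw [dDelta_top, dDelta_top, eulB_jscale, AlgHom.commutes, map_mul, Algebra.smul_def]

/-! ### Radial integrals -/

/-- The radial integral `∫₀¹ tᵏ f(x, ρ_t j) dt`. -/
noncomputable def jint (k : ℕ) (f : E m → Jet m → ℝ) (x : E m) (j : Jet m) : ℝ :=
  ∫ t in (0 : ℝ)..1, t ^ k * f x (jscale t j)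

section Radial

variable {U : Set (E m)} {r : ℕ} {f : E m → Jet m → ℝ}

theorem IsJetFun.contDiffOn_jscale (hf : IsJetFun U r f) :
    ContDiffOn ℝ ∞ (fun q : (E m × TJet m r) × ℝ => f q.1.1 (jscale q.2 (extend r q.1.2)))
      ((U ×ˢ Set.univ) ×ˢ Set.univ) := by
  obtain ⟨g, h1, h2⟩ := hf
  let A : TJet m r →ₗ[ℝ] TJet m r := trunc r ∘ₗ eulProj ∘ₗ extend r
  have hA : Continuous A := LinearMap.continuous_of_finiteDimensional _
  let B : TJet m r →L[ℝ] TJet m r := ⟨A, hA⟩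
  have h3 : ContDiffOn ℝ ∞ (fun q : (E m × TJet m r) × ℝ =>
      g (q.1.1, q.1.2 + (q.2 - 1) • B q.1.2)) ((U ×ˢ Set.univ) ×ˢ Set.univ) := by
    refine h1.comp (g := g) (f := fun q : (E m × TJet m r) × ℝ =>
      (q.1.1, q.1.2 + (q.2 - 1) • B q.1.2)) ?_ (fun q hq => ⟨hq.1.1, Set.mem_univ _⟩)
    exact ContDiff.contDiffOn (by fun_prop)
  refine h3.congr fun q hq => ?_
  rw [h2 _ hq.1.1]
  congr 2
  have : trunc r (jscale q.2 (extend r q.1.2)) = q.1.2 + (q.2 - 1) • B q.1.2 := by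
    rw [jscale, map_add, map_smul, trunc_extend]
    rfl
  exact this

theorem IsJetFun.jint (hU : IsOpen U) (hf : IsJetFun U r f) (k : ℕ) :
    IsJetFun U r (jint k f) := by
  rw [isJetFun_iff]
  constructor
  · refine contDiffOn_integral (hU.prod isOpen_univ)
      (G := fun (p : E m × TJet m r) t => t ^ k * f p.1 (jscale t (extend r p.2))) ?_
    refine ContDiffOn.mul ?_ hf.contDiffOn_jscale
    exact ContDiff.contDiffOn (by fun_prop)
  · intro x hx j j' h
    have h2 := (isJetFun_iff.mp hf).2 x hx
    simp only [BFTheory.jint]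
    congr 1
    funext t
    rw [h2 _ _ (trunc_jscale h t)]

theorem IsJetFun.continuous_jscale (hf : IsJetFun U r f) {x : E m} (hx : x ∈ U) (j : Jet m) :
    Continuous fun t => f x (jscale t j) := by
  have h1 := hf.contDiffOn_jscale.continuousOn
  have h2 : ContinuousOn (fun t : ℝ => f x (jscale t (extend r (trunc r j)))) Set.univ :=
    h1.comp (f := fun t : ℝ => ((x, trunc r j), t)) (by fun_prop)
      (fun t _ => ⟨⟨hx, Set.mem_univ _⟩, Set.mem_univ _⟩)
  rw [← continuousOn_univ]
  refine h2.congr fun t _ => ?_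
  exact (isJetFun_iff.mp hf).2 x hx _ _ (trunc_jscale (trunc_extend r (trunc r j)).symm t)

/-- The substitution `s = u t` turns `u^(k+1)` times the radial integral at the jet scaled by `u`
into the integral of `s^k f` over `[0, u]`. Differentiation at `u = 1` shows that `jint k` inverts
the Euler field plus `k + 1`. -/
theorem IsJetFun.jint_euler (hU : IsOpen U) (hf : IsJetFun U r f) (k : ℕ) {x : E m} (hx : x ∈ U)
    (j : Jet m) : BFTheory.jdir (eulProj j) (BFTheory.jint k f) x j + (k + 1) * BFTheory.jint k f x j =
      f x j := by
  have hc := hf.continuous_jscale hx j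
  have hc2 : Continuous fun t => t ^ k * f x (jscale t j) := (continuous_id.pow k).mul hc
  have h1 : ∀ u : ℝ, u ^ (k + 1) * BFTheory.jint k f x (jscale u j) =
      ∫ s in (0 : ℝ)..u, s ^ k * f x (jscale s j) := by
    intro u
    have := intervalIntegral.mul_integral_comp_mul_left (a := 0) (b := 1) (c := u)
      (f := fun s => s ^ k * f x (jscale s j))
    simp only [mul_zero, mul_one] at this
    rw [← this, BFTheory.jint, pow_succ', mul_assoc, ← intervalIntegral.integral_const_mul]
    congr 2
    funext t
    rw [jscale_jscale, mul_pow, mul_comm t u]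
    ring
  have h2 : HasDerivAt (fun u : ℝ => ∫ s in (0 : ℝ)..u, s ^ k * f x (jscale s j))
      (1 ^ k * f x (jscale 1 j)) 1 :=
    intervalIntegral.integral_hasDerivAt_right (hc2.intervalIntegrable _ _)
      (hc2.stronglyMeasurableAtFilter _ _) hc2.continuousAt
  have h3 := (hf.jint hU k).hasDerivAt hU hx j (eulProj j)
  have h4 : HasDerivAt (fun u : ℝ => BFTheory.jint k f x (jscale u j))
      (BFTheory.jdir (eulProj j) (BFTheory.jint k f) x j) 1 := by
    have h5 : HasDerivAt (fun s : ℝ => BFTheory.jint k f x (j + s • eulProj j))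
      (BFTheory.jdir (eulProj j) (BFTheory.jint k f) x j) ((1 : ℝ) - 1) := by rwa [sub_self]
    exact h5.comp_sub_const 1 1
  have h6 := (hasDerivAt_pow (k + 1) (1 : ℝ)).mul h4
  have h7 : (fun u : ℝ => u ^ (k + 1)) * (fun u : ℝ => BFTheory.jint k f x (jscale u j)) =
      fun u : ℝ => ∫ s in (0 : ℝ)..u, s ^ k * f x (jscale s j) := by
    funext u
    exact h1 u
  rw [h7] at h6
  have h8 := h6.unique h2
  simp only [jscale_one, one_pow, one_mul, mul_one] at h8
  push_cast at h8
  linarith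

/-- Radial integration preserves cycles. -/
theorem jint_closed {S : Finset (List (Anti m))} {c : List (Anti m) → E m → Jet m → ℝ}
    (hc : ∀ w ∈ S, IsJetFun U r (c w)) (e : List (Anti m) → ℕ) (s : ℕ)
    (he : ∀ w ∈ S, e w + s = w.length)
    (h : ∀ x ∈ U, ∀ j, ∑ w ∈ S, c w x j • ktf j (aword w) = 0) :
    ∀ x ∈ U, ∀ j, ∑ w ∈ S, jint (e w) (c w) x j • ktf j (aword w) = 0 := by
  intro x hx j
  -- The algebra carries no topology; linear functionals reduce the claim to real integrals.
  refine (Module.forall_dual_apply_eq_zero_iff ℝ _).mp fun φ => ?_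
  have hcont : ∀ w ∈ S, Continuous fun t : ℝ =>
      t ^ e w * c w x (jscale t j) * φ (ktf j (aword w)) := fun w hw => by
    have := (hc w hw).continuous_jscale hx j
    exact ((continuous_id.pow _).mul this).mul continuous_const
  rw [map_sum]
  simp only [map_smul, smul_eq_mul, jint, ← intervalIntegral.integral_mul_const]
  rw [← intervalIntegral.integral_finsetSum]
  -- The cycle condition at the scaled jet, transported by the scaling of antifields, is a condition
  -- at `j` with coefficients multiplied by `t ^ w.length`. The common factor `t ^ s` can be
  -- cancelled except at `t = 0`, which does not affect the integral.
  · have hz : ∀ t : ℝ, t ≠ 0 →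
        ∑ w ∈ S, t ^ e w * c w x (jscale t j) * φ (ktf j (aword w)) = 0 := by
      intro t ht
      have h1 := congrArg (scaleHom m t) (h x hx (jscale t j))
      rw [map_sum, map_zero] at h1
      simp only [map_smul, ← ktf_scaleHom, scaleHom_word] at h1
      have h2 := congrArg φ h1
      simp only [map_sum, map_smul, map_zero, smul_eq_mul] at h2
      have h3 : t ^ s * ∑ w ∈ S, t ^ e w * c w x (jscale t j) * φ (ktf j (aword w)) = 0 := by
        rw [Finset.mul_sum, ← h2]
        refine Finset.sum_congr rfl fun w hw => ?_
        rw [← he w hw, pow_add]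
        ring
      exact (mul_eq_zero.mp h3).resolve_left (pow_ne_zero _ ht)
    have hae : ∀ᵐ t : ℝ, t ∈ Set.uIoc (0 : ℝ) 1 →
        ∑ w ∈ S, t ^ e w * c w x (jscale t j) * φ (ktf j (aword w)) = 0 :=
      Filter.Eventually.of_forall fun t ht => by
        rw [Set.uIoc_of_le zero_le_one] at ht
        exact hz t ht.1.ne'
    exact (intervalIntegral.integral_congr_ae hae).trans (by simp)
  · intro w hw
    exact (hcont w hw).intervalIntegrable _ _

end Radial

end BFTheory

namespace BFTheory

variable {m : ℕ}

/-! ### Local exactness -/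

/-- `δ` is affine in the jet because the field equations are linear. So it can be differentiated
along jet directions although it is an operator on an infinite-dimensional algebra. -/
theorem ktf_add_smul (j e : Jet m) (s : ℝ) (u : AntiAlg m) :
    ktf (j + s • e) u = ktf j u + s • ktLin e u := by
  have : ktf (j + s • e) = ktf j + s • ktLin e := by
    refine (kt_isOddRight _ _).ext ((kt_isOddRight _ _).add ((ktLin_isOddRight e).smul s))
      fun g => ?_
    rw [LinearMap.add_apply, LinearMap.smul_apply]
    change ktf _ (agen g) = ktf j (agen g) + s • ktLin e (agen g)
    cases g with
    | s L =>
      rw [ktf_s, ktf_s, ktLin_s, eulA_add, eulA_smul, map_add, map_mul, Algebra.smul_def]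
    | c l =>
      obtain ⟨q, lt, t, L⟩ := l
      by_cases h : q < m
      · rw [ktLin_c_lt e lt h, ktf_c, ktf_c]
        simp [dDelta, h]
      · have hq : q = m := by omega
        subst hq
        rw [ktf_c, ktf_c, ktLin_c, dDelta_top, dDelta_top, eulB_add, eulB_smul, map_add, map_mul,
          Algebra.smul_def]
  rw [this]
  rfl

/-- The Koszul homotopy of `c • u`, with the algebraic part restricted to antifield numbers in
`p`. -/
noncomputable def homOp (p : Set ℕ) (r : ℕ) (c : E m → Jet m → ℝ) (u : AntiAlg m) (x : E m)
    (j : Jet m) : AntiAlg m :=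
  (∑ S ∈ miLe m (r + 1), jdir (dirA S) c x j • (u * koszA S) +
    ∑ S ∈ miLe m r, jdir (dirB S) c x j • (u * agen (.s S))) + c x j • koszDer p u

section Local

variable {U : Set (E m)} {r : ℕ}

theorem isPolyIn_homOp (hU : IsOpen U) {p : Set ℕ} {T T' a : ℕ} (hT : 1 ≤ T) (hT' : T ≤ T')
    (hp : ∀ b ∈ p, b ≤ T → b + 1 ≤ T') {c : E m → Jet m → ℝ} (hc : IsJetFun U r c)
    {u : AntiAlg m} (hu : u ∈ antiSpan m T a r) :
    IsPolyIn (fun _ => agen) (AntiWord T' (a + 1) r) U r (homOp p r c u) := by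
  have hu' : u ∈ antiSpan m T' a r := antiSpan_mono hT' le_rfl hu
  refine ((isPolyIn_sum fun S hS => ?_).add (isPolyIn_sum fun S hS => ?_)).add ?_
  · exact isPolyIn_of_mem_antiSpan (antiSpan_mul hu'
      (antiSpan_mono (hT.trans hT') le_rfl (koszA_mem (mem_miLe.mp hS)))) (hc.jdir hU _)
  · exact isPolyIn_of_mem_antiSpan (antiSpan_mul hu'
      (agen_mem_antiSpan (show (Anti.s S).ant ≤ T' from hT.trans hT') (mem_miLe.mp hS) rfl)) (hc.jdir hU _)
  · exact isPolyIn_of_mem_antiSpan (koszDer_mem hT' hp hu) hc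

theorem antiInv_koszA (S : MI m) : antiInv m (koszA S) = -koszA S := by
  have h := parityInv_span (hp := Anti.Alt.ant_eq) (p := 1) (y := koszA S)
    (genSpan_mono (fun g h => by
      have := h.1
      change g.ant = 1
      omega)
      (Submodule.neg_mem _ (kosz_mem m (Nat.lt_succ_self m) id S)))
  rw [antiInv, h, pow_one]
  module

theorem antiInv_s (S : MI m) : antiInv m (agen (.s S)) = -agen (.s S) := by
  rw [antiInv, agen, parityInv_gen, show (Anti.s S).ant = 1 from rfl, pow_one]
  module

theorem mul_algebraMap_eq (u : AntiAlg m) (a : ℝ) : u * algebraMap ℝ _ a = a • u := by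
  rw [← Algebra.commutes, Algebra.smul_def]

/-- This is the anticommutator formula for an arbitrary `c • u`. Beside `δ` of the homotopy, the
left side contains the homotopy of `δ (c u)`, with the coefficient part expanded by the product
rule. The right side is the Euler operator minus the contribution of the part of the homotopy that
was left out. -/
theorem ktf_homOp (hU : IsOpen U) (p : Set ℕ) {c : E m → Jet m → ℝ} (hc : IsJetFun U r c)
    (u : AntiAlg m) {x : E m} (hx : x ∈ U) (j : Jet m) :
    ktf j (homOp pᶜ r c u x j) + koszDer pᶜ (c x j • ktf j u) +
      ∑ S ∈ miLe m (r + 1), (jdir (dirA S) c x j • ktf j u + c x j • ktLin (dirA S) u) * koszA S +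
      ∑ S ∈ miLe m r, (jdir (dirB S) c x j • ktf j u + c x j • ktLin (dirB S) u) * agen (.s S) =
    jdir (eulProj j) c x j • u + c x j • homLap r j u -
      c x j • (ktf j (koszDer p u) + koszDer p (ktf j u)) := by
  have hK : ∀ v : AntiAlg m, koszDer Set.univ v = koszDer pᶜ v + koszDer p v := fun v => by
    rw [koszDer_add p]; rfl
  have hR : jdir (eulProj j) c x j =
      ∑ S ∈ miLe m (r + 1), (if S = 0 then 0 else jetA j S) * jdir (dirA S) c x j +
      ∑ S ∈ miLe m r, eulA j S * jdir (dirB S) c x j := by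
    have := hc.jdir_sum hU hx j (eulProj j) ((miLe m (r + 1)).disjSum (miLe m r))
      (Sum.elim (fun S => if S = 0 then 0 else jetA j S) (fun S => eulA j S))
      (Sum.elim dirA dirB) (by
        rw [Finset.sum_disjSum]
        exact trunc_eulProj_eq r j)
    rw [this, Finset.sum_disjSum]
    rfl
  rw [homOp, homLap_apply, hR, hK, hK, map_add, map_add, map_sum, map_sum]
  simp only [map_smul, (kt_isOddRight _ j).map_mul, antiInv_koszA, antiInv_s, ktf_koszA, ktf_s,
    mul_algebraMap_eq, gc_mul_neg, add_mul, smul_mul_assoc, Finset.sum_add_distrib, smul_add,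
    Finset.smul_sum, add_smul, Finset.sum_smul, smul_neg, Finset.sum_neg_distrib, map_add]
  have h1 : ∀ S : MI m, jdir (dirA S) c x j • (if S = 0 then (0 : ℝ) else jetA j S) • u =
      ((if S = 0 then 0 else jetA j S) * jdir (dirA S) c x j) • u := fun S => by
    rw [smul_smul, mul_comm]
  have h2 : ∀ S : MI m, jdir (dirB S) c x j • eulA j S • u =
      (eulA j S * jdir (dirB S) c x j) • u := fun S => by rw [smul_smul, mul_comm]
  simp only [h1, h2]
  abel

/-- The homotopy formula for cycles. -/
theorem homotopy_cycle (hU : IsOpen U) (p : Set ℕ) {ι : Type*} {s : Finset ι}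
    {c : ι → E m → Jet m → ℝ} (hc : ∀ i ∈ s, IsJetFun U r (c i)) (u : ι → AntiAlg m)
    (h : ∀ x ∈ U, ∀ j, ∑ i ∈ s, c i x j • ktf j (u i) = 0) {x : E m} (hx : x ∈ U) (j : Jet m) :
    ktf j (∑ i ∈ s, homOp pᶜ r (c i) (u i) x j) =
      ∑ i ∈ s, (jdir (eulProj j) (c i) x j • u i + c i x j • homLap r j (u i) -
        c i x j • (ktf j (koszDer p (u i)) + koszDer p (ktf j (u i)))) := by
  -- The cycle condition is differentiated along `e`. Both the coefficients and `δ` vary with the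
  -- jet, which produces the sums that occur in `ktf_homOp`.
  have hd : ∀ e : Jet m, ∑ i ∈ s, (jdir e (c i) x j • ktf j (u i) + c i x j • ktLin e (u i)) = 0 := by
    intro e
    refine (Module.forall_dual_apply_eq_zero_iff ℝ _).mp fun φ => ?_
    have h1 : HasDerivAt (fun s' : ℝ => ∑ i ∈ s,
        c i x (j + s' • e) * (φ (ktf j (u i)) + s' * φ (ktLin e (u i))))
        (∑ i ∈ s, (jdir e (c i) x j * (φ (ktf j (u i)) + 0 * φ (ktLin e (u i))) +
          c i x (j + (0 : ℝ) • e) * φ (ktLin e (u i)))) 0 := by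
      refine HasDerivAt.fun_sum fun i hi => ?_
      refine ((hc i hi).hasDerivAt hU hx j e).mul ?_
      have := ((hasDerivAt_id (0 : ℝ)).mul_const (φ (ktLin e (u i)))).const_add (φ (ktf j (u i)))
      simpa using this
    have h2 : (fun s' : ℝ => ∑ i ∈ s,
        c i x (j + s' • e) * (φ (ktf j (u i)) + s' * φ (ktLin e (u i)))) = fun _ => 0 := by
      funext s'
      have := congrArg φ (h x hx (j + s' • e))
      simp only [map_sum, map_smul, ktf_add_smul, map_add, map_zero, smul_eq_mul] at this
      exact this
    rw [h2] at h1
    have h3 := h1.unique (hasDerivAt_const 0 (0 : ℝ))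
    simp only [zero_smul, zero_mul, add_zero] at h3
    simpa only [map_sum, map_add, map_smul, smul_eq_mul] using h3
  rw [← Finset.sum_congr rfl fun i hi => ktf_homOp hU p (hc i hi) (u i) hx j]
  simp only [Finset.sum_add_distrib]
  have e1 : ∑ i ∈ s, koszDer pᶜ (c i x j • ktf j (u i)) = 0 := by
    rw [← map_sum, h x hx, map_zero]
  have e2 : ∀ (I : Finset (MI m)) (d : MI m → Jet m) (v : MI m → AntiAlg m),
      ∑ i ∈ s, ∑ S ∈ I, (jdir (d S) (c i) x j • ktf j (u i) +
        c i x j • ktLin (d S) (u i)) * v S = 0 := by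
    intro I d v
    rw [Finset.sum_comm]
    refine Finset.sum_eq_zero fun S _ => ?_
    rw [← Finset.sum_mul, hd, zero_mul]
  rw [e1, e2 _ dirA koszA, e2 _ dirB fun S => agen (.s S), map_sum]
  simp

theorem koszDer_empty (u : AntiAlg m) : koszDer ∅ u = 0 := by
  have : koszDer (m := m) ∅ = (0 : ℝ) • koszDer ∅ := by
    refine (koszDer_isOddRight _).ext ((koszDer_isOddRight _).smul 0) fun g => ?_
    have := koszDer_agen (m := m) ∅ g
    rw [agen, koszVal_not_mem (by simp)] at this
    rw [LinearMap.smul_apply, this, smul_zero]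
  rw [this]
  simp

theorem AntiWord.length_pos {T a r : ℕ} {w : List (Anti m)} (h : AntiWord T a r w) (ha : 1 ≤ a) :
    1 ≤ w.length := by
  cases w with
  | nil => have := h.2; simp at this; omega
  | cons g w => simp

theorem AntiWord.two_le_length {T a r : ℕ} {w : List (Anti m)} (h : AntiWord T a r w)
    (ha : T < a) (ha1 : 1 ≤ a) : 2 ≤ w.length := by
  match w, h with
  | [], h => have := h.2; simp at this; omega
  | [g], h =>
    have h1 := h.2
    have h2 := (h.1 g (by simp)).1
    simp at h1
    omega
  | _ :: _ :: w, _ => simp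

theorem cycle_rep {S : Finset (List (Anti m))} {c : List (Anti m) → E m → Jet m → ℝ}
    {F : E m → Jet m → AntiAlg m} (h2 : ∀ x ∈ U, ∀ j, F x j = ∑ w ∈ S, c w x j • (w.map agen).prod)
    (hF : ∀ x ∈ U, ∀ j, ktf j (F x j) = 0) :
    ∀ x ∈ U, ∀ j, ∑ w ∈ S, c w x j • ktf j (aword w) = 0 := by
  intro x hx j
  have := hF x hx j
  rw [h2 x hx, map_sum] at this
  simp only [map_smul] at this
  exact this

/-- The local Poincaré lemma for the full Koszul-Tate differential. -/
theorem local_exact (hU : IsOpen U) {T a : ℕ} (hT : 1 ≤ T) (ha : 1 ≤ a)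
    {F : E m → Jet m → AntiAlg m} (h : IsPolyIn (fun _ => agen) (AntiWord T a r) U r F)
    (hF : ∀ x ∈ U, ∀ j, ktf j (F x j) = 0) :
    ∃ Ψ, IsPolyIn (fun _ => agen) (AntiWord (T + 1) (a + 1) r) U r Ψ ∧
      ∀ x ∈ U, ∀ j, ktf j (Ψ x j) = F x j := by
  obtain ⟨S, c, h1, h2⟩ := h
  have hc : ∀ w ∈ S, IsJetFun U r (c w) := fun w hw => (h1 w hw).2
  have h3 := cycle_rep h2 hF
  -- The weight `w.length - 1` makes the Euler field plus `w.length` send `c' w` to `c w`, so that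
  -- the Euler operator reproduces the given cycle.
  let c' : List (Anti m) → E m → Jet m → ℝ := fun w => jint (w.length - 1) (c w)
  have hlen : ∀ w ∈ S, w.length - 1 + 1 = w.length := fun w hw => by
    have := (h1 w hw).1.length_pos ha
    omega
  have h4 : ∀ x ∈ U, ∀ j, ∑ w ∈ S, c' w x j • ktf j (aword w) = 0 :=
    jint_closed hc (fun w => w.length - 1) 1 hlen h3
  have hc' : ∀ w ∈ S, IsJetFun U r (c' w) := fun w hw => (hc w hw).jint hU _
  -- Nothing is left out of the homotopy, at the price that antifields of number `T + 1` may appear.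
  refine ⟨fun x j => ∑ w ∈ S, homOp ∅ᶜ r (c' w) (aword w) x j, isPolyIn_sum fun w hw =>
    isPolyIn_homOp hU hT (Nat.le_succ T) (fun b _ hb => by omega) (hc' w hw)
      (aword_mem (h1 w hw).1), fun x hx j => ?_⟩
  rw [homotopy_cycle hU ∅ hc' aword h4 hx j, h2 x hx]
  refine Finset.sum_congr rfl fun w hw => ?_
  have h5 := (hc w hw).jint_euler hU (w.length - 1) hx j
  have h6 : ((w.length - 1 : ℕ) : ℝ) + 1 = w.length := by exact_mod_cast hlen w hw
  rw [h6] at h5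
  rw [homLap_word j fun g hg => ((h1 w hw).1.1 g hg).2, koszDer_empty, koszDer_empty, map_zero,
    add_zero, smul_zero, sub_zero, smul_smul, ← add_smul, mul_comm (c' w x j), h5]
  rfl

theorem isPolyIn_dDelta {T : ℕ} (hT : 1 ≤ T) {u : AntiAlg m}
    (hu : u ∈ genSpan m fun g => g.ant = T + 1 ∧ g.order ≤ r) :
    IsPolyIn dDelta (fun w => (∃ l : Lab m (m + 1), w = [l] ∧ l.q + T = m) ∧ ∀ l ∈ w, l.ord.card ≤ r)
      U r fun _ j => ktf j u := by
  induction hu using Submodule.span_induction with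
  | zero => simpa using isPolyIn_zero
  | add a b _ _ ha hb =>
    simp only [map_add]
    exact ha.add hb
  | smul k a _ ha =>
    simp only [map_smul]
    exact ha.smul (isJetFun_const k)
  | mem x hx =>
    obtain ⟨g, ⟨h1, h2⟩, rfl⟩ := hx
    cases g with
    | s L =>
      have : (Anti.s L).ant = 1 := rfl
      omega
    | c l =>
      have h3 : (Anti.c l).ant = m + 1 - l.q := rfl
      have h4 := l.lt
      have h5 : (Anti.c l).order = l.ord.card := rfl
      refine (isPolyIn_single (w := [l]) ⟨⟨l, rfl, by omega⟩, ?_⟩ (isJetFun_const 1)).congr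
        fun x _ j => ?_
      · simp [ktf_c]
      · simpa [h5] using h2

theorem isPolyIn_homProj_agen {T : ℕ} (hT : 1 ≤ T) {g : Anti m} (hg : g.ant = T)
    (hr : g.order ≤ r) :
    IsPolyIn dDelta (fun w => (∃ l : Lab m (m + 1), w = [l] ∧ l.q + T = m) ∧ ∀ l ∈ w, l.ord.card ≤ r)
      U r fun _ j => homProj T j (agen g) := by
  have := isPolyIn_dDelta (U := U) (r := r) hT (u := koszVal Set.univ g)
    (genSpan_mono (fun g' h => ⟨by omega, by have := h.2; omega⟩) (koszVal_mem Set.univ g))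
  refine this.congr fun x _ j => ?_
  rw [homProj_agen j hg.le, if_pos hg]

/-- A word of antifield number `T` either consists of letters of smaller number and is killed, or is
a single letter of number `T`, because all antifield numbers are positive. -/
theorem isPolyIn_homProj_word {T : ℕ} (hT : 1 ≤ T) {w : List (Anti m)} (hw : AntiWord T T r w) :
    IsPolyIn dDelta (fun w => (∃ l : Lab m (m + 1), w = [l] ∧ l.q + T = m) ∧ ∀ l ∈ w, l.ord.card ≤ r)
      U r fun _ j => homProj T j (aword w) := by
  by_cases h : ∀ g ∈ w, g.ant < T
  · simp only [homProj_word_eq_zero _ h]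
    exact isPolyIn_zero
  · push Not at h
    obtain ⟨g, hg, hT'⟩ := h
    have hgT : g.ant = T := le_antisymm (hw.1 g hg).1 hT'
    obtain ⟨l1, l2, rfl⟩ := List.append_of_mem hg
    have hs := hw.2
    simp only [List.map_append, List.map_cons, List.sum_append, List.sum_cons] at hs
    have e1 : l1 = [] := sum_ant_eq_zero (by omega)
    have e2 : l2 = [] := sum_ant_eq_zero (by omega)
    subst e1 e2
    have := isPolyIn_homProj_agen (U := U) hT hgT (hw.1 g hg).2
    refine this.congr fun x _ j => ?_
    simp [aword]

/-- Local completeness of Noether identities. -/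
theorem local_complete (hU : IsOpen U) {T : ℕ} (hT : 1 ≤ T)
    {F : E m → Jet m → AntiAlg m} (h : IsPolyIn (fun _ => agen) (AntiWord T T r) U r F)
    (hF : ∀ x ∈ U, ∀ j, ktf j (F x j) = 0) :
    ∃ Ψ, IsPolyIn (fun _ => agen) (AntiWord T (T + 1) r) U r Ψ ∧
      IsPolyIn dDelta
        (fun w => (∃ l : Lab m (m + 1), w = [l] ∧ l.q + T = m) ∧ ∀ l ∈ w, l.ord.card ≤ r)
        U r (fun x j => F x j - ktf j (Ψ x j)) := by
  obtain ⟨S, c, h1, h2⟩ := h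
  have hc : ∀ w ∈ S, IsJetFun U r (c w) := fun w hw => (h1 w hw).2
  have h3 := cycle_rep h2 hF
  let c' : List (Anti m) → E m → Jet m → ℝ := fun w => jint (w.length - 1) (c w)
  have hlen : ∀ w ∈ S, w.length - 1 + 1 = w.length := fun w hw => by
    have := (h1 w hw).1.length_pos hT
    omega
  have h4 : ∀ x ∈ U, ∀ j, ∑ w ∈ S, c' w x j • ktf j (aword w) = 0 :=
    jint_closed hc (fun w => w.length - 1) 1 hlen h3
  have hc' : ∀ w ∈ S, IsJetFun U r (c' w) := fun w hw => (hc w hw).jint hU _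
  -- Without the homotopy on letters of number `T` the result stays among antifields of number at
  -- most `T`. The error term is the sum of the projected words with the coefficients `c'`.
  refine ⟨fun x j => ∑ w ∈ S, homOp {T}ᶜ r (c' w) (aword w) x j, isPolyIn_sum fun w hw =>
    isPolyIn_homOp hU hT le_rfl (fun b hb hb' => by
      simp only [Set.mem_compl_iff, Set.mem_singleton_iff] at hb
      omega) (hc' w hw) (aword_mem (h1 w hw).1), ?_⟩
  refine (isPolyIn_sum (s := S) (F := fun w x j => c' w x j • homProj T j (aword w))
    fun w hw => (isPolyIn_homProj_word hT (h1 w hw).1).smul (hc' w hw)).congr fun x hx j => ?_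
  rw [homotopy_cycle hU {T} hc' aword h4 hx j, h2 x hx, ← Finset.sum_sub_distrib]
  refine Finset.sum_congr rfl fun w hw => ?_
  have h5 := (hc w hw).jint_euler hU (w.length - 1) hx j
  have h6 : ((w.length - 1 : ℕ) : ℝ) + 1 = w.length := by exact_mod_cast hlen w hw
  rw [h6] at h5
  rw [homLap_word j fun g hg => ((h1 w hw).1.1 g hg).2, smul_smul, ← add_smul,
    mul_comm (c' w x j), h5]
  change c w x j • aword w - (c w x j • aword w - c' w x j • homProj T j (aword w)) = _
  abel

/-- For `T ≥ 2` the derivation `P` is idempotent on such words. For `T = 1` the word is `g g'` with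
`P` idempotent on letters, and the difference is `2 P(g) P(g')`, a product of two combinations of
`d_Λ Δ`. -/
theorem isPolyIn_homProj_sub {T : ℕ} (hT : 1 ≤ T) {w : List (Anti m)}
    (hw : AntiWord T (T + 1) r w) :
    IsPolyIn dDelta (fun w : List (Lab m (m + 1)) => (((∀ l ∈ w, m + 1 ≤ l.q + (T + 1)) ∧
        (w.map fun l => m - l.q).sum = T + 1) ∧ w.length ≤ 2) ∧ ∀ l ∈ w, l.ord.card ≤ r)
      U r fun _ j => homProj T j (homProj T j (aword w)) - homProj T j (aword w) := by
  by_cases h2 : 2 ≤ T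
  · refine isPolyIn_zero.congr fun x _ j => ?_
    rw [homProj_homProj_word h2 j (fun g hg => (hw.1 g hg).1) hw.2.le, sub_self]
  · have hT1 : T = 1 := by omega
    subst hT1
    obtain ⟨hw1, hw2⟩ := hw
    match w, hw1, hw2 with
    | [], _, h => simp at h
    | [g], h, h' =>
      have := (h g (by simp)).1
      simp at h'
      omega
    | [g, g'], h, h' =>
      have a1 : g.ant = 1 := le_antisymm (h g (by simp)).1 (one_le_ant g)
      have a2 : g'.ant = 1 := le_antisymm (h g' (by simp)).1 (one_le_ant g')
      have p1 := isPolyIn_homProj_agen (U := U) le_rfl a1 (h g (by simp)).2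
      have p2 := isPolyIn_homProj_agen (U := U) le_rfl a2 (h g' (by simp)).2
      have := (p1.mul p2 (P'' := fun w : List (Lab m (m + 1)) =>
        (((∀ l ∈ w, m + 1 ≤ l.q + (1 + 1)) ∧ (w.map fun l => m - l.q).sum = 1 + 1) ∧
          w.length ≤ 2) ∧ ∀ l ∈ w, l.ord.card ≤ r) (by
        rintro _ _ ⟨⟨l, rfl, hl⟩, h3⟩ ⟨⟨l', rfl, hl'⟩, h3'⟩
        refine ⟨⟨⟨?_, ?_⟩, le_rfl⟩, ?_⟩
        · intro k hk
          simp at hk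
          rcases hk with rfl | rfl <;> omega
        · simp
          omega
        · intro k hk
          simp at hk
          rcases hk with rfl | rfl
          · exact h3 _ (by simp)
          · exact h3' _ (by simp))).smul (isJetFun_const 2)
      refine this.congr fun x _ j => ?_
      have i1 := homProj_homProj_agen le_rfl j a1.le
      have i2 := homProj_homProj_agen le_rfl j a2.le
      rw [agen] at i1 i2
      simp only [aword, word_cons, word_nil, mul_one, homProj_isEvenDer 1 j _ _, map_add, i1, i2,
        agen, two_smul]
      abel
    | g :: g' :: g'' :: w, _, h =>
      have := one_le_ant g
      have := one_le_ant g'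
      have := one_le_ant g''
      simp at h
      omega

/-- Cycles of antifield number `T + 1` in antifields of antifield number at most `T`. -/
theorem local_factor (hU : IsOpen U) {T : ℕ} (hT : 1 ≤ T)
    {F : E m → Jet m → AntiAlg m} (h : IsPolyIn (fun _ => agen) (AntiWord T (T + 1) r) U r F)
    (hF : ∀ x ∈ U, ∀ j, ktf j (F x j) = 0) :
    ∃ Ψ, IsPolyIn (fun _ => agen) (AntiWord T (T + 2) r) U r Ψ ∧
      IsPolyIn dDelta (fun w : List (Lab m (m + 1)) => (((∀ l ∈ w, m + 1 ≤ l.q + (T + 1)) ∧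
        (w.map fun l => m - l.q).sum = T + 1) ∧ w.length ≤ 2) ∧ ∀ l ∈ w, l.ord.card ≤ r)
        U r (fun x j => F x j - ktf j (Ψ x j)) := by
  obtain ⟨S, c, h1, h2⟩ := h
  have hc : ∀ w ∈ S, IsJetFun U r (c w) := fun w hw => (h1 w hw).2
  have h3 := cycle_rep h2 hF
  let c' : List (Anti m) → E m → Jet m → ℝ := fun w => jint (w.length - 1) (c w)
  -- The second radial integral inverts the Euler field plus `w.length - 1` rather than `w.length`.
  -- The shift accounts for the term that the incomplete homotopy subtracts when `P` acts as the
  -- identity on a projected word.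
  let c'' : List (Anti m) → E m → Jet m → ℝ := fun w => jint (w.length - 2) (c' w)
  have hlen2 : ∀ w ∈ S, w.length - 2 + 2 = w.length := fun w hw => by
    have := (h1 w hw).1.two_le_length (Nat.lt_succ_self T) (by omega)
    omega
  have hlen : ∀ w ∈ S, w.length - 1 + 1 = w.length := fun w hw => by
    have := hlen2 w hw
    omega
  have h4 : ∀ x ∈ U, ∀ j, ∑ w ∈ S, c' w x j • ktf j (aword w) = 0 :=
    jint_closed hc (fun w => w.length - 1) 1 hlen h3
  have hc' : ∀ w ∈ S, IsJetFun U r (c' w) := fun w hw => (hc w hw).jint hU _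
  have h4' : ∀ x ∈ U, ∀ j, ∑ w ∈ S, c'' w x j • ktf j (aword w) = 0 :=
    jint_closed hc' (fun w => w.length - 2) 2 hlen2 h4
  have hc'' : ∀ w ∈ S, IsJetFun U r (c'' w) := fun w hw => (hc' w hw).jint hU _
  have hind : ∀ w ∈ S, ∀ j, homProj T 0 (aword w) = homProj T j (aword w) := fun w hw j =>
    homProj_indep 0 j fun g hg => ((h1 w hw).1.1 g hg).1
  -- `P` commutes with `δ`, so the projected words with coefficients `c''` again form a cycle, to
  -- which the homotopy can be applied a second time.
  have h4P : ∀ x ∈ U, ∀ j, ∑ w ∈ S, c'' w x j • ktf j (homProj T 0 (aword w)) = 0 := by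
    intro x hx j
    have := congrArg (homProj T j) (h4' x hx j)
    rw [map_sum, map_zero] at this
    rw [← this]
    refine Finset.sum_congr rfl fun w hw => ?_
    rw [map_smul, hind w hw j, ktf_homProj]
  have hp : ∀ b ∈ ({T} : Set ℕ)ᶜ, b ≤ T → b + 1 ≤ T := fun b hb hb' => by
    simp only [Set.mem_compl_iff, Set.mem_singleton_iff] at hb
    omega
  refine ⟨fun x j => ∑ w ∈ S, homOp {T}ᶜ r (c' w) (aword w) x j +
    ∑ w ∈ S, homOp {T}ᶜ r (c'' w) (homProj T 0 (aword w)) x j, (isPolyIn_sum fun w hw =>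
    isPolyIn_homOp hU hT le_rfl hp (hc' w hw) (aword_mem (h1 w hw).1)).add
    (isPolyIn_sum fun w hw => isPolyIn_homOp hU hT le_rfl hp (hc'' w hw)
      (homProj_mem 0 (h1 w hw).1)), ?_⟩
  -- The first application leaves `∑ c' P(w)`. The second removes it and leaves `∑ c'' (P² - P)(w)`.
  refine (isPolyIn_sum (s := S) (F := fun w x j => c'' w x j •
    (homProj T j (homProj T j (aword w)) - homProj T j (aword w)))
    fun w hw => (isPolyIn_homProj_sub hT (h1 w hw).1).smul (hc'' w hw)).congr fun x hx j => ?_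
  rw [map_add, homotopy_cycle hU {T} hc' aword h4 hx j, homotopy_cycle hU {T} hc'' _ h4P hx j,
    h2 x hx, ← Finset.sum_add_distrib, ← Finset.sum_sub_distrib]
  refine Finset.sum_congr rfl fun w hw => ?_
  have h5 := (hc w hw).jint_euler hU (w.length - 1) hx j
  have h5' := (hc' w hw).jint_euler hU (w.length - 2) hx j
  have h6 : ((w.length - 1 : ℕ) : ℝ) + 1 = w.length := by exact_mod_cast hlen w hw
  have h6' : ((w.length - 2 : ℕ) : ℝ) + 1 = w.length - 1 := by
    have : ((w.length - 2 : ℕ) : ℝ) + 2 = w.length := by exact_mod_cast hlen2 w hw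
    linarith
  rw [h6] at h5
  rw [h6'] at h5'
  have e1 : jdir (eulProj j) (c' w) x j = c w x j - w.length * c' w x j := by
    rw [← h5]; simp only [c']; ring
  have e2 : jdir (eulProj j) (c'' w) x j = c' w x j - (w.length - 1) * c'' w x j := by
    rw [← h5']; simp only [c'']; ring
  rw [homLap_word j fun g hg => ((h1 w hw).1.1 g hg).2, homLap_homProj_word j 0 (h1 w hw).1.1,
    hind w hw j, e1, e2]
  change c w x j • aword w - ((c w x j - w.length * c' w x j) • aword w +
    c' w x j • (w.length : ℝ) • aword w - c' w x j • homProj T j (aword w) +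
    ((c' w x j - (w.length - 1) * c'' w x j) • homProj T j (aword w) +
      c'' w x j • (w.length : ℝ) • homProj T j (aword w) -
      c'' w x j • homProj T j (homProj T j (aword w)))) = _
  module

end Local

end BFTheory

/-! ### Jets of functions: partial derivatives, Taylor polynomials, prolongations -/

namespace BFTheory

variable {m : ℕ}

section Pd

variable {U : Set (E m)} {f g : E m → ℝ} {x : E m}

/-- Iterated partial derivatives. -/
noncomputable def pd (L : List (Fin (m + 1))) (f : E m → ℝ) : E m → ℝ := L.foldr pderiv f

theorem contDiffOn_pderiv (hU : IsOpen U) (hf : ContDiffOn ℝ ∞ f U) (μ : Fin (m + 1)) :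
    ContDiffOn ℝ ∞ (pderiv μ f) U :=
  (hf.fderiv_of_isOpen hU (m := ∞) (by simp)).clm_apply contDiffOn_const

theorem contDiffOn_pd (hU : IsOpen U) (hf : ContDiffOn ℝ ∞ f U) (L : List (Fin (m + 1))) :
    ContDiffOn ℝ ∞ (pd L f) U := by
  induction L with
  | nil => exact hf
  | cons l L ih => exact contDiffOn_pderiv hU ih l

theorem pderiv_congr (hU : IsOpen U) (h : ∀ y ∈ U, f y = g y) (hx : x ∈ U) (μ : Fin (m + 1)) :
    pderiv μ f x = pderiv μ g x := by
  unfold pderiv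
  rw [Filter.EventuallyEq.fderiv_eq (Filter.eventuallyEq_of_mem (hU.mem_nhds hx) h)]

theorem ContDiffOn.differentiableAt_of_isOpen (hf : ContDiffOn ℝ ∞ f U) (hU : IsOpen U)
    (hx : x ∈ U) : DifferentiableAt ℝ f x :=
  (hf.contDiffAt (hU.mem_nhds hx)).differentiableAt (by simp)

theorem pderiv_comm (hU : IsOpen U) (hf : ContDiffOn ℝ ∞ f U) (hx : x ∈ U)
    (μ ν : Fin (m + 1)) : pderiv μ (pderiv ν f) x = pderiv ν (pderiv μ f) x := by
  have h1 : DifferentiableAt ℝ (fderiv ℝ f) x :=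
    ((hf.fderiv_of_isOpen hU (m := ∞) (by simp)).contDiffAt
      (hU.mem_nhds hx)).differentiableAt (by simp)
  have h2 : IsSymmSndFDerivAt ℝ f x :=
    (hf.contDiffAt (hU.mem_nhds hx)).isSymmSndFDerivAt (by
      rw [minSmoothness_of_isRCLikeNormedField]
      exact ENat.LEInfty.out)
  have h3 : ∀ a b : Fin (m + 1), pderiv a (pderiv b f) x =
      fderiv ℝ (fderiv ℝ f) x (EuclideanSpace.single a 1) (EuclideanSpace.single b 1) := by
    intro a b
    unfold pderiv
    rw [fderiv_clm_apply h1 (differentiableAt_const _)]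
    simp
  rw [h3, h3]
  exact h2.eq _ _

theorem pd_perm (hU : IsOpen U) (hf : ContDiffOn ℝ ∞ f U) (hx : x ∈ U)
    {L L' : List (Fin (m + 1))} (h : L.Perm L') : pd L f x = pd L' f x := by
  induction h generalizing x with
  | nil => rfl
  | cons l _ ih => exact pderiv_congr hU (fun y hy => ih hy) hx l
  | swap a b L => exact pderiv_comm hU (contDiffOn_pd hU hf L) hx b a
  | trans _ _ h1 h2 => rw [h1 hx, h2 hx]

theorem pd_sort_cons (hU : IsOpen U) (hf : ContDiffOn ℝ ∞ f U) (hx : x ∈ U)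
    (μ : Fin (m + 1)) (S : MI m) :
    pd (μ ::ₘ S).sort f x = pderiv μ (pd S.sort f) x := by
  refine pd_perm (L' := μ :: S.sort) hU hf hx ?_
  rw [← Multiset.coe_eq_coe, ← Multiset.cons_coe, Multiset.sort_eq, Multiset.sort_eq]

theorem pderiv_mul (hf : DifferentiableAt ℝ f x) (hg : DifferentiableAt ℝ g x)
    (μ : Fin (m + 1)) :
    pderiv μ (fun y => f y * g y) x = pderiv μ f x * g x + f x * pderiv μ g x := by
  unfold pderiv
  rw [fderiv_fun_mul hf hg]
  simp
  ring

theorem pderiv_const (c : ℝ) (μ : Fin (m + 1)) : pderiv μ (fun _ => c) x = 0 := by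
  unfold pderiv
  simp

theorem pderiv_sum {ι : Type*} {s : Finset ι} {f : ι → E m → ℝ}
    (hf : ∀ i ∈ s, DifferentiableAt ℝ (f i) x) (μ : Fin (m + 1)) :
    pderiv μ (fun y => ∑ i ∈ s, f i y) x = ∑ i ∈ s, pderiv μ (f i) x := by
  unfold pderiv
  rw [fderiv_fun_sum hf]
  simp

theorem pderiv_const_mul (hf : DifferentiableAt ℝ f x) (c : ℝ) (μ : Fin (m + 1)) :
    pderiv μ (fun y => c * f y) x = c * pderiv μ f x := by
  rw [pderiv_mul (differentiableAt_const c) hf, pderiv_const]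
  ring

theorem pd_sum_mul (hU : IsOpen U) {ι : Type*} {s : Finset ι} {f : ι → E m → ℝ}
    (hf : ∀ i ∈ s, ContDiffOn ℝ ∞ (f i) U) (c : ι → ℝ) (hx : x ∈ U) (L : List (Fin (m + 1))) :
    pd L (fun y => ∑ i ∈ s, c i * f i y) x = ∑ i ∈ s, c i * pd L (f i) x := by
  induction L generalizing x with
  | nil => rfl
  | cons l L ih =>
    have hd : ∀ i ∈ s, DifferentiableAt ℝ (pd L (f i)) x := fun i hi =>
      ContDiffOn.differentiableAt_of_isOpen (contDiffOn_pd hU (hf i hi) L) hU hx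
    refine (pderiv_congr hU (fun y hy => ih hy) hx l).trans ?_
    rw [pderiv_sum fun i hi => (hd i hi).const_mul (c i)]
    exact Finset.sum_congr rfl fun i hi => pderiv_const_mul (hd i hi) _ _

theorem eq_sum_single (v : E m) : v = ∑ κ, v κ • EuclideanSpace.single κ (1 : ℝ) := by
  ext i
  simp [Finset.sum_apply, Pi.single_apply]

theorem pderiv_comp {τ : E m → E m} (hτ : DifferentiableAt ℝ τ x)
    (hg : DifferentiableAt ℝ g (τ x)) (μ : Fin (m + 1)) :
    pderiv μ (fun y => g (τ y)) x =
      ∑ κ, pderiv μ (fun y => τ y κ) x * pderiv κ g (τ x) := by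
  have h1 : ∀ κ, pderiv μ (fun y => τ y κ) x = fderiv ℝ τ x (EuclideanSpace.single μ 1) κ := by
    intro κ
    have := ((EuclideanSpace.proj (𝕜 := ℝ) κ).hasFDerivAt.comp x hτ.hasFDerivAt).fderiv
    unfold pderiv
    have h2 : (fun y => τ y κ) = (EuclideanSpace.proj (𝕜 := ℝ) κ : E m → ℝ) ∘ τ := rfl
    rw [h2, this]
    rfl
  have h3 : (fun y => g (τ y)) = g ∘ τ := rfl
  rw [h3]
  simp only [h1]
  unfold pderiv
  rw [fderiv_comp x hg hτ, ContinuousLinearMap.comp_apply]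
  conv_lhs => rw [eq_sum_single (fderiv ℝ τ x (EuclideanSpace.single μ 1)), map_sum]
  simp

end Pd

section Realization

/-- The monomials `∏ (y^μ - x^μ)^k / k!`. -/
noncomputable def taylorMonomial (x : E m) (S : MI m) (y : E m) : ℝ :=
  ∏ μ, (y μ - x μ) ^ S.count μ / ((S.count μ).factorial : ℝ)

theorem contDiff_taylorMonomial (x : E m) (S : MI m) : ContDiff ℝ ∞ (taylorMonomial x S) := by
  unfold taylorMonomial
  fun_prop

theorem taylorMonomial_self (x : E m) (S : MI m) :
    taylorMonomial x S x = if S = 0 then 1 else 0 := by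
  unfold taylorMonomial
  split_ifs with h
  · simp [h]
  · obtain ⟨μ, hμ⟩ := Multiset.exists_mem_of_ne_zero h
    refine Finset.prod_eq_zero (Finset.mem_univ μ) ?_
    have := Multiset.count_pos.mpr hμ
    simp [zero_pow this.ne']

theorem pderiv_taylorMonomial (x : E m) (S : MI m) (ν : Fin (m + 1)) (y : E m) :
    pderiv ν (taylorMonomial x S) y = if ν ∈ S then taylorMonomial x (S.erase ν) y else 0 := by
  have hd : DifferentiableAt ℝ (taylorMonomial x S) y :=
    (contDiff_taylorMonomial x S).differentiable (by simp) y
  unfold pderiv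
  rw [← hd.lineDeriv_eq_fderiv, lineDeriv]
  set C : ℝ := ∏ μ ∈ Finset.univ.erase ν, (y μ - x μ) ^ S.count μ / ((S.count μ).factorial : ℝ)
  have h1 : (fun t : ℝ => taylorMonomial x S (y + t • EuclideanSpace.single ν 1)) =
      fun t => (t + (y ν - x ν)) ^ S.count ν / ((S.count ν).factorial : ℝ) * C := by
    funext t
    unfold taylorMonomial
    rw [← Finset.mul_prod_erase _ _ (Finset.mem_univ ν)]
    congr 1
    · simp
      ring
    · refine Finset.prod_congr rfl fun μ hμ => ?_
      simp [(Finset.mem_erase.mp hμ).1]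
  rw [h1]
  have h2 : HasDerivAt (fun t : ℝ => (t + (y ν - x ν)) ^ S.count ν /
      ((S.count ν).factorial : ℝ) * C) (S.count ν * (0 + (y ν - x ν)) ^ (S.count ν - 1) * 1 /
        ((S.count ν).factorial : ℝ) * C) 0 :=
    ((((hasDerivAt_id (0 : ℝ)).add_const (y ν - x ν)).pow _).div_const _).mul_const _
  rw [h2.deriv]
  split_ifs with h
  · unfold taylorMonomial
    rw [← Finset.mul_prod_erase _ _ (Finset.mem_univ ν)]
    obtain ⟨k, hk⟩ : ∃ k, S.count ν = k + 1 :=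
      ⟨S.count ν - 1, by have := Multiset.count_pos.mpr h; omega⟩
    congr 1
    · rw [Multiset.count_erase_self, hk, Nat.factorial_succ]
      push_cast
      simp only [zero_add, mul_one]
      field_simp
    · refine Finset.prod_congr rfl fun μ hμ => ?_
      rw [Multiset.count_erase_of_ne (Finset.mem_erase.mp hμ).1]
  · simp [Multiset.count_eq_zero.mpr h]

theorem pd_taylorMonomial (x : E m) (S : MI m) (L : List (Fin (m + 1))) (y : E m) :
    pd L (taylorMonomial x S) y =
      if (L : MI m) ≤ S then taylorMonomial x (S - (L : MI m)) y else 0 := by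
  induction L generalizing y with
  | nil => simp [pd]
  | cons l L ih =>
    have h1 : pd (l :: L) (taylorMonomial x S) y =
        pderiv l (fun y => if (L : MI m) ≤ S then taylorMonomial x (S - (L : MI m)) y else 0) y :=
      congrArg (fun F => pderiv l F y) (funext ih)
    rw [h1]
    have h2 : ((l :: L : List _) : MI m) = {l} + (L : MI m) := by
      rw [← Multiset.cons_coe, Multiset.singleton_add]
    by_cases hL : (L : MI m) ≤ S
    · simp only [hL, if_true]
      have h3 : ((l :: L : List _) : MI m) ≤ S ↔ l ∈ S - (L : MI m) := by
        rw [h2, ← le_tsub_iff_right hL, Multiset.singleton_le]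
      change pderiv l (taylorMonomial x (S - (L : MI m))) y = _
      rw [pderiv_taylorMonomial]
      simp only [h3]
      rw [h2]
      rw [add_comm {l} (L : MI m), tsub_add_eq_tsub_tsub, Multiset.sub_singleton]
    · simp only [hL, if_false]
      rw [pderiv_const, if_neg]
      intro h
      exact hL ((Multiset.le_cons_self _ _).trans (by rwa [← Multiset.cons_coe] at h))

/-- The polynomial with given partial derivatives of order at most `r` at `x`. -/
noncomputable def taylorPoly (x : E m) (r : ℕ) (v : MI m → ℝ) (y : E m) : ℝ :=
  ∑ S ∈ miLe m r, v S * taylorMonomial x S y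

theorem contDiff_taylorPoly (x : E m) (r : ℕ) (v : MI m → ℝ) :
    ContDiff ℝ ∞ (taylorPoly x r v) := by
  unfold taylorPoly
  exact ContDiff.sum fun S _ => contDiff_const.mul (contDiff_taylorMonomial x S)

/-- Every formal jet of finite order is the jet of a smooth function at the given point. Identities
between formal prolongations may therefore be checked on actual functions. -/
theorem pd_taylorPoly (x : E m) {r : ℕ} (v : MI m → ℝ) {S : MI m} (hS : S.card ≤ r) :
    pd S.sort (taylorPoly x r v) x = v S := by
  have h := pd_sum_mul (s := miLe m r) (f := fun S => taylorMonomial x S) isOpen_univ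
    (fun S _ => (contDiff_taylorMonomial x S).contDiffOn) v (Set.mem_univ x) S.sort
  refine h.trans ?_
  rw [Finset.sum_eq_single S]
  · rw [pd_taylorMonomial, Multiset.sort_eq, if_pos le_rfl, taylorMonomial_self,
      if_pos (tsub_self S), mul_one]
  · intro R _ hR
    rw [pd_taylorMonomial, Multiset.sort_eq]
    split_ifs with h1
    · rw [taylorMonomial_self, if_neg, mul_zero]
      intro h2
      exact hR (le_antisymm (tsub_eq_zero_iff_le.mp h2) h1)
    · simp
  · intro h1
    exact absurd (mem_miLe.mpr hS) h1

end Realization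

section LinJetLemmas

variable {β : Type} {M : Type*} [AddCommGroup M] [Module ℝ M]

theorem LinJet.eval_single (p : β × MI m) (f : E m → ℝ) (x : E m) (v : β → MI m → M) :
    LinJet.eval (Finsupp.single p f) x v = f x • v p.1 p.2 := by
  unfold LinJet.eval
  rw [Finsupp.sum_single_index]
  simp

theorem LinJet.eval_add (F G : LinJet β m) (x : E m) (v : β → MI m → M) :
    LinJet.eval (F + G) x v = LinJet.eval F x v + LinJet.eval G x v := by
  classical
  unfold LinJet.eval
  exact Finsupp.sum_add_index' (by simp) (by simp [add_smul])

theorem LinJet.eval_sum {ι : Type*} (s : Finset ι) (F : ι → LinJet β m) (x : E m)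
    (v : β → MI m → M) : LinJet.eval (∑ i ∈ s, F i) x v = ∑ i ∈ s, LinJet.eval (F i) x v := by
  classical
  induction s using Finset.induction_on with
  | empty => simp [LinJet.eval]
  | insert a s ha ih => rw [Finset.sum_insert ha, Finset.sum_insert ha, LinJet.eval_add, ih]

theorem LinJet.eval_smul (K : E m → ℝ) (F : LinJet β m) (x : E m) (v : β → MI m → M) :
    LinJet.eval (K • F) x v = K x • LinJet.eval F x v := by
  unfold LinJet.eval
  rw [Finsupp.sum_of_support_subset _ Finsupp.support_smul _ (by simp), Finsupp.smul_sum]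
  simp [Finsupp.sum, smul_smul]

theorem LinJet.eval_total (F : LinJet β m) (μ : Fin (m + 1)) (x : E m) (v : β → MI m → M) :
    LinJet.eval (LinJet.total μ F) x v =
      F.sum fun p f => pderiv μ f x • v p.1 p.2 + f x • v p.1 (μ ::ₘ p.2) := by
  unfold LinJet.total Finsupp.sum
  rw [LinJet.eval_sum]
  simp only [LinJet.eval_add, LinJet.eval_single]

theorem LinJet.map_eval {M' : Type*} [AddCommGroup M'] [Module ℝ M'] (ℓ : M →ₗ[ℝ] M')
    (F : LinJet β m) (x : E m) (v : β → MI m → M) :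
    ℓ (LinJet.eval F x v) = LinJet.eval F x fun b S => ℓ (v b S) := by
  unfold LinJet.eval Finsupp.sum
  simp

/-- Linear expressions of jet order at most `k` with coefficients smooth on `U`. -/
def LinJet.Good (U : Set (E m)) (k : ℕ) (F : LinJet β m) : Prop :=
  ∀ p, ContDiffOn ℝ ∞ (F p) U ∧ (k < p.2.card → F p = 0)

variable {U : Set (E m)} {k : ℕ}

theorem LinJet.good_zero : LinJet.Good U k (0 : LinJet β m) := fun _ =>
  ⟨contDiffOn_const (c := (0 : ℝ)), fun _ => rfl⟩

theorem LinJet.good_single {b : β} {S : MI m} {f : E m → ℝ} (hf : ContDiffOn ℝ ∞ f U)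
    (hS : S.card ≤ k) : LinJet.Good U k (Finsupp.single (b, S) f) := by
  classical
  intro p
  rw [Finsupp.single_apply]
  split_ifs with h
  · exact ⟨hf, fun h' => by subst h; simp at h'; omega⟩
  · exact ⟨contDiffOn_const (c := (0 : ℝ)), fun _ => rfl⟩

theorem LinJet.Good.add {F G : LinJet β m} (hF : LinJet.Good U k F) (hG : LinJet.Good U k G) :
    LinJet.Good U k (F + G) := fun p =>
  ⟨(hF p).1.add (hG p).1, fun h => by rw [Finsupp.add_apply, (hF p).2 h, (hG p).2 h, add_zero]⟩

theorem LinJet.good_sum {ι : Type*} {s : Finset ι} {F : ι → LinJet β m}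
    (h : ∀ i ∈ s, LinJet.Good U k (F i)) : LinJet.Good U k (∑ i ∈ s, F i) := by
  classical
  induction s using Finset.induction_on with
  | empty => exact LinJet.good_zero
  | insert a s ha ih =>
    rw [Finset.sum_insert ha]
    exact (h a (by simp)).add (ih fun i hi => h i (by simp [hi]))

theorem LinJet.Good.smul {F : LinJet β m} (hF : LinJet.Good U k F) {K : E m → ℝ}
    (hK : ContDiffOn ℝ ∞ K U) : LinJet.Good U k (K • F) := fun p =>
  ⟨hK.mul (hF p).1, fun h => by rw [Finsupp.smul_apply, (hF p).2 h, smul_zero]⟩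

theorem LinJet.Good.card_le {F : LinJet β m} (hF : LinJet.Good U k F) {p : β × MI m}
    (hp : p ∈ F.support) : p.2.card ≤ k := by
  by_contra h
  exact (Finsupp.mem_support_iff.mp hp) ((hF p).2 (not_le.mp h))

theorem LinJet.Good.total {F : LinJet β m} (hU : IsOpen U) (hF : LinJet.Good U k F)
    (μ : Fin (m + 1)) : LinJet.Good U (k + 1) (LinJet.total μ F) :=
  LinJet.good_sum fun p hp =>
    (LinJet.good_single (contDiffOn_pderiv hU (hF p).1 μ) ((hF.card_le hp).trans (by omega))).add
      (LinJet.good_single (hF p).1 (by simpa using hF.card_le hp))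

theorem LinJet.Good.eval_congr {F : LinJet β m} (hF : LinJet.Good U k F) (x : E m)
    {v v' : β → MI m → M} (h : ∀ b S, S.card ≤ k → v b S = v' b S) :
    LinJet.eval F x v = LinJet.eval F x v' :=
  Finset.sum_congr rfl fun p hp => congrArg (F p x • ·) (h _ _ (hF.card_le hp))

theorem good_prolong [Fintype β] (hU : IsOpen U) {K : Fin (m + 1) → Fin (m + 1) → E m → ℝ}
    (hK : ∀ μ l, ContDiffOn ℝ ∞ (K μ l) U) {T : β → β → E m → ℝ}
    (hT : ∀ a b, ContDiffOn ℝ ∞ (T a b) U) (L : List (Fin (m + 1))) (a : β) :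
    LinJet.Good U L.length (prolong K T L a) := by
  induction L with
  | nil => exact LinJet.good_sum fun b _ => LinJet.good_single (hT a b) (by simp)
  | cons l L ih => exact LinJet.good_sum fun μ _ => (ih.total hU μ).smul (hK μ l)

/-- The jets of a tuple of functions. -/
noncomputable def jets (f : β → E m → ℝ) (x : E m) (b : β) (S : MI m) : ℝ := pd S.sort (f b) x

/-- On jets of functions the formal total derivative is the partial derivative of the evaluated
expression. -/
theorem eval_total_jets {F : LinJet β m} (hU : IsOpen U) (hF : LinJet.Good U k F)
    {f : β → E m → ℝ} (hf : ∀ b, ContDiffOn ℝ ∞ (f b) U) {x : E m} (hx : x ∈ U)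
    (μ : Fin (m + 1)) :
    LinJet.eval (LinJet.total μ F) x (jets f x) =
      pderiv μ (fun y => LinJet.eval F y (jets f y)) x := by
  rw [LinJet.eval_total]
  have hd : ∀ p, DifferentiableAt ℝ (F p) x := fun p =>
    ContDiffOn.differentiableAt_of_isOpen (hF p).1 hU hx
  have hd' : ∀ p : β × MI m, DifferentiableAt ℝ (fun y => jets f y p.1 p.2) x := fun p =>
    ContDiffOn.differentiableAt_of_isOpen (contDiffOn_pd hU (hf p.1) _) hU hx
  simp only [LinJet.eval, Finsupp.sum, smul_eq_mul]
  rw [pderiv_sum (f := fun p y => F p y * jets f y p.1 p.2) fun p _ => (hd p).mul (hd' p)]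
  refine Finset.sum_congr rfl fun p _ => ?_
  rw [pderiv_mul (hd p) (hd' p)]
  congr 2
  exact pd_sort_cons hU (hf p.1) hx μ p.2

/-- The formal prolongation computes the derivatives of the transformed functions. The induction
adds one derivative at a time, and `hKτ` is the chain rule in the new coordinates. -/
theorem prolong_jets [Fintype β] {V : Set (E m)} (hU : IsOpen U) (hV : IsOpen V) {τ : E m → E m}
    {K : Fin (m + 1) → Fin (m + 1) → E m → ℝ} (hK : ∀ μ l, ContDiffOn ℝ ∞ (K μ l) U)
    (hKτ : ∀ g : E m → ℝ, ContDiffOn ℝ ∞ g V → ∀ x ∈ U, ∀ l,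
      pderiv l g (τ x) = ∑ μ, K μ l x * pderiv μ (fun y => g (τ y)) x)
    {T : β → β → E m → ℝ} (hT : ∀ a b, ContDiffOn ℝ ∞ (T a b) U)
    {f g : β → E m → ℝ} (hf : ∀ b, ContDiffOn ℝ ∞ (f b) U) (hg : ∀ b, ContDiffOn ℝ ∞ (g b) V)
    (h : ∀ a, ∀ x ∈ U, g a (τ x) = ∑ b, T a b x * f b x) (L : List (Fin (m + 1))) (a : β)
    {x : E m} (hx : x ∈ U) :
    LinJet.eval (prolong K T L a) x (jets f x) = pd L (g a) (τ x) := by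
  induction L generalizing x with
  | nil =>
    simp only [prolong, LinJet.eval_sum, LinJet.eval_single, jets, smul_eq_mul]
    simp only [Multiset.sort_zero, pd, List.foldr_nil]
    exact (h a x hx).symm
  | cons l L ih =>
    simp only [prolong, LinJet.eval_sum, LinJet.eval_smul, smul_eq_mul]
    have h1 : pd (l :: L) (g a) (τ x) = pderiv l (pd L (g a)) (τ x) := rfl
    rw [h1, hKτ _ (contDiffOn_pd hV (hg a) L) x hx l]
    refine Finset.sum_congr rfl fun μ _ => ?_
    rw [eval_total_jets hU (good_prolong hU hK hT L a) hf hx μ]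
    congr 1
    exact pderiv_congr hU (fun y hy => ih hy) hx μ

end LinJetLemmas

end BFTheory

/-! ### Transition maps and functoriality of jet prolongation -/

namespace BFTheory

variable {m : ℕ}

section Transition

variable {X : Type*} [TopologicalSpace X]

/-- The transition map from the coordinates of `φ` to those of `ψ`. -/
def trans (φ ψ : OpenPartialHomeomorph X (E m)) (x : E m) : E m := ψ (φ.symm x)

/-- The coordinate domain of an open set. -/
def reg (φ : OpenPartialHomeomorph X (E m)) (O : Set X) : Set (E m) :=
  φ.target ∩ φ.symm ⁻¹' O

variable {φ ψ χ : OpenPartialHomeomorph X (E m)} {O : Set X}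

theorem isOpen_reg (hO : IsOpen O) : IsOpen (reg φ O) := φ.isOpen_inter_preimage_symm hO

theorem mapsTo_trans (hψ : O ⊆ ψ.source) : Set.MapsTo (trans φ ψ) (reg φ O) (reg ψ O) := by
  intro x hx
  have h := hψ hx.2
  refine ⟨ψ.map_source h, ?_⟩
  change ψ.symm (ψ (φ.symm x)) ∈ O
  rw [ψ.left_inv h]
  exact hx.2

theorem symm_trans {x : E m} (hx : φ.symm x ∈ ψ.source) : ψ.symm (trans φ ψ x) = φ.symm x :=
  ψ.left_inv hx

theorem trans_trans {x : E m} (hx : φ.symm x ∈ ψ.source) :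
    trans ψ χ (trans φ ψ x) = trans φ χ x := by
  rw [trans, symm_trans hx, trans]

theorem trans_self {x : E m} (hx : x ∈ φ.target) : trans φ φ x = x := φ.right_inv hx

theorem jac_self (hOo : IsOpen O) {x : E m} (hx : x ∈ reg φ O) (μ ν : Fin (m + 1)) :
    jac φ φ μ ν x = if μ = ν then 1 else 0 := by
  have h2 : pderiv ν (fun y => (EuclideanSpace.proj (𝕜 := ℝ) μ : E m →L[ℝ] ℝ) y) x =
      jac φ φ μ ν x :=
    pderiv_congr (isOpen_reg hOo) (fun y hy => by
      have := trans_self hy.1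
      change y μ = trans φ φ y μ
      rw [this]) hx ν
  rw [← h2, pderiv, ContinuousLinearMap.fderiv]
  simp

variable {β : Type} [Fintype β]

/-- The transformed tuple of functions. -/
noncomputable def transf (φ ψ : OpenPartialHomeomorph X (E m)) (T : β → β → E m → ℝ)
    (f : β → E m → ℝ) (a : β) (y : E m) : ℝ :=
  ∑ b, T a b (trans ψ φ y) * f b (trans ψ φ y)

theorem transf_trans (T : β → β → E m → ℝ) (f : β → E m → ℝ) (a : β) {x : E m}
    (hx : x ∈ φ.target) (hx' : φ.symm x ∈ ψ.source) :
    transf φ ψ T f a (trans φ ψ x) = ∑ b, T a b x * f b x := by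
  rw [transf, trans_trans hx', trans_self hx]

variable [ChartedSpace (E m) X]

theorem contDiffOn_trans (hφ : φ ∈ charts m X) (hψ : ψ ∈ charts m X) (hO : O ⊆ ψ.source) :
    ContDiffOn ℝ ∞ (trans φ ψ) (reg φ O) := by
  rw [← contMDiffOn_iff_contDiffOn]
  exact (contMDiffOn_of_mem_maximalAtlas hψ).comp
    ((contMDiffOn_symm_of_mem_maximalAtlas hφ).mono Set.inter_subset_left) fun x hx => hO hx.2

theorem contDiffOn_trans_apply (hφ : φ ∈ charts m X) (hψ : ψ ∈ charts m X) (hO : O ⊆ ψ.source)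
    (κ : Fin (m + 1)) : ContDiffOn ℝ ∞ (fun x => trans φ ψ x κ) (reg φ O) :=
  (EuclideanSpace.proj (𝕜 := ℝ) κ : E m →L[ℝ] ℝ).contDiff.comp_contDiffOn
    (contDiffOn_trans hφ hψ hO)

theorem contDiffOn_comp_trans (hφ : φ ∈ charts m X) (hψ : ψ ∈ charts m X) (hO : O ⊆ ψ.source)
    {g : E m → ℝ} (hg : ContDiffOn ℝ ∞ g (reg ψ O)) :
    ContDiffOn ℝ ∞ (fun x => g (trans φ ψ x)) (reg φ O) :=
  hg.comp (contDiffOn_trans hφ hψ hO) (mapsTo_trans hO)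

theorem differentiableAt_trans (hφ : φ ∈ charts m X) (hψ : ψ ∈ charts m X) (hOo : IsOpen O)
    (hO : O ⊆ ψ.source) {x : E m} (hx : x ∈ reg φ O) : DifferentiableAt ℝ (trans φ ψ) x :=
  ((contDiffOn_trans hφ hψ hO).contDiffAt ((isOpen_reg hOo).mem_nhds hx)).differentiableAt (by simp)

theorem contDiffOn_jac (hφ : φ ∈ charts m X) (hψ : ψ ∈ charts m X) (hOo : IsOpen O)
    (hO : O ⊆ ψ.source) (μ ν : Fin (m + 1)) : ContDiffOn ℝ ∞ (jac φ ψ μ ν) (reg φ O) :=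
  contDiffOn_pderiv (isOpen_reg hOo) (contDiffOn_trans_apply hφ hψ hO μ) ν

theorem contDiffOn_invJac (hφ : φ ∈ charts m X) (hψ : ψ ∈ charts m X) (hOo : IsOpen O)
    (hO' : O ⊆ φ.source) (hO : O ⊆ ψ.source) (μ ν : Fin (m + 1)) :
    ContDiffOn ℝ ∞ (invJac φ ψ μ ν) (reg φ O) :=
  contDiffOn_comp_trans hφ hψ hO (contDiffOn_jac hψ hφ hOo hO' μ ν)

theorem pderiv_comp_trans (hφ : φ ∈ charts m X) (hψ : ψ ∈ charts m X) (hOo : IsOpen O)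
    (hO : O ⊆ ψ.source) {g : E m → ℝ} (hg : ContDiffOn ℝ ∞ g (reg ψ O)) {x : E m}
    (hx : x ∈ reg φ O) (μ : Fin (m + 1)) :
    pderiv μ (fun y => g (trans φ ψ y)) x = ∑ κ, jac φ ψ κ μ x * pderiv κ g (trans φ ψ x) :=
  pderiv_comp (differentiableAt_trans hφ hψ hOo hO hx)
    (ContDiffOn.differentiableAt_of_isOpen hg (isOpen_reg hOo) (mapsTo_trans hO hx)) μ

theorem jac_comp (hφ : φ ∈ charts m X) (hψ : ψ ∈ charts m X) (hχ : χ ∈ charts m X)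
    (hOo : IsOpen O) (hO : O ⊆ ψ.source) (hO' : O ⊆ χ.source) {x : E m} (hx : x ∈ reg φ O)
    (μ ν : Fin (m + 1)) :
    jac φ χ μ ν x = ∑ κ, jac ψ χ μ κ (trans φ ψ x) * jac φ ψ κ ν x := by
  have h := pderiv_comp_trans hφ hψ hOo hO (contDiffOn_trans_apply hψ hχ hO' μ) hx ν
  have h2 : pderiv ν (fun y => trans ψ χ (trans φ ψ y) μ) x = jac φ χ μ ν x :=
    pderiv_congr (isOpen_reg hOo) (fun y hy => by rw [trans_trans (hO hy.2)]; rfl) hx ν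
  rw [← h2, h]
  exact Finset.sum_congr rfl fun κ _ => mul_comm _ _

theorem invJac_mul_jac (hφ : φ ∈ charts m X) (hψ : ψ ∈ charts m X) (hOo : IsOpen O)
    (hO' : O ⊆ φ.source) (hO : O ⊆ ψ.source) {x : E m} (hx : x ∈ reg φ O) (μ ν : Fin (m + 1)) :
    ∑ κ, invJac φ ψ μ κ x * jac φ ψ κ ν x = if μ = ν then 1 else 0 := by
  rw [← jac_self hOo hx μ ν, jac_comp hφ hψ hφ hOo hO hO' hx]
  rfl

theorem jac_mul_invJac (hφ : φ ∈ charts m X) (hψ : ψ ∈ charts m X) (hOo : IsOpen O)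
    (hO' : O ⊆ φ.source) (hO : O ⊆ ψ.source) {x : E m} (hx : x ∈ reg φ O) (μ ν : Fin (m + 1)) :
    ∑ κ, jac φ ψ μ κ x * invJac φ ψ κ ν x = if μ = ν then 1 else 0 := by
  have h1 : (Matrix.of fun μ ν => invJac φ ψ μ ν x) * (Matrix.of fun μ ν => jac φ ψ μ ν x) = 1 := by
    ext a b
    rw [Matrix.mul_apply, Matrix.one_apply]
    exact invJac_mul_jac hφ hψ hOo hO' hO hx a b
  have h2 := congrArg (fun A => A μ ν) (mul_eq_one_comm.mp h1)
  simp only [Matrix.mul_apply, Matrix.one_apply] at h2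
  exact h2

theorem invDet_mul_jacDet (hφ : φ ∈ charts m X) (hψ : ψ ∈ charts m X) (hOo : IsOpen O)
    (hO' : O ⊆ φ.source) (hO : O ⊆ ψ.source) {x : E m} (hx : x ∈ reg φ O) :
    invDet φ ψ x * jacDet φ ψ x = 1 := by
  unfold invDet jacDet
  rw [← Matrix.det_mul]
  have h1 : (Matrix.of fun μ ν => invJac φ ψ μ ν x) * (Matrix.of fun μ ν => jac φ ψ μ ν x) = 1 := by
    ext a b
    rw [Matrix.mul_apply, Matrix.one_apply]
    exact invJac_mul_jac hφ hψ hOo hO' hO hx a b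
  rw [h1, Matrix.det_one]

theorem invJac_comp (hφ : φ ∈ charts m X) (hψ : ψ ∈ charts m X) (hχ : χ ∈ charts m X)
    (hOo : IsOpen O) (hO'' : O ⊆ φ.source) (hO : O ⊆ ψ.source) (hO' : O ⊆ χ.source) {x : E m}
    (hx : x ∈ reg φ O) (μ ν : Fin (m + 1)) :
    invJac φ χ μ ν x = ∑ κ, invJac φ ψ μ κ x * invJac ψ χ κ ν (trans φ ψ x) := by
  have h := jac_comp hχ hψ hφ hOo hO hO'' (mapsTo_trans hO' hx) μ ν
  rw [trans_trans (hO' hx.2)] at h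
  refine h.trans (Finset.sum_congr rfl fun κ _ => ?_)
  change _ = _ * jac χ ψ κ ν (trans ψ χ (trans φ ψ x))
  rw [trans_trans (hO hx.2)]
  rfl

theorem jacDet_comp (hφ : φ ∈ charts m X) (hψ : ψ ∈ charts m X) (hχ : χ ∈ charts m X)
    (hOo : IsOpen O) (hO : O ⊆ ψ.source) (hO' : O ⊆ χ.source) {x : E m} (hx : x ∈ reg φ O) :
    jacDet φ χ x = jacDet φ ψ x * jacDet ψ χ (trans φ ψ x) := by
  unfold jacDet
  rw [mul_comm, ← Matrix.det_mul]
  congr 1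
  ext a b
  rw [Matrix.mul_apply]
  exact jac_comp hφ hψ hχ hOo hO hO' hx a b

theorem invDet_comp (hφ : φ ∈ charts m X) (hψ : ψ ∈ charts m X) (hχ : χ ∈ charts m X)
    (hOo : IsOpen O) (hO'' : O ⊆ φ.source) (hO : O ⊆ ψ.source) (hO' : O ⊆ χ.source) {x : E m}
    (hx : x ∈ reg φ O) : invDet φ χ x = invDet φ ψ x * invDet ψ χ (trans φ ψ x) := by
  unfold invDet
  rw [← Matrix.det_mul]
  congr 1
  ext a b
  rw [Matrix.mul_apply]
  exact invJac_comp hφ hψ hχ hOo hO'' hO hO' hx a b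

theorem contDiffOn_det {U : Set (E m)} {n : Type*} [Fintype n] [DecidableEq n]
    {A : n → n → E m → ℝ} (hA : ∀ i k, ContDiffOn ℝ ∞ (A i k) U) :
    ContDiffOn ℝ ∞ (fun x => (Matrix.of fun i k => A i k x).det) U := by
  simp only [Matrix.det_apply, Matrix.of_apply]
  exact ContDiffOn.sum fun σ _ => (contDiffOn_prod fun i _ => hA _ _).const_smul _

theorem contDiffOn_jacDet (hφ : φ ∈ charts m X) (hψ : ψ ∈ charts m X) (hOo : IsOpen O)
    (hO : O ⊆ ψ.source) : ContDiffOn ℝ ∞ (jacDet φ ψ) (reg φ O) :=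
  contDiffOn_det fun μ ν => contDiffOn_jac hφ hψ hOo hO μ ν

theorem contDiffOn_invDet (hφ : φ ∈ charts m X) (hψ : ψ ∈ charts m X) (hOo : IsOpen O)
    (hO' : O ⊆ φ.source) (hO : O ⊆ ψ.source) : ContDiffOn ℝ ∞ (invDet φ ψ) (reg φ O) :=
  contDiffOn_det fun μ ν => contDiffOn_invJac hφ hψ hOo hO' hO μ ν

theorem contDiffOn_covLaw (hφ : φ ∈ charts m X) (hψ : ψ ∈ charts m X) (hOo : IsOpen O)
    (hO' : O ⊆ φ.source) (hO : O ⊆ ψ.source) {q : ℕ} (t u : Fin q → Fin (m + 1)) :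
    ContDiffOn ℝ ∞ (covLaw φ ψ q t u) (reg φ O) :=
  contDiffOn_prod fun _ _ => contDiffOn_invJac hφ hψ hOo hO' hO _ _

theorem contDiffOn_conDensLaw (hφ : φ ∈ charts m X) (hψ : ψ ∈ charts m X) (hOo : IsOpen O)
    (hO' : O ⊆ φ.source) (hO : O ⊆ ψ.source) {q : ℕ} (t u : Fin q → Fin (m + 1)) :
    ContDiffOn ℝ ∞ (conDensLaw φ ψ q t u) (reg φ O) :=
  (contDiffOn_invDet hφ hψ hOo hO' hO).mul
    (contDiffOn_prod fun _ _ => contDiffOn_jac hφ hψ hOo hO _ _)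

theorem sum_prod_mul_prod {q : ℕ} (a b : Fin (m + 1) → Fin q → ℝ) :
    ∑ t : Fin q → Fin (m + 1), (∏ i, a (t i) i) * ∏ i, b (t i) i =
      ∏ i, ∑ κ, a κ i * b κ i := by
  simp only [← Finset.prod_mul_distrib]
  rw [Finset.prod_univ_sum, Fintype.piFinset_univ]

theorem covLaw_comp (hφ : φ ∈ charts m X) (hψ : ψ ∈ charts m X) (hχ : χ ∈ charts m X)
    (hOo : IsOpen O) (hO'' : O ⊆ φ.source) (hO : O ⊆ ψ.source) (hO' : O ⊆ χ.source) {x : E m}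
    (hx : x ∈ reg φ O) {q : ℕ} (t u : Fin q → Fin (m + 1)) :
    covLaw φ χ q t u x = ∑ b, covLaw ψ χ q t b (trans φ ψ x) * covLaw φ ψ q b u x := by
  unfold covLaw
  rw [sum_prod_mul_prod (fun κ i => invJac ψ χ κ (t i) (trans φ ψ x))
    fun κ i => invJac φ ψ (u i) κ x]
  refine Finset.prod_congr rfl fun i _ => ?_
  rw [invJac_comp hφ hψ hχ hOo hO'' hO hO' hx]
  exact Finset.sum_congr rfl fun κ _ => mul_comm _ _

theorem conDensLaw_comp (hφ : φ ∈ charts m X) (hψ : ψ ∈ charts m X) (hχ : χ ∈ charts m X)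
    (hOo : IsOpen O) (hO'' : O ⊆ φ.source) (hO : O ⊆ ψ.source) (hO' : O ⊆ χ.source) {x : E m}
    (hx : x ∈ reg φ O) {q : ℕ} (t u : Fin q → Fin (m + 1)) :
    conDensLaw φ χ q t u x =
      ∑ b, conDensLaw ψ χ q t b (trans φ ψ x) * conDensLaw φ ψ q b u x := by
  unfold conDensLaw
  have h := sum_prod_mul_prod (fun κ i => jac ψ χ (t i) κ (trans φ ψ x))
    fun κ i => jac φ ψ κ (u i) x
  have h2 : ∏ i, jac φ χ (t i) (u i) x =
      ∏ i, ∑ κ, jac ψ χ (t i) κ (trans φ ψ x) * jac φ ψ κ (u i) x :=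
    Finset.prod_congr rfl fun i _ => jac_comp hφ hψ hχ hOo hO hO' hx _ _
  rw [h2, ← h, invDet_comp hφ hψ hχ hOo hO'' hO hO' hx, Finset.mul_sum]
  exact Finset.sum_congr rfl fun b _ => by ring

/-- The chain rule is solved for the derivatives in the new coordinates by means of the inverse
Jacobian. It supplies the hypothesis `hKτ` of `prolong_jets`. -/
theorem pderiv_trans_eq (hφ : φ ∈ charts m X) (hψ : ψ ∈ charts m X) (hOo : IsOpen O)
    (hO' : O ⊆ φ.source) (hO : O ⊆ ψ.source) {g : E m → ℝ} (hg : ContDiffOn ℝ ∞ g (reg ψ O))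
    {x : E m} (hx : x ∈ reg φ O) (l : Fin (m + 1)) :
    pderiv l g (trans φ ψ x) =
      ∑ μ, invJac φ ψ μ l x * pderiv μ (fun y => g (trans φ ψ y)) x := by
  simp only [pderiv_comp_trans hφ hψ hOo hO hg hx, Finset.mul_sum, ← mul_assoc]
  rw [Finset.sum_comm]
  simp only [← Finset.sum_mul]
  have h : ∀ κ, ∑ μ, invJac φ ψ μ l x * jac φ ψ κ μ x = if κ = l then 1 else 0 := fun κ => by
    rw [← jac_mul_invJac hφ hψ hOo hO' hO hx κ l]
    exact Finset.sum_congr rfl fun μ _ => mul_comm _ _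
  simp [h]

theorem contDiffOn_transf (hφ : φ ∈ charts m X) (hψ : ψ ∈ charts m X)
    (hO' : O ⊆ φ.source) {T : β → β → E m → ℝ} (hT : ∀ a b, ContDiffOn ℝ ∞ (T a b) (reg φ O))
    {f : β → E m → ℝ} (hf : ∀ b, ContDiffOn ℝ ∞ (f b) (reg φ O)) (a : β) :
    ContDiffOn ℝ ∞ (transf φ ψ T f a) (reg ψ O) :=
  ContDiffOn.sum fun b _ => (contDiffOn_comp_trans hψ hφ hO' (hT a b)).mul
    (contDiffOn_comp_trans hψ hφ hO' (hf b))

theorem prolong_jets_trans (hφ : φ ∈ charts m X) (hψ : ψ ∈ charts m X) (hOo : IsOpen O)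
    (hO' : O ⊆ φ.source) (hO : O ⊆ ψ.source) {T : β → β → E m → ℝ}
    (hT : ∀ a b, ContDiffOn ℝ ∞ (T a b) (reg φ O)) {f g : β → E m → ℝ}
    (hf : ∀ b, ContDiffOn ℝ ∞ (f b) (reg φ O)) (hg : ∀ b, ContDiffOn ℝ ∞ (g b) (reg ψ O))
    (h : ∀ a, ∀ x ∈ reg φ O, g a (trans φ ψ x) = ∑ b, T a b x * f b x)
    (L : List (Fin (m + 1))) (a : β) {x : E m} (hx : x ∈ reg φ O) :
    LinJet.eval (prolong (invJac φ ψ) T L a) x (jets f x) = pd L (g a) (trans φ ψ x) :=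
  prolong_jets (isOpen_reg hOo) (isOpen_reg hOo)
    (contDiffOn_invJac hφ hψ hOo hO' hO)
    (fun _ hg _ hx l => pderiv_trans_eq hφ hψ hOo hO' hO hg hx l) hT hf hg h L a hx

theorem good_prolong_trans (hφ : φ ∈ charts m X) (hψ : ψ ∈ charts m X) (hOo : IsOpen O)
    (hO' : O ⊆ φ.source) (hO : O ⊆ ψ.source) {T : β → β → E m → ℝ}
    (hT : ∀ a b, ContDiffOn ℝ ∞ (T a b) (reg φ O)) (L : List (Fin (m + 1))) (a : β) :
    LinJet.Good (reg φ O) L.length (prolong (invJac φ ψ) T L a) :=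
  good_prolong (isOpen_reg hOo) (contDiffOn_invJac hφ hψ hOo hO' hO) hT L a

/-- Functoriality of jet prolongation. -/
theorem prolong_comp (hφ : φ ∈ charts m X) (hψ : ψ ∈ charts m X) (hχ : χ ∈ charts m X)
    (hOo : IsOpen O) (hO'' : O ⊆ φ.source) (hO : O ⊆ ψ.source) (hO' : O ⊆ χ.source)
    {T T' T'' : β → β → E m → ℝ}
    (hT : ∀ a b, ContDiffOn ℝ ∞ (T a b) (reg φ O)) (hT' : ∀ a b, ContDiffOn ℝ ∞ (T' a b) (reg ψ O))
    (hT'' : ∀ a b, ContDiffOn ℝ ∞ (T'' a b) (reg φ O))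
    (hc : ∀ a c, ∀ x ∈ reg φ O, T'' a c x = ∑ b, T' a b (trans φ ψ x) * T b c x)
    {M : Type*} [AddCommGroup M] [Module ℝ M] (v : β → MI m → M) (L : List (Fin (m + 1))) (a : β)
    {x : E m} (hx : x ∈ reg φ O) :
    LinJet.eval (prolong (invJac φ χ) T'' L a) x v =
      LinJet.eval (prolong (invJac ψ χ) T' L a) (trans φ ψ x) fun b S =>
        LinJet.eval (prolong (invJac φ ψ) T S.sort b) x v := by
  rw [← sub_eq_zero]
  -- A linear functional makes the values scalar. They are then realized as jets at `x` of Taylor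
  -- polynomials, whose order is the number of derivatives taken.
  refine (Module.forall_dual_apply_eq_zero_iff ℝ _).mp fun ℓ => ?_
  rw [map_sub, sub_eq_zero, LinJet.map_eval, LinJet.map_eval]
  simp only [LinJet.map_eval]
  set f : β → E m → ℝ := fun b => taylorPoly x L.length fun S => ℓ (v b S) with hf_def
  have hf : ∀ b, ContDiffOn ℝ ∞ (f b) (reg φ O) := fun b => (contDiff_taylorPoly ..).contDiffOn
  have hfv : ∀ b S, S.card ≤ L.length → ℓ (v b S) = jets f x b S := fun b S hS =>
    (pd_taylorPoly x (fun S => ℓ (v b S)) hS).symm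
  have hg := contDiffOn_transf (ψ := ψ) hφ hψ hO'' hT hf
  have hgT : ∀ a, ∀ x ∈ reg φ O, transf φ ψ T f a (trans φ ψ x) = ∑ b, T a b x * f b x :=
    fun a x hx => transf_trans T f a hx.1 (hO hx.2)
  have hh := contDiffOn_transf (ψ := χ) hφ hχ hO'' hT'' hf
  have hhT : ∀ a, ∀ x ∈ reg φ O, transf φ χ T'' f a (trans φ χ x) = ∑ b, T'' a b x * f b x :=
    fun a x hx => transf_trans T'' f a hx.1 (hO' hx.2)
  -- The functions transformed in one step and in two steps coincide by the cocycle condition, so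
  -- both sides are derivatives of the same function.
  have hgh : ∀ a, ∀ y ∈ reg ψ O, transf φ χ T'' f a (trans ψ χ y) =
      ∑ b, T' a b y * transf φ ψ T f b y := by
    intro a y hy
    have hz := mapsTo_trans (ψ := φ) hO'' hy
    have hzy : trans φ ψ (trans ψ φ y) = y := by rw [trans_trans (hO'' hy.2), trans_self hy.1]
    have h1 := hhT a _ hz
    rw [trans_trans (hO'' hy.2)] at h1
    rw [h1]
    simp only [hc a _ _ hz, hzy, transf, Finset.sum_mul, Finset.mul_sum]
    rw [Finset.sum_comm]
    exact Finset.sum_congr rfl fun _ _ => Finset.sum_congr rfl fun _ _ => by ring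
  have hxψ := mapsTo_trans (ψ := ψ) hO hx
  rw [(good_prolong_trans hφ hχ hOo hO'' hO' hT'' L a).eval_congr x hfv,
    prolong_jets_trans hφ hχ hOo hO'' hO' hT'' hf hh hhT L a hx,
    (good_prolong_trans hψ hχ hOo hO hO' hT' L a).eval_congr (trans φ ψ x)
      (v' := jets (transf φ ψ T f) (trans φ ψ x)) ?_,
    prolong_jets_trans hψ hχ hOo hO hO' hT' hg hh hgh L a hxψ, trans_trans (hO hx.2)]
  intro b S hS
  refine ((good_prolong_trans hφ hψ hOo hO'' hO hT S.sort b).eval_congr x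
    fun b R hR => hfv b R (hR.trans (by rwa [Multiset.length_sort]))).trans ?_
  exact prolong_jets_trans hφ hψ hOo hO'' hO hT hf hg hgT S.sort b hx

end Transition

end BFTheory

/-! ### Tensoriality of divergence and exterior derivative -/

namespace BFTheory

variable {m : ℕ}

theorem sum_tuple_cons {M : Type*} [AddCommMonoid M] {q : ℕ} (F : (Fin (q + 1) → Fin (m + 1)) → M) :
    ∑ w, F w = ∑ κ, ∑ t : Fin q → Fin (m + 1), F (Fin.cons κ t) := by
  rw [← Equiv.sum_comp (Fin.consEquiv fun _ => Fin (m + 1)), Fintype.sum_prod_type]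
  rfl

theorem IsAlt.sum_smul_eq_zero {M : Type*} [AddCommGroup M] [Module ℝ M] {q : ℕ}
    {f : (Fin q → Fin (m + 1)) → M} (hf : IsAlt f) (H : (Fin q → Fin (m + 1)) → ℝ) {i k : Fin q}
    (hik : i ≠ k) (hH : ∀ w, H (w ∘ Equiv.swap i k) = H w) : ∑ w, H w • f w = 0 := by
  have h : ∑ w, H w • f w = -∑ w, H w • f w := by
    conv_lhs => rw [← Equiv.sum_comp (tupPerm m (Equiv.swap i k))]
    rw [← Finset.sum_neg_distrib]
    refine Finset.sum_congr rfl fun w _ => ?_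
    change H (w ∘ Equiv.swap i k) • f (w ∘ Equiv.swap i k) = _
    rw [hH, hf, Equiv.Perm.sign_swap hik]
    simp
  have h2 : (2 : ℝ) • ∑ w, H w • f w = 0 := by
    rw [two_smul]
    nth_rewrite 1 [h]
    simp
  exact (smul_eq_zero.mp h2).resolve_left (by norm_num)

theorem sum_sign_smul_eq_zero {M : Type*} [AddCommGroup M] [Module ℝ M] {q : ℕ}
    (H : Equiv.Perm (Fin q) → M) {i k : Fin q} (hik : i ≠ k)
    (hH : ∀ σ, H (σ * Equiv.swap i k) = H σ) :
    ∑ σ, ((Equiv.Perm.sign σ : ℤ) : ℝ) • H σ = 0 := by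
  have h : ∑ σ, ((Equiv.Perm.sign σ : ℤ) : ℝ) • H σ =
      -∑ σ, ((Equiv.Perm.sign σ : ℤ) : ℝ) • H σ := by
    conv_lhs => rw [← Equiv.sum_comp (Equiv.mulRight (Equiv.swap i k))]
    rw [← Finset.sum_neg_distrib]
    refine Finset.sum_congr rfl fun σ _ => ?_
    simp only [Equiv.coe_mulRight, hH, Equiv.Perm.sign_mul, Equiv.Perm.sign_swap hik]
    simp
  have h2 : (2 : ℝ) • ∑ σ, ((Equiv.Perm.sign σ : ℤ) : ℝ) • H σ = 0 := by
    rw [two_smul]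
    nth_rewrite 1 [h]
    simp
  exact (smul_eq_zero.mp h2).resolve_left (by norm_num)

theorem det_eq_sum_levi (A : Fin (m + 1) → Fin (m + 1) → ℝ) :
    (Matrix.of A).det = ∑ u : Fin (m + 1) → Fin (m + 1), (∏ i, A i (u i)) * levi u := by
  have h1 : Matrix.of A =
      fun i => ∑ k, A i k • (fun l => if k = l then (1 : ℝ) else 0) := by
    ext i l
    simp [Finset.sum_apply]
  have h2 := (Matrix.detRowAlternating (R := ℝ) (n := Fin (m + 1))).toMultilinearMap.map_sum
    (fun i k => A i k • (fun l => if k = l then (1 : ℝ) else 0))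
  rw [h1]
  refine h2.trans (Finset.sum_congr rfl fun u _ => ?_)
  rw [MultilinearMap.map_smul_univ]
  rfl

theorem det_comp_eq (A : Fin (m + 1) → Fin (m + 1) → ℝ) (t : Fin (m + 1) → Fin (m + 1)) :
    (Matrix.of fun i k => A (t i) k).det = levi t * (Matrix.of A).det := by
  have h : IsAlt fun t : Fin (m + 1) → Fin (m + 1) => (Matrix.of fun i k => A (t i) k).det := by
    intro σ t
    have := Matrix.det_permute σ (Matrix.of fun i k => A (t i) k)
    rw [smul_eq_mul]
    exact this
  have := h.eq_levi t
  simpa using this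

theorem sum_prod_levi (A : Fin (m + 1) → Fin (m + 1) → ℝ) (t : Fin (m + 1) → Fin (m + 1)) :
    ∑ u : Fin (m + 1) → Fin (m + 1), (∏ i, A (t i) (u i)) * levi u = (Matrix.of A).det * levi t := by
  rw [← det_eq_sum_levi fun i k => A (t i) k, det_comp_eq, mul_comm]

theorem differentiableAt_prod {ι : Type*} {s : Finset ι} {f : ι → E m → ℝ} {x : E m}
    (hf : ∀ i ∈ s, DifferentiableAt ℝ (f i) x) :
    DifferentiableAt ℝ (fun y => ∏ i ∈ s, f i y) x := by
  classical
  exact (HasFDerivAt.finsetProd fun i hi => (hf i hi).hasFDerivAt).differentiableAt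

theorem pderiv_prod {ι : Type*} [DecidableEq ι] {s : Finset ι} {f : ι → E m → ℝ} {x : E m}
    (hf : ∀ i ∈ s, DifferentiableAt ℝ (f i) x) (μ : Fin (m + 1)) :
    pderiv μ (fun y => ∏ i ∈ s, f i y) x =
      ∑ i ∈ s, (∏ k ∈ s.erase i, f k x) * pderiv μ (f i) x := by
  unfold pderiv
  rw [(HasFDerivAt.finsetProd fun i hi => (hf i hi).hasFDerivAt).fderiv]
  simp

/-- This is Jacobi's formula: the derivative is taken column by column, and Cramer's rule with
adjugate `det · B` evaluates the determinant with the differentiated column. -/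
theorem pderiv_det {n : Type*} [Fintype n] [DecidableEq n] {A : n → n → E m → ℝ} {B : n → n → ℝ}
    {x : E m} (hA : ∀ i k, DifferentiableAt ℝ (A i k) x)
    (hB : ∀ i k, ∑ l, B i l * A l k x = if i = k then 1 else 0) (μ : Fin (m + 1)) :
    pderiv μ (fun y => (Matrix.of fun i k => A i k y).det) x =
      (Matrix.of fun i k => A i k x).det * ∑ k, ∑ l, B k l * pderiv μ (A l k) x := by
  set N : Matrix n n ℝ := Matrix.of fun i k => A i k x
  have hBN : (Matrix.of B) * N = 1 := by
    ext i k
    rw [Matrix.mul_apply, Matrix.one_apply]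
    exact hB i k
  have hadj : N.adjugate = N.det • Matrix.of B := by
    calc N.adjugate = (Matrix.of B * N) * N.adjugate := by rw [hBN, one_mul]
      _ = N.det • Matrix.of B := by rw [mul_assoc, Matrix.mul_adjugate]; simp
  have h1 : ∀ k, ∑ l, N.det * (B k l * pderiv μ (A l k) x) =
      (N.updateCol k fun l => pderiv μ (A l k) x).det := by
    intro k
    rw [← Matrix.cramer_apply, Matrix.cramer_eq_adjugate_mulVec, hadj]
    simp [Matrix.mulVec, dotProduct, mul_assoc]
  have hdet : (fun y => (Matrix.of fun i k => A i k y).det) = fun y =>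
      ∑ σ : Equiv.Perm n, ((Equiv.Perm.sign σ : ℤ) : ℝ) * ∏ i, A (σ i) i y := by
    funext y
    simp [Matrix.det_apply']
  rw [hdet, pderiv_sum fun σ _ => (differentiableAt_prod fun i _ => hA _ _).const_mul _]
  rw [Finset.mul_sum]
  simp only [Finset.mul_sum (s := (Finset.univ : Finset n)) (a := N.det), h1]
  simp only [Matrix.det_apply']
  rw [Finset.sum_comm]
  refine Finset.sum_congr rfl fun σ _ => ?_
  rw [pderiv_const_mul (differentiableAt_prod fun i _ => hA _ _),
    pderiv_prod fun i _ => hA _ _, Finset.mul_sum]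
  refine Finset.sum_congr rfl fun k _ => ?_
  congr 1
  rw [← Finset.mul_prod_erase _ _ (Finset.mem_univ k), mul_comm]
  congr 1
  · simp
  · refine Finset.prod_congr rfl fun i hi => ?_
    rw [Matrix.updateCol_ne (Finset.mem_erase.mp hi).1]
    rfl

/-- Linear constraints on the jet values, in particular antisymmetry, are inherited by the functions
that realize them. -/
theorem taylorPoly_mem {β : Type} (C : Submodule ℝ (β → ℝ)) (x : E m) (r : ℕ) {v : β → MI m → ℝ}
    (hv : ∀ S, (fun b => v b S) ∈ C) (y : E m) : (fun b => taylorPoly x r (v b) y) ∈ C := by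
  have : (fun b => taylorPoly x r (v b) y) =
      ∑ S ∈ miLe m r, taylorMonomial x S y • fun b => v b S := by
    funext b
    simp [taylorPoly, Finset.sum_apply, mul_comm]
  rw [this]
  exact C.sum_mem fun S _ => C.smul_mem _ (hv S)

section Transition

variable {X : Type*} [TopologicalSpace X] {φ ψ : OpenPartialHomeomorph X (E m)} {O : Set X}
variable [ChartedSpace (E m) X]

/-- The Levi-Civita symbol is an invariant contravariant density: the determinant from its `n`
indices cancels that of the density. -/
theorem sum_conDensLaw_levi (hφ : φ ∈ charts m X) (hψ : ψ ∈ charts m X) (hOo : IsOpen O)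
    (hO' : O ⊆ φ.source) (hO : O ⊆ ψ.source) {x : E m} (hx : x ∈ reg φ O)
    (t : Fin (m + 1) → Fin (m + 1)) :
    ∑ u, conDensLaw φ ψ (m + 1) t u x * levi u = levi t := by
  have h := sum_prod_levi (fun μ ν => jac φ ψ μ ν x) t
  have h2 := invDet_mul_jacDet hφ hψ hOo hO' hO hx
  simp only [conDensLaw, mul_assoc]
  rw [← Finset.mul_sum, h, ← mul_assoc]
  unfold jacDet at h2
  rw [h2, one_mul]

/-- Contraction with the Levi-Civita symbol turns the components of an `(n-1)`-form into a vector
density. The expansion of the determinant over the `n` indices is inverted in the one index that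
stays free. -/
theorem sum_levi_covLaw (hφ : φ ∈ charts m X) (hψ : ψ ∈ charts m X) (hOo : IsOpen O)
    (hO' : O ⊆ φ.source) (hO : O ⊆ ψ.source) {x : E m} (hx : x ∈ reg φ O)
    (μ : Fin (m + 1)) (u : Fin m → Fin (m + 1)) :
    ∑ t, levi (Fin.cons μ t) * covLaw φ ψ m t u x =
      ∑ ν, invDet φ ψ x * jac φ ψ μ ν x * levi (Fin.cons ν u) := by
  have h : ∀ ν, invDet φ ψ x * levi (Fin.cons ν u) = ∑ κ, ∑ t : Fin m → Fin (m + 1),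
      invJac φ ψ ν κ x * covLaw φ ψ m t u x * levi (Fin.cons κ t) := by
    intro ν
    have := sum_prod_levi (fun μ ν => invJac φ ψ μ ν x) (Fin.cons ν u)
    rw [sum_tuple_cons] at this
    unfold invDet
    rw [← this]
    simp [Fin.prod_univ_succ, covLaw]
  have h2 : ∀ ν, invDet φ ψ x * jac φ ψ μ ν x * levi (Fin.cons ν u) = ∑ κ,
      (jac φ ψ μ ν x * invJac φ ψ ν κ x) *
        ∑ t : Fin m → Fin (m + 1), covLaw φ ψ m t u x * levi (Fin.cons κ t) := by
    intro ν
    rw [mul_comm (invDet φ ψ x), mul_assoc, h, Finset.mul_sum]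
    simp only [Finset.mul_sum, mul_assoc]
  simp only [h2]
  rw [Finset.sum_comm]
  simp only [← Finset.sum_mul, jac_mul_invJac hφ hψ hOo hO' hO hx]
  simp [mul_comm]

/-- The divergence of an antisymmetric contravariant density is a density. -/
theorem div_transf (hφ : φ ∈ charts m X) (hψ : ψ ∈ charts m X) (hOo : IsOpen O)
    (hO' : O ⊆ φ.source) (hO : O ⊆ ψ.source) {q : ℕ}
    {f g : (Fin (q + 1) → Fin (m + 1)) → E m → ℝ} (hf : ∀ u, ContDiffOn ℝ ∞ (f u) (reg φ O))
    (hg : ∀ u, ContDiffOn ℝ ∞ (g u) (reg ψ O)) (ha : ∀ x, IsAlt fun u => f u x)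
    (h : ∀ a, ∀ x ∈ reg φ O, g a (trans φ ψ x) = ∑ u, conDensLaw φ ψ (q + 1) a u x * f u x)
    (t : Fin q → Fin (m + 1)) {x : E m} (hx : x ∈ reg φ O) :
    ∑ κ, pderiv κ (g (Fin.cons κ t)) (trans φ ψ x) =
      ∑ u, conDensLaw φ ψ q t u x * ∑ κ, pderiv κ (f (Fin.cons κ u)) x := by
  have hR := isOpen_reg (φ := φ) hOo
  have dJ : ∀ μ ν, DifferentiableAt ℝ (jac φ ψ μ ν) x := fun μ ν =>
    ContDiffOn.differentiableAt_of_isOpen (contDiffOn_jac hφ hψ hOo hO μ ν) hR hx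
  have dD : DifferentiableAt ℝ (invDet φ ψ) x :=
    ContDiffOn.differentiableAt_of_isOpen (contDiffOn_invDet hφ hψ hOo hO' hO) hR hx
  have df : ∀ u, DifferentiableAt ℝ (f u) x := fun u =>
    ContDiffOn.differentiableAt_of_isOpen (hf u) hR hx
  have hKJ := invJac_mul_jac hφ hψ hOo hO' hO hx
  -- derivative of the inverse determinant
  have hD : ∀ κ, pderiv κ (invDet φ ψ) x +
      invDet φ ψ x * ∑ ν, ∑ l, invJac φ ψ ν l x * pderiv κ (jac φ ψ l ν) x = 0 := by
    intro κ
    have h1 : pderiv κ (fun y => invDet φ ψ y * jacDet φ ψ y) x = 0 := by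
      rw [pderiv_congr hR (g := fun _ => 1)
        (fun y hy => invDet_mul_jacDet hφ hψ hOo hO' hO hy) hx, pderiv_const]
    have h2 := pderiv_det (A := jac φ ψ) (B := fun i l => invJac φ ψ i l x) dJ hKJ κ
    have h3 := invDet_mul_jacDet hφ hψ hOo hO' hO hx
    rw [pderiv_mul dD (ContDiffOn.differentiableAt_of_isOpen
      (contDiffOn_jacDet hφ hψ hOo hO) hR hx)] at h1
    change pderiv κ (jacDet φ ψ) x = jacDet φ ψ x * _ at h2
    rw [h2] at h1
    have h4 : jacDet φ ψ x * (pderiv κ (invDet φ ψ) x +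
      invDet φ ψ x * ∑ ν, ∑ l, invJac φ ψ ν l x * pderiv κ (jac φ ψ l ν) x) = 0 := by
      linear_combination h1
    refine (mul_eq_zero.mp h4).resolve_left fun h5 => ?_
    rw [h5, mul_zero] at h3
    exact zero_ne_one h3
  have hsymm : ∀ l κ ν, pderiv ν (jac φ ψ l κ) x = pderiv κ (jac φ ψ l ν) x := fun l κ ν =>
    pderiv_comm hR (contDiffOn_trans_apply hφ hψ hO l) hx ν κ
  -- This is the Piola identity: the cofactor columns `det(∂x/∂x') ∂x'^l/∂x^κ` are divergence free
  -- in the new coordinates. The derivative of the determinant cancels that of the Jacobian because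
  -- second derivatives commute.
  have piola : ∀ κ, ∑ l, ∑ ν, invJac φ ψ ν l x *
      pderiv ν (fun y => invDet φ ψ y * jac φ ψ l κ y) x = 0 := by
    intro κ
    rw [← hD κ]
    simp only [pderiv_mul dD (dJ _ _), mul_add, Finset.sum_add_distrib]
    congr 1
    · rw [Finset.sum_comm]
      have : ∀ ν, ∑ l, invJac φ ψ ν l x * (pderiv ν (invDet φ ψ) x * jac φ ψ l κ x) =
          pderiv ν (invDet φ ψ) x * if ν = κ then 1 else 0 := by
        intro ν
        rw [← hKJ ν κ, Finset.mul_sum]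
        exact Finset.sum_congr rfl fun l _ => by ring
      simp [this]
    · rw [Finset.sum_comm, Finset.mul_sum]
      refine Finset.sum_congr rfl fun ν _ => ?_
      rw [Finset.mul_sum]
      refine Finset.sum_congr rfl fun l _ => ?_
      rw [hsymm l κ ν]
      ring
  set P : (Fin q → Fin (m + 1)) → E m → ℝ := fun u y => ∏ i, jac φ ψ (t i) (u i) y
  have dP : ∀ u, DifferentiableAt ℝ (P u) x := fun u =>
    differentiableAt_prod fun i _ => dJ _ _
  have dPf : ∀ κ u, DifferentiableAt ℝ (fun y => P u y * f (Fin.cons κ u) y) x := fun κ u =>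
    (dP u).mul (df _)
  have hgτ : ∀ l, ∀ y ∈ reg φ O, g (Fin.cons l t) (trans φ ψ y) =
      ∑ κ, ∑ u : Fin q → Fin (m + 1), (invDet φ ψ y * jac φ ψ l κ y) *
        (P u y * f (Fin.cons κ u) y) := by
    intro l y hy
    rw [h _ y hy, sum_tuple_cons]
    refine Finset.sum_congr rfl fun κ _ => Finset.sum_congr rfl fun u _ => ?_
    simp [conDensLaw, Fin.prod_univ_succ, P]
    ring
  have step1 : ∀ l, pderiv l (g (Fin.cons l t)) (trans φ ψ x) =
      ∑ κ, ∑ u : Fin q → Fin (m + 1), ∑ ν, (invJac φ ψ ν l x *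
        pderiv ν (fun y => invDet φ ψ y * jac φ ψ l κ y) x * (P u x * f (Fin.cons κ u) x) +
        invDet φ ψ x * (invJac φ ψ ν l x * jac φ ψ l κ x) *
          pderiv ν (fun y => P u y * f (Fin.cons κ u) y) x) := by
    intro l
    rw [pderiv_trans_eq hφ hψ hOo hO' hO (hg _) hx]
    have : ∀ ν, pderiv ν (fun y => g (Fin.cons l t) (trans φ ψ y)) x =
        ∑ κ, ∑ u : Fin q → Fin (m + 1),
          (pderiv ν (fun y => invDet φ ψ y * jac φ ψ l κ y) x * (P u x * f (Fin.cons κ u) x) +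
            (invDet φ ψ x * jac φ ψ l κ x) *
              pderiv ν (fun y => P u y * f (Fin.cons κ u) y) x) := by
      intro ν
      rw [pderiv_congr hR (hgτ l) hx, pderiv_sum (f := fun κ y => ∑ u : Fin q → Fin (m + 1),
        (invDet φ ψ y * jac φ ψ l κ y) * (P u y * f (Fin.cons κ u) y)) fun κ _ =>
        DifferentiableAt.fun_sum fun u _ => (dD.mul (dJ l κ)).mul (dPf κ u)]
      refine Finset.sum_congr rfl fun κ _ => ?_
      rw [pderiv_sum (f := fun u y =>
        (invDet φ ψ y * jac φ ψ l κ y) * (P u y * f (Fin.cons κ u) y)) fun u _ =>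
        (dD.mul (dJ l κ)).mul (dPf κ u)]
      exact Finset.sum_congr rfl fun u _ => pderiv_mul (dD.mul (dJ l κ)) (dPf κ u) ν
    simp only [this, Finset.mul_sum]
    rw [Finset.sum_comm]
    refine Finset.sum_congr rfl fun κ _ => ?_
    rw [Finset.sum_comm]
    refine Finset.sum_congr rfl fun u _ => Finset.sum_congr rfl fun ν _ => ?_
    ring
  have step2 : ∀ κ (u : Fin q → Fin (m + 1)), ∑ l, ∑ ν, (invJac φ ψ ν l x *
        pderiv ν (fun y => invDet φ ψ y * jac φ ψ l κ y) x * (P u x * f (Fin.cons κ u) x) +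
        invDet φ ψ x * (invJac φ ψ ν l x * jac φ ψ l κ x) *
          pderiv ν (fun y => P u y * f (Fin.cons κ u) y) x) =
      invDet φ ψ x * pderiv κ (fun y => P u y * f (Fin.cons κ u) y) x := by
    intro κ u
    simp only [Finset.sum_add_distrib, ← Finset.sum_mul]
    rw [piola κ, zero_mul, zero_add, Finset.sum_comm]
    have : ∀ ν, ∑ l, invDet φ ψ x * (invJac φ ψ ν l x * jac φ ψ l κ x) *
          pderiv ν (fun y => P u y * f (Fin.cons κ u) y) x =
        invDet φ ψ x * (if ν = κ then 1 else 0) *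
          pderiv ν (fun y => P u y * f (Fin.cons κ u) y) x := by
      intro ν
      rw [← hKJ ν κ, Finset.mul_sum, Finset.sum_mul]
    simp [this]
  simp only [step1]
  rw [Finset.sum_comm]
  have step3 : ∀ κ, ∑ l, ∑ u : Fin q → Fin (m + 1), ∑ ν, (invJac φ ψ ν l x *
        pderiv ν (fun y => invDet φ ψ y * jac φ ψ l κ y) x * (P u x * f (Fin.cons κ u) x) +
        invDet φ ψ x * (invJac φ ψ ν l x * jac φ ψ l κ x) *
          pderiv ν (fun y => P u y * f (Fin.cons κ u) y) x) =
      ∑ u : Fin q → Fin (m + 1),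
        invDet φ ψ x * pderiv κ (fun y => P u y * f (Fin.cons κ u) y) x := by
    intro κ
    rw [Finset.sum_comm]
    exact Finset.sum_congr rfl fun u _ => step2 κ u
  simp only [step3]
  simp only [pderiv_mul (dP _) (df _), mul_add, Finset.sum_add_distrib]
  -- The derivatives of the remaining Jacobian factors are symmetric in the divergence index and one
  -- tensor index, and the tensor is antisymmetric in them.
  have step4 : ∑ κ, ∑ u : Fin q → Fin (m + 1),
      invDet φ ψ x * (pderiv κ (P u) x * f (Fin.cons κ u) x) = 0 := by
    have h1 : ∀ u κ, pderiv κ (P u) x =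
        ∑ i, (∏ k ∈ Finset.univ.erase i, jac φ ψ (t k) (u k) x) *
          pderiv κ (jac φ ψ (t i) (u i)) x := fun u κ => pderiv_prod (fun i _ => dJ _ _) κ
    simp only [h1, Finset.sum_mul, Finset.mul_sum]
    have h2 : ∀ i : Fin q, ∑ κ, ∑ u : Fin q → Fin (m + 1), invDet φ ψ x *
        ((∏ k ∈ Finset.univ.erase i, jac φ ψ (t k) (u k) x) *
          pderiv κ (jac φ ψ (t i) (u i)) x * f (Fin.cons κ u) x) = 0 := by
      intro i
      have h3 := (ha x).sum_smul_eq_zero (fun w => invDet φ ψ x *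
        ((∏ k ∈ Finset.univ.erase i, jac φ ψ (t k) (w k.succ) x) *
          pderiv (w 0) (jac φ ψ (t i) (w i.succ)) x)) (i := 0) (k := i.succ)
        (Fin.succ_ne_zero i).symm (by
          intro w
          simp only [Function.comp_apply, Equiv.swap_apply_left, Equiv.swap_apply_right]
          rw [hsymm (t i) (w 0) (w i.succ)]
          congr 2
          refine Finset.prod_congr rfl fun k hk => ?_
          rw [Equiv.swap_apply_of_ne_of_ne (Fin.succ_ne_zero k)
            (fun h => (Finset.mem_erase.mp hk).1 (Fin.succ_injective _ h))])
      rw [sum_tuple_cons] at h3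
      simpa [mul_assoc] using h3
    calc _ = ∑ i : Fin q, ∑ κ, ∑ u : Fin q → Fin (m + 1), invDet φ ψ x *
        ((∏ k ∈ Finset.univ.erase i, jac φ ψ (t k) (u k) x) *
          pderiv κ (jac φ ψ (t i) (u i)) x * f (Fin.cons κ u) x) := by
          rw [Finset.sum_comm (s := Finset.univ (α := Fin q))]
          refine Finset.sum_congr rfl fun κ _ => ?_
          rw [Finset.sum_comm]
      _ = 0 := Finset.sum_eq_zero fun i _ => h2 i
  rw [step4, zero_add, Finset.sum_comm]
  refine Finset.sum_congr rfl fun u _ => ?_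
  rw [Finset.mul_sum]
  refine Finset.sum_congr rfl fun κ _ => ?_
  simp only [conDensLaw, P]
  ring

/-- The exterior derivative commutes with coordinate changes. -/
theorem extDeriv_transf (hφ : φ ∈ charts m X) (hψ : ψ ∈ charts m X) (hOo : IsOpen O)
    (hO' : O ⊆ φ.source) (hO : O ⊆ ψ.source) {q : ℕ}
    {f g : (Fin q → Fin (m + 1)) → E m → ℝ} (hf : ∀ u, ContDiffOn ℝ ∞ (f u) (reg φ O))
    (hg : ∀ u, ContDiffOn ℝ ∞ (g u) (reg ψ O))
    (h : ∀ a, ∀ x ∈ reg φ O, g a (trans φ ψ x) = ∑ u, covLaw φ ψ q a u x * f u x)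
    (v : Fin (q + 1) → Fin (m + 1)) {x : E m} (hx : x ∈ reg φ O) :
    ∑ σ : Equiv.Perm (Fin (q + 1)), ((Equiv.Perm.sign σ : ℤ) : ℝ) *
        pderiv (v (σ 0)) (g (Fin.tail (v ∘ σ))) (trans φ ψ x) =
      ∑ w, covLaw φ ψ (q + 1) v w x * ∑ σ : Equiv.Perm (Fin (q + 1)),
        ((Equiv.Perm.sign σ : ℤ) : ℝ) * pderiv (w (σ 0)) (f (Fin.tail (w ∘ σ))) x := by
  have hR := isOpen_reg (φ := φ) hOo
  have hR' := isOpen_reg (φ := ψ) hOo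
  have dK : ∀ μ ν, DifferentiableAt ℝ (invJac φ ψ μ ν) x := fun μ ν =>
    ContDiffOn.differentiableAt_of_isOpen (contDiffOn_invJac hφ hψ hOo hO' hO μ ν) hR hx
  have df : ∀ u, DifferentiableAt ℝ (f u) x := fun u =>
    ContDiffOn.differentiableAt_of_isOpen (hf u) hR hx
  have dL : ∀ t u, DifferentiableAt ℝ (covLaw φ ψ q t u) x := fun t u =>
    differentiableAt_prod fun i _ => dK _ _
  -- These are the second derivatives of the old coordinates with respect to the new ones; their
  -- symmetry removes all inhomogeneous terms.
  set S : Fin (m + 1) → Fin (m + 1) → Fin (m + 1) → ℝ := fun l u t =>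
    ∑ μ, invJac φ ψ μ l x * pderiv μ (invJac φ ψ u t) x
  have hS : ∀ l u t, S l u t = S t u l := by
    intro l u t
    have h1 : ∀ l t, S l u t = pderiv l (jac ψ φ u t) (trans φ ψ x) := fun l t =>
      (pderiv_trans_eq hφ hψ hOo hO' hO (contDiffOn_jac hψ hφ hOo hO' u t) hx l).symm
    rw [h1, h1]
    exact pderiv_comm hR' (contDiffOn_trans_apply hψ hφ hO' u) (mapsTo_trans hO hx) l t
  have step1 : ∀ l t, pderiv l (g t) (trans φ ψ x) =
      ∑ u, (∑ i, (∏ k ∈ Finset.univ.erase i, invJac φ ψ (u k) (t k) x) * S l (u i) (t i)) * f u x +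
        ∑ u, ∑ μ, invJac φ ψ μ l x * covLaw φ ψ q t u x * pderiv μ (f u) x := by
    intro l t
    rw [pderiv_trans_eq hφ hψ hOo hO' hO (hg _) hx]
    have h1 : ∀ μ, pderiv μ (fun y => g t (trans φ ψ y)) x =
        ∑ u, (pderiv μ (covLaw φ ψ q t u) x * f u x + covLaw φ ψ q t u x * pderiv μ (f u) x) := by
      intro μ
      rw [pderiv_congr hR (h t) hx, pderiv_sum (f := fun u y => covLaw φ ψ q t u y * f u y)
        fun u _ => (dL t u).mul (df u)]
      exact Finset.sum_congr rfl fun u _ => pderiv_mul (dL t u) (df u) μ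
    have h2 : ∀ u μ, pderiv μ (covLaw φ ψ q t u) x =
        ∑ i, (∏ k ∈ Finset.univ.erase i, invJac φ ψ (u k) (t k) x) *
          pderiv μ (invJac φ ψ (u i) (t i)) x := fun u μ => pderiv_prod (fun i _ => dK _ _) μ
    simp only [h1, Finset.mul_sum]
    rw [Finset.sum_comm, ← Finset.sum_add_distrib]
    refine Finset.sum_congr rfl fun u _ => ?_
    simp only [mul_add, Finset.sum_add_distrib, h2]
    congr 1
    · simp only [S, Finset.mul_sum, Finset.sum_mul]
      rw [Finset.sum_comm]
      exact Finset.sum_congr rfl fun i _ => Finset.sum_congr rfl fun μ _ => by ring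
    · exact Finset.sum_congr rfl fun μ _ => by ring
  simp only [step1, mul_add, Finset.sum_add_distrib]
  -- Exchanging the derivative index with the tensor index whose factor was differentiated reverses
  -- the sign of the permutation and leaves the summand unchanged.
  have step2 : ∑ σ : Equiv.Perm (Fin (q + 1)), ((Equiv.Perm.sign σ : ℤ) : ℝ) *
      ∑ u : Fin q → Fin (m + 1), (∑ i, (∏ k ∈ Finset.univ.erase i,
        invJac φ ψ (u k) (Fin.tail (v ∘ σ) k) x) *
          S (v (σ 0)) (u i) (Fin.tail (v ∘ σ) i)) * f u x = 0 := by
    have h1 : ∀ u : Fin q → Fin (m + 1), ∀ i : Fin q,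
        ∑ σ : Equiv.Perm (Fin (q + 1)), ((Equiv.Perm.sign σ : ℤ) : ℝ) •
          ((∏ k ∈ Finset.univ.erase i, invJac φ ψ (u k) (v (σ k.succ)) x) *
            S (v (σ 0)) (u i) (v (σ i.succ))) = 0 := by
      intro u i
      refine sum_sign_smul_eq_zero _ (i := 0) (k := i.succ) (Fin.succ_ne_zero i).symm fun σ => ?_
      simp only [Equiv.Perm.coe_mul, Function.comp_apply, Equiv.swap_apply_left,
        Equiv.swap_apply_right]
      rw [hS]
      congr 1
      refine Finset.prod_congr rfl fun k hk => ?_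
      rw [Equiv.swap_apply_of_ne_of_ne (Fin.succ_ne_zero k)
        (fun h => (Finset.mem_erase.mp hk).1 (Fin.succ_injective _ h))]
    calc _ = ∑ u : Fin q → Fin (m + 1), ∑ i, (∑ σ : Equiv.Perm (Fin (q + 1)),
        ((Equiv.Perm.sign σ : ℤ) : ℝ) •
          ((∏ k ∈ Finset.univ.erase i, invJac φ ψ (u k) (v (σ k.succ)) x) *
            S (v (σ 0)) (u i) (v (σ i.succ)))) * f u x := by
          simp only [Finset.mul_sum, Finset.sum_mul]
          rw [Finset.sum_comm]
          refine Finset.sum_congr rfl fun u _ => ?_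
          rw [Finset.sum_comm]
          refine Finset.sum_congr rfl fun i _ => Finset.sum_congr rfl fun σ _ => ?_
          simp only [Fin.tail, Function.comp_apply, smul_eq_mul]
          ring
      _ = 0 := Finset.sum_eq_zero fun u _ => Finset.sum_eq_zero fun i _ => by rw [h1, zero_mul]
  rw [step2, zero_add]
  have step3 : ∀ σ : Equiv.Perm (Fin (q + 1)), ∑ u : Fin q → Fin (m + 1), ∑ μ,
      invJac φ ψ μ (v (σ 0)) x * covLaw φ ψ q (Fin.tail (v ∘ σ)) u x * pderiv μ (f u) x =
      ∑ w : Fin (q + 1) → Fin (m + 1), covLaw φ ψ (q + 1) v w x *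
        pderiv (w (σ 0)) (f (Fin.tail (w ∘ σ))) x := by
    intro σ
    have h1 := sum_tuple_cons fun w : Fin (q + 1) → Fin (m + 1) =>
      covLaw φ ψ (q + 1) (v ∘ σ) w x * pderiv (w 0) (f (Fin.tail w)) x
    have h2 := Equiv.sum_comp (tupPerm m σ) fun w : Fin (q + 1) → Fin (m + 1) =>
      covLaw φ ψ (q + 1) (v ∘ σ) w x * pderiv (w 0) (f (Fin.tail w)) x
    have h3 : ∀ w : Fin (q + 1) → Fin (m + 1),
        covLaw φ ψ (q + 1) (v ∘ σ) (w ∘ σ) x = covLaw φ ψ (q + 1) v w x := fun w =>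
      Equiv.prod_comp σ fun i => invJac φ ψ (w i) (v i) x
    rw [Finset.sum_comm]
    calc _ = ∑ w : Fin (q + 1) → Fin (m + 1),
          covLaw φ ψ (q + 1) (v ∘ σ) w x * pderiv (w 0) (f (Fin.tail w)) x := by
          rw [h1]
          refine Finset.sum_congr rfl fun κ _ => Finset.sum_congr rfl fun u _ => ?_
          simp [covLaw, Fin.prod_univ_succ, Fin.tail]
      _ = _ := by
          rw [← h2]
          refine Finset.sum_congr rfl fun w _ => ?_
          change covLaw φ ψ (q + 1) (v ∘ σ) (w ∘ σ) x * _ = _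
          rw [h3]
          rfl
  simp only [step3, Finset.mul_sum]
  rw [Finset.sum_comm]
  exact Finset.sum_congr rfl fun w _ => Finset.sum_congr rfl fun σ _ => by ring

variable {β β' : Type} [Fintype β] [Fintype β']

theorem pd_sort_sum_pderiv {U : Set (E m)} (hU : IsOpen U) {ι : Type*} [Fintype ι]
    {f : ι → E m → ℝ} (hf : ∀ i, ContDiffOn ℝ ∞ (f i) U) (c : ι → ℝ) (d : ι → Fin (m + 1))
    {x : E m} (hx : x ∈ U) (S : MI m) :
    pd S.sort (fun y => ∑ i, c i * pderiv (d i) (f i) y) x =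
      ∑ i, c i * pd (d i ::ₘ S).sort (f i) x := by
  refine (pd_sum_mul (f := fun i => pderiv (d i) (f i)) hU
    (fun i _ => contDiffOn_pderiv hU (hf i) (d i)) c hx _).trans ?_
  refine Finset.sum_congr rfl fun i _ => congrArg (c i * ·) ?_
  have h1 : pd S.sort (pderiv (d i) (f i)) x = pd (S.sort ++ [d i]) (f i) x := by
    simp [pd, List.foldr_append]
  rw [h1]
  refine pd_perm hU (hf i) hx ?_
  rw [← Multiset.coe_eq_coe, Multiset.sort_eq, ← Multiset.coe_add, Multiset.sort_eq,
    Multiset.coe_singleton, ← Multiset.singleton_add]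
  exact add_comm _ _

/-- Naturality of first order operators with constant coefficients on the level of jets. -/
theorem prolong_natural (hφ : φ ∈ charts m X) (hψ : ψ ∈ charts m X) (hOo : IsOpen O)
    (hO' : O ⊆ φ.source) (hO : O ⊆ ψ.source)
    {T : β → β → E m → ℝ} (hT : ∀ a b, ContDiffOn ℝ ∞ (T a b) (reg φ O))
    {T' : β' → β' → E m → ℝ} (hT' : ∀ a b, ContDiffOn ℝ ∞ (T' a b) (reg φ O))
    {ι : Type*} [Fintype ι] (c : ι → ℝ) (d : β' → ι → Fin (m + 1)) (e : β' → ι → β)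
    (C : Submodule ℝ (β → ℝ))
    (hnat : ∀ f g : β → E m → ℝ, (∀ b, ContDiffOn ℝ ∞ (f b) (reg φ O)) →
      (∀ b, ContDiffOn ℝ ∞ (g b) (reg ψ O)) → (∀ y, (fun b => f b y) ∈ C) →
      (∀ a, ∀ x ∈ reg φ O, g a (trans φ ψ x) = ∑ b, T a b x * f b x) →
      ∀ a, ∀ x ∈ reg φ O, ∑ k, c k * pderiv (d a k) (g (e a k)) (trans φ ψ x) =
        ∑ b, T' a b x * ∑ k, c k * pderiv (d b k) (f (e b k)) x)
    {M : Type*} [AddCommGroup M] [Module ℝ M] (v : β → MI m → M)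
    (hv : ∀ (ℓ : Module.Dual ℝ M) (S : MI m), (fun b => ℓ (v b S)) ∈ C)
    (L : MI m) (a : β') {x : E m} (hx : x ∈ reg φ O) :
    ∑ k, c k • LinJet.eval (prolong (invJac φ ψ) T (d a k ::ₘ L).sort (e a k)) x v =
      LinJet.eval (prolong (invJac φ ψ) T' L.sort a) x fun b S =>
        ∑ k, c k • v (e b k) (d b k ::ₘ S) := by
  rw [← sub_eq_zero]
  refine (Module.forall_dual_apply_eq_zero_iff ℝ _).mp fun ℓ => ?_
  rw [map_sub, sub_eq_zero, LinJet.map_eval, map_sum]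
  simp only [map_smul, map_sum, LinJet.map_eval, smul_eq_mul]
  -- The operator has order one, so jets up to order `|L| + 1` must be realized. The submodule `C`
  -- restricts the test functions to those for which naturality holds, such as antisymmetric ones.
  set f : β → E m → ℝ := fun b => taylorPoly x (L.card + 1) fun S => ℓ (v b S)
  have hf : ∀ b, ContDiffOn ℝ ∞ (f b) (reg φ O) := fun b => (contDiff_taylorPoly ..).contDiffOn
  have hfC : ∀ y, (fun b => f b y) ∈ C := taylorPoly_mem C x _ (hv ℓ)
  have hfv : ∀ b S, S.card ≤ L.card + 1 → ℓ (v b S) = jets f x b S := fun b S hS =>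
    (pd_taylorPoly x (fun S => ℓ (v b S)) hS).symm
  have hg := contDiffOn_transf (ψ := ψ) hφ hψ hO' hT hf
  have hgT : ∀ a, ∀ x ∈ reg φ O, transf φ ψ T f a (trans φ ψ x) = ∑ b, T a b x * f b x :=
    fun a x hx => transf_trans T f a hx.1 (hO hx.2)
  have hn := hnat f _ hf hg hfC hgT
  have hRφ := isOpen_reg (φ := φ) hOo
  have hRψ := isOpen_reg (φ := ψ) hOo
  have hL : ∀ k, LinJet.eval (prolong (invJac φ ψ) T (d a k ::ₘ L).sort (e a k)) x
      (fun b S => ℓ (v b S)) = pd (d a k ::ₘ L).sort (transf φ ψ T f (e a k)) (trans φ ψ x) := by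
    intro k
    refine ((good_prolong_trans hφ hψ hOo hO' hO hT _ _).eval_congr x fun b S hS =>
      hfv b S (by simpa using hS)).trans ?_
    exact prolong_jets_trans hφ hψ hOo hO' hO hT hf hg hgT _ _ hx
  set f' : β' → E m → ℝ := fun b y => ∑ k, c k * pderiv (d b k) (f (e b k)) y with hf'_def
  set g' : β' → E m → ℝ := fun b y => ∑ k, c k * pderiv (d b k) (transf φ ψ T f (e b k)) y
    with hg'_def
  have hf' : ∀ b, ContDiffOn ℝ ∞ (f' b) (reg φ O) :=
    fun b => ContDiffOn.sum fun k _ => contDiffOn_const.mul (contDiffOn_pderiv hRφ (hf _) _)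
  have hg' : ∀ b, ContDiffOn ℝ ∞ (g' b) (reg ψ O) :=
    fun b => ContDiffOn.sum fun k _ => contDiffOn_const.mul (contDiffOn_pderiv hRψ (hg _) _)
  have hR : ∀ b S, S.card ≤ L.sort.length →
      ∑ k, c k * ℓ (v (e b k) (d b k ::ₘ S)) = jets f' x b S := by
    intro b S hS
    rw [Multiset.length_sort] at hS
    rw [jets, hf'_def, pd_sort_sum_pderiv (f := fun k => f (e b k)) hRφ (fun k => hf _) c (d b) hx]
    refine Finset.sum_congr rfl fun k _ => congrArg (c k * ·) (hfv _ _ ?_)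
    rw [Multiset.card_cons]
    exact Nat.succ_le_succ hS
  have h1 : ∑ k, c k * LinJet.eval (prolong (invJac φ ψ) T (d a k ::ₘ L).sort (e a k)) x
        (fun b S => ℓ (v b S)) =
      ∑ k, c k * pd (d a k ::ₘ L).sort (transf φ ψ T f (e a k)) (trans φ ψ x) :=
    Finset.sum_congr rfl fun k _ => congrArg (c k * ·) (hL k)
  have h2 : pd L.sort (g' a) (trans φ ψ x) =
      ∑ k, c k * pd (d a k ::ₘ L).sort (transf φ ψ T f (e a k)) (trans φ ψ x) :=
    pd_sort_sum_pderiv (f := fun k => transf φ ψ T f (e a k)) hRψ (fun k => hg _) c (d a)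
      (mapsTo_trans hO hx) L
  have h3 := prolong_jets_trans hφ hψ hOo hO' hO hT' hf' hg' hn L.sort a hx
  have h4 := (good_prolong_trans hφ hψ hOo hO' hO hT' L.sort a).eval_congr x hR
  rw [h1, ← h2, ← h3]
  exact h4.symm

/-- Naturality of algebraic operators with constant coefficients on the level of jets. -/
theorem prolong_natural_zero (hφ : φ ∈ charts m X) (hψ : ψ ∈ charts m X) (hOo : IsOpen O)
    (hO' : O ⊆ φ.source) (hO : O ⊆ ψ.source)
    {T : β → β → E m → ℝ} (hT : ∀ a b, ContDiffOn ℝ ∞ (T a b) (reg φ O))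
    {T' : β' → β' → E m → ℝ} (hT' : ∀ a b, ContDiffOn ℝ ∞ (T' a b) (reg φ O))
    (C : β' → β → ℝ)
    (hC : ∀ a b, ∀ x ∈ reg φ O, ∑ k, C a k * T k b x = ∑ k, T' a k x * C k b)
    {M : Type*} [AddCommGroup M] [Module ℝ M] (v : β → MI m → M)
    (L : MI m) (a : β') {x : E m} (hx : x ∈ reg φ O) :
    ∑ k, C a k • LinJet.eval (prolong (invJac φ ψ) T L.sort k) x v =
      LinJet.eval (prolong (invJac φ ψ) T' L.sort a) x fun b S => ∑ k, C b k • v k S := by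
  rw [← sub_eq_zero]
  refine (Module.forall_dual_apply_eq_zero_iff ℝ _).mp fun ℓ => ?_
  rw [map_sub, sub_eq_zero, LinJet.map_eval, map_sum]
  simp only [map_smul, map_sum, LinJet.map_eval, smul_eq_mul]
  set f : β → E m → ℝ := fun b => taylorPoly x L.card fun S => ℓ (v b S)
  have hf : ∀ b, ContDiffOn ℝ ∞ (f b) (reg φ O) := fun b => (contDiff_taylorPoly ..).contDiffOn
  have hfv : ∀ b S, S.card ≤ L.card → ℓ (v b S) = jets f x b S := fun b S hS =>
    (pd_taylorPoly x (fun S => ℓ (v b S)) hS).symm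
  have hg := contDiffOn_transf (ψ := ψ) hφ hψ hO' hT hf
  have hgT : ∀ a, ∀ x ∈ reg φ O, transf φ ψ T f a (trans φ ψ x) = ∑ b, T a b x * f b x :=
    fun a x hx => transf_trans T f a hx.1 (hO hx.2)
  have hRφ := isOpen_reg (φ := φ) hOo
  have hRψ := isOpen_reg (φ := ψ) hOo
  have hL : ∀ k, LinJet.eval (prolong (invJac φ ψ) T L.sort k) x
      (fun b S => ℓ (v b S)) = pd L.sort (transf φ ψ T f k) (trans φ ψ x) := by
    intro k
    refine ((good_prolong_trans hφ hψ hOo hO' hO hT _ _).eval_congr x fun b S hS =>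
      hfv b S (by simpa using hS)).trans ?_
    exact prolong_jets_trans hφ hψ hOo hO' hO hT hf hg hgT _ _ hx
  set f' : β' → E m → ℝ := fun b y => ∑ k, C b k * f k y with hf'_def
  set g' : β' → E m → ℝ := fun b y => ∑ k, C b k * transf φ ψ T f k y with hg'_def
  have hf' : ∀ b, ContDiffOn ℝ ∞ (f' b) (reg φ O) :=
    fun b => ContDiffOn.sum fun k _ => contDiffOn_const.mul (hf k)
  have hg' : ∀ b, ContDiffOn ℝ ∞ (g' b) (reg ψ O) :=
    fun b => ContDiffOn.sum fun k _ => contDiffOn_const.mul (hg k)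
  have hn : ∀ a, ∀ y ∈ reg φ O, g' a (trans φ ψ y) = ∑ b, T' a b y * f' b y := by
    intro a y hy
    simp only [hf'_def, hg'_def, hgT _ y hy, Finset.mul_sum]
    rw [Finset.sum_comm]
    simp only [← mul_assoc, ← Finset.sum_mul, hC a _ y hy]
    rw [Finset.sum_comm]
    simp only [Finset.sum_mul]
  have hR : ∀ b S, S.card ≤ L.sort.length → ∑ k, C b k * ℓ (v k S) = jets f' x b S := by
    intro b S hS
    rw [Multiset.length_sort] at hS
    rw [jets, hf'_def, pd_sum_mul (f := f) hRφ (fun k _ => hf k) _ hx]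
    exact Finset.sum_congr rfl fun k _ => congrArg (C b k * ·) (hfv _ _ hS)
  have h1 : ∑ k, C a k * LinJet.eval (prolong (invJac φ ψ) T L.sort k) x (fun b S => ℓ (v b S)) =
      ∑ k, C a k * pd L.sort (transf φ ψ T f k) (trans φ ψ x) :=
    Finset.sum_congr rfl fun k _ => congrArg (C a k * ·) (hL k)
  have h2 : pd L.sort (g' a) (trans φ ψ x) =
      ∑ k, C a k * pd L.sort (transf φ ψ T f k) (trans φ ψ x) :=
    pd_sum_mul (s := Finset.univ) (f := transf φ ψ T f) hRψ (fun k _ => hg k) (C a)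
      (mapsTo_trans hO hx) L.sort
  have h3 := prolong_jets_trans hφ hψ hOo hO' hO hT' hf' hg' hn L.sort a hx
  have h4 := (good_prolong_trans hφ hψ hOo hO' hO hT' L.sort a).eval_congr x hR
  rw [h1, ← h2, ← h3]
  exact h4.symm

end Transition

end BFTheory

/-! ### Coordinate changes of jets, antifields and ghosts -/

namespace BFTheory

variable {m : ℕ}

section Transport

variable {X : Type*} [TopologicalSpace X] {φ ψ χ : OpenPartialHomeomorph X (E m)} {O : Set X}

/-- The coordinates in `ψ` of a point of the jet space. -/
noncomputable def jetTr (φ ψ : OpenPartialHomeomorph X (E m)) (x : E m) (j : Jet m) : Jet m :=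
  fun L => ((prolong (invJac φ ψ) (fun _ _ : Unit => 1) L.sort ()).eval x fun _ S => jetA j S,
    ⟨fun t => (prolong (invJac φ ψ) (covLaw φ ψ m) L.sort t).eval x fun u S => jetB j u S, by
      intro σ t
      have h1 := prolong_equivariant (invJac φ ψ) (covLaw φ ψ m) (tupPerm m σ)
        (by
          intro a b
          funext x
          simp only [covLaw, tupPerm, Equiv.coe_fn_mk, Function.comp_apply]
          rw [Equiv.prod_comp σ fun i => invJac φ ψ (b i) (a i) x]) L.sort t
      have h2 := eval_equivariant (tupPerm m σ) (prolong (invJac φ ψ) (covLaw φ ψ m) L.sort t)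
        x (fun u S => jetB j u S) ((Equiv.Perm.sign σ : ℤ) : ℝ) (fun b S => (j S).2.2 σ b)
      rw [← h1] at h2
      exact h2⟩)

theorem jetA_jetTr (x : E m) (j : Jet m) (L : MI m) : jetA (jetTr φ ψ x j) L =
    (prolong (invJac φ ψ) (fun _ _ : Unit => 1) L.sort ()).eval x fun _ S => jetA j S := rfl

theorem jetB_jetTr (x : E m) (j : Jet m) (t : Fin m → Fin (m + 1)) (L : MI m) :
    jetB (jetTr φ ψ x j) t L =
      (prolong (invJac φ ψ) (covLaw φ ψ m) L.sort t).eval x fun u S => jetB j u S := rfl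

theorem jet_ext {j j' : Jet m} (hA : ∀ L, jetA j L = jetA j' L)
    (hB : ∀ t L, jetB j t L = jetB j' t L) : j = j' := by
  funext L
  exact Prod.ext (hA L) (Subtype.ext (funext fun t => hB t L))

theorem jetTransf_iff {x : E m} {j j' : Jet m} : JetTransf φ ψ x j j' ↔ j' = jetTr φ ψ x j := by
  constructor
  · rintro ⟨h1, h2⟩
    exact jet_ext h1 h2
  · rintro rfl
    exact ⟨fun _ => rfl, fun _ _ => rfl⟩

theorem antiTransport_s (x : E m) (L : MI m) : antiTransport φ ψ x (agen (.s L)) =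
    (prolong (invJac φ ψ) (fun _ _ : Unit => invDet φ ψ) L.sort ()).eval x
      fun _ S => agen (.s S) := by
  rw [antiTransport, agen, gcHom_gen, antiTr]

theorem antiTransport_c (x : E m) (q : ℕ) (lt : q < m + 1) (t : Fin q → Fin (m + 1)) (L : MI m) :
    antiTransport φ ψ x (agen (.c ⟨q, lt, t, L⟩)) =
      (prolong (invJac φ ψ) (conDensLaw φ ψ q) L.sort t).eval x
        fun u S => agen (.c ⟨q, lt, u, S⟩) := by
  rw [antiTransport, agen, gcHom_gen, antiTr]

theorem ghostTransport_gen (x : E m) (q : ℕ) (lt : q < m) (t : Fin q → Fin (m + 1)) (L : MI m) :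
    ghostTransport φ ψ x (ggen ⟨q, lt, t, L⟩) =
      (prolong (invJac φ ψ) (covLaw φ ψ q) L.sort t).eval x
        fun u S => ggen ⟨q, lt, u, S⟩ := by
  rw [ghostTransport, ggen, gcHom_gen, ghostTr]

variable [ChartedSpace (E m) X]

theorem jetTr_jetTr (hφ : φ ∈ charts m X) (hψ : ψ ∈ charts m X) (hχ : χ ∈ charts m X)
    (hOo : IsOpen O) (hO'' : O ⊆ φ.source) (hO : O ⊆ ψ.source) (hO' : O ⊆ χ.source)
    {x : E m} (hx : x ∈ reg φ O) (j : Jet m) :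
    jetTr ψ χ (trans φ ψ x) (jetTr φ ψ x j) = jetTr φ χ x j := by
  refine jet_ext (fun L => ?_) fun t L => ?_
  · exact (prolong_comp hφ hψ hχ hOo hO'' hO hO' (fun _ _ => contDiffOn_const (c := (1 : ℝ)))
      (fun _ _ => contDiffOn_const (c := (1 : ℝ))) (fun _ _ => contDiffOn_const (c := (1 : ℝ)))
      (by simp) (fun _ S => jetA j S) L.sort () hx).symm
  · exact (prolong_comp hφ hψ hχ hOo hO'' hO hO' (contDiffOn_covLaw hφ hψ hOo hO'' hO)
      (contDiffOn_covLaw hψ hχ hOo hO hO') (contDiffOn_covLaw hφ hχ hOo hO'' hO')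
      (fun a c x hx => covLaw_comp hφ hψ hχ hOo hO'' hO hO' hx a c)
      (fun u S => jetB j u S) L.sort t hx).symm

theorem antiTransport_antiTransport (hφ : φ ∈ charts m X) (hψ : ψ ∈ charts m X)
    (hχ : χ ∈ charts m X)
    (hOo : IsOpen O) (hO'' : O ⊆ φ.source) (hO : O ⊆ ψ.source) (hO' : O ⊆ χ.source)
    {x : E m} (hx : x ∈ reg φ O) (u : AntiAlg m) :
    antiTransport φ ψ x (antiTransport ψ χ (trans φ ψ x) u) = antiTransport φ χ x u := by
  have h : (antiTransport φ ψ x).comp (antiTransport ψ χ (trans φ ψ x)) = antiTransport φ χ x := by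
    refine algHom_ext_gen fun g => ?_
    rw [AlgHom.comp_apply]
    match g with
    | .s L =>
      rw [antiTransport_s, antiTransport_s, ← AlgHom.toLinearMap_apply, LinJet.map_eval]
      simp only [AlgHom.toLinearMap_apply, antiTransport_s]
      have h := prolong_comp (T := fun _ _ : Unit => invDet φ ψ)
        (T' := fun _ _ : Unit => invDet ψ χ) (T'' := fun _ _ : Unit => invDet φ χ)
        (M := AntiAlg m) hφ hψ hχ hOo hO'' hO hO'
        (fun _ _ => contDiffOn_invDet hφ hψ hOo hO'' hO)
        (fun _ _ => contDiffOn_invDet hψ hχ hOo hO hO')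
        (fun _ _ => contDiffOn_invDet hφ hχ hOo hO'' hO')
        (fun _ _ x hx => by
          rw [invDet_comp hφ hψ hχ hOo hO'' hO hO' hx]
          simp [mul_comm]) (fun _ S => agen (.s S)) L.sort () hx
      rw [h]
    | .c ⟨q, lt, t, L⟩ =>
      rw [antiTransport_c, antiTransport_c, ← AlgHom.toLinearMap_apply, LinJet.map_eval]
      simp only [AlgHom.toLinearMap_apply, antiTransport_c]
      have h := prolong_comp (T := conDensLaw φ ψ q) (T' := conDensLaw ψ χ q)
        (T'' := conDensLaw φ χ q) (M := AntiAlg m) hφ hψ hχ hOo hO'' hO hO'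
        (contDiffOn_conDensLaw hφ hψ hOo hO'' hO)
        (contDiffOn_conDensLaw hψ hχ hOo hO hO') (contDiffOn_conDensLaw hφ hχ hOo hO'' hO')
        (fun a c x hx => conDensLaw_comp hφ hψ hχ hOo hO'' hO hO' hx a c)
        (fun u S => agen (.c ⟨q, lt, u, S⟩)) L.sort t hx
      rw [h]
  exact DFunLike.congr_fun h u

theorem prolong_div (hφ : φ ∈ charts m X) (hψ : ψ ∈ charts m X) (hOo : IsOpen O)
    (hO' : O ⊆ φ.source) (hO : O ⊆ ψ.source) {M : Type*} [AddCommGroup M] [Module ℝ M] {q : ℕ}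
    (v : (Fin (q + 1) → Fin (m + 1)) → MI m → M) (hv : ∀ S, IsAlt fun u => v u S)
    (L : MI m) (t : Fin q → Fin (m + 1)) {x : E m} (hx : x ∈ reg φ O) :
    ∑ κ, LinJet.eval (prolong (invJac φ ψ) (conDensLaw φ ψ (q + 1)) (κ ::ₘ L).sort
        (Fin.cons κ t)) x v =
      LinJet.eval (prolong (invJac φ ψ) (conDensLaw φ ψ q) L.sort t) x fun u S =>
        ∑ κ, v (Fin.cons κ u) (κ ::ₘ S) := by
  have h := prolong_natural hφ hψ hOo hO' hO (contDiffOn_conDensLaw hφ hψ hOo hO' hO)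
    (contDiffOn_conDensLaw hφ hψ hOo hO' hO) (fun _ : Fin (m + 1) => 1)
    (fun _ κ => κ) (fun (u : Fin q → Fin (m + 1)) κ => (Fin.cons κ u : Fin (q + 1) → Fin (m + 1)))
    (AltComp m (q + 1)) (fun f g hf hg ha h a x hx => by
      simp only [one_mul]
      exact div_transf hφ hψ hOo hO' hO hf hg (fun x σ t => ha x σ t) h a hx) v
    (fun ℓ S σ t => (congrArg ℓ (hv S σ t)).trans (map_smul _ _ _)) L t hx
  simpa only [one_smul] using h

theorem prolong_extDeriv (hφ : φ ∈ charts m X) (hψ : ψ ∈ charts m X) (hOo : IsOpen O)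
    (hO' : O ⊆ φ.source) (hO : O ⊆ ψ.source) {M : Type*} [AddCommGroup M] [Module ℝ M] {q : ℕ}
    (v : (Fin q → Fin (m + 1)) → MI m → M)
    (L : MI m) (t : Fin (q + 1) → Fin (m + 1)) {x : E m} (hx : x ∈ reg φ O) :
    ∑ σ : Equiv.Perm (Fin (q + 1)), ((Equiv.Perm.sign σ : ℤ) : ℝ) •
      LinJet.eval (prolong (invJac φ ψ) (covLaw φ ψ q) (t (σ 0) ::ₘ L).sort
        (Fin.tail (t ∘ σ))) x v =
      LinJet.eval (prolong (invJac φ ψ) (covLaw φ ψ (q + 1)) L.sort t) x fun u S =>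
        ∑ σ : Equiv.Perm (Fin (q + 1)), ((Equiv.Perm.sign σ : ℤ) : ℝ) •
          v (Fin.tail (u ∘ σ)) (u (σ 0) ::ₘ S) :=
  prolong_natural hφ hψ hOo hO' hO (contDiffOn_covLaw hφ hψ hOo hO' hO)
    (contDiffOn_covLaw hφ hψ hOo hO' hO)
    (fun σ : Equiv.Perm (Fin (q + 1)) => ((Equiv.Perm.sign σ : ℤ) : ℝ))
    (fun (u : Fin (q + 1) → Fin (m + 1)) σ => u (σ 0)) (fun u σ => Fin.tail (u ∘ σ))
    ⊤ (fun _ _ hf hg _ h a _ hx => extDeriv_transf hφ hψ hOo hO' hO hf hg h a hx) v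
    (fun _ _ => trivial) L t hx

/-- The scalar `A` times the Levi-Civita symbol is a contravariant density with `n` indices, that
is, it transforms as the next member of the antifield series would. -/
theorem levi_jetA_jetTr (hφ : φ ∈ charts m X) (hψ : ψ ∈ charts m X) (hOo : IsOpen O)
    (hO' : O ⊆ φ.source) (hO : O ⊆ ψ.source) (j : Jet m) (L : MI m)
    (t : Fin (m + 1) → Fin (m + 1)) {x : E m} (hx : x ∈ reg φ O) :
    levi t * jetA (jetTr φ ψ x j) L =
      LinJet.eval (prolong (invJac φ ψ) (conDensLaw φ ψ (m + 1)) L.sort t) x fun u S =>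
        levi u * jetA j S := by
  have h := prolong_natural_zero hφ hψ hOo hO' hO
    (T := fun _ _ : Unit => 1) (fun _ _ => contDiffOn_const (c := (1 : ℝ)))
    (contDiffOn_conDensLaw hφ hψ hOo hO' hO) (fun t _ => levi t)
    (fun a b x hx => by
      rw [sum_conDensLaw_levi hφ hψ hOo hO' hO hx]
      simp) (fun _ S => jetA j S) L t hx
  simp only [Finset.univ_unique, Finset.sum_singleton, smul_eq_mul] at h
  exact h

theorem eulA_jetTr (hφ : φ ∈ charts m X) (hψ : ψ ∈ charts m X) (hOo : IsOpen O)
    (hO' : O ⊆ φ.source) (hO : O ⊆ ψ.source) (j : Jet m) (L : MI m) {x : E m}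
    (hx : x ∈ reg φ O) :
    eulA (jetTr φ ψ x j) L =
      LinJet.eval (prolong (invJac φ ψ) (fun _ _ : Unit => invDet φ ψ) L.sort ()) x fun _ S =>
        eulA j S := by
  -- `𝓔` is the divergence of the vector density `ε^{μ t} B_t`. With a single index antisymmetry is
  -- automatic, so the divergence lemma applies and the result has no indices left: it is a density.
  set b : (Fin 1 → Fin (m + 1)) → MI m → ℝ := fun w S => ∑ t, levi (Fin.cons (w 0) t) * jetB j t S
  have hb : ∀ S, IsAlt fun u => b u S := by
    intro S σ t
    rw [Subsingleton.elim σ 1]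
    simp
  have h1 : ∀ κ, ∑ t, levi (Fin.cons κ t) * jetB (jetTr φ ψ x j) t (κ ::ₘ L) =
      LinJet.eval (prolong (invJac φ ψ) (conDensLaw φ ψ 1) (κ ::ₘ L).sort
        (Fin.cons κ (Fin.elim0 : Fin 0 → Fin (m + 1)))) x b := by
    intro κ
    have h := prolong_natural_zero hφ hψ hOo hO' hO (contDiffOn_covLaw hφ hψ hOo hO' hO)
      (contDiffOn_conDensLaw hφ hψ hOo hO' hO)
      (fun (w : Fin 1 → Fin (m + 1)) (t : Fin m → Fin (m + 1)) => levi (Fin.cons (w 0) t))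
      (fun a u x hx => by
        rw [sum_levi_covLaw hφ hψ hOo hO' hO hx, sum_tuple_cons]
        simp [conDensLaw]) (fun t S => jetB j t S) (κ ::ₘ L)
      (Fin.cons κ (Fin.elim0 : Fin 0 → Fin (m + 1))) hx
    simp only [smul_eq_mul, Fin.cons_zero] at h
    exact h
  have h2 := prolong_div hφ hψ hOo hO' hO b hb L (Fin.elim0 : Fin 0 → Fin (m + 1)) hx
  have h3 := prolong_natural_zero hφ hψ hOo hO' hO
    (T := conDensLaw φ ψ 0) (T' := fun _ _ : Unit => invDet φ ψ)
    (contDiffOn_conDensLaw hφ hψ hOo hO' hO)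
    (fun _ _ => contDiffOn_invDet hφ hψ hOo hO' hO) (fun _ _ => 1)
    (fun a b x hx => by simp [conDensLaw])
    (fun u S => ∑ κ, b (Fin.cons κ u) (κ ::ₘ S)) L () hx
  unfold eulA
  simp only [h1]
  rw [h2]
  simpa [Subsingleton.elim _ (Fin.elim0 : Fin 0 → Fin (m + 1)), b] using h3

/-- The extended generators follow one transformation law, so the naturality of all `Δ`, including
`𝓔^t`, is one application of the divergence lemma. -/
theorem antiTransport_extGen (hφ : φ ∈ charts m X) (hψ : ψ ∈ charts m X) (hOo : IsOpen O)
    (hO' : O ⊆ φ.source) (hO : O ⊆ ψ.source) (j : Jet m) {q : ℕ}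
    (t : Fin (q + 1) → Fin (m + 1)) (L : MI m) {x : E m} (hx : x ∈ reg φ O) :
    antiTransport φ ψ x (extGen (jetTr φ ψ x j) q t L) =
      LinJet.eval (prolong (invJac φ ψ) (conDensLaw φ ψ (q + 1)) L.sort t) x
        fun u S => extGen j q u S := by
  unfold extGen
  by_cases h : q < m
  · simp only [h, dif_pos]
    exact antiTransport_c ..
  · by_cases h' : q = m
    · subst h'
      simp only [lt_irrefl, dif_neg, not_false_eq_true, dif_pos, Fin.cast_eq_self]
      rw [AlgHom.commutes, levi_jetA_jetTr hφ hψ hOo hO' hO j L t hx, ← Algebra.linearMap_apply,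
        map_neg, LinJet.map_eval]
      simp only [map_neg, Algebra.linearMap_apply, LinJet.eval, Finsupp.sum, smul_neg,
        Finset.sum_neg_distrib]
    · simp [h, h', LinJet.eval]

theorem antiTransport_dDelta (hφ : φ ∈ charts m X) (hψ : ψ ∈ charts m X) (hOo : IsOpen O)
    (hO' : O ⊆ φ.source) (hO : O ⊆ ψ.source) (j : Jet m) {q : ℕ} (lt : q < m + 1)
    (t : Fin q → Fin (m + 1)) (L : MI m) {x : E m} (hx : x ∈ reg φ O) :
    antiTransport φ ψ x (dDelta (jetTr φ ψ x j) ⟨q, lt, t, L⟩) =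
      LinJet.eval (prolong (invJac φ ψ) (conDensLaw φ ψ q) L.sort t) x
        fun u S => dDelta j ⟨q, lt, u, S⟩ := by
  simp only [dDelta_eq]
  rw [map_sum]
  simp only [antiTransport_extGen hφ hψ hOo hO' hO j _ _ hx]
  exact prolong_div hφ hψ hOo hO' hO _ (isAlt_extGen j q) L t hx

omit [ChartedSpace (E m) X] in
theorem antiTransport_agen_mem (x : E m) (g : Anti m) : antiTransport φ ψ x (agen g) ∈
    Submodule.span ℝ (gen Anti.ant Anti.Alt '' {h | h.ant = g.ant}) := by
  rw [antiTransport, agen, gcHom_gen]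
  exact antiTr_mem φ ψ x g

/-- The Koszul-Tate differential commutes with coordinate changes. -/
theorem kt_antiTransport (hφ : φ ∈ charts m X) (hψ : ψ ∈ charts m X) (hOo : IsOpen O)
    (hO' : O ⊆ φ.source) (hO : O ⊆ ψ.source) (T : ℕ) (j : Jet m) {x : E m} (hx : x ∈ reg φ O)
    (u : AntiAlg m) :
    kt T j (antiTransport φ ψ x u) = antiTransport φ ψ x (kt T (jetTr φ ψ x j) u) := by
  refine (kt_isOddRight T j).intertwine (kt_isOddRight T _) _ (fun g => ?_) (fun g => ?_) u
  · exact parityInv_span (antiTransport_agen_mem x g)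
  · rw [kt_agen]
    match g with
    | .s L =>
      rw [antiTransport_s, LinJet.map_eval]
      simp only [kt_agen]
      unfold ktVal
      have h1 : ∀ S : MI m, (Anti.s S).ant = 1 := fun _ => rfl
      simp only [h1]
      split_ifs
      · rw [AlgHom.commutes, eulA_jetTr hφ hψ hOo hO' hO j L hx, ← Algebra.linearMap_apply,
          LinJet.map_eval]
        rfl
      · simp [LinJet.eval]
    | .c ⟨q, lt, t, L⟩ =>
      rw [antiTransport_c, LinJet.map_eval]
      simp only [kt_agen]
      unfold ktVal
      have h1 : ∀ u S, (Anti.c ⟨q, lt, u, S⟩ : Anti m).ant = m + 1 - q := fun _ _ => rfl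
      simp only [h1]
      split_ifs
      · exact (antiTransport_dDelta hφ hψ hOo hO' hO j lt t L hx).symm
      · simp [LinJet.eval]

end Transport

end BFTheory

/-! ### Cutting off and transporting polynomial expressions -/

namespace BFTheory

variable {m : ℕ}

section Cutoff

open Filter Topology

variable {U : Set (E m)} {r : ℕ}

theorem IsJetFun.of_locally {f : E m → Jet m → ℝ} (hU : IsOpen U)
    (h : ∀ x ∈ U, ∃ V, IsOpen V ∧ x ∈ V ∧ IsJetFun (U ∩ V) r f) : IsJetFun U r f := by
  refine isJetFun_iff.mpr ⟨fun p hp => ?_, fun x hx j j' hj => ?_⟩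
  · obtain ⟨V, hV, hxV, hf⟩ := h p.1 hp.1
    have h1 := (isJetFun_iff.mp hf).1 p ⟨⟨hp.1, hxV⟩, trivial⟩
    refine (h1.contDiffAt ?_).contDiffWithinAt
    exact ((hU.inter hV).prod isOpen_univ).mem_nhds ⟨⟨hp.1, hxV⟩, trivial⟩
  · obtain ⟨V, hV, hxV, hf⟩ := h x hx
    exact (isJetFun_iff.mp hf).2 x ⟨hx, hxV⟩ j j' hj

variable {ι : Type*} {ρ : ι → E m → ℝ} {V : ι → Set (E m)} {I : E m → Finset ι}

/-- Near a given point the varying index sets lie in one finite set. Each cut-off summand extends by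
zero because its weight vanishes in a neighbourhood of every point outside `V i`. -/
theorem isJetFun_sum_cutoff (hU : IsOpen U) (hV : ∀ i, IsOpen (V i))
    (hρ : ∀ i, ContDiffOn ℝ ∞ (ρ i) U) (hI : ∀ x ∈ U, ∀ i, i ∉ I x → ρ i x = 0)
    (hloc : ∀ x ∈ U, ∃ I₀ : Finset ι, ∀ᶠ y in 𝓝 x, I y ⊆ I₀)
    (hsupp : ∀ i, ∀ x ∈ U, x ∉ V i → ∀ᶠ y in 𝓝 x, ρ i y = 0)
    {f : ι → E m → Jet m → ℝ} (hf : ∀ i, IsJetFun (U ∩ V i) r (f i)) :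
    IsJetFun U r fun x j => ∑ i ∈ I x, ρ i x * f i x j := by
  have h1 : ∀ i, IsJetFun U r fun x j => ρ i x * f i x j := by
    refine fun i => IsJetFun.of_locally hU fun x hx => ?_
    by_cases h : x ∈ V i
    · exact ⟨V i, hV i, h, (isJetFun_base ((hρ i).mono Set.inter_subset_left)).mul (hf i)⟩
    · obtain ⟨W, hW, hWo, hxW⟩ := eventually_nhds_iff.mp (hsupp i x hx h)
      exact ⟨W, hWo, hxW, (isJetFun_const 0).congr fun y hy j => by rw [hW y hy.2, zero_mul]⟩
  refine IsJetFun.of_locally hU fun x hx => ?_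
  obtain ⟨I₀, h0⟩ := hloc x hx
  obtain ⟨W, hW, hWo, hxW⟩ := eventually_nhds_iff.mp h0
  refine ⟨W, hWo, hxW, (IsJetFun.sum (s := I₀) (f := fun i x j => ρ i x * f i x j)
    fun i _ => (h1 i).mono_set Set.inter_subset_left).congr fun y hy j => ?_⟩
  refine Finset.sum_subset (hW y hy.2) fun i _ hi => ?_
  rw [hI y hy.1 i hi, zero_mul]

/-- Finiteness of the set of admissible words lets all local expansions, however many, be written
over the same words. Only the coefficients are then glued. -/
theorem isPolyIn_sum_cutoff {G Q : Type*} [Ring Q] [Algebra ℝ Q] {val : Jet m → G → Q}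
    {P : List G → Prop} (hP : {w | P w}.Finite) (hU : IsOpen U) (hV : ∀ i, IsOpen (V i))
    (hρ : ∀ i, ContDiffOn ℝ ∞ (ρ i) U) (hI : ∀ x ∈ U, ∀ i, i ∉ I x → ρ i x = 0)
    (hloc : ∀ x ∈ U, ∃ I₀ : Finset ι, ∀ᶠ y in 𝓝 x, I y ⊆ I₀)
    (hsupp : ∀ i, ∀ x ∈ U, x ∉ V i → ∀ᶠ y in 𝓝 x, ρ i y = 0)
    {F : ι → E m → Jet m → Q} (hF : ∀ i, IsPolyIn val P (U ∩ V i) r (F i)) :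
    IsPolyIn val P U r fun x j => ∑ i ∈ I x, ρ i x • F i x j := by
  classical
  choose S c h1 h2 using hF
  let c' : List G → ι → E m → Jet m → ℝ := fun w i x j => if w ∈ S i then c i w x j else 0
  have hc' : ∀ w i, IsJetFun (U ∩ V i) r (c' w i) := by
    intro w i
    by_cases h : w ∈ S i
    · simp only [c', h, if_true]
      exact (h1 i w h).2
    · simp only [c', h, if_false]
      exact isJetFun_const 0
  refine ⟨hP.toFinset, fun w x j => ∑ i ∈ I x, ρ i x * c' w i x j, fun w hw =>
    ⟨by simpa using hw, isJetFun_sum_cutoff hU hV hρ hI hloc hsupp (hc' w)⟩, fun x hx j => ?_⟩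
  simp only [Finset.sum_smul]
  rw [Finset.sum_comm]
  refine Finset.sum_congr rfl fun i _ => ?_
  by_cases h : x ∈ V i
  · rw [h2 i x ⟨hx, h⟩ j, Finset.smul_sum]
    have hS : S i ⊆ hP.toFinset := fun w hw => by simpa using (h1 i w hw).1
    refine (Finset.sum_congr rfl fun w hw => ?_).trans
      (Finset.sum_subset hS fun w _ hw => ?_)
    · rw [show c' w i x j = c i w x j from if_pos hw, mul_smul]
    · rw [show c' w i x j = 0 from if_neg hw, mul_zero, zero_smul]
  · rw [(hsupp i x hx h).self_of_nhds]
    simp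

end Cutoff

section Transport

variable {X : Type*} [TopologicalSpace X] {φ ψ : OpenPartialHomeomorph X (E m)} {O : Set X}
variable {U : Set (E m)} {r : ℕ}

theorem isPolyIn_eval {G Q : Type*} [Ring Q] [Algebra ℝ Q] {val : Jet m → G → Q}
    {P : List G → Prop} {β : Type} {k : ℕ} {F : LinJet β m} (hF : LinJet.Good U k F)
    {v : β → MI m → Jet m → Q}
    (hv : ∀ b S, S.card ≤ k → IsPolyIn val P U r fun _ j => v b S j) :
    IsPolyIn val P U r fun x j => LinJet.eval F x fun b S => v b S j :=
  isPolyIn_sum fun p hp => (hv p.1 p.2 (hF.card_le hp)).smul (isJetFun_base (hF p).1)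

theorem contDiffOn_eval {β : Type} {P : Type*} [NormedAddCommGroup P] [NormedSpace ℝ P]
    [FiniteDimensional ℝ P] {k : ℕ} {F : LinJet β m} (hF : LinJet.Good U k F)
    (v : β → MI m → P →ₗ[ℝ] ℝ) :
    ContDiffOn ℝ ∞ (fun p : E m × P => LinJet.eval F p.1 fun b S => v b S p.2)
      (U ×ˢ Set.univ) := by
  simp only [LinJet.eval, Finsupp.sum, smul_eq_mul]
  refine ContDiffOn.sum fun q _ => ContDiffOn.mul ?_ ?_
  · exact (hF q).1.comp contDiffOn_fst fun p hp => hp.1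
  · exact ((LinearMap.toContinuousLinearMap (v q.1 q.2)).contDiff.comp contDiff_snd).contDiffOn

variable [ChartedSpace (E m) X]

theorem contDiffOn_jetTr (hφ : φ ∈ charts m X) (hψ : ψ ∈ charts m X) (hOo : IsOpen O)
    (hO' : O ⊆ φ.source) (hO : O ⊆ ψ.source) (r : ℕ) (L : MI m) :
    ContDiffOn ℝ ∞ (fun p : E m × TJet m r => jetTr φ ψ p.1 (extend r p.2) L)
      (reg φ O ×ˢ Set.univ) := by
  have hA := contDiffOn_eval (P := TJet m r) (good_prolong_trans hφ hψ hOo hO' hO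
    (T := fun _ _ : Unit => 1) (fun _ _ => contDiffOn_const (c := (1 : ℝ))) L.sort ())
    fun _ S => (jetAₗ S).comp (extend r)
  have hB := fun t => contDiffOn_eval (P := TJet m r) (good_prolong_trans hφ hψ hOo hO' hO
    (contDiffOn_covLaw hφ hψ hOo hO' hO) L.sort t)
    fun u S => (jetBₗ u S).comp (extend r)
  -- The transformed components are smooth in the ambient space of all tuples; a linear left inverse
  -- of the inclusion brings smoothness down to the antisymmetric subspace.
  obtain ⟨P, hP⟩ := (AltComp m m).subtype.exists_leftInverse_of_injective
    (Submodule.ker_subtype _)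
  have hB' : ContDiffOn ℝ ∞ (fun p : E m × TJet m r => P fun t =>
      (jetTr φ ψ p.1 (extend r p.2) L).2.1 t) (reg φ O ×ˢ Set.univ) :=
    (LinearMap.toContinuousLinearMap P).contDiff.comp_contDiffOn (contDiffOn_pi.mpr hB)
  refine (hA.prodMk hB').congr fun p _ => Prod.ext rfl ?_
  exact (DFunLike.congr_fun hP (jetTr φ ψ p.1 (extend r p.2) L).2).symm

theorem IsJetFun.transport (hφ : φ ∈ charts m X) (hψ : ψ ∈ charts m X) (hOo : IsOpen O)
    (hO' : O ⊆ φ.source) (hO : O ⊆ ψ.source) {f : E m → Jet m → ℝ}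
    (h : IsJetFun (reg ψ O) r f) :
    IsJetFun (reg φ O) r fun x j => f (trans φ ψ x) (jetTr φ ψ x j) := by
  obtain ⟨g, hg, hf⟩ := h
  refine isJetFun_iff.mpr ⟨?_, fun x hx j j' hj => ?_⟩
  · have h1 : ContDiffOn ℝ ∞ (fun p : E m × TJet m r =>
        (trans φ ψ p.1, trunc r (jetTr φ ψ p.1 (extend r p.2)))) (reg φ O ×ˢ Set.univ) := by
      refine ContDiffOn.prodMk ?_ (contDiffOn_pi.mpr fun q =>
        contDiffOn_jetTr hφ hψ hOo hO' hO r _)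
      exact (contDiffOn_trans hφ hψ hO).comp contDiffOn_fst fun p hp => hp.1
    refine (hg.comp h1 fun p hp => ⟨mapsTo_trans hO hp.1, trivial⟩).congr fun p hp => ?_
    exact hf _ (mapsTo_trans hO hp.1) _
  · rw [hf _ (mapsTo_trans hO hx), hf _ (mapsTo_trans hO hx)]
    have h1 : trunc r (jetTr φ ψ x j) = trunc r (jetTr φ ψ x j') := by
      rw [trunc_eq_iff] at hj ⊢
      intro L hL
      refine Prod.ext ?_ (Subtype.ext (funext fun t => ?_))
      · exact (good_prolong_trans hφ hψ hOo hO' hO (T := fun _ _ : Unit => 1)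
          (fun _ _ => contDiffOn_const (c := (1 : ℝ))) L.sort ()).eval_congr x fun _ S hS =>
            congrArg Prod.fst (hj S (by rw [Multiset.length_sort] at hS; omega))
      · exact (good_prolong_trans hφ hψ hOo hO' hO
          (contDiffOn_covLaw hφ hψ hOo hO' hO) L.sort t).eval_congr x fun u S hS =>
            congrArg (fun p : Fib m => p.2.1 u)
              (hj S (by rw [Multiset.length_sort] at hS; omega))
    exact congrArg (fun y => g (trans φ ψ x, y)) h1

/-- The relation `R` connects a letter with the letters that occur in its transform. A word
predicate that survives letterwise replacement along `R` is preserved by coordinate changes. -/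
theorem IsPolyIn.transport {G Q : Type*} [Ring Q] [Algebra ℝ Q] {val : Jet m → G → Q}
    {P : List G → Prop} {R : G → G → Prop} {F : E m → Jet m → Q}
    (hφ : φ ∈ charts m X) (hψ : ψ ∈ charts m X) (hOo : IsOpen O)
    (hO' : O ⊆ φ.source) (hO : O ⊆ ψ.source) (θ : E m → Q →ₐ[ℝ] Q)
    (hθ : ∀ g, IsPolyIn val (fun w => ∃ g', w = [g'] ∧ R g g') (reg φ O) r
      fun x j => θ x (val (jetTr φ ψ x j) g))
    (hP : ∀ w w', P w → List.Forall₂ R w w' → P w') (h : IsPolyIn val P (reg ψ O) r F) :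
    IsPolyIn val P (reg φ O) r fun x j => θ x (F (trans φ ψ x) (jetTr φ ψ x j)) := by
  have hw : ∀ w, IsPolyIn val (fun w' => List.Forall₂ R w w') (reg φ O) r
      fun x j => θ x (w.map (val (jetTr φ ψ x j))).prod := by
    intro w
    induction w with
    | nil =>
      refine (isPolyIn_single (w := []) List.Forall₂.nil (isJetFun_const 1)).congr fun x _ j => ?_
      simp
    | cons g w ih =>
      refine ((hθ g).mul ih (P'' := fun w' => List.Forall₂ R (g :: w) w') ?_).congr
        fun x _ j => ?_
      · rintro _ w' ⟨g', rfl, hg⟩ hw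
        exact List.Forall₂.cons hg hw
      · simp
  obtain ⟨S, c, h1, h2⟩ := h
  refine (isPolyIn_sum (s := S) fun w hwS => ((hw w).mono (hP w · (h1 w hwS).1) le_rfl).smul
    (IsJetFun.transport hφ hψ hOo hO' hO (h1 w hwS).2)).congr fun x hx j => ?_
  rw [h2 _ (mapsTo_trans hO hx), map_sum]
  simp only [map_smul]

theorem forall₂_map_eq {G H : Type*} {R : G → G → Prop} (f : G → H) (h : ∀ a b, R a b → f b = f a)
    {w w' : List G} (hw : List.Forall₂ R w w') : w'.map f = w.map f := by
  induction hw with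
  | nil => rfl
  | cons h1 _ ih => simp [ih, h _ _ h1]

theorem forall₂_forall_mem {G : Type*} {R : G → G → Prop} {p : G → Prop}
    (h : ∀ a b, R a b → p a → p b) {w w' : List G} (hw : List.Forall₂ R w w')
    (hp : ∀ a ∈ w, p a) : ∀ b ∈ w', p b := by
  induction hw with
  | nil => simp
  | cons h1 _ ih =>
    intro b hb
    rcases List.mem_cons.mp hb with rfl | hb
    · exact h _ _ h1 (hp _ (by simp))
    · exact ih (fun a ha => hp a (by simp [ha])) b hb

theorem IsPolyIn.antiTransport {T a : ℕ} {F : E m → Jet m → AntiAlg m}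
    (hφ : φ ∈ charts m X) (hψ : ψ ∈ charts m X) (hOo : IsOpen O)
    (hO' : O ⊆ φ.source) (hO : O ⊆ ψ.source)
    (h : IsPolyIn (fun _ => agen) (AntiWord T a r) (reg ψ O) r F) :
    IsPolyIn (fun _ => agen) (AntiWord T a r) (reg φ O) r
      fun x j => antiTransport φ ψ x (F (trans φ ψ x) (jetTr φ ψ x j)) := by
  refine h.transport (R := fun g g' => g'.ant = g.ant ∧ g'.order ≤ g.order)
    hφ hψ hOo hO' hO _ (fun g => ?_) fun w w' hw hww' => ⟨?_, ?_⟩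
  · match g with
    | .s L =>
      have h1 : ∀ (_ : Unit) (S : MI m), S.card ≤ L.sort.length →
          IsPolyIn (fun _ : Jet m => agen) (fun w => ∃ g' : Anti m, w = [g'] ∧
            g'.ant = (Anti.s L : Anti m).ant ∧ g'.order ≤ (Anti.s L : Anti m).order)
            (reg φ O) r fun _ _ => agen (.s S) := fun _ S hS => by
        refine (isPolyIn_single (w := [.s S]) ⟨_, rfl, rfl, ?_⟩ (isJetFun_const 1)).congr
          fun x _ j => by simp
        simpa [Anti.order] using hS
      have h2 := isPolyIn_eval (Q := AntiAlg m) (v := fun _ S _ => agen (.s S))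
        (good_prolong_trans hφ hψ hOo hO' hO
          (fun _ _ => contDiffOn_invDet hφ hψ hOo hO' hO) L.sort ()) h1
      exact h2.congr fun x _ j => antiTransport_s x L
    | .c ⟨q, lt, t, L⟩ =>
      have h1 : ∀ (u : Fin q → Fin (m + 1)) (S : MI m), S.card ≤ L.sort.length →
          IsPolyIn (fun _ : Jet m => agen) (fun w => ∃ g' : Anti m, w = [g'] ∧
            g'.ant = (Anti.c ⟨q, lt, t, L⟩ : Anti m).ant ∧
            g'.order ≤ (Anti.c ⟨q, lt, t, L⟩ : Anti m).order)
            (reg φ O) r fun _ _ => agen (.c ⟨q, lt, u, S⟩) := fun u S hS => by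
        refine (isPolyIn_single (w := [.c ⟨q, lt, u, S⟩]) ⟨_, rfl, rfl, ?_⟩
          (isJetFun_const 1)).congr fun x _ j => by simp
        simpa [Anti.order] using hS
      have h2 := isPolyIn_eval (Q := AntiAlg m) (v := fun u S _ => agen (.c ⟨q, lt, u, S⟩))
        (good_prolong_trans hφ hψ hOo hO' hO
          (contDiffOn_conDensLaw hφ hψ hOo hO' hO) L.sort t) h1
      exact h2.congr fun x _ j => antiTransport_c x q lt t L
  · exact forall₂_forall_mem (fun a b hab ha => ⟨hab.1.le.trans ha.1, hab.2.trans ha.2⟩) hww' hw.1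
  · rw [forall₂_map_eq Anti.ant (fun a b hab => hab.1) hww', hw.2]

theorem IsPolyIn.dDeltaTransport {P : List (Lab m (m + 1)) → Prop} {F : E m → Jet m → AntiAlg m}
    (hφ : φ ∈ charts m X) (hψ : ψ ∈ charts m X) (hOo : IsOpen O)
    (hO' : O ⊆ φ.source) (hO : O ⊆ ψ.source)
    (hP : ∀ w w', P w → List.Forall₂ (fun l l' => l'.q = l.q ∧ l'.ord.card ≤ l.ord.card) w w' →
      P w')
    (h : IsPolyIn dDelta P (reg ψ O) r F) :
    IsPolyIn dDelta P (reg φ O) r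
      fun x j => BFTheory.antiTransport φ ψ x (F (trans φ ψ x) (jetTr φ ψ x j)) := by
  refine h.transport (R := fun l l' => l'.q = l.q ∧ l'.ord.card ≤ l.ord.card)
    hφ hψ hOo hO' hO _ (fun ⟨q, lt, t, L⟩ => ?_) hP
  have h1 : ∀ (u : Fin q → Fin (m + 1)) (S : MI m), S.card ≤ L.sort.length →
      IsPolyIn dDelta (fun w => ∃ l' : Lab m (m + 1), w = [l'] ∧ l'.q = q ∧ l'.ord.card ≤ L.card)
        (reg φ O) r fun _ j => dDelta j ⟨q, lt, u, S⟩ := fun u S hS => by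
    refine (isPolyIn_single (w := [⟨q, lt, u, S⟩]) ⟨_, rfl, rfl, ?_⟩ (isJetFun_const 1)).congr
      fun x _ j => by simp
    simpa using hS
  have h2 := isPolyIn_eval (Q := AntiAlg m) (v := fun u S j => dDelta j ⟨q, lt, u, S⟩)
    (good_prolong_trans hφ hψ hOo hO' hO
      (contDiffOn_conDensLaw hφ hψ hOo hO' hO) L.sort t) h1
  exact h2.congr fun x hx j => antiTransport_dDelta hφ hψ hOo hO' hO j lt t L hx

end Transport

section Finite

theorem finite_words {G : Type*} {A : Set G} (hA : A.Finite) (n : ℕ) :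
    {w : List G | (∀ g ∈ w, g ∈ A) ∧ w.length ≤ n}.Finite := by
  have := hA.to_subtype
  refine ((List.finite_length_le A n).image (List.map Subtype.val)).subset ?_
  rintro w ⟨h1, h2⟩
  refine ⟨w.attach.map fun g => ⟨g.1, h1 g.1 g.2⟩, by simpa using h2, ?_⟩
  simp [Function.comp_def]

theorem finite_lab (m p r : ℕ) : {l : Lab m p | l.ord.card ≤ r}.Finite := by
  refine (Set.finite_range fun x : (Σ q : Fin p, Fin q → Fin (m + 1)) × {L // L ∈ miLe m r} =>
    (⟨x.1.1, x.1.1.2, x.1.2, x.2⟩ : Lab m p)).subset ?_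
  rintro ⟨q, lt, t, L⟩ h
  exact ⟨(⟨⟨q, lt⟩, t⟩, ⟨L, mem_miLe.mpr h⟩), rfl⟩

theorem finite_anti (m r : ℕ) : {g : Anti m | g.order ≤ r}.Finite := by
  refine (((finite_lab m (m + 1) r).image Anti.c).union
    ((miLe m r).finite_toSet.image Anti.s)).subset ?_
  rintro (L | l) h
  · exact Or.inr ⟨L, mem_miLe.mpr h, rfl⟩
  · exact Or.inl ⟨l, h, rfl⟩

/-- Each letter has antifield number at least one. Together with the order bound this leaves
finitely many words. -/
theorem AntiWord.length_le {T a r : ℕ} {w : List (Anti m)} (h : AntiWord T a r w) :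
    w.length ≤ a := by
  obtain ⟨-, rfl⟩ := h
  induction w with
  | nil => simp
  | cons g w ih =>
    have := one_le_ant g
    simp only [List.length_cons, List.map_cons, List.sum_cons]
    omega

theorem finite_antiWord (m T a r : ℕ) : {w : List (Anti m) | AntiWord T a r w}.Finite :=
  (finite_words (finite_anti m r) a).subset fun _ hw =>
    ⟨fun g hg => (hw.1 g hg).2, hw.length_le⟩

end Finite

end BFTheory

/-! ### Gluing by a partition of unity -/

namespace BFTheory

variable {m : ℕ}

section Glue

open Filter Topology

variable {X : Type*} [TopologicalSpace X] [ChartedSpace (E m) X]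
variable {ρ : SmoothPartitionOfUnity X 𝓘(ℝ, E m) X}
variable {r : ℕ} {φ : OpenPartialHomeomorph X (E m)}

/-- The local expression `Ψ` of a density in the chart at `i`, rewritten in the chart `φ`. -/
noncomputable def changeChart (φ : OpenPartialHomeomorph X (E m)) (i : X)
    (Ψ : E m → Jet m → AntiAlg m) (x : E m) (j : Jet m) : AntiAlg m :=
  jacDet φ (chartAt (E m) i) x • antiTransport φ (chartAt (E m) i) x
    (Ψ (trans φ (chartAt (E m) i) x) (jetTr φ (chartAt (E m) i) x j))

open Classical in
/-- Gluing of local expressions by a partition of unity. -/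
noncomputable def glue (ρ : SmoothPartitionOfUnity X 𝓘(ℝ, E m) X)
    (Ψ : X → E m → Jet m → AntiAlg m) : Fam m X (AntiAlg m) := fun φ x j =>
  if φ ∈ charts m X ∧ x ∈ φ.target then
    ∑ i ∈ ρ.finsupport (φ.symm x), ρ i (φ.symm x) • changeChart φ i (Ψ i) x j
  else 0

theorem glue_of_mem (Ψ : X → E m → Jet m → AntiAlg m) (hφ : φ ∈ charts m X) {x : E m}
    (hx : x ∈ φ.target) (j : Jet m) : glue ρ Ψ φ x j =
      ∑ i ∈ ρ.finsupport (φ.symm x), ρ i (φ.symm x) • changeChart φ i (Ψ i) x j :=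
  if_pos ⟨hφ, hx⟩

theorem glue_of_not_mem (Ψ : X → E m → Jet m → AntiAlg m) {x : E m}
    (h : ¬(φ ∈ charts m X ∧ x ∈ φ.target)) (j : Jet m) : glue ρ Ψ φ x j = 0 :=
  if_neg h

theorem mem_source_of_mem_finsupport (hρ : ρ.IsSubordinate fun i => (chartAt (E m) i).source)
    {i p : X} (hi : i ∈ ρ.finsupport p) : p ∈ (chartAt (E m) i).source :=
  hρ i (subset_closure ((ρ.mem_finsupport p).mp hi))

theorem chartAt_mem_charts [IsManifold 𝓘(ℝ, E m) ∞ X] (i : X) : chartAt (E m) i ∈ charts m X :=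
  IsManifold.chart_mem_maximalAtlas i

theorem isPolyIn_glue {G : Type*} {val : Jet m → G → AntiAlg m} {P : List G → Prop}
    [IsManifold 𝓘(ℝ, E m) ∞ X] (hρ : ρ.IsSubordinate fun i => (chartAt (E m) i).source)
    (hP : {w | P w}.Finite) {Ψ : X → E m → Jet m → AntiAlg m} (hφ : φ ∈ charts m X)
    (h : ∀ i, IsPolyIn val P (reg φ (φ.source ∩ (chartAt (E m) i).source)) r
      fun x j => antiTransport φ (chartAt (E m) i) x
        (Ψ i (trans φ (chartAt (E m) i) x) (jetTr φ (chartAt (E m) i) x j))) :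
    IsPolyIn val P φ.target r (glue ρ Ψ φ) := by
  have hO : ∀ i, IsOpen (φ.source ∩ (chartAt (E m) i).source) := fun i =>
    φ.open_source.inter (chartAt (E m) i).open_source
  refine (isPolyIn_sum_cutoff (ρ := fun i x => ρ i (φ.symm x))
    (I := fun x => ρ.finsupport (φ.symm x))
    (V := fun i => reg φ (φ.source ∩ (chartAt (E m) i).source))
    (F := fun i => changeChart φ i (Ψ i)) hP φ.open_target
    (fun i => isOpen_reg (hO i)) (fun i => ?_) (fun x _ i hi => ?_) (fun x hx => ?_)
    (fun i x hx hxi => ?_) (fun i => ?_)).congr fun x hx j => glue_of_mem Ψ hφ hx j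
  · refine contMDiffOn_iff_contDiffOn.mp ?_
    exact (ρ i).contMDiff.comp_contMDiffOn (contMDiffOn_symm_of_mem_maximalAtlas hφ)
  · by_contra h0
    exact hi ((ρ.mem_finsupport _).mpr h0)
  · exact ⟨ρ.fintsupport (φ.symm x), (φ.continuousAt_symm hx).eventually
      (ρ.eventually_finsupport_subset (φ.symm x))⟩
  · have h1 : φ.symm x ∉ tsupport (ρ i) := fun h1 =>
      hxi ⟨hx, φ.map_target hx, hρ i h1⟩
    exact (φ.continuousAt_symm hx).eventually (notMem_tsupport_iff_eventuallyEq.mp h1)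
  · refine IsPolyIn.mono_set (IsPolyIn.smul (f := fun x _ => jacDet φ (chartAt (E m) i) x)
      (isJetFun_base (contDiffOn_jacDet hφ (chartAt_mem_charts i) (hO i)
        Set.inter_subset_right)) (h i)) Set.inter_subset_right

theorem isPolyIn_glue_anti {T a : ℕ}
    [IsManifold 𝓘(ℝ, E m) ∞ X] (hρ : ρ.IsSubordinate fun i => (chartAt (E m) i).source)
    {Ψ : X → E m → Jet m → AntiAlg m} (hφ : φ ∈ charts m X)
    (h : ∀ i, IsPolyIn (fun _ => agen) (AntiWord T a r) (chartAt (E m) i).target r (Ψ i)) :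
    IsPolyIn (fun _ => agen) (AntiWord T a r) φ.target r (glue ρ Ψ φ) := by
  refine isPolyIn_glue hρ (finite_antiWord m T a r) hφ fun i => ?_
  refine IsPolyIn.antiTransport hφ (chartAt_mem_charts i)
    (φ.open_source.inter (chartAt (E m) i).open_source) Set.inter_subset_left
    Set.inter_subset_right ((h i).mono_set Set.inter_subset_left)

theorem isPolyIn_glue_dDelta {P : List (Lab m (m + 1)) → Prop} (hP : {w | P w}.Finite)
    (hP' : ∀ w w', P w → List.Forall₂ (fun l l' => l'.q = l.q ∧ l'.ord.card ≤ l.ord.card) w w' →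
      P w')
    [IsManifold 𝓘(ℝ, E m) ∞ X] (hρ : ρ.IsSubordinate fun i => (chartAt (E m) i).source)
    {Ψ : X → E m → Jet m → AntiAlg m} (hφ : φ ∈ charts m X)
    (h : ∀ i, IsPolyIn dDelta P (chartAt (E m) i).target r (Ψ i)) :
    IsPolyIn dDelta P φ.target r (glue ρ Ψ φ) := by
  refine isPolyIn_glue hρ hP hφ fun i => ?_
  exact IsPolyIn.dDeltaTransport hφ (chartAt_mem_charts i)
    (φ.open_source.inter (chartAt (E m) i).open_source) Set.inter_subset_left
    Set.inter_subset_right hP' ((h i).mono_set Set.inter_subset_left)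

/-- Both charts use the same weights at the same point of `X`, so the claim reduces, summand by
summand, to the cocycle properties of transport, jets and Jacobian determinants on triple overlaps.
-/
theorem glue_compat [IsManifold 𝓘(ℝ, E m) ∞ X]
    (hρ : ρ.IsSubordinate fun i => (chartAt (E m) i).source)
    (Ψ : X → E m → Jet m → AntiAlg m) {ψ : OpenPartialHomeomorph X (E m)}
    (hφ : φ ∈ charts m X) (hψ : ψ ∈ charts m X) {x : E m} (hx : x ∈ φ.target)
    (hx' : φ.symm x ∈ ψ.source) (j : Jet m) :
    glue ρ Ψ φ x j = jacDet φ ψ x • antiTransport φ ψ x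
      (glue ρ Ψ ψ (trans φ ψ x) (jetTr φ ψ x j)) := by
  have h1 : trans φ ψ x ∈ ψ.target := ψ.map_source hx'
  rw [glue_of_mem Ψ hφ hx, glue_of_mem Ψ hψ h1, symm_trans hx', map_sum, Finset.smul_sum]
  refine Finset.sum_congr rfl fun i hi => ?_
  have hi' := mem_source_of_mem_finsupport hρ hi
  have hi2 := chartAt_mem_charts (m := m) i
  have hO : IsOpen (φ.source ∩ ψ.source ∩ (chartAt (E m) i).source) :=
    (φ.open_source.inter ψ.open_source).inter (chartAt (E m) i).open_source
  have hO1 : φ.source ∩ ψ.source ∩ (chartAt (E m) i).source ⊆ φ.source := fun p hp => hp.1.1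
  have hO2 : φ.source ∩ ψ.source ∩ (chartAt (E m) i).source ⊆ ψ.source := fun p hp => hp.1.2
  have hO3 : φ.source ∩ ψ.source ∩ (chartAt (E m) i).source ⊆ (chartAt (E m) i).source :=
    fun p hp => hp.2
  have hxO : x ∈ reg φ (φ.source ∩ ψ.source ∩ (chartAt (E m) i).source) :=
    ⟨hx, ⟨φ.map_target hx, hx'⟩, hi'⟩
  unfold changeChart
  rw [map_smul, map_smul, antiTransport_antiTransport hφ hψ hi2 hO hO1 hO2 hO3 hxO,
    jetTr_jetTr hφ hψ hi2 hO hO1 hO2 hO3 hxO, trans_trans hx',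
    jacDet_comp hφ hψ hi2 hO hO2 hO3 hxO]
  module

theorem isGradedDensity_glue {T a : ℕ} [IsManifold 𝓘(ℝ, E m) ∞ X]
    (hρ : ρ.IsSubordinate fun i => (chartAt (E m) i).source)
    {Ψ : X → E m → Jet m → AntiAlg m}
    (h : ∀ i, IsPolyIn (fun _ => agen) (AntiWord T a r) (chartAt (E m) i).target r (Ψ i)) :
    IsGradedDensity X T a (glue ρ Ψ) where
  zero _ _ j h := glue_of_not_mem Ψ h j
  poly := ⟨r, fun _ hφ => isPolyIn_glue_anti hρ hφ h⟩
  compat φ hφ ψ hψ x hx hx' j j' hj := by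
    rw [jetTransf_iff.mp hj]
    exact glue_compat hρ Ψ hφ hψ hx hx' j

/-- The weights are functions on `X`, over which `δ` is linear, and `δ` commutes with the change of
chart in each summand. -/
theorem kt_glue (T : ℕ) [IsManifold 𝓘(ℝ, E m) ∞ X]
    (hρ : ρ.IsSubordinate fun i => (chartAt (E m) i).source)
    (Ψ : X → E m → Jet m → AntiAlg m) :
    KT T (glue ρ Ψ) = glue ρ fun i x j => kt T j (Ψ i x j) := by
  funext φ x j
  rw [KT]
  by_cases h : φ ∈ charts m X ∧ x ∈ φ.target
  · rw [glue_of_mem Ψ h.1 h.2, glue_of_mem _ h.1 h.2, map_sum]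
    refine Finset.sum_congr rfl fun i hi => ?_
    have hi' := mem_source_of_mem_finsupport hρ hi
    unfold changeChart
    rw [map_smul, map_smul, kt_antiTransport h.1 (chartAt_mem_charts i)
      (φ.open_source.inter (chartAt (E m) i).open_source) Set.inter_subset_left
      Set.inter_subset_right T j ⟨h.2, φ.map_target h.2, hi'⟩]
  · rw [glue_of_not_mem Ψ h, glue_of_not_mem _ h, map_zero]

theorem glue_congr (hρ : ρ.IsSubordinate fun i => (chartAt (E m) i).source)
    {Ψ Ψ' : X → E m → Jet m → AntiAlg m}
    (h : ∀ i, ∀ x ∈ (chartAt (E m) i).target, ∀ j, Ψ i x j = Ψ' i x j) :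
    glue ρ Ψ = glue ρ Ψ' := by
  funext φ x j
  by_cases hφ : φ ∈ charts m X ∧ x ∈ φ.target
  · rw [glue_of_mem Ψ hφ.1 hφ.2, glue_of_mem _ hφ.1 hφ.2]
    refine Finset.sum_congr rfl fun i hi => ?_
    unfold changeChart
    rw [h i (trans φ (chartAt (E m) i) x)
      ((chartAt (E m) i).map_source (mem_source_of_mem_finsupport hρ hi))]
  · rw [glue_of_not_mem Ψ hφ, glue_of_not_mem _ hφ]

theorem glue_sub (Ψ Ψ' : X → E m → Jet m → AntiAlg m) :
    glue ρ Ψ - glue ρ Ψ' = glue ρ fun i x j => Ψ i x j - Ψ' i x j := by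
  funext φ x j
  rw [Pi.sub_apply, Pi.sub_apply, Pi.sub_apply]
  by_cases hφ : φ ∈ charts m X ∧ x ∈ φ.target
  · rw [glue_of_mem Ψ hφ.1 hφ.2, glue_of_mem _ hφ.1 hφ.2, glue_of_mem _ hφ.1 hφ.2,
      ← Finset.sum_sub_distrib]
    refine Finset.sum_congr rfl fun i hi => ?_
    unfold changeChart
    rw [map_sub, smul_sub, smul_sub]
  · rw [glue_of_not_mem Ψ hφ, glue_of_not_mem _ hφ, glue_of_not_mem _ hφ, sub_zero]

/-- By compatibility every summand is the weight times the density itself, and the weights add up to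
one. -/
theorem IsGradedDensity.glue_eq {T a : ℕ} [IsManifold 𝓘(ℝ, E m) ∞ X]
    (hρ : ρ.IsSubordinate fun i => (chartAt (E m) i).source) {Φ : Fam m X (AntiAlg m)}
    (hΦ : IsGradedDensity X T a Φ) : glue ρ (fun i => Φ (chartAt (E m) i)) = Φ := by
  funext φ x j
  by_cases hφ : φ ∈ charts m X ∧ x ∈ φ.target
  · rw [glue_of_mem _ hφ.1 hφ.2]
    have h1 : ∀ i ∈ ρ.finsupport (φ.symm x), ρ i (φ.symm x) •
        changeChart φ i (Φ (chartAt (E m) i)) x j = ρ i (φ.symm x) • Φ φ x j := fun i hi => by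
      rw [hΦ.compat φ hφ.1 _ (chartAt_mem_charts i) x hφ.2
        (mem_source_of_mem_finsupport hρ hi) j _ (jetTransf_iff.mpr rfl)]
      rfl
    rw [Finset.sum_congr rfl h1, ← Finset.sum_smul, ρ.sum_finsupport _ (Set.mem_univ _), one_smul]
  · rw [glue_of_not_mem _ hφ, hΦ.zero φ x j hφ]

end Glue

end BFTheory

/-! ### Cycles, boundaries and Noether identities on the manifold -/

namespace BFTheory

variable {m : ℕ}

section KoszulTateFamilies

variable {U : Set (E m)} {r : ℕ}

theorem isJetFun_eulA (L : MI m) (h : L.card + 1 ≤ r) : IsJetFun U r fun _ j => eulA j L := by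
  unfold eulA
  refine IsJetFun.sum fun μ _ => IsJetFun.sum fun t _ => IsJetFun.const_mul _ (isJetFun_jetB ?_)
  simpa using h

theorem isJetFun_eulB (t : Fin m → Fin (m + 1)) (L : MI m) (h : L.card + 1 ≤ r) :
    IsJetFun U r fun _ j => eulB j t L := by
  unfold eulB
  refine IsJetFun.neg (IsJetFun.sum fun μ _ => IsJetFun.const_mul _ (isJetFun_jetA ?_))
  simpa using h

theorem isPolyIn_kt_agen {T : ℕ} {g : Anti m} (hT : g.ant ≤ T) (hr : g.order ≤ r) :
    IsPolyIn (fun _ => agen) (fun w => (∀ g' ∈ w, g'.ant ≤ T ∧ g'.order ≤ r + 1) ∧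
      (w.map Anti.ant).sum + 1 = g.ant) U (r + 1) fun _ j => kt T j (agen g) := by
  have h0 : ∀ c : E m → Jet m → ℝ, g.ant = 1 → IsJetFun U (r + 1) c →
      IsPolyIn (fun _ => agen) (fun w => (∀ g' ∈ w, g'.ant ≤ T ∧ g'.order ≤ r + 1) ∧
        (w.map Anti.ant).sum + 1 = g.ant) U (r + 1) fun x j => algebraMap ℝ (AntiAlg m) (c x j) :=
    fun c hg hc => (isPolyIn_single (w := []) (by simp [hg]) hc).congr fun x _ j => by
      simp [Algebra.smul_def]
  match g with
  | .s L =>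
    refine (h0 (fun _ j => eulA j L) rfl (isJetFun_eulA L (Nat.succ_le_succ hr))).congr
      fun x _ j => ?_
    rw [kt_agen_eq j hT, ktf_s]
  | .c ⟨q, lt, t, L⟩ =>
    by_cases hq : q < m
    · refine (isPolyIn_sum (s := Finset.univ) (val := fun _ : Jet m => agen)
        (F := fun μ _ _ => agen (.c ⟨q + 1, Nat.succ_lt_succ hq, Fin.cons μ t, μ ::ₘ L⟩))
        fun μ _ => ?_).congr fun x _ j => ?_
      · refine (isPolyIn_single (w := [.c ⟨q + 1, Nat.succ_lt_succ hq, Fin.cons μ t, μ ::ₘ L⟩])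
          ⟨?_, ?_⟩ (isJetFun_const 1)).congr fun x _ j => by simp
        · simp only [List.mem_singleton, forall_eq, Anti.order, Multiset.card_cons, Anti.ant]
            at hr hT ⊢
          omega
        · simp only [Anti.ant, List.map_cons, List.map_nil, List.sum_cons, List.sum_nil]
          omega
      · rw [kt_agen_eq j hT, ktf_c, dDelta, dif_pos hq]
    · obtain rfl : q = m := by omega
      refine (h0 (fun _ j => eulB j t L) ?_ (isJetFun_eulB t L (Nat.succ_le_succ hr))).congr
        fun x _ j => ?_
      · simp only [Anti.ant]
        omega
      · rw [kt_agen_eq j hT, ktf_c, dDelta_top]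

theorem isPolyIn_kt_word {T : ℕ} {w : List (Anti m)} (hw : ∀ g ∈ w, g.ant ≤ T ∧ g.order ≤ r) :
    IsPolyIn (fun _ => agen) (fun w' => (∀ g' ∈ w', g'.ant ≤ T ∧ g'.order ≤ r + 1) ∧
      (w'.map Anti.ant).sum + 1 = (w.map Anti.ant).sum) U (r + 1)
      fun _ j => kt T j (w.map agen).prod := by
  induction w with
  | nil =>
    refine isPolyIn_zero.congr fun x _ j => ?_
    rw [List.map_nil, List.prod_nil, (kt_isOddRight T j).map_one]
  | cons g w ih =>
    have hg := hw g (by simp)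
    have hw' : ∀ g ∈ w, g.ant ≤ T ∧ g.order ≤ r := fun g hg => hw g (by simp [hg])
    have h1 : IsPolyIn (U := U) (r := r + 1) (fun _ : Jet m => agen) (fun w' => w' = [g])
        fun _ _ => agen g :=
      (isPolyIn_single (w := [g]) (P := (· = [g])) rfl (isJetFun_const 1)).congr fun x _ j => by simp
    have h2 : IsPolyIn (U := U) (r := r + 1) (fun _ : Jet m => agen) (fun w' => w' = w)
        fun _ _ => parityInv Anti.ant Anti.Alt Anti.Alt.ant_eq (w.map agen).prod :=
      (isPolyIn_single (w := w) (P := (· = w)) rfl (isJetFun_const ((-1 : ℝ) ^ (w.map Anti.ant).sum))).congr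
        fun x _ j => parityInv_word w
    have h3 := h1.mul (ih hw') (P'' := fun w' => (∀ g' ∈ w', g'.ant ≤ T ∧ g'.order ≤ r + 1) ∧
      (w'.map Anti.ant).sum + 1 = ((g :: w).map Anti.ant).sum) (by
        rintro _ w' rfl ⟨h4, h5⟩
        refine ⟨?_, ?_⟩
        · simp only [List.singleton_append, List.mem_cons, forall_eq_or_imp]
          exact ⟨⟨hg.1, by omega⟩, h4⟩
        · simp only [List.singleton_append, List.map_cons, List.sum_cons]
          omega)
    have h4 := (isPolyIn_kt_agen (U := U) hg.1 hg.2).mul h2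
      (P'' := fun w' => (∀ g' ∈ w', g'.ant ≤ T ∧ g'.order ≤ r + 1) ∧
      (w'.map Anti.ant).sum + 1 = ((g :: w).map Anti.ant).sum) (by
        rintro v _ ⟨h4, h5⟩ rfl
        refine ⟨?_, ?_⟩
        · simp only [List.mem_append]
          rintro g' (h | h)
          · exact h4 g' h
          · exact ⟨(hw' g' h).1, by have := (hw' g' h).2; omega⟩
        · simp only [List.map_append, List.sum_append, List.map_cons, List.sum_cons]
          omega)
    refine (h3.add h4).congr fun x _ j => ?_
    rw [List.map_cons, List.prod_cons, (kt_isOddRight T j).map_mul]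

theorem IsPolyIn.kt {T a : ℕ} {F : E m → Jet m → AntiAlg m}
    (h : IsPolyIn (fun _ => agen) (AntiWord T (a + 1) r) U r F) :
    IsPolyIn (fun _ => agen) (AntiWord T a (r + 1)) U (r + 1)
      fun x j => BFTheory.kt T j (F x j) := by
  refine h.bind (Nat.le_succ r) (fun _ j => BFTheory.kt T j) fun w hw => ?_
  exact (isPolyIn_kt_word hw.1).mono (fun w' hw' => ⟨hw'.1, by have := hw'.2; have := hw.2; omega⟩)
    le_rfl

theorem IsPolyIn.kt_eq {T a : ℕ} {F : E m → Jet m → AntiAlg m}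
    (h : IsPolyIn (fun _ => agen) (AntiWord T a r) U r F) {x : E m} (hx : x ∈ U) (j : Jet m) :
    BFTheory.kt T j (F x j) = ktf j (F x j) := by
  obtain ⟨S, c, h1, h2⟩ := h
  rw [h2 x hx j, map_sum, map_sum]
  refine Finset.sum_congr rfl fun w hw => ?_
  rw [map_smul, map_smul]
  congr 1
  exact (kt_isOddRight T j).word_eq (kt_isOddRight (m + 1) j)
    fun g hg => kt_agen_eq j ((h1 w hw).1.1 g hg).1

/-- `δ` lowers the antifield number of a letter, so its value stays in the range where the truncated
and the full differential agree. Letters beyond the range are sent to zero. -/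
theorem kt_kt (T : ℕ) (j : Jet m) (u : AntiAlg m) : kt T j (kt T j u) = 0 := by
  refine (kt_isOddRight T j).sq_zero (fun g => ?_) u
  by_cases hg : g.ant ≤ T
  · have h1 : kt T j (agen g) = ktf j (agen g) := kt_agen_eq j hg
    have h2 : ∀ v ∈ genSpan m fun g' => g'.ant + 1 = g.ant, kt T j v = ktf j v := fun v hv => by
      induction hv using Submodule.span_induction with
      | zero => simp
      | add a b _ _ ha hb => rw [map_add, ha, hb, map_add]
      | smul c a _ ha => rw [map_smul, ha, map_smul]
      | mem x hx =>
        obtain ⟨g', hg', rfl⟩ := hx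
        have : g'.ant + 1 = g.ant := hg'
        exact kt_agen_eq j (by omega)
    rcases ktf_agen_cases j g with ⟨c, hc⟩ | hc
    · rw [show kt T j (gen _ _ g) = _ from h1.trans hc, (kt_isOddRight T j).map_algebraMap]
    · rw [show kt T j (gen _ _ g) = _ from h1, h2 _ hc, ktf_ktf]
  · rw [show kt T j (gen _ _ g) = 0 from (kt_agen T j g).trans (if_neg hg), map_zero]

end KoszulTateFamilies

section Manifold

variable {X : Type*} [TopologicalSpace X]

theorem KT_KT (T : ℕ) (Φ : Fam m X (AntiAlg m)) : KT T (KT T Φ) = 0 := by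
  funext φ x j
  exact kt_kt T j _

theorem kt_apply_eq_zero {T : ℕ} {Φ : Fam m X (AntiAlg m)} (h : KT T Φ = 0)
    (φ : OpenPartialHomeomorph X (E m)) (x : E m) (j : Jet m) : kt T j (Φ φ x j) = 0 :=
  congrFun (congrFun (congrFun h φ) x) j

variable [ChartedSpace (E m) X]

theorem IsGradedDensity.kt {T a : ℕ} [IsManifold 𝓘(ℝ, E m) ∞ X] {Φ : Fam m X (AntiAlg m)}
    (h : IsGradedDensity X T (a + 1) Φ) : IsGradedDensity X T a (KT T Φ) where
  zero φ x j hx := by rw [KT, h.zero φ x j hx, map_zero]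
  poly := by
    obtain ⟨r, hr⟩ := h.poly
    exact ⟨r + 1, fun φ hφ => IsPolyIn.kt (hr φ hφ)⟩
  compat φ hφ ψ hψ x hx hx' j j' hj := by
    rw [KT, KT, h.compat φ hφ ψ hψ x hx hx' j j' hj, map_smul, jetTransf_iff.mp hj,
      kt_antiTransport hφ hψ (φ.open_source.inter ψ.open_source) Set.inter_subset_left
        Set.inter_subset_right T j ⟨hx, φ.map_target hx, hx'⟩]

variable [IsManifold 𝓘(ℝ, E m) ∞ X] [T2Space X] [SecondCountableTopology X]

variable (m X) in
theorem exists_subordinate_partition : ∃ ρ : SmoothPartitionOfUnity X 𝓘(ℝ, E m) X,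
    ρ.IsSubordinate fun i => (chartAt (E m) i).source := by
  have := ChartedSpace.locallyCompactSpace (E m) X
  exact SmoothPartitionOfUnity.exists_isSubordinate_chartAt_source 𝓘(ℝ, E m) X

/-- The parameters separate three ranges of antifields: `T` for the given cycle, `T₁` for the words
that can really occur in it, and `T₂` for the primitive, which the local homotopy bounds by `T₁ +
1`. -/
theorem isBoundary_of_cycle {T T₁ T₂ a : ℕ} (hT₁ : 1 ≤ T₁) (ha : 1 ≤ a)
    (h₁ : ∀ r (w : List (Anti m)), AntiWord T a r w → AntiWord T₁ a r w)
    (h₂ : ∀ r (w : List (Anti m)), AntiWord (T₁ + 1) (a + 1) r w → AntiWord T₂ (a + 1) r w)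
    {Φ : Fam m X (AntiAlg m)} (hΦ : IsGradedDensity X T a Φ) (h0 : KT T Φ = 0) :
    IsBoundary X T₂ a Φ := by
  obtain ⟨ρ, hρ⟩ := exists_subordinate_partition m X
  obtain ⟨r, hr⟩ := hΦ.poly
  have hp : ∀ i : X, IsPolyIn (fun _ => agen) (AntiWord T a r) (chartAt (E m) i).target r
    (Φ (chartAt (E m) i)) := fun i => hr _ (chartAt_mem_charts i)
  have hloc : ∀ i : X, ∃ Ψ, IsPolyIn (fun _ => agen) (AntiWord (T₁ + 1) (a + 1) r)
      (chartAt (E m) i).target r Ψ ∧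
        ∀ x ∈ (chartAt (E m) i).target, ∀ j, ktf j (Ψ x j) = Φ (chartAt (E m) i) x j := fun i =>
    local_exact (chartAt (E m) i).open_target hT₁ ha ((hp i).mono (h₁ r) le_rfl)
      fun x hx j => ((hp i).kt_eq hx j).symm.trans (kt_apply_eq_zero h0 _ x j)
  choose Ψ hΨ hΨ' using hloc
  have hΨ'' := fun i => (hΨ i).mono (h₂ r) le_rfl
  refine ⟨glue ρ Ψ, isGradedDensity_glue hρ hΨ'', ?_⟩
  rw [kt_glue T₂ hρ, ← hΦ.glue_eq hρ]
  exact glue_congr hρ fun i x hx j =>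
    ((hΨ'' i).kt_eq hx j |>.trans (hΨ' i x hx j)).symm

/-- A change of coordinates mixes labels with the same number of tensor indices, so the predicate
may depend on these numbers only. The bound on the length makes the set of words finite, as gluing
requires. -/
theorem factorsThroughDelta_of_local {T a : ℕ} (P : List (Lab m (m + 1)) → Prop) (n : ℕ)
    (hP : ∀ w, P w → w.length ≤ n)
    (hP' : ∀ w w' : List (Lab m (m + 1)), P w → w'.map Lab.q = w.map Lab.q → P w')
    {Φ : Fam m X (AntiAlg m)} (hΦ : IsGradedDensity X T a Φ) {r : ℕ}
    (h : ∀ i : X, ∃ Ψ, IsPolyIn (fun _ => agen) (AntiWord T (a + 1) r)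
      (chartAt (E m) i).target r Ψ ∧
      IsPolyIn dDelta (fun w => P w ∧ ∀ l ∈ w, l.ord.card ≤ r) (chartAt (E m) i).target r
        fun x j => Φ (chartAt (E m) i) x j - ktf j (Ψ x j)) :
    ∃ Ψ, IsGradedDensity X T (a + 1) Ψ ∧ FactorsThroughDelta X P (Φ - KT T Ψ) := by
  obtain ⟨ρ, hρ⟩ := exists_subordinate_partition m X
  choose Ψ hΨ hΨ' using h
  refine ⟨glue ρ Ψ, isGradedDensity_glue hρ hΨ, r, fun φ hφ => ?_⟩
  have h1 : Φ - KT T (glue ρ Ψ) =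
      glue ρ fun i x j => Φ (chartAt (E m) i) x j - ktf j (Ψ i x j) := by
    conv_lhs => rw [← hΦ.glue_eq hρ, kt_glue T hρ, glue_sub]
    exact glue_congr hρ fun i x hx j => by rw [(hΨ i).kt_eq hx j]
  rw [h1]
  refine isPolyIn_glue_dDelta ?_ (fun w w' hw hww' => ⟨hP' w w' hw.1 ?_, ?_⟩) hρ hφ hΨ'
  · exact (finite_words (finite_lab m (m + 1) r) n).subset fun w hw => ⟨hw.2, hP w hw.1⟩
  · exact forall₂_map_eq Lab.q (fun a b hab => hab.1) hww'
  · exact forall₂_forall_mem (fun a b hab ha => hab.2.trans ha) hww' hw.2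

theorem isBoundary_succ {T : ℕ} (hT : 1 ≤ T) {Φ : Fam m X (AntiAlg m)}
    (hΦ : IsGradedDensity X T (T + 1) Φ) (h0 : KT T Φ = 0) : IsBoundary X (T + 1) (T + 1) Φ :=
  isBoundary_of_cycle hT (Nat.succ_pos T) (fun _ _ h => h) (fun _ _ h => h) hΦ h0

theorem homologyRegular (M : ℕ) : HomologyRegular m M X :=
  fun _ hT _ _ hΦ h0 => isBoundary_succ hT hΦ h0

/-- A word of antifield number `a ≤ T` has only letters of number at most `T`. So antifields of
number `T + 1` are absent from the cycle and available for its primitive. -/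
theorem exactAt_of_le {T a : ℕ} (hT : 1 ≤ T) (ha : 1 ≤ a) (h : a ≤ T) :
    ExactAt m (T + 1) a X := fun Φ hΦ h0 => by
  refine isBoundary_of_cycle hT ha (fun r w hw => ⟨fun g hg => ⟨?_, (hw.1 g hg).2⟩, hw.2⟩)
    (fun _ _ h => h) hΦ h0
  have := ant_le_sum hg
  have := hw.2
  omega

/-- All antifield numbers are at most `n`, so at the last stage the bound on the primitive is no
restriction. -/
theorem exactAt_top {a : ℕ} (ha : 1 ≤ a) : ExactAt m (m + 1) a X := fun _ hΦ h0 =>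
  isBoundary_of_cycle (Nat.succ_pos m) ha (fun _ _ h => h)
    (fun _ _ hw => ⟨fun g hg => ⟨ant_le g, (hw.1 g hg).2⟩, hw.2⟩) hΦ h0

theorem completeNoether {T : ℕ} (hT : 1 ≤ T) : CompleteNoether m T X := fun Φ hΦ h0 => by
  obtain ⟨r, hr⟩ := hΦ.poly
  refine factorsThroughDelta_of_local _ 1 ?_ ?_ hΦ (r := r) fun i => ?_
  · rintro _ ⟨l, rfl, -⟩
    simp
  · rintro _ w' ⟨l, rfl, hl⟩ h
    obtain ⟨l', rfl⟩ : ∃ l', w' = [l'] := by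
      rw [← List.length_eq_one_iff]
      simpa using congrArg List.length h
    refine ⟨l', rfl, ?_⟩
    have : l'.q = l.q := by simpa using h
    omega
  · have hp := hr _ (chartAt_mem_charts i)
    exact local_complete (chartAt (E m) i).open_target hT hp
      fun x hx j => (IsPolyIn.kt_eq hp hx j).symm.trans (kt_apply_eq_zero h0 _ x j)

theorem exists_factor {T : ℕ} (hT : 1 ≤ T) {Φ : Fam m X (AntiAlg m)}
    (hΦ : IsGradedDensity X T (T + 1) Φ) (h0 : KT T Φ = 0) :
    ∃ Ψ, IsGradedDensity X T (T + 2) Ψ ∧ FactorsThroughDelta X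
      (fun w => (∀ l ∈ w, m + 1 ≤ l.q + (T + 1)) ∧ (w.map fun l => m - l.q).sum = T + 1)
      (Φ - KT T Ψ) := by
  obtain ⟨r, hr⟩ := hΦ.poly
  -- The bound on the length, provided by `local_factor`, is carried along only to have finitely
  -- many words in the gluing, and is dropped at the end.
  let P : List (Lab m (m + 1)) → Prop := fun w =>
    ((∀ l ∈ w, m + 1 ≤ l.q + (T + 1)) ∧ (w.map fun l => m - l.q).sum = T + 1) ∧ w.length ≤ 2
  have hP : ∀ w w' : List (Lab m (m + 1)), P w → w'.map Lab.q = w.map Lab.q → P w' :=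
      fun w w' hw hww' => by
    have h1 : ∀ v : List (Lab m (m + 1)), (v.map fun l => m - l.q) =
        (v.map Lab.q).map fun q => m - q := fun v => by simp
    have h2 : ∀ v : List (Lab m (m + 1)), (∀ l ∈ v, m + 1 ≤ l.q + (T + 1)) ↔
        ∀ q ∈ v.map Lab.q, m + 1 ≤ q + (T + 1) := fun v => by simp
    have h3 : w'.length = w.length := by simpa using congrArg List.length hww'
    simp only [P] at hw ⊢
    rw [h2, h1, hww', ← h1, ← h2, h3]
    exact hw
  obtain ⟨Ψ, hΨ, r', h⟩ := factorsThroughDelta_of_local P 2 (fun w hw => hw.2) hP hΦ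
    (r := r) fun i => local_factor (chartAt (E m) i).open_target hT
      (hr _ (chartAt_mem_charts i)) fun x hx j => (IsPolyIn.kt_eq (hr _ (chartAt_mem_charts i))
        hx j).symm.trans (kt_apply_eq_zero h0 _ x j)
  exact ⟨Ψ, hΨ, r', fun φ hφ => (h φ hφ).mono (fun w hw => ⟨hw.1.1, hw.2⟩) le_rfl⟩

theorem stageReducible (N : ℕ) : StageReducible m N X where
  map_chain _ _ h := h.kt
  nilpotent _ Φ _ := KT_KT _ Φ
  complete _ hT _ := completeNoether hT
  exact_at _ ha h := exactAt_of_le (Nat.succ_pos N) ha h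
  regular := homologyRegular _

end Manifold

end BFTheory

/-! ### Weak derivatives and the ghost part of the ascent operator -/

namespace BFTheory

variable {m : ℕ}

section WeakDeriv

variable {Q Q' : Type*} [AddCommGroup Q] [Module ℝ Q] [AddCommGroup Q'] [Module ℝ Q']

/-- `v` is the derivative at `0` of a curve with respect to all linear functionals. -/
def HasWeakDeriv (F : ℝ → Q) (v : Q) : Prop :=
  ∀ ℓ : Module.Dual ℝ Q, HasDerivAt (fun s => ℓ (F s)) (ℓ v) 0

theorem HasWeakDeriv.eq {F : ℝ → Q} {v : Q} (h : HasWeakDeriv F v) : weakDeriv F = v := by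
  have hex : ∃ v : Q, ∀ ℓ : Module.Dual ℝ Q, HasDerivAt (fun s => ℓ (F s)) (ℓ v) 0 := ⟨v, h⟩
  rw [weakDeriv, dif_pos hex, ← sub_eq_zero, ← Module.forall_dual_apply_eq_zero_iff ℝ]
  intro ℓ
  rw [map_sub, (hex.choose_spec ℓ).unique (h ℓ), sub_self]

theorem HasWeakDeriv.map {F : ℝ → Q} {v : Q} (h : HasWeakDeriv F v) (L : Q →ₗ[ℝ] Q') :
    HasWeakDeriv (fun s => L (F s)) (L v) := fun ℓ => h (ℓ.comp L)

theorem HasWeakDeriv.add {F F' : ℝ → Q} {v v' : Q} (h : HasWeakDeriv F v)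
    (h' : HasWeakDeriv F' v') : HasWeakDeriv (fun s => F s + F' s) (v + v') := fun ℓ => by
  simp only [map_add]
  exact (h ℓ).add (h' ℓ)

theorem HasWeakDeriv.sum {ι : Type*} {t : Finset ι} {F : ι → ℝ → Q} {v : ι → Q}
    (h : ∀ i ∈ t, HasWeakDeriv (F i) (v i)) :
    HasWeakDeriv (fun s => ∑ i ∈ t, F i s) (∑ i ∈ t, v i) := fun ℓ => by
  simp only [map_sum]
  exact HasDerivAt.fun_sum fun i hi => h i hi ℓ

theorem HasDerivAt.smul_weak {c : ℝ → ℝ} {c' : ℝ} (h : HasDerivAt c c' 0) (u : Q) :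
    HasWeakDeriv (fun s => c s • u) (c' • u) := fun ℓ => by
  simp only [map_smul, smul_eq_mul]
  exact h.mul_const _

/-- The derivative of a polynomial in odd variables along a jet direction. -/
noncomputable def pdir (e : Jet m) (F : E m → Jet m → Q) (x : E m) (j : Jet m) : Q :=
  weakDeriv fun s : ℝ => F x (j + s • e)

end WeakDeriv

section Poly

variable {G Q : Type*} [Ring Q] [Algebra ℝ Q] {val : G → Q} {P : List G → Prop}
variable {U : Set (E m)} {r : ℕ} {F : E m → Jet m → Q}

theorem hasWeakDeriv_sum (hU : IsOpen U) {S : Finset (List G)} {c : List G → E m → Jet m → ℝ}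
    (h1 : ∀ w ∈ S, IsJetFun U r (c w))
    (h2 : ∀ x ∈ U, ∀ j, F x j = ∑ w ∈ S, c w x j • (w.map val).prod) {x : E m} (hx : x ∈ U)
    (j e : Jet m) : HasWeakDeriv (fun s : ℝ => F x (j + s • e))
      (∑ w ∈ S, jdir e (c w) x j • (w.map val).prod) := by
  simp only [h2 x hx]
  exact HasWeakDeriv.sum fun w hw => ((h1 w hw).hasDerivAt hU hx j e).smul_weak _

theorem IsPolyIn.hasWeakDeriv (hU : IsOpen U) (h : IsPolyIn (fun _ => val) P U r F) {x : E m}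
    (hx : x ∈ U) (j e : Jet m) : HasWeakDeriv (fun s : ℝ => F x (j + s • e)) (pdir e F x j) := by
  obtain ⟨S, c, h1, h2⟩ := h
  have h3 := hasWeakDeriv_sum hU (fun w hw => (h1 w hw).2) h2 hx j e
  rw [pdir, h3.eq]
  exact h3

theorem IsPolyIn.pdir (hU : IsOpen U) (h : IsPolyIn (fun _ => val) P U r F) (e : Jet m) :
    IsPolyIn (fun _ => val) P U r (pdir e F) := by
  obtain ⟨S, c, h1, h2⟩ := h
  exact ⟨S, fun w => jdir e (c w), fun w hw => ⟨(h1 w hw).1, (h1 w hw).2.jdir hU e⟩,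
    fun x hx j => (hasWeakDeriv_sum hU (fun w hw => (h1 w hw).2) h2 hx j e).eq⟩

theorem IsPolyIn.pdir_comm (hU : IsOpen U) (h : IsPolyIn (fun _ => val) P U r F) {x : E m}
    (hx : x ∈ U) (j e e' : Jet m) :
    BFTheory.pdir e (BFTheory.pdir e' F) x j = BFTheory.pdir e' (BFTheory.pdir e F) x j := by
  obtain ⟨S, c, h1, h2⟩ := h
  have h3 : ∀ e e', BFTheory.pdir e (BFTheory.pdir e' F) x j =
      ∑ w ∈ S, BFTheory.jdir e (BFTheory.jdir e' (c w)) x j • (w.map val).prod := fun e e' =>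
    (hasWeakDeriv_sum hU (fun w hw => (h1 w hw).2.jdir hU e')
      (fun x hx j => (hasWeakDeriv_sum hU (fun w hw => (h1 w hw).2) h2 hx j e').eq) hx j e).eq
  rw [h3, h3]
  exact Finset.sum_congr rfl fun w hw => by rw [(h1 w hw).2.jdir_comm hU hx]

theorem IsPolyIn.pdir_sum (hU : IsOpen U) (h : IsPolyIn (fun _ => val) P U r F) {x : E m}
    (hx : x ∈ U) (j e : Jet m) {ι : Type*} (s : Finset ι) (c : ι → ℝ) (d : ι → Jet m)
    (he : trunc r e = ∑ i ∈ s, c i • trunc r (d i)) :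
    BFTheory.pdir e F x j = ∑ i ∈ s, c i • BFTheory.pdir (d i) F x j := by
  obtain ⟨S, c', h1, h2⟩ := h
  have h3 : ∀ e, BFTheory.pdir e F x j =
      ∑ w ∈ S, BFTheory.jdir e (c' w) x j • (w.map val).prod := fun e =>
    (hasWeakDeriv_sum hU (fun w hw => (h1 w hw).2) h2 hx j e).eq
  simp only [h3, Finset.smul_sum]
  rw [Finset.sum_comm]
  refine Finset.sum_congr rfl fun w hw => ?_
  rw [(h1 w hw).2.jdir_sum hU hx j e s c d he, Finset.sum_smul]
  simp only [mul_smul]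

end Poly

section GhostAlgebra

theorem GhostAlt.num_eq (a b : Lab m m) (z : ℤ) (h : GhostAlt a b z) :
    ghostNum a = ghostNum b := by
  obtain ⟨q, lt, t, L, σ⟩ := h
  rfl

theorem gaugeVar_mem_span (q : ℕ) (h : q ≤ m) (v : Fin q → Fin (m + 1)) (L : MI m) :
    gaugeVar q h v L ∈
      Submodule.span ℝ (gen ghostNum GhostAlt '' {g | ghostNum g = m + 1 - q}) := by
  cases q with
  | zero => exact Submodule.zero_mem _
  | succ q =>
    refine Submodule.neg_mem _ (Submodule.smul_mem _ _ (Submodule.sum_mem _ fun σ _ =>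
      Submodule.smul_mem _ _ (Submodule.subset_span (Set.mem_image_of_mem _ ?_))))
    simp only [ghostNum, Set.mem_ofPred_eq]
    omega

theorem ghostDer_ggen (l : Lab m m) : ghostDer m (ggen l) = gaugeVar l.q l.lt.le l.idx l.ord :=
  leftDer_gen ..

theorem ghostDer_isOddLeft : IsOddLeft GhostAlt.num_eq (ghostDer m) := by
  refine leftDer_isOddLeft _ _ _ fun ⟨q, lt, v, L⟩ => ?_
  rw [parityInv_span (gaugeVar_mem_span q lt.le v L)]
  rw [show ghostNum (⟨q, lt, v, L⟩ : Lab m m) + 1 = m + 1 - q from (Nat.sub_add_comm lt.le).symm]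

theorem tail_comp_cons {q : ℕ} (u : Fin (q + 1) → Fin (m + 1)) (τ : Equiv.Perm (Fin q)) :
    Fin.tail u ∘ τ = Fin.tail (u ∘ Equiv.Perm.decomposeFin.symm (0, τ)) := by
  funext i
  simp [Fin.tail, Equiv.Perm.decomposeFin_symm_apply_succ]

/-- Both steps are antisymmetrized derivatives, so this is `d ∘ d = 0`. With fewer than two indices
no second derivative arises. -/
theorem ghostDer_gaugeVar (q : ℕ) (h : q ≤ m) (v : Fin q → Fin (m + 1)) (L : MI m) :
    ghostDer m (gaugeVar q h v L) = 0 := by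
  cases q with
  | zero => simp [gaugeVar]
  | succ q =>
    cases q with
    | zero => simp [gaugeVar, ghostDer_ggen]
    | succ q =>
      -- A transposition of the first two positions changes the sign of the permutation and fixes
      -- the generator, as the two derivative indices enter through a multiset.
      let f : Equiv.Perm (Fin (q + 2)) → GhostAlg m := fun σ =>
        ((Equiv.Perm.sign σ : ℤ) : ℝ) • ggen ⟨q, by omega, Fin.tail (Fin.tail (v ∘ σ)),
          v (σ 1) ::ₘ v (σ 0) ::ₘ L⟩
      have hf : ∑ σ, f σ = 0 := by
        have h1 : ∑ σ, f σ = -∑ σ, f σ := by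
          rw [← Finset.sum_neg_distrib]
          conv_lhs => rw [← Equiv.sum_comp (Equiv.mulRight (Equiv.swap 0 1))]
          refine Finset.sum_congr rfl fun σ _ => ?_
          have h2 : Fin.tail (Fin.tail (v ∘ (σ * Equiv.swap 0 1 : Equiv.Perm (Fin (q + 2))))) =
              Fin.tail (Fin.tail (v ∘ σ)) := by
            funext i
            simp only [Fin.tail, Function.comp_apply, Equiv.Perm.mul_apply]
            rw [Equiv.swap_apply_of_ne_of_ne (Fin.succ_ne_zero _)]
            exact fun h => Fin.succ_ne_zero i (Fin.succ_injective _ h)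
          have h3 : v ((σ * Equiv.swap 0 1 : Equiv.Perm (Fin (q + 2))) 1) ::ₘ
              v ((σ * Equiv.swap 0 1 : Equiv.Perm (Fin (q + 2))) 0) ::ₘ L =
              v (σ 1) ::ₘ v (σ 0) ::ₘ L := by
            rw [Equiv.Perm.mul_apply, Equiv.Perm.mul_apply, Equiv.swap_apply_left,
              Equiv.swap_apply_right, Multiset.cons_swap]
          simp only [f, Equiv.coe_mulRight]
          rw [h2, h3, Equiv.Perm.sign_mul, Equiv.Perm.sign_swap (by simp)]
          push_cast
          module
        have h2 : (2 : ℝ) • ∑ σ, f σ = 0 := by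
          rw [two_smul]
          nth_rewrite 1 [h1]
          abel
        simpa using h2
      -- The inner antisymmetrization is absorbed: for each `τ` the outer sum is reindexed by the
      -- extension of `τ` that fixes position `0`.
      have h4 : ∀ τ : Equiv.Perm (Fin (q + 1)), ∑ σ : Equiv.Perm (Fin (q + 2)),
          ((Equiv.Perm.sign σ : ℤ) : ℝ) • ((Equiv.Perm.sign τ : ℤ) : ℝ) •
            ggen (m := m) ⟨q, by omega, Fin.tail (Fin.tail (v ∘ σ) ∘ τ),
              Fin.tail (v ∘ σ) (τ 0) ::ₘ v (σ 0) ::ₘ L⟩ = 0 := fun τ => by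
        refine Eq.trans ?_ hf
        rw [← Equiv.sum_comp (Equiv.mulRight (Equiv.Perm.decomposeFin.symm (0, τ))) f]
        refine Finset.sum_congr rfl fun σ _ => ?_
        simp only [f, Equiv.coe_mulRight]
        rw [tail_comp_cons, Equiv.Perm.sign_mul, Equiv.Perm.decomposeFin.symm_sign, smul_smul]
        have h5 : (σ * Equiv.Perm.decomposeFin.symm (0, τ)) 0 = σ 0 := by simp
        have h6 : v ((σ * Equiv.Perm.decomposeFin.symm (0, τ)) 1) =
            Fin.tail (v ∘ σ) (τ 0) := by
          have := Equiv.Perm.decomposeFin_symm_apply_succ τ 0 0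
          rw [Equiv.Perm.mul_apply, ← Fin.succ_zero_eq_one, this]
          simp [Fin.tail]
        rw [h5, h6]
        simp [Function.comp_assoc]
      simp only [gaugeVar, map_neg, map_smul, map_sum, ghostDer_ggen, smul_neg, Finset.smul_sum,
        Finset.sum_neg_distrib, neg_neg]
      rw [Finset.sum_comm]
      refine Finset.sum_eq_zero fun τ _ => ?_
      have h7 := congrArg (fun y => (1 / ((q + 1 + 1).factorial : ℝ)) •
        (1 / ((q + 1).factorial : ℝ)) • y) (h4 τ)
      simp only [Finset.smul_sum, smul_zero] at h7
      refine Eq.trans (Finset.sum_congr rfl fun σ _ => ?_) h7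
      module

theorem ghostDer_ghostDer (u : GhostAlg m) : ghostDer m (ghostDer m u) = 0 :=
  ghostDer_isOddLeft.sq_zero (fun l => by
    rw [show ghostDer m (gen _ _ l) = _ from ghostDer_ggen l, ghostDer_gaugeVar]) u

end GhostAlgebra

end BFTheory

/-! ### Naturality and local form of the ascent operator -/

namespace BFTheory

variable {m : ℕ}

section Naturality

variable {X : Type*} [TopologicalSpace X] {φ ψ : OpenPartialHomeomorph X (E m)} {O : Set X}

theorem ghostTransport_ggen_mem (x : E m) (l : Lab m m) : ghostTransport φ ψ x (ggen l) ∈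
    Submodule.span ℝ (gen ghostNum GhostAlt '' {g | ghostNum g = ghostNum l}) := by
  rw [ghostTransport, ggen, gcHom_gen]
  exact ghostTr_mem φ ψ x l

theorem jetTr_add_smul (x : E m) (j e : Jet m) (s : ℝ) :
    jetTr φ ψ x (j + s • e) = jetTr φ ψ x j + s • jetTr φ ψ x e := by
  refine jet_ext (fun L => ?_) fun t L => ?_
  · change jetA (jetTr φ ψ x (j + s • e)) L = jetA (jetTr φ ψ x j) L + s * jetA (jetTr φ ψ x e) L
    simp only [jetA_jetTr, LinJet.eval, Finsupp.sum, Finset.mul_sum, ← Finset.sum_add_distrib]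
    refine Finset.sum_congr rfl fun p _ => ?_
    simp only [jetA, Pi.add_apply, Pi.smul_apply, Prod.fst_add, Prod.smul_fst, smul_eq_mul]
    ring
  · change jetB (jetTr φ ψ x (j + s • e)) t L =
      jetB (jetTr φ ψ x j) t L + s * jetB (jetTr φ ψ x e) t L
    simp only [jetB_jetTr, LinJet.eval, Finsupp.sum, Finset.mul_sum, ← Finset.sum_add_distrib]
    refine Finset.sum_congr rfl fun p _ => ?_
    simp only [jetB, Pi.add_apply, Pi.smul_apply, Prod.snd_add, Prod.smul_snd, smul_eq_mul,
      Submodule.coe_add, Submodule.coe_smul]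
    ring

variable [ChartedSpace (E m) X]

/-- The gauge variation is a constant multiple of an exterior derivative and inherits its
tensoriality. -/
theorem ghostTransport_gaugeVar (hφ : φ ∈ charts m X) (hψ : ψ ∈ charts m X) (hOo : IsOpen O)
    (hO' : O ⊆ φ.source) (hO : O ⊆ ψ.source) (q : ℕ) (h : q ≤ m) (v : Fin q → Fin (m + 1))
    (L : MI m) {x : E m} (hx : x ∈ reg φ O) :
    ghostTransport φ ψ x (gaugeVar q h v L) =
      (prolong (invJac φ ψ) (covLaw φ ψ q) L.sort v).eval x fun u S => gaugeVar q h u S := by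
  cases q with
  | zero => simp [gaugeVar, LinJet.eval]
  | succ q =>
    have h1 := prolong_extDeriv hφ hψ hOo hO' hO (M := GhostAlg m)
      (fun u S => ggen ⟨q, h, u, S⟩) L v hx
    let ℓ : GhostAlg m →ₗ[ℝ] GhostAlg m := -((1 / ((q + 1).factorial : ℝ)) • LinearMap.id)
    have h2 : ∀ u S, gaugeVar (q + 1) h u S = ℓ (∑ σ : Equiv.Perm (Fin (q + 1)),
        ((Equiv.Perm.sign σ : ℤ) : ℝ) • ggen ⟨q, h, Fin.tail (u ∘ σ), u (σ 0) ::ₘ S⟩) :=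
      fun u S => rfl
    simp only [h2]
    rw [← LinJet.map_eval, ← h1]
    simp only [ℓ, LinearMap.neg_apply, LinearMap.smul_apply, LinearMap.id_apply, map_neg, map_smul,
      map_sum, ghostTransport_gen]

theorem ghostDer_ghostTransport (hφ : φ ∈ charts m X) (hψ : ψ ∈ charts m X) (hOo : IsOpen O)
    (hO' : O ⊆ φ.source) (hO : O ⊆ ψ.source) {x : E m} (hx : x ∈ reg φ O) (u : GhostAlg m) :
    ghostDer m (ghostTransport φ ψ x u) = ghostTransport φ ψ x (ghostDer m u) := by
  refine ghostDer_isOddLeft.intertwine ghostDer_isOddLeft _ (fun l => ?_) (fun l => ?_) u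
  · exact parityInv_span (ghostTransport_ggen_mem x l)
  · obtain ⟨q, lt, t, L⟩ := l
    have h1 := ghostTransport_gen (φ := φ) (ψ := ψ) x q lt t L
    have h2 := ghostDer_ggen (⟨q, lt, t, L⟩ : Lab m m)
    rw [show ghostTransport φ ψ x (gen _ _ _) = _ from h1, show ghostDer m (gen _ _ _) = _ from h2,
      LinJet.map_eval, ghostTransport_gaugeVar hφ hψ hOo hO' hO q lt.le t L hx]
    simp only [ghostDer_ggen]

end Naturality

section Directions

/-- The direction `∂/∂B_{v,L}` in the jet space. -/
noncomputable def dirOf (p : (Fin m → Fin (m + 1)) × MI m) : Jet m :=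
  Pi.single p.2 (0, altBasis p.1)

/-- The jet directions `∂/∂B_{v,L}` with `|L| ≤ r`. -/
def dirs (m r : ℕ) : Finset ((Fin m → Fin (m + 1)) × MI m) := Finset.univ ×ˢ miLe m r

theorem altBasis_comm (u v : Fin m → Fin (m + 1)) : (altBasis u).1 v = (altBasis v).1 u := by
  simp only [altBasis]
  congr 1
  rw [← Equiv.sum_comp (Equiv.inv _)]
  refine Finset.sum_congr rfl fun σ _ => ?_
  have h : v = u ∘ (Equiv.symm σ) ↔ u = v ∘ σ := by
    constructor
    · rintro rfl
      funext i
      simp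
    · rintro rfl
      funext i
      simp
  simp [h]

theorem jetA_dirOf (p : (Fin m → Fin (m + 1)) × MI m) (L : MI m) : jetA (dirOf p) L = 0 := by
  unfold jetA dirOf
  by_cases h : L = p.2
  · subst h
    simp
  · rw [Pi.single_eq_of_ne h]
    rfl

theorem jetB_dirOf (p : (Fin m → Fin (m + 1)) × MI m) (t : Fin m → Fin (m + 1)) (L : MI m) :
    jetB (dirOf p) t L = if p.2 = L then (altBasis p.1).1 t else 0 := by
  unfold jetB dirOf
  split_ifs with h
  · subst h
    simp
  · rw [Pi.single_eq_of_ne (Ne.symm h)]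
    rfl

/-- The directions `∂/∂B_{v,L}` over all tuples `v` are redundant, but with antisymmetrization of
weight one they resolve the identity on antisymmetric arguments. -/
theorem sum_dirOf_smul {M : Type*} [AddCommGroup M] [Module ℝ M] {r : ℕ}
    (g : (Fin m → Fin (m + 1)) → MI m → M) (hg : ∀ L, IsAlt fun v => g v L)
    (u : Fin m → Fin (m + 1)) {S : MI m} (hS : S.card ≤ r) :
    ∑ p ∈ dirs m r, jetB (dirOf p) u S • g p.1 p.2 = g u S := by
  rw [dirs, Finset.sum_product]
  simp only [jetB_dirOf, ite_smul, zero_smul]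
  rw [← sum_altBasis (hg S) u]
  refine Finset.sum_congr rfl fun v _ => ?_
  rw [Finset.sum_ite_eq', if_pos (mem_miLe.mpr hS), altBasis_comm]

theorem trunc_eq_sum_dirOf (r : ℕ) (e : Jet m) (he : ∀ L, jetA e L = 0) :
    trunc r e = ∑ p ∈ dirs m r, jetB e p.1 p.2 • trunc r (dirOf p) := by
  simp only [← map_smul, ← map_sum]
  rw [trunc_eq_iff]
  refine fun L hL => Prod.ext ?_ (Subtype.ext (funext fun t => ?_))
  · change jetA e L = jetAₗ L (∑ p ∈ dirs m r, jetB e p.1 p.2 • dirOf p)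
    rw [he, map_sum, Finset.sum_eq_zero]
    intro p _
    rw [map_smul, show jetAₗ L (dirOf p) = 0 from jetA_dirOf p L, smul_zero]
  · change jetB e t L = jetBₗ t L (∑ p ∈ dirs m r, jetB e p.1 p.2 • dirOf p)
    rw [map_sum]
    have h1 := sum_dirOf_smul (fun v L => jetB e v L) (fun L σ v => (e L).2.2 σ v) t hL
    refine h1.symm.trans (Finset.sum_congr rfl fun p _ => ?_)
    rw [map_smul, smul_eq_mul, smul_eq_mul, mul_comm]
    rfl

theorem trunc_dirOf_eq_zero {r : ℕ} {p : (Fin m → Fin (m + 1)) × MI m} (hp : r < p.2.card) :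
    trunc r (dirOf p) = 0 := by
  rw [← map_zero (trunc r), trunc_eq_iff]
  intro L hL
  refine Pi.single_eq_of_ne ?_ _
  rintro rfl
  omega

end Directions

section Ascent

variable {X : Type*} [TopologicalSpace X] {φ ψ : OpenPartialHomeomorph X (E m)}
variable {f : Fam m X (GhostAlg m)} {P : List (Lab m m) → Prop} {r : ℕ}

/-- Derivatives along jets of order above `r` vanish, so any bound `R ≥ r` gives the same sum. The
freedom in `R` is needed to use one index set for both factors of `u_e ∘ u_e`. -/
theorem ascent_eq (h : IsPolyIn (fun _ => ggen) P φ.target r (f φ)) {R : ℕ} (hR : r ≤ R) {x : E m}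
    (hx : x ∈ φ.target) (j : Jet m) : ascent f φ x j =
      ∑ p ∈ dirs m R, gaugeVar m le_rfl p.1 p.2 * pdir (dirOf p) (f φ) x j +
        ghostDer m (f φ x j) := by
  unfold ascent
  congr 1
  refine finsum_eq_sum_of_support_subset _ fun p hp => ?_
  by_contra hn
  refine hp ?_
  have h1 : R < p.2.card := by
    simpa [dirs, mem_miLe] using hn
  -- The direction is invisible after truncation, so it is the empty combination of directions.
  have h2 := h.pdir_sum φ.open_target hx j (dirOf p) (∅ : Finset Unit) (fun _ => 0) (fun _ => 0)
    (by rw [trunc_dirOf_eq_zero (lt_of_le_of_lt hR h1), Finset.sum_empty])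
  rw [Finset.sum_empty] at h2
  have h3 : gaugeVar m le_rfl p.1 p.2 * pdir (dirOf p) (f φ) x j = 0 := by rw [h2, mul_zero]
  exact h3

theorem isPolyIn_gaugeVar {U : Set (E m)} {q : ℕ} (hq : q ≤ m) (v : Fin q → Fin (m + 1))
    {L : MI m} (hL : L.card ≤ r) :
    IsPolyIn (fun _ => ggen) (fun w => (∀ l ∈ w, l.ord.card ≤ r + 1) ∧
      (w.map ghostNum).sum = m - q + 1) U (r + 1) fun _ _ => gaugeVar q hq v L := by
  cases q with
  | zero => exact isPolyIn_zero
  | succ q =>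
    have h1 : ∀ σ : Equiv.Perm (Fin (q + 1)), IsPolyIn (fun _ : Jet m => ggen)
        (fun w => (∀ l ∈ w, l.ord.card ≤ r + 1) ∧ (w.map ghostNum).sum = m - (q + 1) + 1)
        U (r + 1) fun _ _ => ggen ⟨q, hq, Fin.tail (v ∘ σ), v (σ 0) ::ₘ L⟩ := fun σ => by
      refine (isPolyIn_single (w := [⟨q, hq, Fin.tail (v ∘ σ), v (σ 0) ::ₘ L⟩]) ⟨?_, ?_⟩
        (isJetFun_const 1)).congr fun x _ j => by simp
      · simpa using hL
      · simp only [List.map_cons, List.map_nil, List.sum_cons, List.sum_nil, ghostNum]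
        omega
    exact (((isPolyIn_sum (s := Finset.univ) fun σ _ =>
      (h1 σ).smul (isJetFun_const ((Equiv.Perm.sign σ : ℤ) : ℝ))).smul
      (isJetFun_const (1 / ((q + 1).factorial : ℝ)))).neg).congr fun x _ j => rfl

theorem isPolyIn_ghostDer_word {U : Set (E m)} {w : List (Lab m m)}
    (hw : ∀ l ∈ w, l.ord.card ≤ r) :
    IsPolyIn (fun _ => ggen) (fun w' => (∀ l ∈ w', l.ord.card ≤ r + 1) ∧
      (w'.map ghostNum).sum = (w.map ghostNum).sum + 1) U (r + 1)
      fun _ _ => ghostDer m (w.map ggen).prod := by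
  induction w with
  | nil =>
    refine isPolyIn_zero.congr fun x _ j => ?_
    rw [List.map_nil, List.prod_nil, ghostDer_isOddLeft.map_one]
  | cons g w ih =>
    have hw' : ∀ g ∈ w, g.ord.card ≤ r := fun g hg => hw g (by simp [hg])
    have h1 : IsPolyIn (U := U) (r := r + 1) (fun _ : Jet m => ggen) (fun w' => w' = [g])
        fun _ _ => parityInv ghostNum GhostAlt GhostAlt.num_eq (ggen g) :=
      (isPolyIn_single (w := [g]) (P := (· = [g])) rfl
        (isJetFun_const ((-1 : ℝ) ^ ghostNum g))).congr fun x _ j => by simp [parityInv_gen]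
    have h2 : IsPolyIn (U := U) (r := r + 1) (fun _ : Jet m => ggen) (fun w' => w' = w)
        fun _ _ => (w.map ggen).prod :=
      (isPolyIn_single (w := w) (P := (· = w)) rfl (isJetFun_const 1)).congr
        fun x _ j => by rw [one_smul]
    have h3 := h1.mul (ih hw') (P'' := fun w' => (∀ l ∈ w', l.ord.card ≤ r + 1) ∧
      (w'.map ghostNum).sum = ((g :: w).map ghostNum).sum + 1) (by
        rintro _ w' rfl ⟨h4, h5⟩
        refine ⟨?_, ?_⟩
        · simp only [List.singleton_append, List.mem_cons, forall_eq_or_imp]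
          exact ⟨(hw g (by simp)).trans (Nat.le_succ r), h4⟩
        · simp only [List.singleton_append, List.map_cons, List.sum_cons]
          omega)
    have h4 := (isPolyIn_gaugeVar (U := U) g.lt.le g.idx (hw g (by simp))).mul h2
      (P'' := fun w' => (∀ l ∈ w', l.ord.card ≤ r + 1) ∧
      (w'.map ghostNum).sum = ((g :: w).map ghostNum).sum + 1) (by
        rintro v _ ⟨h4, h5⟩ rfl
        refine ⟨?_, ?_⟩
        · simp only [List.mem_append]
          rintro g' (h | h)
          · exact h4 g' h
          · exact (hw' g' h).trans (Nat.le_succ r)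
        · simp only [List.map_append, List.sum_append, List.map_cons, List.sum_cons, h5, ghostNum]
          omega)
    refine (h4.add h3).congr fun x _ j => ?_
    rw [List.map_cons, List.prod_cons, ghostDer_isOddLeft.map_mul, ghostDer_ggen]

theorem isPolyIn_ascent {a : ℕ} (h : IsPolyIn (fun _ => ggen)
      (fun w => (∀ g ∈ w, g.ord.card ≤ r) ∧ (w.map ghostNum).sum = a) φ.target r (f φ)) :
    IsPolyIn (fun _ => ggen)
      (fun w => (∀ g ∈ w, g.ord.card ≤ r + 1) ∧ (w.map ghostNum).sum = a + 1) φ.target (r + 1)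
      (ascent f φ) := by
  have h1 : IsPolyIn (fun _ => ggen)
      (fun w => (∀ g ∈ w, g.ord.card ≤ r + 1) ∧ (w.map ghostNum).sum = a + 1) φ.target (r + 1)
      fun x j => ∑ p ∈ dirs m r, gaugeVar m le_rfl p.1 p.2 * pdir (dirOf p) (f φ) x j := by
    refine isPolyIn_sum fun p hp => ?_
    have hp' : p.2.card ≤ r := by simpa [dirs, mem_miLe] using hp
    refine (isPolyIn_gaugeVar le_rfl p.1 hp').mul
      ((h.pdir φ.open_target (dirOf p)).mono (fun _ hw => hw) (Nat.le_succ r))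
      fun v w hv hw => ⟨?_, ?_⟩
    · simp only [List.mem_append]
      rintro g' (h | h)
      · exact hv.1 g' h
      · exact (hw.1 g' h).trans (Nat.le_succ r)
    · rw [List.map_append, List.sum_append, hv.2, hw.2]
      omega
  have h2 : IsPolyIn (fun _ => ggen)
      (fun w => (∀ g ∈ w, g.ord.card ≤ r + 1) ∧ (w.map ghostNum).sum = a + 1) φ.target (r + 1)
      fun x j => ghostDer m (f φ x j) := by
    refine h.bind (Nat.le_succ r) (fun _ _ => ghostDer m) fun w hw => ?_
    refine (isPolyIn_ghostDer_word hw.1).mono (fun w' hw' => ⟨hw'.1, ?_⟩) le_rfl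
    rw [hw'.2, hw.2]
  exact (h1.add h2).congr fun x hx j => ascent_eq h le_rfl hx j

end Ascent

end BFTheory

/-! ### The complex of the ascent operator -/

namespace BFTheory

variable {m : ℕ}

section AscentComplex

variable {X : Type*} [TopologicalSpace X] {φ ψ : OpenPartialHomeomorph X (E m)} {O : Set X}
variable {f : Fam m X (GhostAlg m)} {P : List (Lab m m) → Prop} {r : ℕ}

theorem ascent_eq_zero {x : E m} (h : ∀ j, f φ x j = 0) (j : Jet m) : ascent f φ x j = 0 := by
  have h1 : weakDeriv (fun _ : ℝ => (0 : GhostAlg m)) = 0 :=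
    HasWeakDeriv.eq fun ℓ => by simpa using hasDerivAt_const (0 : ℝ) (0 : ℝ)
  unfold ascent
  simp only [h, h1, mul_zero, finsum_zero, map_zero, add_zero]

theorem gaugeVar_mul_comm (u v : Fin m → Fin (m + 1)) (L S : MI m) :
    gaugeVar m le_rfl u L * gaugeVar m le_rfl v S =
      -(gaugeVar m le_rfl v S * gaugeVar m le_rfl u L) := by
  have h := superComm_mul (span_le_superComm (gaugeVar_mem_span m le_rfl u L))
    (gaugeVar_mem_span m le_rfl v S)
  rw [h, show m + 1 - m = 1 by omega, one_mul, pow_one]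
  module

theorem ghostDer_gaugeVar_mul (v : Fin m → Fin (m + 1)) (L : MI m) (u : GhostAlg m) :
    ghostDer m (gaugeVar m le_rfl v L * u) = -(gaugeVar m le_rfl v L * ghostDer m u) := by
  rw [ghostDer_isOddLeft.map_mul, ghostDer_gaugeVar,
    parityInv_span (gaugeVar_mem_span m le_rfl v L), show m + 1 - m = 1 by omega, zero_mul,
    zero_add, pow_one, smul_mul_assoc]
  module

/-- The gauge variations of `B` have ghost number one and anticommute, so exchanging the summation
indices reverses the sign of the symmetric expression. -/
theorem sum_gaugeVar_mul_gaugeVar_mul (S : Finset ((Fin m → Fin (m + 1)) × MI m))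
    (D : (Fin m → Fin (m + 1)) × MI m → (Fin m → Fin (m + 1)) × MI m → GhostAlg m)
    (hD : ∀ p q, D p q = D q p) :
    ∑ p ∈ S, gaugeVar m le_rfl p.1 p.2 * ∑ q ∈ S, gaugeVar m le_rfl q.1 q.2 * D p q = 0 := by
  have h1 : ∑ p ∈ S, gaugeVar m le_rfl p.1 p.2 * ∑ q ∈ S, gaugeVar m le_rfl q.1 q.2 * D p q =
      -∑ p ∈ S, gaugeVar m le_rfl p.1 p.2 * ∑ q ∈ S, gaugeVar m le_rfl q.1 q.2 * D p q := by
    conv_lhs => simp only [Finset.mul_sum]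
    conv_rhs => simp only [Finset.mul_sum, ← Finset.sum_neg_distrib]
    rw [Finset.sum_comm]
    refine Finset.sum_congr rfl fun p _ => Finset.sum_congr rfl fun q _ => ?_
    rw [← mul_assoc, gaugeVar_mul_comm, gc_neg_mul, mul_assoc, hD]
  have h2 : (2 : ℝ) • ∑ p ∈ S, gaugeVar m le_rfl p.1 p.2 *
      ∑ q ∈ S, gaugeVar m le_rfl q.1 q.2 * D p q = 0 := by
    rw [two_smul]
    nth_rewrite 1 [h1]
    abel
  simpa using h2

/-- The square has three parts: the double derivative of the coefficients, killed by symmetry; the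
mixed terms, which cancel because `ghostDer` passes an odd, closed factor with a sign; and the
square of `ghostDer`. -/
theorem ascent_ascent_eq_zero (h : IsPolyIn (fun _ => ggen) P φ.target r (f φ))
    {P' : List (Lab m m) → Prop} {R : ℕ} (hR : r ≤ R)
    (h' : IsPolyIn (fun _ => ggen) P' φ.target R (ascent f φ)) {x : E m} (hx : x ∈ φ.target)
    (j : Jet m) : ascent (ascent f) φ x j = 0 := by
  have h1 : ∀ e, pdir e (ascent f φ) x j = ∑ q ∈ dirs m R, gaugeVar m le_rfl q.1 q.2 *
      pdir e (pdir (dirOf q) (f φ)) x j + ghostDer m (pdir e (f φ) x j) := fun e => by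
    have h2 : (fun s : ℝ => ascent f φ x (j + s • e)) = fun s : ℝ =>
        ∑ q ∈ dirs m R, gaugeVar m le_rfl q.1 q.2 * pdir (dirOf q) (f φ) x (j + s • e) +
          ghostDer m (f φ x (j + s • e)) := funext fun s => ascent_eq h hR hx _
    rw [pdir, h2]
    refine HasWeakDeriv.eq (HasWeakDeriv.add (HasWeakDeriv.sum fun q _ => ?_) ?_)
    · exact ((h.pdir φ.open_target (dirOf q)).hasWeakDeriv φ.open_target hx j e).map
        (LinearMap.mulLeft ℝ (gaugeVar m le_rfl q.1 q.2))
    · exact (h.hasWeakDeriv φ.open_target hx j e).map (ghostDer m)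
  rw [ascent_eq h' le_rfl hx, ascent_eq h hR hx, map_add, ghostDer_ghostDer, add_zero, map_sum]
  simp only [h1, mul_add, Finset.sum_add_distrib, ghostDer_gaugeVar_mul, Finset.sum_neg_distrib]
  rw [sum_gaugeVar_mul_gaugeVar_mul _
    (fun p q => pdir (dirOf p) (pdir (dirOf q) (f φ)) x j)
    fun p q => h.pdir_comm φ.open_target hx j _ _]
  abel

/-- The chain rule: transport of jets is linear, so a direction in one chart is carried to a
direction in the other, expanded there in the directions `∂/∂B_{v,L}`. Directions without
`A`-components keep this property. -/
theorem pdir_transport (h : IsPolyIn (fun _ => ggen) P ψ.target r (f ψ))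
    {x : E m} (hx : trans φ ψ x ∈ ψ.target)
    (hf : ∀ j, f φ x j = ghostTransport φ ψ x (f ψ (trans φ ψ x) (jetTr φ ψ x j)))
    (j e : Jet m) (he : ∀ L, jetA e L = 0) :
    pdir e (f φ) x j = ∑ q ∈ dirs m r, jetB (jetTr φ ψ x e) q.1 q.2 •
      ghostTransport φ ψ x (pdir (dirOf q) (f ψ) (trans φ ψ x) (jetTr φ ψ x j)) := by
  have h1 : (fun s : ℝ => f φ x (j + s • e)) = fun s : ℝ => (ghostTransport φ ψ x).toLinearMap
      (f ψ (trans φ ψ x) (jetTr φ ψ x j + s • jetTr φ ψ x e)) := funext fun s => by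
    rw [hf, jetTr_add_smul]
    rfl
  have h2 : ∀ L, jetA (jetTr φ ψ x e) L = 0 := fun L => by
    rw [jetA_jetTr]
    simp [LinJet.eval, he]
  rw [pdir, h1, ((h.hasWeakDeriv ψ.open_target hx _ _).map _).eq,
    h.pdir_sum ψ.open_target hx _ _ _ _ _ (trunc_eq_sum_dirOf r _ h2)]
  simp only [map_sum, map_smul, AlgHom.toLinearMap_apply]

variable [ChartedSpace (E m) X]

/-- The derivatives along `∂/∂B` transform contragrediently to the gauge variations, so in `u` the
two transformations cancel. -/
theorem sum_jetB_jetTr_smul (hφ : φ ∈ charts m X) (hψ : ψ ∈ charts m X) (hOo : IsOpen O)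
    (hO' : O ⊆ φ.source) (hO : O ⊆ ψ.source) {x : E m} (hx : x ∈ reg φ O)
    (v : Fin m → Fin (m + 1)) {L : MI m} (hL : L.card ≤ r) :
    ∑ p ∈ dirs m r, jetB (jetTr φ ψ x (dirOf p)) v L • gaugeVar m le_rfl p.1 p.2 =
      ghostTransport φ ψ x (gaugeVar m le_rfl v L) := by
  rw [ghostTransport_gaugeVar hφ hψ hOo hO' hO m le_rfl v L hx]
  have h1 := (good_prolong_trans hφ hψ hOo hO' hO (contDiffOn_covLaw hφ hψ hOo hO' hO)
    L.sort v).eval_congr (M := GhostAlg m) x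
    (v := fun u S => ∑ p ∈ dirs m r, jetB (dirOf p) u S • gaugeVar m le_rfl p.1 p.2)
    (v' := fun u S => gaugeVar m le_rfl u S) fun u S hS =>
      sum_dirOf_smul (fun u S => gaugeVar m le_rfl u S)
        (fun L σ t => gaugeVar_alt m le_rfl t L σ) u
        (by rw [Multiset.length_sort] at hS; omega)
  rw [← h1]
  simp only [jetB_jetTr, LinJet.eval, Finsupp.sum, Finset.smul_sum, Finset.sum_smul, smul_smul,
    smul_eq_mul]
  exact Finset.sum_comm

theorem ascent_transport (hφ : φ ∈ charts m X) (hψ : ψ ∈ charts m X)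
    (h : IsPolyIn (fun _ => ggen) P φ.target r (f φ))
    (h' : IsPolyIn (fun _ => ggen) P ψ.target r (f ψ))
    {x : E m} (hx : x ∈ φ.target) (hx' : φ.symm x ∈ ψ.source)
    (hf : ∀ j, f φ x j = ghostTransport φ ψ x (f ψ (trans φ ψ x) (jetTr φ ψ x j))) (j : Jet m) :
    ascent f φ x j = ghostTransport φ ψ x (ascent f ψ (trans φ ψ x) (jetTr φ ψ x j)) := by
  have hy : trans φ ψ x ∈ ψ.target := ψ.map_source hx'
  have hO : IsOpen (φ.source ∩ ψ.source) := φ.open_source.inter ψ.open_source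
  have hO1 : φ.source ∩ ψ.source ⊆ φ.source := Set.inter_subset_left
  have hO2 : φ.source ∩ ψ.source ⊆ ψ.source := Set.inter_subset_right
  have hxO : x ∈ reg φ (φ.source ∩ ψ.source) := ⟨hx, φ.map_target hx, hx'⟩
  rw [ascent_eq h le_rfl hx, ascent_eq h' le_rfl hy, map_add,
    ← ghostDer_ghostTransport hφ hψ hO hO1 hO2 hxO, ← hf, map_sum]
  congr 1
  have h1 : ∀ q ∈ dirs m r, ghostTransport φ ψ x (gaugeVar m le_rfl q.1 q.2 *
      pdir (dirOf q) (f ψ) (trans φ ψ x) (jetTr φ ψ x j)) =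
      ∑ p ∈ dirs m r, gaugeVar m le_rfl p.1 p.2 * (jetB (jetTr φ ψ x (dirOf p)) q.1 q.2 •
        ghostTransport φ ψ x (pdir (dirOf q) (f ψ) (trans φ ψ x) (jetTr φ ψ x j))) := fun q hq => by
    have hq' : q.2.card ≤ r := by simpa [dirs, mem_miLe] using hq
    rw [map_mul, ← sum_jetB_jetTr_smul hφ hψ hO hO1 hO2 hxO q.1 hq', Finset.sum_mul]
    refine Finset.sum_congr rfl fun p _ => ?_
    rw [smul_mul_assoc, mul_smul_comm]
  rw [Finset.sum_congr rfl h1, Finset.sum_comm]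
  refine Finset.sum_congr rfl fun p _ => ?_
  rw [pdir_transport h' hy hf j _ (jetA_dirOf p), Finset.mul_sum]

theorem IsGhostFun.ascent {a : ℕ} (h : IsGhostFun X a f) :
    IsGhostFun X (a + 1) (BFTheory.ascent f) where
  zero φ x j hx := ascent_eq_zero (fun j => h.zero φ x j hx) j
  poly := by
    obtain ⟨r, hr⟩ := h.poly
    exact ⟨r + 1, fun φ hφ => isPolyIn_ascent (hr φ hφ)⟩
  compat φ hφ ψ hψ x hx hx' j j' hj := by
    obtain ⟨r, hr⟩ := h.poly
    rw [jetTransf_iff.mp hj]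
    exact ascent_transport hφ hψ (hr φ hφ) (hr ψ hψ) hx hx'
      (fun j => h.compat φ hφ ψ hψ x hx hx' j _ (jetTransf_iff.mpr rfl)) j

theorem ascent_ascent {a : ℕ} (h : IsGhostFun X a f) :
    BFTheory.ascent (BFTheory.ascent f) = 0 := by
  funext φ x j
  by_cases hφ : φ ∈ charts m X ∧ x ∈ φ.target
  · obtain ⟨r, hr⟩ := h.poly
    exact ascent_ascent_eq_zero (hr φ hφ.1) (Nat.le_succ r) (isPolyIn_ascent (hr φ hφ.1)) hφ.2 j
  · exact ascent_eq_zero (fun j => h.ascent.zero φ x j hφ) j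

end AscentComplex

end BFTheory

/-! ### Variational derivatives of the Lagrangian -/

namespace BFTheory

variable {m : ℕ}

section Variational

theorem foldr_totalDeriv_zero (l : List (Fin (m + 1))) :
    l.foldr totalDeriv (fun (_ : E m) (_ : Jet m) => (0 : ℝ)) = fun _ _ => 0 := by
  induction l with
  | nil => rfl
  | cons μ l ih =>
    rw [List.foldr_cons, ih]
    funext x j
    simp [totalDeriv]

theorem totalDeriv_mul_jetA (μ : Fin (m + 1)) (c : ℝ) (x : E m) (j : Jet m) :
    totalDeriv μ (fun (_ : E m) j => c * jetA j 0) x j = c * jetA j {μ} := by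
  have h : HasDerivAt (fun s : ℝ => c * (jetA j 0 + s * jetA j {μ})) (c * jetA j {μ}) 0 := by
    simpa using (((hasDerivAt_id (0 : ℝ)).mul_const (jetA j {μ})).const_add (jetA j 0)).const_mul c
  exact h.deriv

theorem lagBF_eq (x : E m) (j : Jet m) :
    lagBF x j = (1 / ((m + 1).factorial : ℝ)) * (jetA j 0 * eulA j 0) := by
  have : ((m + 1).factorial : ℝ) = (m + 1 : ℝ) * m.factorial := by
    rw [Nat.factorial_succ]
    push_cast
    ring
  rw [lagBF, eulA, this]
  simp only [Multiset.cons_zero]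
  field_simp

theorem lineDeriv_lagBF (x : E m) (j e : Jet m) : lineDeriv ℝ (lagBF x) j e =
    (1 / ((m + 1).factorial : ℝ)) * (jetA e 0 * eulA j 0 + jetA j 0 * eulA e 0) := by
  have h : HasDerivAt (fun s : ℝ => (1 / ((m + 1).factorial : ℝ)) *
      ((jetA j 0 + s * jetA e 0) * (eulA j 0 + s * eulA e 0)))
      ((1 / ((m + 1).factorial : ℝ)) * (jetA e 0 * eulA j 0 + jetA j 0 * eulA e 0)) 0 := by
    have h1 := fun a b : ℝ => ((hasDerivAt_id (0 : ℝ)).mul_const b).const_add a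
    simpa using ((h1 (jetA j 0) (jetA e 0)).mul (h1 (eulA j 0) (eulA e 0))).const_mul
      (1 / ((m + 1).factorial : ℝ))
  rw [← h.deriv, lineDeriv]
  congr 1
  funext s
  rw [lagBF_eq, eulA_add, eulA_smul]
  rfl

/-- In `A 𝓔 / n!` the field `A` enters without derivatives and is absent from `𝓔`, so only the empty
multi-index contributes. -/
theorem varDeriv_lagBF_fst (x : E m) (j : Jet m) :
    varDeriv lagBF (1, 0) x j = (1 / ((m + 1).factorial : ℝ)) * eulA j 0 := by
  have h1 : ∀ L : MI m, eulA (Pi.single L ((1, 0) : Fib m)) 0 = 0 := fun L => by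
    have : ∀ t S, jetB (Pi.single L ((1, 0) : Fib m) : Jet m) t S = 0 := fun t S => by
      unfold jetB
      by_cases h : S = L
      · subst h
        simp
      · rw [Pi.single_eq_of_ne h]
        rfl
    simp [eulA, this]
  rw [varDeriv, finsum_eq_single _ 0]
  · simp only [Multiset.card_zero, pow_zero, Multiset.sort_zero, List.foldr_nil, lineDeriv_lagBF,
      h1]
    simp [jetA]
  · intro L hL
    have h2 : jetA (Pi.single L ((1, 0) : Fib m) : Jet m) 0 = 0 := by
      unfold jetA
      rw [Pi.single_eq_of_ne (Ne.symm hL)]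
      rfl
    simp only [lineDeriv_lagBF, h1, h2, zero_mul, mul_zero, add_zero, foldr_totalDeriv_zero]

/-- `B` enters only through first derivatives, so only the multi-indices `{μ}` contribute. The
integration by parts moves `d_μ` onto `A` and accounts for the sign in `𝓔^t`. -/
theorem varDeriv_lagBF_snd (x : E m) (j : Jet m) (b : AltComp m m) :
    varDeriv lagBF (0, b) x j =
      (1 / ((m + 1).factorial : ℝ)) * ∑ t : Fin m → Fin (m + 1), eulB j t 0 * b.1 t := by
  have hA : ∀ L : MI m, jetA (Pi.single L ((0, b) : Fib m) : Jet m) 0 = 0 := fun L => by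
    unfold jetA
    by_cases h : 0 = L
    · subst h
      simp
    · rw [Pi.single_eq_of_ne h]
      rfl
  have hB : ∀ L t S, jetB (Pi.single L ((0, b) : Fib m) : Jet m) t S =
      if S = L then b.1 t else 0 := fun L t S => by
    unfold jetB
    split_ifs with h
    · subst h
      simp
    · rw [Pi.single_eq_of_ne h]
      rfl
  have hE : ∀ L : MI m, eulA (Pi.single L ((0, b) : Fib m)) 0 =
      ∑ μ : Fin (m + 1), ∑ t : Fin m → Fin (m + 1),
        levi (Fin.cons μ t) * if {μ} = L then b.1 t else 0 := fun L => by
    simp only [eulA, hB, Multiset.cons_zero]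
  have h0 : ∀ L : MI m, (∀ μ, {μ} ≠ L) → eulA (Pi.single L ((0, b) : Fib m)) 0 = 0 :=
    fun L hL => by simp [hE, hL]
  have h1 : ∀ μ : Fin (m + 1), eulA (Pi.single {μ} ((0, b) : Fib m)) 0 =
      ∑ t : Fin m → Fin (m + 1), levi (Fin.cons μ t) * b.1 t := fun μ => by
    rw [hE, Finset.sum_eq_single μ (fun ν _ hν => by simp [hν]) (by simp)]
    simp
  have h2 : ∀ L : MI m, (fun (x : E m) j => lineDeriv ℝ (lagBF x) j (Pi.single L (0, b))) =
      fun _ j => ((1 / ((m + 1).factorial : ℝ)) * eulA (Pi.single L ((0, b) : Fib m)) 0) *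
        jetA j 0 := fun L => by
    funext x j
    rw [lineDeriv_lagBF, hA]
    ring
  rw [varDeriv, finsum_eq_sum_of_support_subset
    (s := Finset.univ.image fun μ : Fin (m + 1) => ({μ} : MI m)),
    Finset.sum_image fun _ _ _ _ h => Multiset.singleton_inj.mp h]
  · simp only [h2, Multiset.card_singleton, pow_one,
      Multiset.sort_singleton, List.foldr_cons, List.foldr_nil, totalDeriv_mul_jetA, h1, eulB,
      Multiset.cons_zero]
    simp only [Finset.mul_sum, Finset.sum_mul, Finset.sum_neg_distrib, neg_mul, mul_neg]
    rw [Finset.sum_comm]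
    congr 1
    refine Finset.sum_congr rfl fun t _ => Finset.sum_congr rfl fun μ _ => ?_
    ring
  · intro L hL
    by_contra hn
    refine hL ?_
    have h3 : ∀ μ, {μ} ≠ L := fun μ h => hn (by simp [← h])
    simp only [h2, h0 L h3, mul_zero, zero_mul, foldr_totalDeriv_zero]

end Variational

end BFTheory

/-! ### The theorem -/

theorem mainTheorem9 (m : ℕ) (hm : 1 ≤ m) (X : Type*) [TopologicalSpace X]
    [ChartedSpace (E m) X] [IsManifold 𝓘(ℝ, E m) ∞ X] [T2Space X] [SecondCountableTopology X]
    [ConnectedSpace X] :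
    -- the functions `𝓔`, `𝓔^t` are, up to the factor `n!`, the variational derivatives
    (∀ (x : E m) (j : Jet m) (b : AltComp m m),
      varDeriv lagBF (1, 0) x j = (1 / ((m + 1).factorial : ℝ)) * eulA j 0 ∧
      varDeriv lagBF (0, b) x j =
        (1 / ((m + 1).factorial : ℝ)) * ∑ t : Fin m → Fin (m + 1), eulB j t 0 * b.1 t) ∧
    -- `(N+2)`-cycles with `δ_{N-1}`, `0 ≤ N ≤ n - 2`
    (∀ N : ℕ, N + 1 ≤ m → ∀ Φ : Fam m X (AntiAlg m),
      IsGradedDensity X (N + 1) (N + 2) Φ → KT (N + 1) Φ = 0 →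
        (∃ Ψ, IsGradedDensity X (N + 1) (N + 3) Ψ ∧
          FactorsThroughDelta X
            (fun w => (∀ l ∈ w, m + 1 ≤ l.q + (N + 2)) ∧ (w.map fun l => m - l.q).sum = N + 2)
            (Φ - KT (N + 1) Ψ)) ∧
        IsBoundary X (N + 2) (N + 2) Φ) ∧
    -- regularity and reducibility
    (∀ N : ℕ, N + 1 ≤ m → HomologyRegular m (N + 2) X ∧ StageReducible m N X) ∧
    -- `n`-exactness of the Koszul-Tate complex, whose differential is `δ_{n-2}`
    (∀ a : ℕ, 1 ≤ a → a ≤ m + 1 → ExactAt m (m + 1) a X) ∧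
    -- the cochain complex of the ascent operator
    (∀ (a : ℕ) (f : Fam m X (GhostAlg m)), IsGhostFun X a f →
      IsGhostFun X (a + 1) (ascent f) ∧ ascent (ascent f) = 0) := by
  refine ⟨fun x j b => ⟨varDeriv_lagBF_fst x j, varDeriv_lagBF_snd x j b⟩,
    fun N _ Φ hΦ h0 => ⟨exists_factor (Nat.succ_pos N) hΦ h0,
      isBoundary_succ (Nat.succ_pos N) hΦ h0⟩,
    fun N _ => ⟨homologyRegular _, stageReducible N⟩,
    fun a ha _ => exactAt_top ha,
    fun a f hf => ⟨hf.ascent, ascent_ascent hf⟩⟩
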